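/- **Setting.** Let $B\subset\mathbb R^3$ be a bounded open region with smooth boundary $\partial B$, outward unit normal $n$ and surface area $da$; $I=[0,\infty)$; indices run over $1,2,3$, repeated indices are summed, ${}_{,j}=\partial/\partial x_j$, a dot is $\partial/\partial t$ (derivatives are taken up to $\partial B$ and up to $t=0$). Put $\mathcal D=n_j\partial/\partial x_j$, $\mathcal D_i=(\delta_{ij}-n_in_j)\partial/\partial x_j$. **Material.** $\rho,T_0>0$, $\beta,c\ne0$, $\gamma\in\mathbb R$, $\beta'=\beta+\gamma/(c\beta)\neq0$, and $a^{(11)},a^{(17)},a^{(14)},a^{(22)},a^{(23)},a^{(33)},a^{(77)},a^{(47)},k$ are constant tensors with $a^{(11)}_{ijkl}=a^{(11)}_{jikl}=a^{(11)}_{klij}$, $a^{(77)}_{ijkl}=a^{(77)}_{jikl}=a^{(77)}_{klij}$, $a^{(17)}_{ijkl}=a^{(17)}_{jikl}=a^{(17)}_{ijlk}$, $a^{(22)}_{ijklhm}=a^{(22)}_{jiklhm}=a^{(22)}_{lhmijk}$, $a^{(23)}_{ijkl}=a^{(23)}_{jikl}$, and $a^{(14)},a^{(47)},a^{(33)},k$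 symmetric; moreover $\gamma/\beta\ge0$ and $k_{ij}\eta_i\eta_j\ge0$ for all $\eta$. **Admissible processes.** $\mathcal V$ is the vector space of arrays $\pi=(u_i,\theta,\varphi,e_{ij},\kappa_{ijk},\beta_i,E_i,V_{ij},\tau_{ij},\mu_{ijk},\sigma_i,Q_{ij},\eta,q_i)$ of functions on $\bar B\times I$ with $u_i\in C^{4,2}$, $\varphi\in C^{4,0}$, $\theta\in C^{2,2}$, $e_{ij},V_{ij}\in C^{2,1}$, $\eta\in C^{0,1}$, $\kappa_{ijk},E_i,\mu_{ijk},Q_{ij}\in C^{2,0}$, $\beta_i,\tau_{ij},\sigma_i,q_i\in C^{1,0}$, where $e,V,\tau,Q$ are symmetric and $\kappa,\mu$ are symmetric in their first two indices. Here $C^{M,N}$ means: derivatives of order $\le N$ in $t$ and then $\le M$ in $x$ exist and are continuous on $\bar B\times I$. **Problem $\Pi$.** For $r=1,\dots,5$ let $S_r,\Sigma_r\subseteq\partial B$ be measurable, $\bar S_r\cup\Sigma_r=\partial B$, $S_r\cap\Sigma_r=\varnothing$, such that $\partial B\setminus(S_r\cup\Sigma_r)$ has zero area and every neighbourhood of a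 point of $S_r$ (of $\Sigma_r$) meets $S_r$ (resp. $\Sigma_r$) in positive area. The data are continuous functions $f_i,g,h$ on $\bar B\times I$, $u_i^0,v_i^0,\theta^0,\eta^0$ on $\bar B$, and boundary data, each continuous on its set $S_r\times I$ or $\Sigma_r\times I$ and bounded for $t$ in bounded intervals. $\mathcal K\subseteq\mathcal V$ is the set of $\pi\in\mathcal V$ satisfying: (i) on $B\times I$: $\tau_{ji,j}-\mu_{kji,kj}+\rho f_i=\rho\ddot u_i$, $\ \sigma_{i,i}-Q_{ji,ji}=g$, $\ \rho T_0\dot\eta+q_{j,j}-\rho h=0$; (ii) on $B\times I$: $e_{ij}=\frac12(u_{i,j}+u_{j,i})$, $\kappa_{ijk}=u_{k,ij}$, $\beta_i=\theta_{,i}$, $E_i=-\varphi_{,i}$, $V_{ij}=-\varphi_{,ij}$; (iii) on $B\times I$: $\tau_{ij}=\hat\tau_{ij}+a^{(14)}_{ij}(\theta+\beta\dot\theta)$, $\mu_{ijk}=\hat\mu_{ijk}$, $\sigma_i=\hat\sigma_i$, $-Q_{ij}=-\hat Q_{ij}+a^{(47)}_{ij}(\theta+\beta\dot\theta)$, $-\rho\eta=-\rho\hat\eta+c(\theta+\beta'\dot\theta)$,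 $q_i=\hat q_i$, where $\hat\tau_{ij}=a^{(11)}_{ijkl}e_{kl}+a^{(17)}_{ijkl}V_{kl}$, $\hat\mu_{ijk}=a^{(22)}_{ijklhm}\kappa_{lhm}+a^{(23)}_{ijkl}E_l$, $-\hat\sigma_i=a^{(23)}_{jkli}\kappa_{jkl}+a^{(33)}_{ij}E_j$, $-\hat Q_{ij}=a^{(17)}_{klij}e_{kl}+a^{(77)}_{ijkl}V_{kl}$, $-\rho\hat\eta=a^{(14)}_{ij}e_{ij}+a^{(47)}_{ij}V_{ij}$, $-\hat q_i=T_0k_{ij}\beta_j$; (iv) on $\bar B$ at $t=0$: $u_i=u_i^0$, $\dot u_i=v_i^0$, $\theta=\theta^0$, $\eta=\eta^0$; (v) for $t\in I$: $u_i=\hat u_i$ on $S_1$, $P_i=\hat P_i$ on $\Sigma_1$; $\mathcal Du_i=\hat d_i$ on $S_2$, $R_i=\hat R_i$ on $\Sigma_2$; $\theta=\hat\theta$ on $S_3$, $q=\hat q$ on $\Sigma_3$; $\varphi=\hat\varphi$ on $S_4$, $\Lambda=\hat\Lambda$ on $\Sigma_4$; $\mathcal D\varphi=\hat\omega$ on $S_5$,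 $H=\hat H$ on $\Sigma_5$; where $q=q_in_i$, $R_i=\mu_{kji}n_kn_j$, $H=Q_{kj}n_kn_j$, $$P_i=(\tau_{ji}-\mu_{kji,k})n_j-\mathcal D_j(\mu_{kji}n_k)+(\mathcal D_ln_l)\mu_{kji}n_kn_j,\quad \Lambda=(\sigma_j-Q_{kj,k})n_j-\mathcal D_j(Q_{kj}n_k)+(\mathcal D_ln_l)Q_{kj}n_kn_j.$$ **Functional.** Let $[f_1*f_2](t)=\int_0^tf_1(\tau)f_2(t-\tau)\,d\tau$, $l(t)=1$, $\xi(t)=t$, $\zeta(t)=\frac1\beta e^{-t/\beta}$, $\chi(t)=\frac1{\beta'}e^{-t/\beta'}$, $\mathcal F_i=\rho\,\xi*f_i+\rho v_i^0t+\rho u_i^0$, $\mathcal H=\rho T_0\eta^0+l*\rho h$, $\mathcal L_{ij}=a^{(14)}_{ij}\theta^0e^{-t/\beta}$, $\mathcal M_{ij}=a^{(47)}_{ij}\theta^0e^{-t/\beta}$, $\mathcal R=c\,\theta^0e^{-t/\beta'}$. For $t\in I$ and $\pi\in\mathcal V$ let $\Lambda_t\{\pi\}$ be the value at time $t$ of $$\begin{aligned}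 &\int_B\chi*\Big\{\zeta*\big[\xi*(\tau_{ji,j}-\mu_{kji,kj})+\mathcal F_i-\tfrac12\rho u_i\big]*u_i+\zeta*\xi*(\sigma_{i,i}-Q_{ji,ji}-g)*\varphi\\ &\quad-\xi*\tfrac1{T_0}(-l*q_{i,i}+\mathcal H-\rho T_0\eta)*\theta+\xi*\big[\zeta*(\tau_{ij}-\tfrac12\hat\tau_{ij})+\mathcal L_{ij}\big]*e_{ij}\\ &\quad+\zeta*\xi*(\mu_{ijk}-\tfrac12\hat\mu_{ijk})*\kappa_{ijk}-\zeta*\xi*(\sigma_i-\tfrac12\hat\sigma_i)*E_i+\xi*\big[-\zeta*(Q_{ij}-\tfrac12\hat Q_{ij})+\mathcal M_{ij}\big]*V_{ij}\\ &\quad-\xi*\tfrac1c\big[-\chi*\tfrac12(\rho\eta-\rho\hat\eta)+\mathcal R\big]*(\rho\eta-\rho\hat\eta)-\xi*l*\big[-\tfrac1{T_0}(q_i-\tfrac12\hat q_i)\big]*\beta_i\Big\}\,dv\\ &-\chi*\zeta*\xi*\Big[\int_{S_1}P_i*\hat u_i\,da+\int_{\Sigma_1}(P_i-\hat P_i)*u_i\,da+\int_{S_2}R_i*\hat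 d_i\,da+\int_{\Sigma_2}(R_i-\hat R_i)*\mathcal Du_i\,da\\ &\qquad+\int_{S_4}\Lambda*\hat\varphi\,da+\int_{\Sigma_4}(\Lambda-\hat\Lambda)*\varphi\,da+\int_{S_5}H*\hat\omega\,da+\int_{\Sigma_5}(H-\hat H)*\mathcal D\varphi\,da\Big]\\ &-\tfrac1{T_0}\chi*\xi*l*\Big[\int_{S_3}q*\hat\theta\,da+\int_{\Sigma_3}(q-\hat q)*\theta\,da\Big], \end{aligned}$$ where in the surface integrals (as in (v)) $q$ is the normal heat flux and $\hat q$ its prescribed value. We write $\delta\Lambda_t\{\pi\}=0$ if for every $\pi'\in\mathcal V$ the derivative $\frac{d}{d\lambda}\Lambda_t\{\pi+\lambda\pi'\}\big|_{\lambda=0}$ exists and is $0$. **Theorem.** Let $\pi\in\mathcal V$. 1. $\delta\Lambda_t\{\pi\}=0$ for every $t\in I$ if and only if $\pi\in\mathcal K$. 2. For each fixed $t>0$: $\delta\Lambda_t\{\pi\}=0$ if and only if $\pi$ solves $\Pi$ on the time interval $[0,t]$, i.e. satisfies (iv), and (i), (ii), (iii), (v) at all times in $[0,t]$. -/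

import Mathlib

open MeasureTheory Set Topology
open scoped ContDiff

namespace ThermoPiezo

/-- Euclidean three-dimensional space. -/
abbrev E3 := EuclideanSpace ℝ (Fin 3)

/-- A scalar field depending on position and time. All operations on fields are pointwise. -/
abbrev Field := E3 → ℝ → ℝ

/-! ### Convolution in time -/

/-- `[f * g](t) = ∫₀ᵗ f(τ) g(t - τ) dτ`. -/
noncomputable def tconv (f g : ℝ → ℝ) : ℝ → ℝ := fun t => ∫ τ in (0 : ℝ)..t, f τ * g (t - τ)

/-- Convolution in time of two fields, at each point of space. -/
noncomputable def fconv (F G : Field) : Field := fun x => tconv (F x) (G x)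

infixr:70 " ⊛ " => fconv

/-! ### The region, its outward normal, and derivatives up to the boundary -/

/-- `B` is a bounded open region with smooth boundary, with smooth defining function `r`:
`B = {r < 0}`, and the gradient of `r` vanishes nowhere on the boundary `{r = 0}`. -/
structure IsSmoothRegion (B : Set E3) (r : E3 → ℝ) : Prop where
  bounded : Bornology.IsBounded B
  smooth : ContDiff ℝ ∞ r
  eq_neg : B = {x | r x < 0}
  regular : ∀ x, r x = 0 → fderiv ℝ r x ≠ 0

/-- The components of the outward unit normal `∇r / |∇r|` on the boundary of `{r < 0}`
(as fields constant in time; only their germs along the boundary are used). -/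
noncomputable def nrm (r : E3 → ℝ) (i : Fin 3) : Field :=
  fun x _ => (‖gradient r x‖⁻¹ • gradient r x) i

/-- Partial derivative with respect to `x_j`, on the closed region. -/
noncomputable def dx (B : Set E3) (j : Fin 3) (F : Field) : Field :=
  fun x t => fderivWithin ℝ (fun y => F y t) (closure B) x (EuclideanSpace.single j 1)

/-- Partial derivative with respect to time on `[0, ∞)` (one-sided at `0`). -/
noncomputable def dt (F : Field) : Field := fun x t => derivWithin (F x) (Ici 0) t

/-- The normal derivative `𝒟 F = n_j F_{,j}`. -/
noncomputable def normalD (B : Set E3) (r : E3 → ℝ) (F : Field) : Field :=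
  ∑ j, nrm r j * dx B j F

/-- The surface gradient `𝒟_i F = (δ_{ij} - n_i n_j) F_{,j}`. -/
noncomputable def surfD (B : Set E3) (r : E3 → ℝ) (i : Fin 3) (F : Field) : Field :=
  ∑ j, ((if i = j then 1 else 0) - nrm r i * nrm r j) * dx B j F

/-- The class `C^{M,N}(B̄ × [0,∞))`: the derivatives of order at most `N` in time and then of order
at most `M` in space exist and are jointly continuous up to the boundary. -/
structure IsC (B : Set E3) (M N : ℕ) (F : Field) : Prop where
  time : ∀ x ∈ closure B, ContDiffOn ℝ N (F x) (Ici 0)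
  space : ∀ n ≤ N, ∀ t ∈ Ici (0 : ℝ),
    ContDiffOn ℝ M (fun x => iteratedDerivWithin n (F x) (Ici 0) t) (closure B)
  cont : ∀ n ≤ N, ∀ m ≤ M, ContinuousOn
    (fun p : E3 × ℝ => iteratedFDerivWithin ℝ m
      (fun x => iteratedDerivWithin n (F x) (Ici 0) p.2) (closure B) p.1)
    (closure B ×ˢ Ici 0)

/-! ### The material -/

/-- Constants of a homogeneous, centrosymmetric thermopiezoelectric nonsimple material, with the
symmetry relations and the positive semi-definiteness coming from the dissipation inequality. -/
structure Material where
  ρ : ℝ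
  T0 : ℝ
  β : ℝ
  γ : ℝ
  c : ℝ
  a11 : Fin 3 → Fin 3 → Fin 3 → Fin 3 → ℝ
  a17 : Fin 3 → Fin 3 → Fin 3 → Fin 3 → ℝ
  a14 : Fin 3 → Fin 3 → ℝ
  a22 : Fin 3 → Fin 3 → Fin 3 → Fin 3 → Fin 3 → Fin 3 → ℝ
  a23 : Fin 3 → Fin 3 → Fin 3 → Fin 3 → ℝ
  a33 : Fin 3 → Fin 3 → ℝ
  a77 : Fin 3 → Fin 3 → Fin 3 → Fin 3 → ℝ
  a47 : Fin 3 → Fin 3 → ℝ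
  k : Fin 3 → Fin 3 → ℝ
  ρ_pos : 0 < ρ
  T0_pos : 0 < T0
  β_ne : β ≠ 0
  c_ne : c ≠ 0
  β'_ne : β + γ / (c * β) ≠ 0
  a11_symm : ∀ i j p q, a11 i j p q = a11 j i p q ∧ a11 i j p q = a11 p q i j
  a14_symm : ∀ i j, a14 i j = a14 j i
  a22_symm : ∀ i j l p q s, a22 i j l p q s = a22 j i l p q s ∧ a22 i j l p q s = a22 p q s i j l
  a23_symm : ∀ i j p q, a23 i j p q = a23 j i p q
  a33_symm : ∀ i j, a33 i j = a33 j i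
  k_symm : ∀ i j, k i j = k j i
  a17_symm : ∀ i j p q, a17 i j p q = a17 j i p q ∧ a17 i j p q = a17 i j q p
  a77_symm : ∀ i j p q, a77 i j p q = a77 j i p q ∧ a77 i j p q = a77 p q i j
  a47_symm : ∀ i j, a47 i j = a47 j i
  γ_div_β_nonneg : 0 ≤ γ / β
  k_nonneg : ∀ v : Fin 3 → ℝ, 0 ≤ ∑ i, ∑ j, k i j * v i * v j

/-- `β' = β + γ / (c β)`. -/
noncomputable def Material.β' (m : Material) : ℝ := m.β + m.γ / (m.c * m.β)

/-- The kernel `l(t) = 1`. -/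
def kl : Field := fun _ _ => 1

/-- The kernel `ξ(t) = [l * l](t) = t`. -/
def kξ : Field := fun _ t => t

/-- The kernel `ζ(t) = β⁻¹ exp(-t/β)`. -/
noncomputable def kζ (m : Material) : Field := fun _ t => 1 / m.β * Real.exp (-t / m.β)

/-- The kernel `χ(t) = β'⁻¹ exp(-t/β')`. -/
noncomputable def kχ (m : Material) : Field := fun _ t => 1 / m.β' * Real.exp (-t / m.β')

/-! ### Processes -/

/-- An ordered array
`(u_i, θ, φ, e_ij, κ_ijk, β_i, E_i, V_ij, τ_ij, μ_ijk, σ_i, Q_ij, η, q_i)` of fields. -/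
@[ext] structure Proc where
  u : Fin 3 → Field
  θ : Field
  φ : Field
  e : Fin 3 → Fin 3 → Field
  κ : Fin 3 → Fin 3 → Fin 3 → Field
  b : Fin 3 → Field
  E : Fin 3 → Field
  V : Fin 3 → Fin 3 → Field
  τ : Fin 3 → Fin 3 → Field
  μ : Fin 3 → Fin 3 → Fin 3 → Field
  σ : Fin 3 → Field
  Q : Fin 3 → Fin 3 → Field
  η : Field
  q : Fin 3 → Field

instance : Add Proc where
  add p p' := ⟨p.u + p'.u, p.θ + p'.θ, p.φ + p'.φ, p.e + p'.e, p.κ + p'.κ, p.b + p'.b, p.E + p'.E,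
    p.V + p'.V, p.τ + p'.τ, p.μ + p'.μ, p.σ + p'.σ, p.Q + p'.Q, p.η + p'.η, p.q + p'.q⟩

instance : SMul ℝ Proc where
  smul s p := ⟨s • p.u, s • p.θ, s • p.φ, s • p.e, s • p.κ, s • p.b, s • p.E,
    s • p.V, s • p.τ, s • p.μ, s • p.σ, s • p.Q, s • p.η, s • p.q⟩

/-- The space `𝒱` of admissible processes on `B̄ × [0,∞)`. -/
structure IsAdmissible (B : Set E3) (p : Proc) : Prop where
  u : ∀ i, IsC B 4 2 (p.u i)
  φ : IsC B 4 0 p.φ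
  θ : IsC B 2 2 p.θ
  e : ∀ i j, IsC B 2 1 (p.e i j)
  V : ∀ i j, IsC B 2 1 (p.V i j)
  η : IsC B 0 1 p.η
  κ : ∀ i j k, IsC B 2 0 (p.κ i j k)
  E : ∀ i, IsC B 2 0 (p.E i)
  μ : ∀ i j k, IsC B 2 0 (p.μ i j k)
  Q : ∀ i j, IsC B 2 0 (p.Q i j)
  b : ∀ i, IsC B 1 0 (p.b i)
  τ : ∀ i j, IsC B 1 0 (p.τ i j)
  σ : ∀ i, IsC B 1 0 (p.σ i)
  q : ∀ i, IsC B 1 0 (p.q i)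
  symm : ∀ x ∈ closure B, ∀ t ∈ Ici (0 : ℝ), ∀ i j k,
    p.e i j x t = p.e j i x t ∧ p.κ i j k x t = p.κ j i k x t ∧ p.V i j x t = p.V j i x t ∧
    p.τ i j x t = p.τ j i x t ∧ p.μ i j k x t = p.μ j i k x t ∧ p.Q i j x t = p.Q j i x t

/-! ### Boundary operators -/

/-- `P_i = (τ_ji - μ_kji,k) n_j - 𝒟_j(μ_kji n_k) + (𝒟_l n_l) μ_kji n_k n_j`. -/
noncomputable def tractionP (B : Set E3) (r : E3 → ℝ) (p : Proc) (i : Fin 3) : Field :=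
  ∑ j, (p.τ j i - ∑ k, dx B k (p.μ k j i)) * nrm r j
    - ∑ j, surfD B r j (∑ k, p.μ k j i * nrm r k)
    + (∑ l, surfD B r l (nrm r l)) * ∑ k, ∑ j, p.μ k j i * nrm r k * nrm r j

/-- `R_i = μ_kji n_k n_j`. -/
noncomputable def hyperR (r : E3 → ℝ) (p : Proc) (i : Fin 3) : Field :=
  ∑ k, ∑ j, p.μ k j i * nrm r k * nrm r j

/-- `Λ = (σ_j - Q_kj,k) n_j - 𝒟_j(Q_kj n_k) + (𝒟_l n_l) Q_kj n_k n_j`. -/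
noncomputable def chargeΛ (B : Set E3) (r : E3 → ℝ) (p : Proc) : Field :=
  ∑ j, (p.σ j - ∑ k, dx B k (p.Q k j)) * nrm r j
    - ∑ j, surfD B r j (∑ k, p.Q k j * nrm r k)
    + (∑ l, surfD B r l (nrm r l)) * ∑ k, ∑ j, p.Q k j * nrm r k * nrm r j

/-- `H = Q_kj n_k n_j`. -/
noncomputable def hyperH (r : E3 → ℝ) (p : Proc) : Field :=
  ∑ k, ∑ j, p.Q k j * nrm r k * nrm r j

/-- The heat flux `q = q_i n_i` through the boundary. -/
noncomputable def fluxq (r : E3 → ℝ) (p : Proc) : Field := ∑ i, p.q i * nrm r i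

/-! ### Boundary pieces and given data -/

/-- The pairs `(S i, Sg i)`, `i = 0, …, 4`, of complementary parts of the boundary. The last two
conditions are the regularity of these parts: they cover the boundary up to zero area, and
no point of a part has a neighbourhood meeting that part in zero area. -/
structure IsBoundarySplitting (B : Set E3) (S Sg : Fin 5 → Set E3) : Prop where
  cover : ∀ i, closure (S i) ∪ Sg i = frontier B
  disjoint : ∀ i, S i ∩ Sg i = ∅
  meas : ∀ i, MeasurableSet (S i) ∧ MeasurableSet (Sg i)
  null : ∀ i, μHE[2] (frontier B \ (S i ∪ Sg i)) = 0
  fat : ∀ i, (∀ x ∈ S i, ∀ U ∈ 𝓝 x, 0 < μHE[2] (S i ∩ U)) ∧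
    (∀ x ∈ Sg i, ∀ U ∈ 𝓝 x, 0 < μHE[2] (Sg i ∩ U))

/-- The array of given data: supplies `f, g, h`, initial data `u0, v0, θ0, η0`, and boundary data
(`bu` for `û`, `bd` for `d̂`, `bθ` for `θ̂`, `bφ` for `φ̂`, `bω` for `ω̂`, `bP` for `P̂`, `bR` for `R̂`,
`bq` for `q̂`, `bΛ` for `Λ̂`, `bH` for `Ĥ`). -/
structure Data where
  f : Fin 3 → Field
  g : Field
  h : Field
  u0 : Fin 3 → E3 → ℝ
  v0 : Fin 3 → E3 → ℝ
  θ0 : E3 → ℝ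
  η0 : E3 → ℝ
  bu : Fin 3 → Field
  bd : Fin 3 → Field
  bθ : Field
  bφ : Field
  bω : Field
  bP : Fin 3 → Field
  bR : Fin 3 → Field
  bq : Field
  bΛ : Field
  bH : Field

/-- `F` is continuous on `S × [0,∞)`, and bounded on `S × [0,T]` for every `T`. -/
def IsBoundaryDatum (S : Set E3) (F : Field) : Prop :=
  ContinuousOn (fun p : E3 × ℝ => F p.1 p.2) (S ×ˢ Ici 0) ∧
    ∀ T : ℝ, ∃ C : ℝ, ∀ x ∈ S, ∀ t ∈ Icc 0 T, |F x t| ≤ C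

/-- `F` is continuous on `B̄ × [0,∞)`. -/
def IsSupply (B : Set E3) (F : Field) : Prop :=
  ContinuousOn (fun p : E3 × ℝ => F p.1 p.2) (closure B ×ˢ Ici 0)

/-- All given data are continuous on their domains. -/
structure Data.IsContinuous (Γ : Data) (B : Set E3) (S Sg : Fin 5 → Set E3) : Prop where
  f : ∀ i, IsSupply B (Γ.f i)
  g : IsSupply B Γ.g
  h : IsSupply B Γ.h
  u0 : ∀ i, ContinuousOn (Γ.u0 i) (closure B)
  v0 : ∀ i, ContinuousOn (Γ.v0 i) (closure B)
  θ0 : ContinuousOn Γ.θ0 (closure B)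
  η0 : ContinuousOn Γ.η0 (closure B)
  bu : ∀ i, IsBoundaryDatum (S 0) (Γ.bu i)
  bd : ∀ i, IsBoundaryDatum (S 1) (Γ.bd i)
  bθ : IsBoundaryDatum (S 2) Γ.bθ
  bφ : IsBoundaryDatum (S 3) Γ.bφ
  bω : IsBoundaryDatum (S 4) Γ.bω
  bP : ∀ i, IsBoundaryDatum (Sg 0) (Γ.bP i)
  bR : ∀ i, IsBoundaryDatum (Sg 1) (Γ.bR i)
  bq : IsBoundaryDatum (Sg 2) Γ.bq
  bΛ : IsBoundaryDatum (Sg 3) Γ.bΛ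
  bH : IsBoundaryDatum (Sg 4) Γ.bH

/-! ### The mixed initial-boundary value problem -/

/-- Balance equations, geometric relations and constitutive equations on `B × J`. -/
structure SatisfiesFieldEquations (m : Material) (B : Set E3) (Γ : Data) (J : Set ℝ)
    (p : Proc) : Prop where
  motion : ∀ x ∈ B, ∀ t ∈ J, ∀ i,
    (∑ j, dx B j (p.τ j i)) x t - (∑ k, ∑ j, dx B j (dx B k (p.μ k j i))) x t + m.ρ * Γ.f i x t
      = m.ρ * dt (dt (p.u i)) x t
  electric : ∀ x ∈ B, ∀ t ∈ J,
    (∑ i, dx B i (p.σ i)) x t - (∑ j, ∑ i, dx B i (dx B j (p.Q j i))) x t = Γ.g x t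
  energy : ∀ x ∈ B, ∀ t ∈ J,
    m.ρ * m.T0 * dt p.η x t + (∑ j, dx B j (p.q j)) x t - m.ρ * Γ.h x t = 0
  geom_e : ∀ x ∈ B, ∀ t ∈ J, ∀ i j, p.e i j x t = 1 / 2 * (dx B j (p.u i) x t + dx B i (p.u j) x t)
  geom_κ : ∀ x ∈ B, ∀ t ∈ J, ∀ i j k, p.κ i j k x t = dx B j (dx B i (p.u k)) x t
  geom_b : ∀ x ∈ B, ∀ t ∈ J, ∀ i, p.b i x t = dx B i p.θ x t
  geom_E : ∀ x ∈ B, ∀ t ∈ J, ∀ i, p.E i x t = -dx B i p.φ x t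
  geom_V : ∀ x ∈ B, ∀ t ∈ J, ∀ i j, p.V i j x t = -dx B j (dx B i p.φ) x t
  const_τ : ∀ x ∈ B, ∀ t ∈ J, ∀ i j,
    p.τ i j x t = ∑ k, ∑ l, m.a11 i j k l * p.e k l x t + ∑ k, ∑ l, m.a17 i j k l * p.V k l x t
      + m.a14 i j * (p.θ x t + m.β * dt p.θ x t)
  const_μ : ∀ x ∈ B, ∀ t ∈ J, ∀ i j k,
    p.μ i j k x t = ∑ l, ∑ h, ∑ n, m.a22 i j k l h n * p.κ l h n x t
      + ∑ l, m.a23 i j k l * p.E l x t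
  const_σ : ∀ x ∈ B, ∀ t ∈ J, ∀ i,
    -p.σ i x t = ∑ j, ∑ k, ∑ l, m.a23 j k l i * p.κ j k l x t + ∑ j, m.a33 i j * p.E j x t
  const_Q : ∀ x ∈ B, ∀ t ∈ J, ∀ i j,
    -p.Q i j x t = ∑ k, ∑ l, m.a17 k l i j * p.e k l x t + ∑ k, ∑ l, m.a77 i j k l * p.V k l x t
      + m.a47 i j * (p.θ x t + m.β * dt p.θ x t)
  const_η : ∀ x ∈ B, ∀ t ∈ J,
    -(m.ρ * p.η x t) = ∑ i, ∑ j, m.a14 i j * p.e i j x t + ∑ i, ∑ j, m.a47 i j * p.V i j x t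
      + m.c * (p.θ x t + m.β' * dt p.θ x t)
  const_q : ∀ x ∈ B, ∀ t ∈ J, ∀ i, -(p.q i x t / m.T0) = ∑ j, m.k i j * p.b j x t

/-- The initial conditions on `B̄`. -/
structure SatisfiesInitial (B : Set E3) (Γ : Data) (p : Proc) : Prop where
  u : ∀ x ∈ closure B, ∀ i, p.u i x 0 = Γ.u0 i x
  v : ∀ x ∈ closure B, ∀ i, dt (p.u i) x 0 = Γ.v0 i x
  θ : ∀ x ∈ closure B, p.θ x 0 = Γ.θ0 x
  η : ∀ x ∈ closure B, p.η x 0 = Γ.η0 x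

/-- The boundary conditions during the time set `J`. -/
structure SatisfiesBoundary (B : Set E3) (r : E3 → ℝ) (S Sg : Fin 5 → Set E3) (Γ : Data)
    (J : Set ℝ) (p : Proc) : Prop where
  u : ∀ x ∈ S 0, ∀ t ∈ J, ∀ i, p.u i x t = Γ.bu i x t
  P : ∀ x ∈ Sg 0, ∀ t ∈ J, ∀ i, tractionP B r p i x t = Γ.bP i x t
  d : ∀ x ∈ S 1, ∀ t ∈ J, ∀ i, normalD B r (p.u i) x t = Γ.bd i x t
  R : ∀ x ∈ Sg 1, ∀ t ∈ J, ∀ i, hyperR r p i x t = Γ.bR i x t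
  θ : ∀ x ∈ S 2, ∀ t ∈ J, p.θ x t = Γ.bθ x t
  q : ∀ x ∈ Sg 2, ∀ t ∈ J, fluxq r p x t = Γ.bq x t
  φ : ∀ x ∈ S 3, ∀ t ∈ J, p.φ x t = Γ.bφ x t
  Λ : ∀ x ∈ Sg 3, ∀ t ∈ J, chargeΛ B r p x t = Γ.bΛ x t
  w : ∀ x ∈ S 4, ∀ t ∈ J, normalD B r p.φ x t = Γ.bω x t
  H : ∀ x ∈ Sg 4, ∀ t ∈ J, hyperH r p x t = Γ.bH x t

/-- `p` is an admissible process that satisfies the initial conditions and, at the times `t ∈ J`,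
the field equations and the boundary conditions. With `J = [0,∞)` this is membership in the
set `𝒦` of solutions of the mixed initial-boundary value problem. -/
structure IsSolutionOn (m : Material) (B : Set E3) (r : E3 → ℝ) (S Sg : Fin 5 → Set E3) (Γ : Data)
    (J : Set ℝ) (p : Proc) : Prop where
  admissible : IsAdmissible B p
  field : SatisfiesFieldEquations m B Γ J p
  initial : SatisfiesInitial B Γ p
  boundary : SatisfiesBoundary B r S Sg Γ J p

/-! ### Reduced constitutive functions and convoluted data -/

/-- `τ̂_ij = a11_ijkl e_kl + a17_ijkl V_kl`. -/
noncomputable def hatτ (m : Material) (p : Proc) (i j : Fin 3) : Field :=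
  ∑ k, ∑ l, m.a11 i j k l • p.e k l + ∑ k, ∑ l, m.a17 i j k l • p.V k l

/-- `μ̂_ijk = a22_ijklhm κ_lhm + a23_ijkl E_l`. -/
noncomputable def hatμ (m : Material) (p : Proc) (i j k : Fin 3) : Field :=
  ∑ l, ∑ h, ∑ n, m.a22 i j k l h n • p.κ l h n + ∑ l, m.a23 i j k l • p.E l

/-- `-σ̂_i = a23_jkli κ_jkl + a33_ij E_j`. -/
noncomputable def hatσ (m : Material) (p : Proc) (i : Fin 3) : Field :=
  -(∑ j, ∑ k, ∑ l, m.a23 j k l i • p.κ j k l + ∑ j, m.a33 i j • p.E j)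

/-- `-Q̂_ij = a17_klij e_kl + a77_ijkl V_kl`. -/
noncomputable def hatQ (m : Material) (p : Proc) (i j : Fin 3) : Field :=
  -(∑ k, ∑ l, m.a17 k l i j • p.e k l + ∑ k, ∑ l, m.a77 i j k l • p.V k l)

/-- `ρ η̂`, where `-ρ η̂ = a14_ij e_ij + a47_ij V_ij`. -/
noncomputable def hatρη (m : Material) (p : Proc) : Field :=
  -(∑ i, ∑ j, m.a14 i j • p.e i j + ∑ i, ∑ j, m.a47 i j • p.V i j)

/-- `-q̂_i = T0 k_ij β_j`. -/
noncomputable def hatq (m : Material) (p : Proc) (i : Fin 3) : Field :=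
  -(m.T0 • ∑ j, m.k i j • p.b j)

/-- `ℱ_i = ρ ξ * f_i + ρ v⁰_i t + ρ u⁰_i`. -/
noncomputable def dataF (m : Material) (Γ : Data) (i : Fin 3) : Field :=
  m.ρ • (kξ ⊛ Γ.f i) + (fun x t => m.ρ * Γ.v0 i x * t + m.ρ * Γ.u0 i x)

/-- `ℋ = ρ T0 η⁰ + l * ρ h`. -/
noncomputable def dataH (m : Material) (Γ : Data) : Field :=
  (fun x _ => m.ρ * m.T0 * Γ.η0 x) + kl ⊛ (m.ρ • Γ.h)

/-- `ℒ_ij = a14_ij θ⁰ exp(-t/β)`. -/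
noncomputable def dataL (m : Material) (Γ : Data) (i j : Fin 3) : Field :=
  fun x t => m.a14 i j * Γ.θ0 x * Real.exp (-t / m.β)

/-- `ℳ_ij = a47_ij θ⁰ exp(-t/β)`. -/
noncomputable def dataM (m : Material) (Γ : Data) (i j : Fin 3) : Field :=
  fun x t => m.a47 i j * Γ.θ0 x * Real.exp (-t / m.β)

/-- `ℛ = c θ⁰ exp(-t/β')`. -/
noncomputable def dataR (m : Material) (Γ : Data) : Field :=
  fun x t => m.c * Γ.θ0 x * Real.exp (-t / m.β')

/-! ### The functional -/

/-- The expression in braces that `χ` is convolved with in the volume integral of `Λ_t`. -/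
noncomputable def volumeDensity (m : Material) (B : Set E3) (Γ : Data) (p : Proc) : Field :=
  ∑ i, (kζ m ⊛ (kξ ⊛ (∑ j, dx B j (p.τ j i) - ∑ k, ∑ j, dx B j (dx B k (p.μ k j i)))
      + dataF m Γ i - (1 / 2 * m.ρ) • p.u i)) ⊛ p.u i
  + kζ m ⊛ kξ ⊛ (∑ i, dx B i (p.σ i) - ∑ j, ∑ i, dx B i (dx B j (p.Q j i)) - Γ.g) ⊛ p.φ
  - kξ ⊛ ((1 / m.T0) • (-(kl ⊛ ∑ i, dx B i (p.q i)) + dataH m Γ - (m.ρ * m.T0) • p.η)) ⊛ p.θ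
  + ∑ i, ∑ j, kξ ⊛ (kζ m ⊛ (p.τ i j - (1 / 2 : ℝ) • hatτ m p i j) + dataL m Γ i j) ⊛ p.e i j
  + ∑ i, ∑ j, ∑ k, kζ m ⊛ kξ ⊛ (p.μ i j k - (1 / 2 : ℝ) • hatμ m p i j k) ⊛ p.κ i j k
  - ∑ i, kζ m ⊛ kξ ⊛ (p.σ i - (1 / 2 : ℝ) • hatσ m p i) ⊛ p.E i
  + ∑ i, ∑ j, kξ ⊛ (-(kζ m ⊛ (p.Q i j - (1 / 2 : ℝ) • hatQ m p i j)) + dataM m Γ i j) ⊛ p.V i j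
  - kξ ⊛ ((1 / m.c) • (-(kχ m ⊛ ((1 / 2 : ℝ) • (m.ρ • p.η - hatρη m p))) + dataR m Γ))
      ⊛ (m.ρ • p.η - hatρη m p)
  - ∑ i, kξ ⊛ kl ⊛ (-((1 / m.T0) • (p.q i - (1 / 2 : ℝ) • hatq m p i))) ⊛ p.b i

/-- The function of time `t ↦ ∫_A F(·, t) da`, with `da` the surface area. -/
noncomputable def surfInt (A : Set E3) (F : Field) : ℝ → ℝ := fun t => ∫ x in A, F x t ∂μHE[2]

/-- The sum of the four brackets of surface integrals in `Λ_t` convolved with `χ * ζ * ξ`. -/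
noncomputable def surfaceMech (B : Set E3) (r : E3 → ℝ) (S Sg : Fin 5 → Set E3) (Γ : Data)
    (p : Proc) : ℝ → ℝ :=
  (surfInt (S 0) (∑ i, tractionP B r p i ⊛ Γ.bu i)
    + surfInt (Sg 0) (∑ i, (tractionP B r p i - Γ.bP i) ⊛ p.u i))
  + (surfInt (S 1) (∑ i, hyperR r p i ⊛ Γ.bd i)
    + surfInt (Sg 1) (∑ i, (hyperR r p i - Γ.bR i) ⊛ normalD B r (p.u i)))
  + (surfInt (S 3) (chargeΛ B r p ⊛ Γ.bφ)
    + surfInt (Sg 3) ((chargeΛ B r p - Γ.bΛ) ⊛ p.φ))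
  + (surfInt (S 4) (hyperH r p ⊛ Γ.bω)
    + surfInt (Sg 4) ((hyperH r p - Γ.bH) ⊛ normalD B r p.φ))

/-- The bracket of surface integrals in `Λ_t` convolved with `T0⁻¹ χ * ξ * l`. -/
noncomputable def surfaceHeat (r : E3 → ℝ) (S Sg : Fin 5 → Set E3) (Γ : Data) (p : Proc) :
    ℝ → ℝ :=
  surfInt (S 2) (fluxq r p ⊛ Γ.bθ) + surfInt (Sg 2) ((fluxq r p - Γ.bq) ⊛ p.θ)

/-- The functional `Λ_t{p}`. (The kernels do not depend on the point, so they are evaluated at `0`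
in the convolutions with functions of time alone.) -/
noncomputable def functional (m : Material) (B : Set E3) (r : E3 → ℝ) (S Sg : Fin 5 → Set E3)
    (Γ : Data) (t : ℝ) (p : Proc) : ℝ :=
  (∫ x in B, (kχ m ⊛ volumeDensity m B Γ p) x t)
  - tconv (kχ m 0) (tconv (kζ m 0) (tconv (kξ 0) (surfaceMech B r S Sg Γ p))) t
  - 1 / m.T0 * tconv (kχ m 0) (tconv (kξ 0) (tconv (kl 0) (surfaceHeat r S Sg Γ p))) t

/-- `δΛ_t{p} = 0` over `𝒱`: for every `p' ∈ 𝒱` the derivative of `s ↦ Λ_t{p + s p'}` at `s = 0`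
exists and is zero. -/
def VariationVanishes (m : Material) (B : Set E3) (r : E3 → ℝ) (S Sg : Fin 5 → Set E3)
    (Γ : Data) (t : ℝ) (p : Proc) : Prop :=
  ∀ p' : Proc, IsAdmissible B p' →
    HasDerivAt (fun s : ℝ => functional m B r S Sg Γ t (p + s • p')) 0 0

end ThermoPiezo

namespace ThermoPiezo

open Filter

/-! ### Geometry of a smooth region -/

namespace IsSmoothRegion

variable {B : Set E3} {r : E3 → ℝ}

/-! Along a line `p + s • p'` the functional is a quadratic polynomial in `s` (`functional_line`),
so its derivative at `s = 0` always exists and is the linear coefficient `firstVar`. The coefficient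
is computed in the commutative algebra of continuous, locally bounded fields under convolution in
time, with a unit adjoined so that ring identities apply. The constitutive matrices are reciprocal,
hence the factors 1/2 disappear (`Arr.quad_line`). Derivatives of the varied stresses, displacements
and heat flux are moved onto `u`, `φ`, `θ` by Green's formula (`conv_green`), and the boundary
integrals this produces cancel against those in the variation of the surface terms (`partInt_line`).
What remains pairs each component of `p'` with a residual of the problem convolved with kernels, and
each boundary value of `p'` with the residual of a boundary condition.

The initial data sit inside the residuals: convolution with `l` turns a time derivative into `A -
A(0)`, and the exponential kernel with constant `b` turns `A + b A'` into `A - A(0) exp(-t/b)`. All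
kernels are injective on every interval `[0, T]` (`isInjKernel_exp`, `IsInjKernel.conv`). Thus the
residuals vanish on `[0, T]` exactly when the field equations hold there and the initial values are
right (`motion_iff`, `energy_iff`, `relaxation_iff`, `stress_iff`, collected in
`symmVanishes_coefP_iff`).

Vanishing of the variation at the single time `T > 0` is enough, because a convolution at `T`
integrates the residual over all of `[0, T]` against the time-reversed test function
(`eq_zero_of_tconv_smooth`). Products of a function of position supported in `B` with a function of
time give the interior equations (`symmVanishes_of_firstVar`). Once these hold the volume term is
zero for every variation, and fields with prescribed boundary values give the ten boundary
conditions (`satisfiesBoundary_of_firstVar`). The statement on `[0, ∞)` is the union over `T`; time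
`0` carries no condition.

The integral theorems are proved on the way. Near a boundary point the boundary is a nearly flat
graph, on which area and plane Lebesgue measure agree up to a factor `1 + O(δ)`; a partition of
unity and `δ → 0` give the divergence theorem (`integral_fderiv_eq_surface`). The surface divergence
theorem (`integral_surfD`) follows from it because second derivatives commute. -/

lemma isOpen (hB : IsSmoothRegion B r) : IsOpen B := by
  rw [hB.eq_neg]; exact isOpen_lt hB.smooth.continuous continuous_const

lemma mem_iff (hB : IsSmoothRegion B r) {x : E3} : x ∈ B ↔ r x < 0 := by
  rw [hB.eq_neg]; rfl

lemma differentiable (hB : IsSmoothRegion B r) : Differentiable ℝ r :=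
  hB.smooth.differentiable (by simp)

/-- The difference quotients of `r` along `w` tend to a negative number, so `r` is negative just
after leaving `x`. Both the description of the closure and unique differentiability rest on this. -/
lemma eventually_line_mem (hB : IsSmoothRegion B r) {x w : E3} (hx : r x = 0)
    (hw : fderiv ℝ r x w < 0) : ∀ᶠ s in 𝓝[>] (0 : ℝ), x + s • w ∈ B := by
  have hd : HasDerivAt (fun s : ℝ => r (x + s • w)) (fderiv ℝ r x w) 0 := by
    have h1 : HasDerivAt (fun s : ℝ => x + s • w) w 0 := by
      simpa using ((hasDerivAt_id (0 : ℝ)).smul_const w).const_add x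
    have h2 : HasFDerivAt r (fderiv ℝ r x) (x + (0 : ℝ) • w) := by
      simpa using (hB.differentiable x).hasFDerivAt
    exact h2.comp_hasDerivAt (0 : ℝ) h1
  have h3 := (hasDerivAt_iff_tendsto_slope.1 hd).mono_left
    (nhdsWithin_mono (0 : ℝ) (fun s (hs : 0 < s) => (ne_of_gt hs : s ≠ 0)))
  filter_upwards [h3.eventually (gt_mem_nhds hw), self_mem_nhdsWithin] with s hs hs0
  have hs0 : 0 < s := hs0
  simp only [slope, sub_zero, zero_smul, add_zero, hx, vsub_eq_sub, smul_eq_mul] at hs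
  rw [hB.mem_iff]
  by_contra hcon
  exact absurd hs (not_lt.2 (mul_nonneg (inv_nonneg.2 hs0.le) (not_lt.1 hcon)))

lemma exists_fderiv_neg (hB : IsSmoothRegion B r) {x : E3} (hx : r x = 0) :
    ∃ w, fderiv ℝ r x w < 0 := by
  by_contra! hcon
  refine hB.regular x hx (ContinuousLinearMap.ext fun w => ?_)
  have h1 := hcon w
  have h2 := hcon (-w)
  rw [map_neg] at h2
  simp; linarith

/-- Regularity of the zero set matters here: a nonzero gradient supplies a direction of decrease, so
each zero of `r` is a limit of points of `B`. -/
lemma closure_eq (hB : IsSmoothRegion B r) : closure B = {x | r x ≤ 0} := by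
  apply Subset.antisymm
  · apply closure_minimal
    · intro x hx; exact (hB.mem_iff.1 hx).le
    · exact isClosed_le hB.smooth.continuous continuous_const
  · intro x hx
    rcases lt_or_eq_of_le (show r x ≤ 0 from hx) with h | h
    · exact subset_closure (hB.mem_iff.2 h)
    · obtain ⟨w, hw⟩ := hB.exists_fderiv_neg h
      have h1 : Tendsto (fun s : ℝ => x + s • w) (𝓝[>] 0) (𝓝 x) := by
        have : Tendsto (fun s : ℝ => x + s • w) (𝓝 0) (𝓝 (x + (0 : ℝ) • w)) := by
          apply Continuous.tendsto; fun_prop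
        simpa using this.mono_left nhdsWithin_le_nhds
      exact mem_closure_of_tendsto h1 (hB.eventually_line_mem h hw)

lemma mem_closure_iff (hB : IsSmoothRegion B r) {x : E3} : x ∈ closure B ↔ r x ≤ 0 := by
  rw [hB.closure_eq]; rfl

lemma frontier_eq (hB : IsSmoothRegion B r) : frontier B = {x | r x = 0} := by
  ext x
  rw [hB.isOpen.frontier_eq, Set.mem_sdiff, hB.mem_closure_iff, hB.mem_iff]
  exact ⟨fun h => le_antisymm h.1 (not_lt.1 h.2), fun h => ⟨le_of_eq h, not_lt.2 (ge_of_eq h)⟩⟩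

lemma mem_frontier_iff (hB : IsSmoothRegion B r) {x : E3} : x ∈ frontier B ↔ r x = 0 := by
  rw [hB.frontier_eq]; rfl

lemma isCompact_closure (hB : IsSmoothRegion B r) : IsCompact (closure B) :=
  hB.bounded.isCompact_closure

lemma isCompact_frontier (hB : IsSmoothRegion B r) : IsCompact (frontier B) :=
  hB.isCompact_closure.of_isClosed_subset isClosed_frontier frontier_subset_closure

lemma measure_lt_top (hB : IsSmoothRegion B r) : volume B < ⊤ := hB.bounded.measure_lt_top

/-- At a boundary point the tangent cone contains an open half-space, which spans. Derivatives up to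
the boundary are therefore well defined. -/
lemma uniqueDiffOn (hB : IsSmoothRegion B r) : UniqueDiffOn ℝ (closure B) := by
  intro x hx
  rcases lt_or_eq_of_le (hB.mem_closure_iff.1 hx) with h | h
  · exact uniqueDiffWithinAt_of_mem_nhds
      (mem_of_superset (hB.isOpen.mem_nhds (hB.mem_iff.2 h)) subset_closure)
  · rw [uniqueDiffWithinAt_iff]
    refine ⟨?_, subset_closure hx⟩
    have hsub : {w : E3 | fderiv ℝ r x w < 0} ⊆ tangentConeAt ℝ (closure B) x := by
      intro w hw
      exact mem_tangentConeAt_of_add_smul_mem (l := 𝓝[>] (0 : ℝ)) (c := id)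
        (tendsto_id'.2 (nhdsGT_le_nhdsNE _))
        ((hB.eventually_line_mem h hw).mono fun _ hs => subset_closure hs)
    have hopen : IsOpen {w : E3 | fderiv ℝ r x w < 0} :=
      isOpen_lt (fderiv ℝ r x).continuous continuous_const
    obtain ⟨w, hw⟩ := hB.exists_fderiv_neg h
    have : Submodule.span ℝ (tangentConeAt ℝ (closure B) x) = ⊤ :=
      Submodule.eq_top_of_nonempty_interior' _
        ⟨w, mem_interior.2 ⟨_, hsub.trans Submodule.subset_span, hopen, hw⟩⟩
    rw [this]; exact dense_univ

end IsSmoothRegion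

/-! ### Fields tangent to the level sets of the defining function -/

/-- `F` is continuous up to the boundary of `B` and continuously differentiable in `B`, with bounded
derivative. -/
structure IsC1Bounded (B : Set E3) (F : E3 → ℝ) : Prop where
  cont : ContinuousOn F (closure B)
  diff : ContDiffOn ℝ 1 F B
  bdd : ∃ C, ∀ x ∈ B, ‖fderiv ℝ F x‖ ≤ C

namespace IsC1Bounded

variable {B : Set E3} {r : E3 → ℝ} {F G : E3 → ℝ}

lemma differentiableAt (hB : IsSmoothRegion B r) (hF : IsC1Bounded B F) {x : E3} (hx : x ∈ B) :
    DifferentiableAt ℝ F x :=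
  (hF.diff.differentiableOn one_ne_zero).differentiableAt (hB.isOpen.mem_nhds hx)

lemma of_contDiff (hB : IsSmoothRegion B r) (hF : ContDiff ℝ 1 F) : IsC1Bounded B F := by
  refine ⟨hF.continuous.continuousOn, hF.contDiffOn, ?_⟩
  obtain ⟨C, hC⟩ := hB.isCompact_closure.exists_bound_of_continuousOn
    (hF.continuous_fderiv one_ne_zero).continuousOn
  exact ⟨C, fun x hx => hC x (subset_closure hx)⟩

lemma mul (hB : IsSmoothRegion B r) (hF : IsC1Bounded B F) (hG : IsC1Bounded B G) :
    IsC1Bounded B (fun x => F x * G x) := by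
  refine ⟨hF.cont.mul hG.cont, hF.diff.mul hG.diff, ?_⟩
  obtain ⟨C, hC⟩ := hB.isCompact_closure.exists_bound_of_continuousOn hF.cont
  obtain ⟨D, hD⟩ := hB.isCompact_closure.exists_bound_of_continuousOn hG.cont
  obtain ⟨C', hC'⟩ := hF.bdd
  obtain ⟨D', hD'⟩ := hG.bdd
  refine ⟨C * D' + D * C', fun x hx => ?_⟩
  rw [fderiv_fun_mul (hF.differentiableAt hB hx) (hG.differentiableAt hB hx)]
  refine (norm_add_le _ _).trans (add_le_add ?_ ?_)
  · rw [norm_smul]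
    exact mul_le_mul (hC x (subset_closure hx)) (hD' x hx) (norm_nonneg _)
      ((norm_nonneg _).trans (hC x (subset_closure hx)))
  · rw [norm_smul]
    exact mul_le_mul (hD x (subset_closure hx)) (hC' x hx) (norm_nonneg _)
      ((norm_nonneg _).trans (hD x (subset_closure hx)))

lemma continuousOn_fderiv (hB : IsSmoothRegion B r) (hF : IsC1Bounded B F) (w : E3) :
    ContinuousOn (fun x => fderiv ℝ F x w) B :=
  (hF.diff.continuousOn_fderiv_of_isOpen hB.isOpen le_rfl).clm_apply continuousOn_const

lemma integrableOn_fderiv (hB : IsSmoothRegion B r) (hF : IsC1Bounded B F) (w : E3) :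
    IntegrableOn (fun x => fderiv ℝ F x w) B := by
  obtain ⟨C, hC⟩ := hF.bdd
  refine IntegrableOn.of_bound hB.measure_lt_top
    ((hF.continuousOn_fderiv hB w).aestronglyMeasurable hB.isOpen.measurableSet) (C * ‖w‖) ?_
  filter_upwards [ae_restrict_mem hB.isOpen.measurableSet] with x hx
  exact (ContinuousLinearMap.le_opNorm _ _).trans
    (mul_le_mul_of_nonneg_right (hC x hx) (norm_nonneg _))

end IsC1Bounded

/-- A smooth cut-off, equal to `1` below `-2 / (n + 1)` and to `0` above `-1 / (n + 1)`. -/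
noncomputable def cutoff (n : ℕ) (s : ℝ) : ℝ := Real.smoothTransition (-(((n : ℝ) + 1) * s) - 1)

lemma contDiff_cutoff (n : ℕ) : ContDiff ℝ 1 (cutoff n) :=
  Real.smoothTransition.contDiff.comp (by fun_prop)

lemma cutoff_eq_zero {n : ℕ} {s : ℝ} (h : -1 / ((n : ℝ) + 1) ≤ s) : cutoff n s = 0 := by
  apply Real.smoothTransition.zero_of_nonpos
  rw [div_le_iff₀ (by positivity)] at h
  linarith

lemma tendsto_cutoff {s : ℝ} (hs : s < 0) : Tendsto (fun n => cutoff n s) atTop (𝓝 1) := by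
  obtain ⟨N, hN⟩ := exists_nat_gt (2 / -s)
  refine tendsto_const_nhds.congr' ?_
  filter_upwards [eventually_ge_atTop N] with n hn
  refine (Real.smoothTransition.one_of_one_le ?_).symm
  rw [div_lt_iff₀ (by linarith)] at hN
  have : (N : ℝ) ≤ n := by exact_mod_cast hn
  nlinarith

lemma abs_cutoff_le (n : ℕ) (s : ℝ) : |cutoff n s| ≤ 1 := by
  rw [cutoff, abs_of_nonneg (Real.smoothTransition.nonneg _)]
  exact Real.smoothTransition.le_one _

section Tangential

variable {B : Set E3} {r : E3 → ℝ} {F G : E3 → ℝ}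

/-- The product of `F` with the cut-off of `r`, extended by zero, is continuously differentiable
with compact support, so its derivative integrates to zero; the integrand is the product rule. -/
lemma integral_cutoff_fderiv (hB : IsSmoothRegion B r) (hF : IsC1Bounded B F) (w : E3) (n : ℕ) :
    ∫ x in B, (cutoff n (r x) * fderiv ℝ F x w + F x * (deriv (cutoff n) (r x) * fderiv ℝ r x w))
      = 0 := by
  set K : E3 → ℝ := B.indicator (fun x => cutoff n (r x) * F x) with hK
  have hpos : (0 : ℝ) < (n : ℝ) + 1 := by positivity
  have hout : ∀ x, -1 / ((n : ℝ) + 1) ≤ r x → K x = 0 := by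
    intro x hx
    by_cases hxB : x ∈ B
    · simp [hK, hxB, cutoff_eq_zero hx]
    · simp [hK, hxB]
  have hneg : -1 / ((n : ℝ) + 1) < 0 := div_neg_of_neg_of_pos (by norm_num) hpos
  have hsm : ContDiff ℝ 1 K := by
    rw [contDiff_iff_contDiffAt]
    intro x
    by_cases hxB : x ∈ B
    · have h1 : ContDiffAt ℝ 1 (fun x => cutoff n (r x) * F x) x :=
        ((contDiff_cutoff n).comp (hB.smooth.of_le (by simp))).contDiffAt.mul
          (hF.diff.contDiffAt (hB.isOpen.mem_nhds hxB))
      refine h1.congr_of_eventuallyEq ?_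
      filter_upwards [hB.isOpen.mem_nhds hxB] with y hy
      simp [hK, hy]
    · have h0 : 0 ≤ r x := not_lt.1 fun h => hxB (hB.mem_iff.2 h)
      have : K =ᶠ[𝓝 x] fun _ => 0 := by
        filter_upwards [hB.smooth.continuous.continuousAt.eventually
          (lt_mem_nhds (hneg.trans_le h0))] with y hy
        exact hout y hy.le
      exact contDiffAt_const.congr_of_eventuallyEq this
  have hcs : HasCompactSupport K := by
    refine HasCompactSupport.intro hB.isCompact_closure fun x hx => ?_
    exact indicator_of_notMem (fun h => hx (subset_closure h)) _
  have hint : Integrable K := hsm.continuous.integrable_of_hasCompactSupport hcs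
  have hint' : Integrable (fun x => fderiv ℝ K x w) :=
    ((hsm.continuous_fderiv one_ne_zero).clm_apply continuous_const).integrable_of_hasCompactSupport
      (hcs.fderiv_apply (𝕜 := ℝ) w)
  have hzero : ∫ x, fderiv ℝ K x w = 0 := by
    have := integral_mul_fderiv_eq_neg_fderiv_mul_of_integrable (μ := (volume : Measure E3))
      (f := fun _ => (1 : ℝ)) (g := K) (v := w) (by simp) (by simpa using hint')
      (by simpa using hint) (fun x _ => differentiableAt_const _)
      (fun x _ => hsm.differentiable one_ne_zero x)
    simpa using this
  have hsupp : ∀ x, x ∉ B → fderiv ℝ K x w = 0 := by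
    intro x hx
    have h0 : 0 ≤ r x := not_lt.1 fun h => hx (hB.mem_iff.2 h)
    have : K =ᶠ[𝓝 x] fun _ => 0 := by
      filter_upwards [hB.smooth.continuous.continuousAt.eventually
        (lt_mem_nhds (hneg.trans_le h0))] with y hy
      exact hout y hy.le
    simp [this.fderiv_eq]
  rw [← hzero, ← setIntegral_eq_integral_of_forall_compl_eq_zero hsupp]
  refine setIntegral_congr_fun hB.isOpen.measurableSet fun x hx => ?_
  have hcongr : K =ᶠ[𝓝 x] fun x => cutoff n (r x) * F x := by
    filter_upwards [hB.isOpen.mem_nhds hx] with y hy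
    simp [hK, hy]
  have hc : HasFDerivAt (fun x => cutoff n (r x)) (deriv (cutoff n) (r x) • fderiv ℝ r x) x :=
    (((contDiff_cutoff n).differentiable one_ne_zero (r x)).hasDerivAt).comp_hasFDerivAt x
      (hB.differentiable x).hasFDerivAt
  have h2 := hc.mul (hF.differentiableAt hB hx).hasFDerivAt
  have h3 : fderiv ℝ K x = _ := hcongr.fderiv_eq.trans h2.fderiv
  simp [h3]

/-- The divergence of a field tangent to the level sets of `r` integrates to zero. -/
lemma integral_fderiv_add_eq_zero (hB : IsSmoothRegion B r) (hF : IsC1Bounded B F)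
    (hG : IsC1Bounded B G) (v w : E3)
    (htan : ∀ x ∈ B, F x * fderiv ℝ r x v + G x * fderiv ℝ r x w = 0) :
    ∫ x in B, (fderiv ℝ F x v + fderiv ℝ G x w) = 0 := by
  have hFi := hF.integrableOn_fderiv hB v
  have hGi := hG.integrableOn_fderiv hB w
  have hmeas : ∀ n, AEStronglyMeasurable (fun x => cutoff n (r x)) (volume.restrict B) := fun n =>
    ((contDiff_cutoff n).continuous.comp hB.smooth.continuous).aestronglyMeasurable
  -- Tangency cancels the terms with `deriv (cutoff n)`, which are not bounded uniformly in `n`.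
  -- What is left is dominated, so `n` may tend to infinity.
  have hz : ∀ n, ∫ x in B, cutoff n (r x) * (fderiv ℝ F x v + fderiv ℝ G x w) = 0 := by
    intro n
    have hbd : ∃ C, ∀ x ∈ closure B, ‖deriv (cutoff n) (r x)‖ ≤ C :=
      hB.isCompact_closure.exists_bound_of_continuousOn
        (((contDiff_cutoff n).continuous_deriv le_rfl).comp hB.smooth.continuous).continuousOn
    have hi : ∀ {F : E3 → ℝ} (_ : IsC1Bounded B F) (w : E3), IntegrableOn (fun x =>
        cutoff n (r x) * fderiv ℝ F x w + F x * (deriv (cutoff n) (r x) * fderiv ℝ r x w)) B := by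
      intro F hF w
      refine ((hF.integrableOn_fderiv hB w).bdd_mul (hmeas n)
        (Eventually.of_forall fun x => abs_cutoff_le n (r x))).add ?_
      refine IntegrableOn.mono_set ?_ subset_closure
      refine ContinuousOn.integrableOn_compact hB.isCompact_closure (hF.cont.mul ?_)
      refine Continuous.continuousOn (Continuous.mul ?_ ?_)
      · exact ((contDiff_cutoff n).continuous_deriv le_rfl).comp hB.smooth.continuous
      · exact (hB.smooth.continuous_fderiv (by simp)).clm_apply continuous_const
    have h := integral_add (hi hF v) (hi hG w)
    rw [integral_cutoff_fderiv hB hF, integral_cutoff_fderiv hB hG, add_zero] at h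
    rw [← h]
    refine setIntegral_congr_fun hB.isOpen.measurableSet fun x hx => ?_
    have := htan x hx
    linear_combination (-deriv (cutoff n) (r x)) * this
  have hlim := tendsto_integral_of_dominated_convergence (μ := volume.restrict B)
    (F := fun n x => cutoff n (r x) * (fderiv ℝ F x v + fderiv ℝ G x w))
    (f := fun x => fderiv ℝ F x v + fderiv ℝ G x w)
    (fun x => ‖fderiv ℝ F x v + fderiv ℝ G x w‖)
    (fun n => (hmeas n).mul (hFi.add hGi).aestronglyMeasurable) (hFi.add hGi).norm
    (fun n => Eventually.of_forall fun x => by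
      rw [norm_mul]
      exact mul_le_of_le_one_left (norm_nonneg _) (abs_cutoff_le n (r x)))
    (by
      filter_upwards [ae_restrict_mem hB.isOpen.measurableSet] with x hx
      simpa using (tendsto_cutoff (hB.mem_iff.1 hx)).mul_const _)
  simp only [hz] at hlim
  exact (tendsto_nhds_unique hlim tendsto_const_nhds)

end Tangential

end ThermoPiezo

namespace ThermoPiezo

open Filter
open scoped RealInnerProductSpace NNReal ENNReal

/-! ### Comparison of measures -/

/-- Monotonicity in the measure, applied to the nonnegative functions `|f| + f` and `|f| - f`,
bounds the difference of the integrals of `f` by that of the integrals of `|f|`, which is controlled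
by the ratio `c` of the measures. -/
lemma abs_integral_sub_integral_le {α : Type*} [MeasurableSpace α] {μ ν : Measure α} {c : ℝ≥0}
    (h1 : μ ≤ ν) (h2 : ν ≤ c • μ) (hc : 1 ≤ c) {f : α → ℝ} (hf : Integrable f ν) :
    |∫ x, f x ∂ν - ∫ x, f x ∂μ| ≤ ((c : ℝ) - 1) * ∫ x, |f x| ∂ν := by
  have hfμ : Integrable f μ := hf.mono_measure h1
  have hmono : ∀ g : α → ℝ, Integrable g ν → (∀ x, 0 ≤ g x) → 0 ≤ ∫ x, g x ∂ν - ∫ x, g x ∂μ :=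
    fun g hg h0 => sub_nonneg.2 (integral_mono_measure h1 (Eventually.of_forall h0) hg)
  have hp := hmono (fun x => |f x| + f x) (hf.abs.add hf) (fun x => by
    have := neg_abs_le (f x); linarith)
  have hm := hmono (fun x => |f x| - f x) (hf.abs.sub hf) (fun x => by
    have := le_abs_self (f x); linarith)
  rw [integral_add hf.abs hf, integral_add hfμ.abs hfμ] at hp
  rw [integral_sub hf.abs hf, integral_sub hfμ.abs hfμ] at hm
  have hup : ∫ x, |f x| ∂ν ≤ c * ∫ x, |f x| ∂μ := by
    have := integral_mono_measure h2 (Eventually.of_forall fun x => abs_nonneg (f x))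
      (hfμ.abs.smul_measure_nnreal (c := c))
    rwa [integral_smul_nnreal_measure] at this
  have hle : ∫ x, |f x| ∂μ ≤ ∫ x, |f x| ∂ν :=
    integral_mono_measure h1 (Eventually.of_forall fun x => abs_nonneg (f x)) hf.abs
  have hc' : (0 : ℝ) ≤ (c : ℝ) - 1 := sub_nonneg.2 (by exact_mod_cast hc)
  have := mul_le_mul_of_nonneg_left hle hc'
  rw [abs_le]
  constructor <;> linarith

lemma euclideanHausdorffMeasure_image_le {X Y : Type*} [EMetricSpace X] [MeasurableSpace X]
    [BorelSpace X] [EMetricSpace Y] [MeasurableSpace Y] [BorelSpace Y] {f : X → Y} {K : ℝ≥0}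
    {s : Set X} (h : LipschitzOnWith K f s) (d : ℕ) :
    μHE[d] (f '' s) ≤ (K : ℝ≥0∞) ^ d * μHE[d] s := by
  have := h.hausdorffMeasure_image_le (d := (d : ℝ)) (by positivity)
  simp only [Measure.euclideanHausdorffMeasure_def, Measure.smul_apply, ENNReal.smul_def,
    smul_eq_mul]
  rw [ENNReal.rpow_natCast] at this
  calc _ ≤ _ := mul_le_mul_right this _
    _ = _ := by ring

/-! ### Coordinates along a unit vector and in its orthogonal plane -/

section Coordinates

variable (x₀ v : E3)

/-- The point `x₀ + s v + y`. -/
noncomputable def axisPoint (s : ℝ) (y : (ℝ ∙ v)ᗮ) : E3 := x₀ + s • v + y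

/-- The projection of `x - x₀` onto the plane orthogonal to `v`. -/
noncomputable def planeProj (x : E3) : (ℝ ∙ v)ᗮ := (ℝ ∙ v)ᗮ.orthogonalProjectionOnto (x - x₀)

lemma continuous_planeProj : Continuous (planeProj x₀ v) := by
  unfold planeProj; fun_prop

lemma continuous_axisPoint : Continuous fun p : ℝ × (ℝ ∙ v)ᗮ => axisPoint x₀ v p.1 p.2 := by
  unfold axisPoint; fun_prop

lemma planeProj_sub (x x' : E3) : planeProj x₀ v x - planeProj x₀ v x' =
    (ℝ ∙ v)ᗮ.orthogonalProjectionOnto (x - x') := by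
  rw [planeProj, planeProj, ← map_sub]; congr 1; abel

lemma lipschitzWith_planeProj : LipschitzWith 1 (planeProj x₀ v) := by
  refine LipschitzWith.of_dist_le_mul fun x x' => ?_
  rw [dist_eq_norm, dist_eq_norm, planeProj_sub, NNReal.coe_one, one_mul]
  exact Submodule.norm_orthogonalProjectionOnto_apply_le _ _

lemma planeProj_axisPoint (s : ℝ) (y : (ℝ ∙ v)ᗮ) : planeProj x₀ v (axisPoint x₀ v s y) = y := by
  have h2 : axisPoint x₀ v s y - x₀ = s • v + y := by rw [axisPoint]; abel
  rw [planeProj, h2, map_add, map_smul, Submodule.orthogonalProjectionOnto_mem_subspace_eq_self]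
  rw [Submodule.orthogonalProjectionOnto_orthogonalComplement_singleton_eq_zero]; simp

variable {v}

lemma inner_smul_add_proj (hv : ‖v‖ = 1) (w : E3) :
    ⟪v, w⟫ • v + ((ℝ ∙ v)ᗮ.orthogonalProjectionOnto w : E3) = w := by
  have h := Submodule.starProjection_add_starProjection_orthogonal (K := ℝ ∙ v) w
  rw [Submodule.starProjection_unit_singleton ℝ hv] at h
  exact h

lemma axisPoint_coord (hv : ‖v‖ = 1) (x : E3) : axisPoint x₀ v ⟪v, x - x₀⟫ (planeProj x₀ v x) = x := by
  rw [axisPoint, add_assoc, planeProj, inner_smul_add_proj hv]; abel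

lemma inner_axisPoint (hv : ‖v‖ = 1) (s : ℝ) (y : (ℝ ∙ v)ᗮ) : ⟪v, axisPoint x₀ v s y - x₀⟫ = s := by
  have h : ⟪v, (y : E3)⟫ = 0 := Submodule.mem_orthogonal_singleton_iff_inner_right.1 y.2
  have h2 : axisPoint x₀ v s y - x₀ = s • v + y := by rw [axisPoint]; abel
  rw [h2, inner_add_right, inner_smul_right, real_inner_self_eq_norm_sq, hv, h]; ring

lemma norm_sub_le_coord (hv : ‖v‖ = 1) (x x' : E3) :
    ‖x - x'‖ ≤ |⟪v, x - x'⟫| + ‖planeProj x₀ v x - planeProj x₀ v x'‖ := by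
  rw [planeProj_sub]
  nth_rewrite 1 [← inner_smul_add_proj hv (x - x')]
  refine (norm_add_le _ _).trans (add_le_add ?_ le_rfl)
  rw [norm_smul, hv, mul_one, Real.norm_eq_abs]

lemma finrank_plane (hv : ‖v‖ = 1) : Module.finrank ℝ (ℝ ∙ v)ᗮ = 2 := by
  have hv0 : v ≠ 0 := by rintro rfl; simp at hv
  have h := (ℝ ∙ v).finrank_add_finrank_orthogonal
  rw [finrank_span_singleton hv0] at h
  simp at h; omega

lemma plane_measure (hv : ‖v‖ = 1) : (μHE[2] : Measure (ℝ ∙ v)ᗮ) = volume := by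
  rw [← InnerProductSpace.euclideanHausdorffMeasure_eq_volume, finrank_plane hv]

/-- Space is the orthogonal product of the line of `v` and its complement, and the unit vector `v`
identifies the line isometrically with `ℝ`. -/
lemma measurePreserving_axisPoint (hv : ‖v‖ = 1) :
    MeasurePreserving (fun p : ℝ × (ℝ ∙ v)ᗮ => axisPoint x₀ v p.1 p.2)
      (volume.prod volume) volume := by
  have h1 := ((ℝ ∙ v).measurePreserving_measurableEquivProd x₀).symm
  rw [InnerProductSpace.euclideanHausdorffMeasure_eq_volume] at h1
  have h2 : MeasurePreserving (LinearIsometryEquiv.toSpanUnitSingleton (𝕜 := ℝ) v hv)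
    volume volume := LinearIsometryEquiv.measurePreserving _
  have h3 := h1.comp (h2.prod (MeasurePreserving.id (volume : Measure (ℝ ∙ v)ᗮ)))
  convert! h3 using 1
  ext1 p
  simp [axisPoint, add_comm, add_left_comm]

lemma measurableEmbedding_axisPoint (hv : ‖v‖ = 1) :
    MeasurableEmbedding (fun p : ℝ × (ℝ ∙ v)ᗮ => axisPoint x₀ v p.1 p.2) := by
  refine MeasurableEmbedding.of_measurable_inverse (g := fun x => (⟪v, x - x₀⟫, planeProj x₀ v x))
    (continuous_axisPoint x₀ v).measurable ?_ ?_ ?_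
  · rw [Set.range_eq_univ.2 fun x => ⟨(⟪v, x - x₀⟫, planeProj x₀ v x), axisPoint_coord x₀ hv x⟩]
    exact MeasurableSet.univ
  · exact ((by fun_prop : Continuous fun x : E3 => ⟪v, x - x₀⟫).prodMk
      (continuous_planeProj x₀ v)).measurable
  · intro p
    ext1
    · exact inner_axisPoint x₀ hv p.1 p.2
    · exact planeProj_axisPoint x₀ v p.1 p.2

lemma integral_eq_iterated (hv : ‖v‖ = 1) {f : E3 → ℝ} (hf : Integrable f) :
    ∫ x, f x = ∫ y : (ℝ ∙ v)ᗮ, ∫ s : ℝ, f (axisPoint x₀ v s y) := by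
  have hm := measurePreserving_axisPoint x₀ hv
  rw [← hm.integral_comp (measurableEmbedding_axisPoint x₀ hv)]
  rw [← integral_prod_swap, integral_prod]
  · rfl
  · exact (hm.integrable_comp_of_integrable hf).swap

end Coordinates

end ThermoPiezo

namespace ThermoPiezo

open Filter
open scoped RealInnerProductSpace NNReal ENNReal

/-! ### Graph charts of the boundary -/

/-- The projection of `T` to the plane is 1-Lipschitz and its inverse `Γ` is `K`-Lipschitz.
Two-dimensional measure scales at most by the square of the Lipschitz constant, so the projected
area lies between Lebesgue measure on `D` and `K ^ 2` times it. This approximate change of variables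
takes the place of an area formula. -/
lemma surface_projection {x₀ v : E3} (hv : ‖v‖ = 1) {T : Set E3} (hT : MeasurableSet T) {K : ℝ≥0}
    (hK1 : 1 ≤ K) (hK : ∀ x ∈ T, ∀ x' ∈ T, ‖x - x'‖ ≤ K * ‖planeProj x₀ v x - planeProj x₀ v x'‖)
    {D : Set (ℝ ∙ v)ᗮ} (hD : MeasurableSet D) (hDfin : volume D < ⊤)
    (hTD : ∀ x ∈ T, planeProj x₀ v x ∈ D) {Γ : (ℝ ∙ v)ᗮ → E3}
    (hΓ : ∀ y ∈ D, Γ y ∈ T ∧ planeProj x₀ v (Γ y) = y) :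
    μHE[2] T < ⊤ ∧ ∀ H : E3 → ℝ, ContinuousOn H T → (∃ C, ∀ x ∈ T, |H x| ≤ C) →
      |∫ x in T, H x ∂μHE[2] - ∫ y in D, H (Γ y)| ≤
        ((K : ℝ) ^ 2 - 1) * ∫ x in T, |H x| ∂μHE[2] := by
  have hleft : ∀ x ∈ T, Γ (planeProj x₀ v x) = x := by
    intro x hx
    obtain ⟨h1, h2⟩ := hΓ _ (hTD x hx)
    have := hK _ h1 _ hx
    rw [h2, sub_self, norm_zero, mul_zero] at this
    exact sub_eq_zero.1 (norm_le_zero_iff.1 this)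
  have hLip : LipschitzOnWith K Γ D := by
    refine LipschitzOnWith.of_dist_le_mul fun y hy y' hy' => ?_
    have := hK _ (hΓ y hy).1 _ (hΓ y' hy').1
    rwa [(hΓ y hy).2, (hΓ y' hy').2, ← dist_eq_norm, ← dist_eq_norm] at this
  have hup : ∀ A : Set (ℝ ∙ v)ᗮ,
      μHE[2] (T ∩ planeProj x₀ v ⁻¹' A) ≤ (K : ℝ≥0∞) ^ 2 * volume (A ∩ D) := by
    intro A
    have hsub : T ∩ planeProj x₀ v ⁻¹' A ⊆ Γ '' (A ∩ D) := fun x hx =>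
      ⟨_, ⟨hx.2, hTD x hx.1⟩, hleft x hx.1⟩
    rw [← plane_measure hv]
    exact (measure_mono hsub).trans
      (euclideanHausdorffMeasure_image_le (hLip.mono inter_subset_right) 2)
  have hlow : ∀ A : Set (ℝ ∙ v)ᗮ, volume (A ∩ D) ≤ μHE[2] (T ∩ planeProj x₀ v ⁻¹' A) := by
    intro A
    have hsub : A ∩ D ⊆ planeProj x₀ v '' (T ∩ planeProj x₀ v ⁻¹' A) := fun y hy =>
      ⟨Γ y, ⟨(hΓ y hy.2).1, by simpa [(hΓ y hy.2).2] using hy.1⟩, (hΓ y hy.2).2⟩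
    rw [← plane_measure hv]
    refine (measure_mono hsub).trans ?_
    simpa using euclideanHausdorffMeasure_image_le
      ((lipschitzWith_planeProj x₀ v).lipschitzOnWith (s := T ∩ planeProj x₀ v ⁻¹' A)) 2
  have hfin : μHE[2] T < ⊤ := by
    have := hup univ
    simp only [preimage_univ, inter_univ, univ_inter] at this
    exact this.trans_lt (ENNReal.mul_lt_top (by simp) hDfin)
  refine ⟨hfin, fun H hH hHb => ?_⟩
  have hmeas : Measurable (planeProj x₀ v) := (continuous_planeProj x₀ v).measurable
  set ν : Measure (ℝ ∙ v)ᗮ := (μHE[2].restrict T).map (planeProj x₀ v) with hν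
  have hνA : ∀ A, MeasurableSet A → ν A = μHE[2] (T ∩ planeProj x₀ v ⁻¹' A) := by
    intro A hA
    rw [hν, Measure.map_apply hmeas hA, Measure.restrict_apply (hmeas hA), inter_comm]
  have h1 : volume.restrict D ≤ ν := by
    refine Measure.le_iff.2 fun A hA => ?_
    rw [Measure.restrict_apply hA, hνA A hA]
    exact hlow A
  have h2 : ν ≤ (K ^ 2 : ℝ≥0) • volume.restrict D := by
    refine Measure.le_iff.2 fun A hA => ?_
    rw [hνA A hA, Measure.smul_apply, Measure.restrict_apply hA, ENNReal.smul_def, smul_eq_mul]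
    simpa using hup A
  have hHΓ : ContinuousOn (fun y => H (Γ y)) D :=
    hH.comp hLip.continuousOn fun y hy => (hΓ y hy).1
  have hsm : AEStronglyMeasurable (fun y => H (Γ y)) ν :=
    ((hHΓ.aestronglyMeasurable hD).smul_measure (K ^ 2 : ℝ≥0)).mono_measure h2
  have haeT : ∀ᵐ x ∂(μHE[2].restrict T), H (Γ (planeProj x₀ v x)) = H x := by
    filter_upwards [ae_restrict_mem hT] with x hx
    rw [hleft x hx]
  obtain ⟨C, hC⟩ := hHb
  have hint : Integrable H (μHE[2].restrict T) := by
    refine IntegrableOn.of_bound hfin (hH.aestronglyMeasurable hT) C ?_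
    filter_upwards [ae_restrict_mem hT] with x hx using hC x hx
  have hintν : Integrable (fun y => H (Γ y)) ν := by
    rw [hν, integrable_map_measure hsm hmeas.aemeasurable]
    exact hint.congr (haeT.mono fun x hx => hx.symm)
  have h3 := abs_integral_sub_integral_le h1 h2 (one_le_pow₀ hK1) hintν
  have e1 : ∫ y, H (Γ y) ∂ν = ∫ x in T, H x ∂μHE[2] := by
    rw [hν, integral_map hmeas.aemeasurable hsm]
    exact integral_congr_ae haeT
  have e2 : ∫ y, |H (Γ y)| ∂ν = ∫ x in T, |H x| ∂μHE[2] := by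
    rw [hν]
    simp only [← Real.norm_eq_abs]
    rw [integral_map hmeas.aemeasurable hsm.norm]
    exact integral_congr_ae (haeT.mono fun x hx => by simp only [hx])
  rw [e1, e2] at h3
  simpa using h3

/-- On the ball of radius `2 a` about the boundary point `x₀`, the defining function is nearly
linear with gradient `G v`. -/
structure IsFlatBall (r : E3 → ℝ) (x₀ v : E3) (G a δ : ℝ) : Prop where
  zero : r x₀ = 0
  norm_v : ‖v‖ = 1
  G_pos : 0 < G
  a_pos : 0 < a
  δ_pos : 0 < δ
  δ_le : δ ≤ 1 / 2
  approx : ∀ x ∈ Metric.ball x₀ (2 * a), ∀ x' ∈ Metric.ball x₀ (2 * a),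
    |r x - r x' - G * ⟪v, x - x'⟫| ≤ δ * G * ‖x - x'‖
  deriv : ∀ x ∈ Metric.ball x₀ (2 * a), ∀ w, |fderiv ℝ r x w - G * ⟪v, w⟫| ≤ δ * G * ‖w‖

lemma fderiv_eq_inner_gradient (r : E3 → ℝ) (x w : E3) : fderiv ℝ r x w = ⟪gradient r x, w⟫ := by
  rw [← toDual_gradient]; rfl

lemma IsSmoothRegion.gradient_ne_zero {B : Set E3} {r : E3 → ℝ} (hB : IsSmoothRegion B r) {x : E3}
    (hx : r x = 0) : gradient r x ≠ 0 := by
  intro h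
  apply hB.regular x hx
  ext w
  simp [fderiv_eq_inner_gradient, h]

/-- Strict differentiability at `x₀` makes `r` minus its linear part Lipschitz with constant as
small as desired near `x₀`; continuity of the derivative gives the second estimate. -/
lemma IsSmoothRegion.exists_flatBall {B : Set E3} {r : E3 → ℝ} (hB : IsSmoothRegion B r) {x₀ : E3}
    (hx : r x₀ = 0) {δ : ℝ} (hδ : 0 < δ) (hδ' : δ ≤ 1 / 2) :
    ∃ a, IsFlatBall r x₀ (‖gradient r x₀‖⁻¹ • gradient r x₀) ‖gradient r x₀‖ a δ := by
  have hg := hB.gradient_ne_zero hx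
  have hG : 0 < ‖gradient r x₀‖ := norm_pos_iff.2 hg
  have hlin : ∀ w, ‖gradient r x₀‖ * ⟪‖gradient r x₀‖⁻¹ • gradient r x₀, w⟫ = fderiv ℝ r x₀ w := by
    intro w
    rw [inner_smul_left, fderiv_eq_inner_gradient]
    simp only [conj_trivial]
    field_simp
  have hc1 : ContDiffAt ℝ 1 r x₀ := hB.smooth.contDiffAt.of_le (by simp)
  obtain ⟨s, hs, hs'⟩ := (hc1.hasStrictFDerivAt one_ne_zero).approximates_deriv_on_nhds
    (c := ⟨δ * ‖gradient r x₀‖, by positivity⟩) (Or.inr (NNReal.coe_pos.1 (mul_pos hδ hG)))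
  have hcont : ContinuousAt (fun x => fderiv ℝ r x) x₀ :=
    (hB.smooth.continuous_fderiv (by simp)).continuousAt
  have hev := hcont.eventually (Metric.closedBall_mem_nhds (fderiv ℝ r x₀)
    (show 0 < δ * ‖gradient r x₀‖ by positivity))
  obtain ⟨ε, hε, hsub⟩ := Metric.mem_nhds_iff.1 (inter_mem hs hev)
  -- The estimates are required on the ball of radius `2 * a`, hence half of `ε`.
  refine ⟨ε / 2, hx, ?_, hG, by positivity, hδ, hδ', ?_, ?_⟩
  · rw [norm_smul, norm_inv, norm_norm, inv_mul_cancel₀ hG.ne']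
  · intro x hx x' hx'
    rw [show 2 * (ε / 2) = ε by ring] at hx hx'
    rw [hlin]
    exact hs' x (hsub hx).1 x' (hsub hx').1
  · intro x hx w
    rw [show 2 * (ε / 2) = ε by ring] at hx
    rw [hlin]
    have h1 : ‖fderiv ℝ r x - fderiv ℝ r x₀‖ ≤ δ * ‖gradient r x₀‖ := by
      have := (hsub hx).2
      simpa [dist_eq_norm] using this
    have h2 := (fderiv ℝ r x - fderiv ℝ r x₀).le_opNorm w
    exact h2.trans (mul_le_mul_of_nonneg_right h1 (norm_nonneg _))

namespace IsFlatBall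

variable {r : E3 → ℝ} {x₀ v : E3} {G a δ : ℝ}

lemma axisPoint_mem_ball (h : IsFlatBall r x₀ v G a δ) {s : ℝ} (hs : s ∈ Icc (-a) a)
    {y : (ℝ ∙ v)ᗮ} (hy : ‖y‖ < a / 2) : axisPoint x₀ v s y ∈ Metric.ball x₀ (2 * a) := by
  rw [mem_ball_iff_norm, axisPoint, show x₀ + s • v + y - x₀ = s • v + (y : E3) by abel]
  refine (norm_add_le _ _).trans_lt ?_
  rw [norm_smul, h.norm_v, mul_one, Real.norm_eq_abs]
  rw [Submodule.coe_norm] at hy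
  have h1 : |s| ≤ a := abs_le.2 hs
  have := h.a_pos
  linarith

/-- Along `v` the function `r` grows with slope at least `(1 - δ) * G > 0`, so a fibre meets the
boundary at most once. -/
lemma lt_of_lt (h : IsFlatBall r x₀ v G a δ) {s s' : ℝ} (hs : s ∈ Icc (-a) a)
    (hs' : s' ∈ Icc (-a) a) {y : (ℝ ∙ v)ᗮ} (hy : ‖y‖ < a / 2) (hlt : s < s') :
    r (axisPoint x₀ v s y) < r (axisPoint x₀ v s' y) := by
  have h1 := h.approx _ (h.axisPoint_mem_ball hs' hy) _ (h.axisPoint_mem_ball hs hy)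
  have e : axisPoint x₀ v s' y - axisPoint x₀ v s y = (s' - s) • v := by
    rw [axisPoint, axisPoint, sub_smul]; abel
  rw [e, inner_smul_right, real_inner_self_eq_norm_sq, norm_smul, h.norm_v, Real.norm_eq_abs,
    abs_of_pos (sub_pos.2 hlt)] at h1
  have h2 := (abs_le.1 h1).1
  have h3 : 0 < G * (s' - s) := mul_pos h.G_pos (sub_pos.2 hlt)
  nlinarith [h.δ_le]

lemma sign_ends (h : IsFlatBall r x₀ v G a δ) {y : (ℝ ∙ v)ᗮ} (hy : ‖y‖ < a / 2) :
    r (axisPoint x₀ v (-a) y) < 0 ∧ 0 < r (axisPoint x₀ v a y) := by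
  have ha := h.a_pos
  -- An end of the fibre is within `3 * a / 2` of `x₀`, so `r` differs from `G * s` by less than `δ
  -- * G * (3 * a / 2)`, which is smaller than `G * a` because `δ ≤ 1 / 2`.
  have key : ∀ s, s ∈ Icc (-a) a → |s| = a → |r (axisPoint x₀ v s y) - G * s| < G * a := by
    intro s hs hsa
    have h0 : x₀ ∈ Metric.ball x₀ (2 * a) := Metric.mem_ball_self (by linarith)
    have h1 := h.approx _ (h.axisPoint_mem_ball hs hy) _ h0
    rw [h.zero, inner_axisPoint x₀ h.norm_v, sub_zero] at h1
    have e : axisPoint x₀ v s y - x₀ = s • v + (y : E3) := by rw [axisPoint]; abel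
    have h2 : ‖axisPoint x₀ v s y - x₀‖ < a + a / 2 := by
      rw [e]
      refine (norm_add_le _ _).trans_lt ?_
      rw [norm_smul, h.norm_v, mul_one, Real.norm_eq_abs, hsa]
      rw [Submodule.coe_norm] at *
      linarith
    refine h1.trans_lt ?_
    have h3 : δ * G * ‖axisPoint x₀ v s y - x₀‖ < δ * G * (a + a / 2) :=
      mul_lt_mul_of_pos_left h2 (mul_pos h.δ_pos h.G_pos)
    have h4 : δ * (G * a) ≤ 1 / 2 * (G * a) :=
      mul_le_mul_of_nonneg_right h.δ_le (mul_pos h.G_pos ha).le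
    have h5 := mul_pos h.G_pos ha
    nlinarith
  constructor
  · have := key (-a) ⟨le_rfl, by linarith⟩ (by rw [abs_neg, abs_of_pos ha])
    have := (abs_lt.1 this).2
    linarith
  · have := key a ⟨by linarith, le_rfl⟩ (abs_of_pos ha)
    have := (abs_lt.1 this).1
    linarith

lemma exists_graph (h : IsFlatBall r x₀ v G a δ) (hr : Continuous r) {y : (ℝ ∙ v)ᗮ}
    (hy : ‖y‖ < a / 2) : ∃ γ ∈ Ioo (-a) a, r (axisPoint x₀ v γ y) = 0 ∧
      ∀ s ∈ Icc (-a) a, r (axisPoint x₀ v s y) < 0 ↔ s < γ := by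
  obtain ⟨h1, h2⟩ := h.sign_ends hy
  have ha := h.a_pos
  have hc : ContinuousOn (fun s => r (axisPoint x₀ v s y)) (Icc (-a) a) :=
    (hr.comp ((continuous_axisPoint x₀ v).comp (Continuous.prodMk_left y))).continuousOn
  obtain ⟨γ, hγ, hγ0⟩ := intermediate_value_Ioo (by linarith) hc ⟨h1, h2⟩
  refine ⟨γ, hγ, hγ0, fun s hs => ⟨fun hlt => ?_, fun hlt => ?_⟩⟩
  · by_contra hcon
    rcases (not_lt.1 hcon).lt_or_eq with h3 | h3
    · have := h.lt_of_lt (Ioo_subset_Icc_self hγ) hs hy h3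
      simp only at hγ0; linarith
    · rw [← h3] at hlt; simp only at hγ0; linarith
  · have := h.lt_of_lt hs (Ioo_subset_Icc_self hγ) hy hlt
    simp only at hγ0; linarith

/-- The points of the flat box over the disc of radius `a / 2` in the plane orthogonal to `v`. -/
def box (x₀ v : E3) (a : ℝ) : Set E3 :=
  {x | ⟪v, x - x₀⟫ ∈ Ioo (-a) a ∧ ‖planeProj x₀ v x‖ < a / 2}

lemma isOpen_box (x₀ v : E3) (a : ℝ) : IsOpen (box x₀ v a) :=
  (isOpen_Ioo.preimage (by fun_prop : Continuous fun x : E3 => ⟪v, x - x₀⟫)).inter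
    (isOpen_lt (continuous_planeProj x₀ v).norm continuous_const)

lemma mem_box_self (h : IsFlatBall r x₀ v G a δ) : x₀ ∈ box x₀ v a := by
  have := h.a_pos
  simp [box, planeProj, this]

lemma box_subset_ball (h : IsFlatBall r x₀ v G a δ) : box x₀ v a ⊆ Metric.ball x₀ (2 * a) := by
  intro x hx
  rw [← axisPoint_coord x₀ h.norm_v x]
  exact h.axisPoint_mem_ball (Ioo_subset_Icc_self hx.1) hx.2

lemma axisPoint_mem_box (h : IsFlatBall r x₀ v G a δ) {s : ℝ} {y : (ℝ ∙ v)ᗮ} :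
    axisPoint x₀ v s y ∈ box x₀ v a ↔ s ∈ Ioo (-a) a ∧ ‖y‖ < a / 2 := by
  rw [box, mem_ofPred_eq, inner_axisPoint x₀ h.norm_v, planeProj_axisPoint]

/-- Two zeros of `r` differ along `v` by at most `δ` times their distance, so the projection shrinks
that distance at most by the factor `1 - δ`. This gives the Lipschitz constant of the graph. -/
lemma norm_sub_le (h : IsFlatBall r x₀ v G a δ) {x x' : E3} (hx : x ∈ box x₀ v a)
    (hx' : x' ∈ box x₀ v a) (hr : r x = 0) (hr' : r x' = 0) :
    (1 - δ) * ‖x - x'‖ ≤ ‖planeProj x₀ v x - planeProj x₀ v x'‖ := by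
  have h1 := h.approx _ (h.box_subset_ball hx) _ (h.box_subset_ball hx')
  rw [hr, hr', sub_zero, zero_sub, abs_neg, abs_mul, abs_of_pos h.G_pos] at h1
  have h2 : |⟪v, x - x'⟫| ≤ δ * ‖x - x'‖ := by
    have : G * |⟪v, x - x'⟫| ≤ G * (δ * ‖x - x'‖) := by linarith
    exact le_of_mul_le_mul_left this h.G_pos
  have h3 := norm_sub_le_coord x₀ h.norm_v x x'
  linarith

end IsFlatBall

end ThermoPiezo

namespace ThermoPiezo

open Filter
open scoped RealInnerProductSpace NNReal ENNReal

/-! ### The divergence theorem -/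

lemma fderiv_eq_zero_of_notMem_tsupport {F : E3 → ℝ} {x : E3} (hx : x ∉ tsupport F) :
    fderiv ℝ F x = 0 := by
  have h := (notMem_tsupport_iff_eventuallyEq.1 hx).fderiv_eq (𝕜 := ℝ)
  rw [h]; simp

namespace IsFlatBall

variable {B : Set E3} {r : E3 → ℝ} {x₀ v : E3} {G a δ : ℝ}

/-- The fundamental theorem of calculus on the part of the fibre inside `B`. The lower end lies
outside the support of `H`, so only the value at the boundary point survives. -/
lemma integral_fibre (hB : IsSmoothRegion B r) (h : IsFlatBall r x₀ v G a δ) {H : E3 → ℝ}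
    (hH : IsC1Bounded B H) (hsupp : tsupport H ⊆ box x₀ v a) {y : (ℝ ∙ v)ᗮ}
    {γ : ℝ} (hγ : γ ∈ Ioo (-a) a)
    (hsign : ∀ s ∈ Icc (-a) a, r (axisPoint x₀ v s y) < 0 ↔ s < γ) :
    ∫ s : ℝ, B.indicator (fun x => fderiv ℝ H x v) (axisPoint x₀ v s y) =
      H (axisPoint x₀ v γ y) := by
  have ha := h.a_pos
  have hB' : ∀ s ∈ Ioo (-a) γ, axisPoint x₀ v s y ∈ B := fun s hs =>
    hB.mem_iff.2 ((hsign s ⟨hs.1.le, hs.2.le.trans hγ.2.le⟩).2 hs.2)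
  have hcl : ∀ s ∈ Icc (-a) γ, axisPoint x₀ v s y ∈ closure B := by
    intro s hs
    rw [← closure_Ioo hγ.1.ne] at hs
    have hc : Continuous fun s => axisPoint x₀ v s y :=
      (continuous_axisPoint x₀ v).comp (Continuous.prodMk_left y)
    exact (mapsTo_iff_image_subset.2 ((image_subset_iff.2 hB') : _ ⊆ B)).closure hc hs
  have hf : (fun s : ℝ => B.indicator (fun x => fderiv ℝ H x v) (axisPoint x₀ v s y)) =
      (Ioo (-a) γ).indicator (fun s => fderiv ℝ H (axisPoint x₀ v s y) v) := by
    ext s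
    by_cases hs : s ∈ Ioo (-a) γ
    · rw [indicator_of_mem hs, indicator_of_mem (hB' s hs)]
    · rw [indicator_of_notMem hs]
      by_cases hxB : axisPoint x₀ v s y ∈ B
      -- A point of the fibre in `B` beyond the range `(-a, γ)` is outside the box, hence outside
      -- the support of `H`.
      · rw [indicator_of_mem hxB, fderiv_eq_zero_of_notMem_tsupport, zero_apply]
        intro hmem
        have h1 := (h.axisPoint_mem_box.1 (hsupp hmem)).1
        exact hs ⟨h1.1, (hsign s (Ioo_subset_Icc_self h1)).1 (hB.mem_iff.1 hxB)⟩
      · rw [indicator_of_notMem hxB]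
  rw [hf, integral_indicator measurableSet_Ioo, ← integral_Ioc_eq_integral_Ioo,
    ← intervalIntegral.integral_of_le hγ.1.le]
  have haff : ∀ s, HasDerivAt (fun s => axisPoint x₀ v s y) v s := by
    intro s
    have := (((hasDerivAt_id s).smul_const v).const_add x₀).add_const (y : E3)
    simpa [axisPoint] using this
  have hcont : Continuous fun s => axisPoint x₀ v s y :=
    (continuous_axisPoint x₀ v).comp (Continuous.prodMk_left y)
  rw [intervalIntegral.integral_eq_sub_of_hasDerivAt_of_le hγ.1.le
    (f := fun s => H (axisPoint x₀ v s y))]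
  · have : axisPoint x₀ v (-a) y ∉ tsupport H := fun hmem =>
      lt_irrefl _ (h.axisPoint_mem_box.1 (hsupp hmem)).1.1
    rw [image_eq_zero_of_notMem_tsupport this, sub_zero]
  · exact hH.cont.comp hcont.continuousOn hcl
  · intro s hs
    exact (hH.differentiableAt hB (hB' s hs)).hasFDerivAt.comp_hasDerivAt s (haff s)
  · rw [intervalIntegrable_iff_integrableOn_Ioo_of_le hγ.1.le]
    obtain ⟨C, hC⟩ := hH.bdd
    refine IntegrableOn.of_bound (by simp) (((hH.continuousOn_fderiv hB v).comp hcont.continuousOn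
      hB').aestronglyMeasurable measurableSet_Ioo) (C * ‖v‖) ?_
    filter_upwards [ae_restrict_mem measurableSet_Ioo] with s hs
    exact (ContinuousLinearMap.le_opNorm _ _).trans
      (mul_le_mul_of_nonneg_right (hC _ (hB' s hs)) (norm_nonneg _))

lemma exists_graph_param (hB : IsSmoothRegion B r) (h : IsFlatBall r x₀ v G a δ) :
    ∃ γ : (ℝ ∙ v)ᗮ → ℝ, ∀ y ∈ Metric.ball (0 : (ℝ ∙ v)ᗮ) (a / 2), γ y ∈ Ioo (-a) a ∧
      r (axisPoint x₀ v (γ y) y) = 0 ∧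
      ∀ s ∈ Icc (-a) a, r (axisPoint x₀ v s y) < 0 ↔ s < γ y := by
  have : ∀ y : (ℝ ∙ v)ᗮ, ∃ γ : ℝ, y ∈ Metric.ball (0 : (ℝ ∙ v)ᗮ) (a / 2) → γ ∈ Ioo (-a) a ∧
      r (axisPoint x₀ v γ y) = 0 ∧ ∀ s ∈ Icc (-a) a, r (axisPoint x₀ v s y) < 0 ↔ s < γ := by
    intro y
    by_cases hy : ‖y‖ < a / 2
    · obtain ⟨γ, h1, h2⟩ := h.exists_graph hB.smooth.continuous hy
      exact ⟨γ, fun _ => ⟨h1, h2⟩⟩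
    · exact ⟨0, fun hy' => absurd (mem_ball_zero_iff.1 hy') hy⟩
  choose γ hγ using this
  exact ⟨γ, hγ⟩

lemma integral_fderiv_eq_graph (hB : IsSmoothRegion B r) (h : IsFlatBall r x₀ v G a δ) {H : E3 → ℝ}
    (hH : IsC1Bounded B H) (hsupp : tsupport H ⊆ box x₀ v a) {γ : (ℝ ∙ v)ᗮ → ℝ}
    (hγ : ∀ y ∈ Metric.ball (0 : (ℝ ∙ v)ᗮ) (a / 2), γ y ∈ Ioo (-a) a ∧
      r (axisPoint x₀ v (γ y) y) = 0 ∧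
      ∀ s ∈ Icc (-a) a, r (axisPoint x₀ v s y) < 0 ↔ s < γ y) :
    ∫ x in B, fderiv ℝ H x v =
      ∫ y in Metric.ball (0 : (ℝ ∙ v)ᗮ) (a / 2), H (axisPoint x₀ v (γ y) y) := by
  rw [← integral_indicator hB.isOpen.measurableSet, integral_eq_iterated x₀ h.norm_v
    ((hH.integrableOn_fderiv hB v).integrable_indicator hB.isOpen.measurableSet),
    ← integral_indicator Metric.isOpen_ball.measurableSet]
  congr 1
  ext y
  by_cases hy : y ∈ Metric.ball (0 : (ℝ ∙ v)ᗮ) (a / 2)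
  · rw [indicator_of_mem hy]
    exact h.integral_fibre hB hH hsupp (hγ y hy).1 (hγ y hy).2.2
  · rw [indicator_of_notMem hy]
    refine integral_eq_zero_of_ae (Eventually.of_forall fun s => ?_)
    refine indicator_apply_eq_zero.2 fun _ => ?_
    rw [fderiv_eq_zero_of_notMem_tsupport, zero_apply]
    exact fun hmem => hy (mem_ball_zero_iff.2 (h.axisPoint_mem_box.1 (hsupp hmem)).2)

/-- The volume integral of the derivative along `v` is exactly the integral of `H` over the plane
disc; replacing the disc by the surface costs the relative error of `surface_projection`. No normal
appears because it is close to `v`. -/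
lemma surface_estimate (hB : IsSmoothRegion B r) (h : IsFlatBall r x₀ v G a δ) :
    μHE[2] (frontier B ∩ box x₀ v a) < ⊤ ∧ ∀ H : E3 → ℝ, IsC1Bounded B H →
      tsupport H ⊆ box x₀ v a → |∫ x in frontier B, H x ∂μHE[2] - ∫ x in B, fderiv ℝ H x v| ≤
        8 * δ * ∫ x in frontier B, |H x| ∂μHE[2] := by
  obtain ⟨γ, hγ⟩ := h.exists_graph_param hB
  have hδ1 : 0 < 1 - δ := by linarith [h.δ_le]
  have hT : MeasurableSet (frontier B ∩ box x₀ v a) :=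
    isClosed_frontier.measurableSet.inter (isOpen_box x₀ v a).measurableSet
  have hKc : ((Real.toNNReal (1 - δ)⁻¹ : ℝ≥0) : ℝ) = (1 - δ)⁻¹ :=
    Real.coe_toNNReal _ (inv_pos.2 hδ1).le
  have hK1 : 1 ≤ Real.toNNReal (1 - δ)⁻¹ :=
    Real.one_le_toNNReal.2 ((one_le_inv₀ hδ1).2 (by linarith [h.δ_pos]))
  obtain ⟨hfin, hest⟩ := surface_projection h.norm_v hT (K := Real.toNNReal (1 - δ)⁻¹) hK1
    (fun x hx x' hx' => by
      rw [hKc, inv_mul_eq_div, le_div_iff₀ hδ1, mul_comm]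
      exact h.norm_sub_le hx.2 hx'.2 (hB.mem_frontier_iff.1 hx.1) (hB.mem_frontier_iff.1 hx'.1))
    (D := Metric.ball (0 : (ℝ ∙ v)ᗮ) (a / 2)) Metric.isOpen_ball.measurableSet
    measure_ball_lt_top (fun x hx => mem_ball_zero_iff.2 hx.2.2)
    (Γ := fun y => axisPoint x₀ v (γ y) y)
    (fun y hy => ⟨⟨hB.mem_frontier_iff.2 (hγ y hy).2.1,
      h.axisPoint_mem_box.2 ⟨(hγ y hy).1, mem_ball_zero_iff.1 hy⟩⟩, planeProj_axisPoint x₀ v _ _⟩)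
  refine ⟨hfin, fun H hH hsupp => ?_⟩
  have h1 := hest H (hH.cont.mono (inter_subset_left.trans frontier_subset_closure)) (by
    obtain ⟨C, hC⟩ := hB.isCompact_closure.exists_bound_of_continuousOn hH.cont
    exact ⟨C, fun x hx => hC x (frontier_subset_closure hx.1)⟩)
  rw [h.integral_fderiv_eq_graph hB hH hsupp hγ]
  have hz : ∀ x ∈ frontier B \ (frontier B ∩ box x₀ v a), H x = 0 := fun x hx =>
    image_eq_zero_of_notMem_tsupport fun hmem => hx.2 ⟨hx.1, hsupp hmem⟩
  rw [setIntegral_eq_of_subset_of_forall_sdiff_eq_zero isClosed_frontier.measurableSet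
      inter_subset_left hz,
    setIntegral_eq_of_subset_of_forall_sdiff_eq_zero isClosed_frontier.measurableSet
      inter_subset_left fun x hx => by rw [hz x hx, abs_zero]]
  refine h1.trans (mul_le_mul_of_nonneg_right ?_ (integral_nonneg fun x => abs_nonneg _))
  -- What is needed is `(1 - δ)⁻¹ ^ 2 ≤ 1 + 8 * δ`, valid for `0 < δ ≤ 1 / 2`.
  rw [hKc, inv_pow, sub_le_iff_le_add, inv_le_iff_one_le_mul₀ (by positivity)]
  have h2 := h.δ_le
  have h3 := h.δ_pos
  nlinarith [mul_pos h3 h3, mul_nonneg h3.le (sub_nonneg.2 h2)]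

lemma gradient_estimates (h : IsFlatBall r x₀ v G a δ) {x : E3} (hx : x ∈ box x₀ v a) :
    G / 2 ≤ fderiv ℝ r x v ∧ 0 < ‖gradient r x‖ ∧ |‖gradient r x‖ - fderiv ℝ r x v| ≤ 2 * δ * G := by
  have hb := h.deriv x (h.box_subset_ball hx)
  have h1 := hb v
  rw [real_inner_self_eq_norm_sq, h.norm_v] at h1
  -- The bound on the derivative is tested on the deviation vector `gradient r x - G • v` itself,
  -- which turns it into a norm estimate.
  have h2 : ‖gradient r x - G • v‖ ≤ δ * G := by
    have h3 := hb (gradient r x - G • v)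
    rw [fderiv_eq_inner_gradient] at h3
    have e : ⟪gradient r x, gradient r x - G • v⟫ - G * ⟪v, gradient r x - G • v⟫ =
        ‖gradient r x - G • v‖ ^ 2 := by
      rw [← real_inner_self_eq_norm_sq, inner_sub_left (gradient r x) (G • v), inner_smul_left]
      simp
    rw [e, abs_of_nonneg (by positivity)] at h3
    by_contra hcon
    push Not at hcon
    have := mul_pos h.δ_pos h.G_pos
    nlinarith
  have h4 : |‖gradient r x‖ - G| ≤ δ * G := by
    have := abs_norm_sub_norm_le (gradient r x) (G • v)
    rw [norm_smul, h.norm_v, mul_one, Real.norm_eq_abs, abs_of_pos h.G_pos] at this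
    exact this.trans h2
  have h5 : δ * G ≤ 1 / 2 * G := mul_le_mul_of_nonneg_right h.δ_le h.G_pos.le
  have h6 := h.δ_pos
  have h7 := h.G_pos
  have h8 : δ * G < G := by nlinarith
  simp only [mul_one, one_pow] at h1
  rw [abs_le] at h1 h4
  refine ⟨by linarith, by linarith, ?_⟩
  rw [abs_le]; constructor <;> linarith

end IsFlatBall

/-- The outward unit normal, as a vector. -/
noncomputable def normalVec (r : E3 → ℝ) (x : E3) : E3 := ‖gradient r x‖⁻¹ • gradient r x

lemma norm_normalVec_le (r : E3 → ℝ) (x : E3) : ‖normalVec r x‖ ≤ 1 := by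
  rw [normalVec, norm_smul, norm_inv, norm_norm]
  exact inv_mul_le_one

/-- Every boundary point has a box of finite area, and the boundary is compact; the coarsest
admissible flatness `1 / 2` suffices. -/
lemma IsSmoothRegion.area_lt_top {B : Set E3} {r : E3 → ℝ} (hB : IsSmoothRegion B r) :
    μHE[2] (frontier B) < ⊤ := by
  refine hB.isCompact_frontier.measure_lt_top_of_nhdsWithin fun x hx => ?_
  obtain ⟨a, ha⟩ := hB.exists_flatBall (hB.mem_frontier_iff.1 hx) (δ := 1 / 2) (by norm_num) le_rfl
  exact ⟨_, inter_mem_nhdsWithin _ ((IsFlatBall.isOpen_box _ _ _).mem_nhds ha.mem_box_self),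
    (ha.surface_estimate hB).1⟩

/-! ### Local divergence estimates in an arbitrary direction -/

section Local

variable {B : Set E3} {r : E3 → ℝ}

lemma continuousOn_normalVec (hB : IsSmoothRegion B r) : ContinuousOn (normalVec r) (frontier B) := by
  have hg : Continuous (gradient r) :=
    (InnerProductSpace.toDual ℝ E3).symm.continuous.comp (hB.smooth.continuous_fderiv (by simp))
  refine ContinuousOn.smul (ContinuousOn.inv₀ hg.norm.continuousOn fun x hx => ?_) hg.continuousOn
  exact norm_ne_zero_iff.2 (hB.gradient_ne_zero (hB.mem_frontier_iff.1 hx))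

lemma integrableOn_frontier (hB : IsSmoothRegion B r) {F : E3 → ℝ}
    (hF : ContinuousOn F (frontier B)) : IntegrableOn F (frontier B) μHE[2] := by
  obtain ⟨C, hC⟩ := hB.isCompact_frontier.exists_bound_of_continuousOn hF
  refine IntegrableOn.of_bound hB.area_lt_top
    (hF.aestronglyMeasurable isClosed_frontier.measurableSet) C ?_
  filter_upwards [ae_restrict_mem isClosed_frontier.measurableSet] with x hx using hC x hx

/-- The direction `w` is traded for `v`. With `q = φ * ∂_w r / ∂_v r` the vector field `φ F w - q F
v` is tangent to the level sets of `r`, so its divergence integrates to zero, and `surface_estimate`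
applies to `q F`. On the boundary `q` is close to `φ` times the `w`-component of the normal, since
`|∇r|` is close to `∂_v r`. -/
lemma local_divergence (hB : IsSmoothRegion B r) {x₀ v : E3} {G a δ : ℝ}
    (h : IsFlatBall r x₀ v G a δ) {F φ : E3 → ℝ} (hF : IsC1Bounded B F) (hφ : ContDiff ℝ 1 φ)
    (hsupp : tsupport φ ⊆ IsFlatBall.box x₀ v a) (w : E3) :
    |∫ x in frontier B, φ x * F x * ⟪normalVec r x, w⟫ ∂μHE[2] -
        ∫ x in B, fderiv ℝ (fun x => φ x * F x) x w| ≤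
      28 * δ * ‖w‖ * ∫ x in frontier B, |φ x * F x| ∂μHE[2] := by
  have hrw : ∀ w, ContDiff ℝ 1 (fun x => fderiv ℝ r x w) := fun w =>
    ((hB.smooth.fderiv_right (m := ∞) (by simp)).of_le (by simp)).clm_apply contDiff_const
  set q : E3 → ℝ := fun x => φ x * (fderiv ℝ r x w / fderiv ℝ r x v) with hq
  have hqs : ContDiff ℝ 1 q := by
    rw [contDiff_iff_contDiffAt]
    intro x
    by_cases hx : x ∈ tsupport φ
    · have h1 := (h.gradient_estimates (hsupp hx)).1
      exact hφ.contDiffAt.mul ((hrw w).contDiffAt.div (hrw v).contDiffAt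
        (by have := h.G_pos; linarith))
    · have : q =ᶠ[𝓝 x] fun _ => 0 := by
        filter_upwards [notMem_tsupport_iff_eventuallyEq.1 hx] with y hy
        simp [hq, hy]
      exact contDiffAt_const.congr_of_eventuallyEq this
  have hφF := (IsC1Bounded.of_contDiff hB hφ).mul hB hF
  have hH := (IsC1Bounded.of_contDiff hB hqs).mul hB hF
  have hHn := (IsC1Bounded.of_contDiff hB hqs.neg).mul hB hF
  have hsuppH : tsupport (fun x => q x * F x) ⊆ IsFlatBall.box x₀ v a := by
    refine (closure_mono ?_).trans hsupp
    intro x hx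
    simp only [hq, Function.mem_support, ne_eq, mul_eq_zero, not_or] at hx ⊢
    exact hx.1.1
  have key : ∫ x in B, fderiv ℝ (fun x => φ x * F x) x w =
      ∫ x in B, fderiv ℝ (fun x => q x * F x) x v := by
    have h1 := integral_fderiv_add_eq_zero hB hφF hHn w v (fun x hx => by
      by_cases hxs : x ∈ tsupport φ
      · have h1 := (h.gradient_estimates (hsupp hxs)).1
        have h2 : fderiv ℝ r x v ≠ 0 := by have := h.G_pos; linarith
        simp only [hq]
        field_simp
        ring
      · simp [hq, image_eq_zero_of_notMem_tsupport hxs])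
    rw [integral_add (hφF.integrableOn_fderiv hB w) (hHn.integrableOn_fderiv hB v)] at h1
    have h2 : ∀ x, fderiv ℝ (fun x => -q x * F x) x v = -fderiv ℝ (fun x => q x * F x) x v := by
      intro x
      have : (fun x => -q x * F x) = -(fun x => q x * F x) := by ext; simp
      rw [this, fderiv_neg]; simp
    simp only [h2, integral_neg] at h1
    linarith
  have hest := (h.surface_estimate hB).2 _ hH hsuppH
  rw [key]
  -- The relative error is at most `2 * δ * G` over `G / 2`, hence the constant `4 * δ`.
  have hbd : ∀ x, |q x * F x - φ x * F x * ⟪normalVec r x, w⟫| ≤ 4 * δ * ‖w‖ * |φ x * F x| := by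
    intro x
    by_cases hxs : x ∈ tsupport φ
    · obtain ⟨h1, h2, h3⟩ := h.gradient_estimates (hsupp hxs)
      have hG := h.G_pos
      have hv : 0 < fderiv ℝ r x v := by linarith
      have e : q x * F x - φ x * F x * ⟪normalVec r x, w⟫ =
          φ x * F x * (⟪normalVec r x, w⟫ *
            ((‖gradient r x‖ - fderiv ℝ r x v) / fderiv ℝ r x v)) := by
        have : fderiv ℝ r x w = ‖gradient r x‖ * ⟪normalVec r x, w⟫ := by
          rw [fderiv_eq_inner_gradient, normalVec, inner_smul_left]
          simp only [conj_trivial]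
          field_simp
        simp only [hq, this]
        field_simp
      rw [e, abs_mul, mul_comm |φ x * F x|]
      refine mul_le_mul_of_nonneg_right ?_ (abs_nonneg _)
      rw [abs_mul, mul_comm (4 * δ)]
      refine mul_le_mul ?_ ?_ (abs_nonneg _) (norm_nonneg _)
      · refine (abs_real_inner_le_norm _ _).trans ?_
        exact mul_le_of_le_one_left (norm_nonneg _) (norm_normalVec_le r x)
      · rw [abs_div, abs_of_pos hv, div_le_iff₀ hv]
        have := h.δ_pos
        nlinarith
    · simp [hq, image_eq_zero_of_notMem_tsupport hxs]
  have hn : ContinuousOn (fun x => ⟪normalVec r x, w⟫) (frontier B) :=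
    (continuousOn_normalVec hB).inner continuousOn_const
  have hφFc := hφF.cont.mono (frontier_subset_closure (s := B))
  have hHc := hH.cont.mono (frontier_subset_closure (s := B))
  have i1 := integrableOn_frontier hB hHc
  have i2 : IntegrableOn (fun x => φ x * F x * ⟪normalVec r x, w⟫) (frontier B) μHE[2] :=
    integrableOn_frontier hB (hφFc.mul hn)
  have i3 := integrableOn_frontier hB hφFc.abs
  have hA : |∫ x in frontier B, q x * F x ∂μHE[2] -
      ∫ x in frontier B, φ x * F x * ⟪normalVec r x, w⟫ ∂μHE[2]| ≤
      4 * δ * ‖w‖ * ∫ x in frontier B, |φ x * F x| ∂μHE[2] := by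
    rw [← integral_sub i1 i2, ← integral_const_mul]
    refine abs_integral_le_integral_abs.trans (integral_mono (i1.sub i2).abs (i3.const_mul _) hbd)
  have hn1 : ∀ x, |⟪normalVec r x, w⟫| ≤ ‖w‖ := fun x =>
    (abs_real_inner_le_norm _ _).trans
      (mul_le_of_le_one_left (norm_nonneg _) (norm_normalVec_le r x))
  -- The factor 3 is one from the component of the normal along `w` and two from the error `4 * δ ≤
  -- 2`.
  have hC : ∫ x in frontier B, |q x * F x| ∂μHE[2] ≤
      3 * ‖w‖ * ∫ x in frontier B, |φ x * F x| ∂μHE[2] := by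
    rw [← integral_const_mul]
    refine integral_mono i1.abs (i3.const_mul _) fun x => ?_
    have h1 := hbd x
    have h2 : |φ x * F x * ⟪normalVec r x, w⟫| ≤ ‖w‖ * |φ x * F x| := by
      rw [abs_mul, mul_comm]; exact mul_le_mul_of_nonneg_right (hn1 x) (abs_nonneg _)
    have h3 := abs_sub_abs_le_abs_sub (q x * F x) (φ x * F x * ⟪normalVec r x, w⟫)
    have h4 : 4 * δ * (‖w‖ * |φ x * F x|) ≤ 2 * (‖w‖ * |φ x * F x|) :=
      mul_le_mul_of_nonneg_right (by linarith [h.δ_le]) (by positivity)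
    show |q x * F x| ≤ 3 * ‖w‖ * |φ x * F x|
    nlinarith
  have hD : 8 * δ * ∫ x in frontier B, |q x * F x| ∂μHE[2] ≤
      8 * δ * (3 * ‖w‖ * ∫ x in frontier B, |φ x * F x| ∂μHE[2]) :=
    mul_le_mul_of_nonneg_left hC (by linarith [h.δ_pos])
  -- The two errors add up to `4 + 8 * 3 = 28`.
  rw [abs_le] at hA hest ⊢
  constructor <;> linarith

/-- The support of `φ` is compact in `B`, so for large `n` it lies where the cut-off is identically
one, and the cut-off identity becomes the claim. -/
lemma interior_divergence (hB : IsSmoothRegion B r) {F φ : E3 → ℝ} (hF : IsC1Bounded B F)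
    (hφ : ContDiff ℝ 1 φ) (hsupp : tsupport φ ⊆ B) (w : E3) :
    ∫ x in B, fderiv ℝ (fun x => φ x * F x) x w = 0 := by
  have hcpt : IsCompact (tsupport φ) :=
    hB.isCompact_closure.of_isClosed_subset (isClosed_tsupport φ) (hsupp.trans subset_closure)
  obtain ⟨n, hn⟩ : ∃ n : ℕ, ∀ x ∈ tsupport φ, r x < -(2 / ((n : ℝ) + 1)) := by
    rcases (tsupport φ).eq_empty_or_nonempty with h | h
    · exact ⟨0, by simp [h]⟩
    · obtain ⟨z, hz, hmax⟩ := hcpt.exists_isMaxOn h hB.smooth.continuous.continuousOn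
      have hrz := hB.mem_iff.1 (hsupp hz)
      obtain ⟨n, hn⟩ := exists_nat_gt (2 / -r z)
      refine ⟨n, fun x hx => (hmax hx).trans_lt ?_⟩
      rw [div_lt_iff₀ (by linarith)] at hn
      rw [lt_neg, div_lt_iff₀ (by positivity)]
      nlinarith
  have hφF := (IsC1Bounded.of_contDiff hB hφ).mul hB hF
  rw [← integral_cutoff_fderiv hB hφF w n]
  refine setIntegral_congr_fun hB.isOpen.measurableSet fun x hx => ?_
  have hone : ∀ s, s < -(2 / ((n : ℝ) + 1)) → cutoff n s = 1 := by
    intro s hs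
    refine Real.smoothTransition.one_of_one_le ?_
    rw [lt_neg, div_lt_iff₀ (by positivity)] at hs
    linarith
  by_cases hxs : x ∈ tsupport φ
  · have hd : deriv (cutoff n) (r x) = 0 := by
      have : cutoff n =ᶠ[𝓝 (r x)] fun _ => 1 := by
        filter_upwards [gt_mem_nhds (hn x hxs)] with s hs using hone s hs
      rw [this.deriv_eq]; simp
    simp [hd, hone _ (hn x hxs)]
  · have h0 : x ∉ tsupport fun x => φ x * F x := fun hmem =>
      hxs (closure_mono (fun y hy => by
        simp only [Function.mem_support, ne_eq, mul_eq_zero, not_or] at hy ⊢; exact hy.1) hmem)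
    simp [fderiv_eq_zero_of_notMem_tsupport h0, image_eq_zero_of_notMem_tsupport hxs]

end Local

end ThermoPiezo

namespace ThermoPiezo

open Filter
open scoped RealInnerProductSpace Manifold

lemma two_le_infty : (2 : WithTop ℕ∞) ≤ ∞ :=
  WithTop.coe_le_coe.2 (le_top : (2 : ℕ∞) ≤ ⊤)

/-! ### The global divergence theorem, by a partition of unity -/

section Divergence

variable {B : Set E3} {r : E3 → ℝ}

/-- The divergence theorem up to a small relative error. -/
lemma divergence_estimate (hB : IsSmoothRegion B r) {F : E3 → ℝ} (hF : IsC1Bounded B F) (w : E3)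
    {δ : ℝ} (hδ : 0 < δ) (hδ' : δ ≤ 1 / 2) :
    |∫ x in frontier B, F x * ⟪normalVec r x, w⟫ ∂μHE[2] - ∫ x in B, fderiv ℝ F x w| ≤
      28 * δ * ‖w‖ * ∫ x in frontier B, |F x| ∂μHE[2] := by
  have hU : ∀ x : E3, ∃ U : Set E3, x ∈ closure B → IsOpen U ∧ x ∈ U ∧ ∀ φ : E3 → ℝ,
      ContDiff ℝ 1 φ → tsupport φ ⊆ U →
      |∫ x in frontier B, φ x * F x * ⟪normalVec r x, w⟫ ∂μHE[2] -
        ∫ x in B, fderiv ℝ (fun x => φ x * F x) x w| ≤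
      28 * δ * ‖w‖ * ∫ x in frontier B, |φ x * F x| ∂μHE[2] := by
    intro x
    by_cases hx : x ∈ closure B; swap
    · exact ⟨univ, fun h => absurd h hx⟩
    by_cases hxB : x ∈ B
    · refine ⟨B, fun _ => ⟨hB.isOpen, hxB, fun φ hφ hs => ?_⟩⟩
      have hz : ∀ x ∈ frontier B, φ x = 0 := fun x hx =>
        image_eq_zero_of_notMem_tsupport fun h => by
          rw [hB.isOpen.frontier_eq] at hx; exact hx.2 (hs h)
      rw [interior_divergence hB hF hφ hs, setIntegral_eq_zero_of_forall_eq_zero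
        (fun x hx => by rw [hz x hx]; simp)]
      simp only [sub_zero, abs_zero]
      have : 0 ≤ ∫ x in frontier B, |φ x * F x| ∂μHE[2] := integral_nonneg fun x => abs_nonneg _
      positivity
    · have hx0 : r x = 0 := hB.mem_frontier_iff.1 (by
        rw [hB.isOpen.frontier_eq]; exact ⟨hx, hxB⟩)
      obtain ⟨a, ha⟩ := hB.exists_flatBall hx0 hδ hδ'
      exact ⟨_, fun _ => ⟨IsFlatBall.isOpen_box _ _ _, ha.mem_box_self,
        fun φ hφ hs => local_divergence hB ha hF hφ hs w⟩⟩
  choose U hU using hU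
  obtain ⟨t, ht, htc⟩ := hB.isCompact_closure.elim_nhds_subcover U
    (fun x hx => (hU x hx).1.mem_nhds (hU x hx).2.1)
  obtain ⟨f, hf⟩ := SmoothPartitionOfUnity.exists_isSubordinate 𝓘(ℝ, E3) (s := closure B)
    isClosed_closure (fun i : t => U i) (fun i => (hU i (ht i i.2)).1)
    (fun x hx => by simpa using htc hx)
  have hφ : ∀ i, ContDiff ℝ 1 (f i) := fun i =>
    (contMDiff_iff_contDiff.1 (f i).contMDiff).of_le (by simp)
  have hsum : ∀ x ∈ closure B, ∑ i, f i x = 1 := fun x hx => by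
    rw [← finsum_eq_sum_of_fintype]; exact f.sum_eq_one hx
  have hest : ∀ i : t, _ := fun i => (hU i (ht i i.2)).2.2 (f i) (hφ i) (hf i)
  have hfF : ∀ i, IsC1Bounded B fun x => f i x * F x := fun i =>
    (IsC1Bounded.of_contDiff hB (hφ i)).mul hB hF
  have hn : ContinuousOn (fun x => ⟪normalVec r x, w⟫) (frontier B) :=
    (continuousOn_normalVec hB).inner continuousOn_const
  have e1 : ∫ x in frontier B, F x * ⟪normalVec r x, w⟫ ∂μHE[2] =
      ∑ i, ∫ x in frontier B, f i x * F x * ⟪normalVec r x, w⟫ ∂μHE[2] := by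
    rw [← integral_finsetSum]
    · refine setIntegral_congr_fun isClosed_frontier.measurableSet fun x hx => ?_
      simp only [← Finset.sum_mul, hsum x (frontier_subset_closure hx), one_mul]
    · exact fun i _ => integrableOn_frontier hB
        (((hfF i).cont.mono frontier_subset_closure).mul hn)
  have e2 : ∫ x in B, fderiv ℝ F x w = ∑ i, ∫ x in B, fderiv ℝ (fun x => f i x * F x) x w := by
    rw [← integral_finsetSum]
    · refine setIntegral_congr_fun hB.isOpen.measurableSet fun x hx => ?_
      have h1 : F =ᶠ[𝓝 x] fun x => ∑ i, f i x * F x := by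
        filter_upwards [hB.isOpen.mem_nhds hx] with y hy
        simp only [← Finset.sum_mul, hsum y (subset_closure hy), one_mul]
      show fderiv ℝ F x w = _
      rw [h1.fderiv_eq, fderiv_fun_sum fun i _ => (hfF i).differentiableAt hB hx]
      simp
    · exact fun i _ => (hfF i).integrableOn_fderiv hB w
  -- The partition is nonnegative with sum one, so the bounds add up to the integral of `|F|`. The
  -- total error thus does not depend on the number of charts, which may grow as `δ` shrinks.
  have e3 : ∫ x in frontier B, |F x| ∂μHE[2] =
      ∑ i, ∫ x in frontier B, |f i x * F x| ∂μHE[2] := by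
    rw [← integral_finsetSum]
    · refine setIntegral_congr_fun isClosed_frontier.measurableSet fun x hx => ?_
      simp only [abs_mul, abs_of_nonneg (f.nonneg _ x), ← Finset.sum_mul,
        hsum x (frontier_subset_closure hx), one_mul]
    · exact fun i _ => integrableOn_frontier hB
        ((hfF i).cont.mono frontier_subset_closure).abs
  rw [e1, e2, e3, ← Finset.sum_sub_distrib, Finset.mul_sum]
  exact (Finset.abs_sum_le_sum_abs _ _).trans (Finset.sum_le_sum fun i _ => hest i)

/-- The divergence theorem on a smooth region. -/
theorem integral_fderiv_eq_surface (hB : IsSmoothRegion B r) {F : E3 → ℝ} (hF : IsC1Bounded B F)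
    (w : E3) :
    ∫ x in B, fderiv ℝ F x w = ∫ x in frontier B, F x * ⟪normalVec r x, w⟫ ∂μHE[2] := by
  set A := ∫ x in frontier B, F x * ⟪normalVec r x, w⟫ ∂μHE[2] - ∫ x in B, fderiv ℝ F x w with hA
  set M := ∫ x in frontier B, |F x| ∂μHE[2] with hM
  have hlim : Tendsto (fun δ : ℝ => 28 * δ * ‖w‖ * M) (𝓝[>] 0) (𝓝 0) := by
    have : Tendsto (fun δ : ℝ => 28 * δ * ‖w‖ * M) (𝓝 0) (𝓝 (28 * 0 * ‖w‖ * M)) := by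
      apply Continuous.tendsto; fun_prop
    simpa using this.mono_left nhdsWithin_le_nhds
  have hle : |A| ≤ 0 := by
    refine ge_of_tendsto hlim ?_
    filter_upwards [Ioc_mem_nhdsGT (show (0 : ℝ) < 1 / 2 by norm_num)] with δ hδ
    exact divergence_estimate hB hF w hδ.1 hδ.2
  have : A = 0 := abs_eq_zero.1 (le_antisymm hle (abs_nonneg _))
  linarith

/-! ### A smooth extension of the normal -/

/-- `q` is a smooth function on the whole space which equals `1 / |∇r|` near the boundary. -/
structure IsInvGrad (B : Set E3) (r q : E3 → ℝ) : Prop where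
  smooth : ContDiff ℝ ∞ q
  near : ∀ x ∈ frontier B, ∀ᶠ y in 𝓝 x, gradient r y ≠ 0 ∧ q y = ‖gradient r y‖⁻¹

/-- The reciprocal of `|∇r|` is singular at critical points of `r`. With `m` the minimum of `|∇r|²`
on the boundary (or `1` if there is no boundary), it is multiplied by a smooth function of `|∇r|²`
that vanishes below `m / 4` and equals one above `m / 2`. -/
lemma exists_isInvGrad (hB : IsSmoothRegion B r) : ∃ q, IsInvGrad B r q := by
  have hg : ContDiff ℝ ∞ (gradient r) :=
    (InnerProductSpace.toDual ℝ E3).symm.toContinuousLinearEquiv.contDiff.comp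
      (hB.smooth.fderiv_right (m := ∞) (by simp))
  obtain ⟨m, hm, hmin⟩ : ∃ m > 0, ∀ x ∈ frontier B, m ≤ ‖gradient r x‖ ^ 2 := by
    rcases (frontier B).eq_empty_or_nonempty with h | h
    · exact ⟨1, one_pos, by simp [h]⟩
    · obtain ⟨z, hz, hmin⟩ := hB.isCompact_frontier.exists_isMinOn h
        (hg.continuous.norm.pow 2).continuousOn
      have := norm_pos_iff.2 (hB.gradient_ne_zero (hB.mem_frontier_iff.1 hz))
      exact ⟨_, pow_pos this 2, fun x hx => hmin hx⟩
  have hn2 : ContDiff ℝ ∞ fun x => ‖gradient r x‖ ^ 2 := hg.norm_sq ℝ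
  refine ⟨fun x => Real.smoothTransition (4 / m * ‖gradient r x‖ ^ 2 - 1) * ‖gradient r x‖⁻¹,
    contDiff_iff_contDiffAt.2 fun x => ?_, fun x hx => ?_⟩
  · by_cases hx : gradient r x = 0
    · have hev : ∀ᶠ y in 𝓝 x, ‖gradient r y‖ ^ 2 < m / 4 :=
        hn2.continuous.continuousAt.eventually (gt_mem_nhds (by simp [hx, hm]))
      refine (contDiffAt_const (c := (0 : ℝ))).congr_of_eventuallyEq ?_
      filter_upwards [hev] with y hy
      rw [Real.smoothTransition.zero_of_nonpos, zero_mul]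
      rw [div_mul_eq_mul_div, sub_nonpos, div_le_one hm]
      linarith
    · refine ContDiffAt.mul ?_ ((hg.contDiffAt.norm ℝ hx).inv (norm_ne_zero_iff.2 hx))
      exact (Real.smoothTransition.contDiff.comp ((contDiff_const.mul hn2).sub
        contDiff_const)).contDiffAt
  · have hev : ∀ᶠ y in 𝓝 x, m / 2 < ‖gradient r y‖ ^ 2 :=
      hn2.continuous.continuousAt.eventually (lt_mem_nhds (by have := hmin x hx; linarith))
    filter_upwards [hev] with y hy
    refine ⟨fun h => ?_, ?_⟩
    · rw [h] at hy; simp at hy; linarith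
    · rw [Real.smoothTransition.one_of_one_le, one_mul]
      rw [div_mul_eq_mul_div, le_sub_iff_add_le, le_div_iff₀ hm]
      linarith

/-! ### Partial derivatives up to the boundary and integration by parts -/

/-- The partial derivative of a function on the closed region. -/
noncomputable def pd (B : Set E3) (j : Fin 3) (f : E3 → ℝ) (x : E3) : ℝ :=
  fderivWithin ℝ f (closure B) x (EuclideanSpace.single j 1)

/-- The components of the outward unit normal. -/
noncomputable def nor (r : E3 → ℝ) (j : Fin 3) (x : E3) : ℝ := nrm r j x 0

lemma nor_eq_inner (r : E3 → ℝ) (j : Fin 3) (x : E3) :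
    nor r j x = ⟪normalVec r x, EuclideanSpace.single j (1 : ℝ)⟫ := by
  rw [EuclideanSpace.inner_single_right]
  simp [nor, nrm, normalVec]

lemma continuousOn_nor (hB : IsSmoothRegion B r) (j : Fin 3) :
    ContinuousOn (nor r j) (frontier B) := by
  have : nor r j = fun x => ⟪normalVec r x, EuclideanSpace.single j (1 : ℝ)⟫ :=
    funext fun x => nor_eq_inner r j x
  rw [this]
  exact (continuousOn_normalVec hB).inner continuousOn_const

lemma pd_eq_fderiv (hB : IsSmoothRegion B r) (f : E3 → ℝ) {x : E3} (hx : x ∈ B) (j : Fin 3) :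
    pd B j f x = fderiv ℝ f x (EuclideanSpace.single j 1) := by
  rw [pd, fderivWithin_of_mem_nhds (mem_of_superset (hB.isOpen.mem_nhds hx) subset_closure)]

lemma contDiffOn_pd (hB : IsSmoothRegion B r) {f : E3 → ℝ} {n : ℕ}
    (hf : ContDiffOn ℝ (n + 1 : ℕ) f (closure B)) (j : Fin 3) :
    ContDiffOn ℝ n (pd B j f) (closure B) :=
  (hf.fderivWithin hB.uniqueDiffOn (by simp)).clm_apply contDiffOn_const

lemma IsC1Bounded.of_contDiffOn (hB : IsSmoothRegion B r) {f : E3 → ℝ}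
    (hf : ContDiffOn ℝ 1 f (closure B)) : IsC1Bounded B f := by
  refine ⟨hf.continuousOn, hf.mono subset_closure, ?_⟩
  obtain ⟨C, hC⟩ := hB.isCompact_closure.exists_bound_of_continuousOn
    (hf.continuousOn_fderivWithin hB.uniqueDiffOn le_rfl)
  refine ⟨C, fun x hx => ?_⟩
  have := hC x (subset_closure hx)
  rwa [fderivWithin_of_mem_nhds (mem_of_superset (hB.isOpen.mem_nhds hx) subset_closure)] at this

lemma integral_pd (hB : IsSmoothRegion B r) {f : E3 → ℝ} (hf : ContDiffOn ℝ 1 f (closure B))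
    (j : Fin 3) : ∫ x in B, pd B j f x = ∫ x in frontier B, f x * nor r j x ∂μHE[2] := by
  simp only [nor_eq_inner]
  rw [← integral_fderiv_eq_surface hB (IsC1Bounded.of_contDiffOn hB hf)]
  exact setIntegral_congr_fun hB.isOpen.measurableSet fun x hx => pd_eq_fderiv hB f hx j

lemma pd_mul (hB : IsSmoothRegion B r) {f g : E3 → ℝ} (hf : ContDiffOn ℝ 1 f (closure B))
    (hg : ContDiffOn ℝ 1 g (closure B)) {x : E3} (hx : x ∈ closure B) (j : Fin 3) :
    pd B j (fun x => f x * g x) x = pd B j f x * g x + f x * pd B j g x := by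
  rw [pd, fderivWithin_fun_mul (hB.uniqueDiffOn x hx) (hf.differentiableOn one_ne_zero x hx)
    (hg.differentiableOn one_ne_zero x hx)]
  simp [pd]; ring

lemma pd_sum (hB : IsSmoothRegion B r) {ι : Type*} {s : Finset ι} {f : ι → E3 → ℝ}
    (hf : ∀ i, ContDiffOn ℝ 1 (f i) (closure B)) {x : E3} (hx : x ∈ closure B) (j : Fin 3) :
    pd B j (fun x => ∑ i ∈ s, f i x) x = ∑ i ∈ s, pd B j (f i) x := by
  rw [pd, fderivWithin_fun_sum (hB.uniqueDiffOn x hx)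
    fun i _ => (hf i).differentiableOn one_ne_zero x hx]
  simp [pd]

lemma pd_comm (hB : IsSmoothRegion B r) {f : E3 → ℝ} (hf : ContDiffOn ℝ 2 f (closure B)) {x : E3}
    (hx : x ∈ B) (i j : Fin 3) : pd B i (pd B j f) x = pd B j (pd B i f) x := by
  have hev : ∀ k, pd B k f =ᶠ[𝓝 x] fun y => fderiv ℝ f y (EuclideanSpace.single k 1) := fun k => by
    filter_upwards [hB.isOpen.mem_nhds hx] with y hy using pd_eq_fderiv hB f hy k
  have h2 : ContDiffAt ℝ 2 f x :=
    hf.contDiffAt (mem_of_superset (hB.isOpen.mem_nhds hx) subset_closure)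
  have hd : DifferentiableAt ℝ (fderiv ℝ f) x :=
    (h2.fderiv_right (m := 1) (by norm_num)).differentiableAt one_ne_zero
  have key : ∀ k l, pd B k (pd B l f) x =
      fderiv ℝ (fderiv ℝ f) x (EuclideanSpace.single k 1) (EuclideanSpace.single l 1) := by
    intro k l
    rw [pd_eq_fderiv hB _ hx, (hev l).fderiv_eq, fderiv_clm_apply hd (differentiableAt_const _)]
    simp
  rw [key, key]
  exact (h2.isSymmSndFDerivAt (by simp)).eq _ _

/-- Integration by parts. -/
lemma integral_pd_mul (hB : IsSmoothRegion B r) {f g : E3 → ℝ} (hf : ContDiffOn ℝ 1 f (closure B))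
    (hg : ContDiffOn ℝ 1 g (closure B)) (j : Fin 3) :
    ∫ x in B, (pd B j f x * g x + f x * pd B j g x) =
      ∫ x in frontier B, f x * g x * nor r j x ∂μHE[2] := by
  rw [← integral_pd hB (hf.mul hg)]
  exact setIntegral_congr_fun hB.isOpen.measurableSet fun x hx =>
    (pd_mul hB hf hg (subset_closure hx) j).symm

/-- By the divergence theorem the surface integral equals the volume integral of the commutator of
two second derivatives, which is zero. This is Stokes's theorem for a surface without boundary. -/
lemma integral_rot (hB : IsSmoothRegion B r) {g : E3 → ℝ} (hg : ContDiffOn ℝ 2 g (closure B))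
    (j l : Fin 3) :
    ∫ x in frontier B, (nor r l x * pd B j g x - nor r j x * pd B l g x) ∂μHE[2] = 0 := by
  have hc : ∀ k, ContDiffOn ℝ 1 (pd B k g) (closure B) := fun k => contDiffOn_pd hB hg k
  have hi : ∀ k m, IntegrableOn (fun x => pd B k g x * nor r m x) (frontier B) μHE[2] :=
    fun k m => integrableOn_frontier hB
      (((hc k).continuousOn.mono frontier_subset_closure).mul (continuousOn_nor hB m))
  simp only [mul_comm (nor r _ _)]
  rw [integral_sub (hi _ _) (hi _ _), ← integral_pd hB (hc j), ← integral_pd hB (hc l), sub_eq_zero]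
  exact setIntegral_congr_fun hB.isOpen.measurableSet fun x hx => pd_comm hB hg hx l j

/-- The smooth extension `q ∂_j r` of the components of the normal. -/
noncomputable def extNor (r q : E3 → ℝ) (j : Fin 3) (x : E3) : ℝ :=
  q x * fderiv ℝ r x (EuclideanSpace.single j 1)

namespace IsInvGrad

variable {q : E3 → ℝ}

lemma contDiff_extNor (hB : IsSmoothRegion B r) (hq : IsInvGrad B r q) (j : Fin 3) :
    ContDiff ℝ ∞ (extNor r q j) :=
  hq.smooth.mul ((hB.smooth.fderiv_right (m := ∞) (by simp)).clm_apply contDiff_const)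

lemma eventually_nor_eq (hq : IsInvGrad B r q) {x : E3} (hx : x ∈ frontier B) (j : Fin 3) :
    nor r j =ᶠ[𝓝 x] extNor r q j := by
  filter_upwards [hq.near x hx] with y hy
  rw [nor_eq_inner, extNor, hy.2, fderiv_eq_inner_gradient, normalVec, inner_smul_left]
  simp

lemma eventually_sum_sq (hq : IsInvGrad B r q) {x : E3} (hx : x ∈ frontier B) :
    ∀ᶠ y in 𝓝 x, ∑ j, extNor r q j y * extNor r q j y = 1 := by
  filter_upwards [hq.near x hx] with y hy
  have h1 : ∀ j, extNor r q j y = ‖gradient r y‖⁻¹ * gradient r y j := by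
    intro j
    rw [extNor, hy.2, fderiv_eq_inner_gradient, EuclideanSpace.inner_single_right]
    simp
  have h2 : ∑ j, gradient r y j * gradient r y j = ‖gradient r y‖ ^ 2 := by
    rw [EuclideanSpace.real_norm_sq_eq]
    simp [sq]
  simp only [h1]
  have h3 : ‖gradient r y‖ ≠ 0 := norm_ne_zero_iff.2 hy.1
  calc _ = ‖gradient r y‖⁻¹ ^ 2 * ∑ j, gradient r y j * gradient r y j := by
        rw [Finset.mul_sum]; exact Finset.sum_congr rfl fun j _ => by ring
    _ = 1 := by rw [h2]; field_simp

lemma pd_extNor (hB : IsSmoothRegion B r) (hq : IsInvGrad B r q) {x : E3} (hx : x ∈ closure B)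
    (j k : Fin 3) : pd B k (extNor r q j) x =
      fderiv ℝ (extNor r q j) x (EuclideanSpace.single k 1) := by
  rw [pd, ((hq.contDiff_extNor hB j).differentiable (by simp) x).fderivWithin (hB.uniqueDiffOn x hx)]

lemma pd_nor (hq : IsInvGrad B r q) {x : E3} (hx : x ∈ frontier B)
    (j k : Fin 3) : pd B k (nor r j) x = pd B k (extNor r q j) x := by
  rw [pd, pd]
  have h := hq.eventually_nor_eq hx j
  rw [(h.filter_mono nhdsWithin_le_nhds).fderivWithin_eq h.self_of_nhds]

/-- The extended normal has unit length in a whole neighbourhood of `x`, so the square of its length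
may be differentiated in every direction. -/
lemma sum_extNor_mul_pd (hB : IsSmoothRegion B r) (hq : IsInvGrad B r q) {x : E3}
    (hx : x ∈ frontier B) (k : Fin 3) :
    ∑ l, extNor r q l x * pd B k (extNor r q l) x = 0 := by
  have hd : ∀ l, DifferentiableAt ℝ (extNor r q l) x := fun l =>
    (hq.contDiff_extNor hB l).differentiable (by simp) x
  have h1 : (fun y => ∑ j, extNor r q j y * extNor r q j y) =ᶠ[𝓝 x] fun _ => 1 :=
    hq.eventually_sum_sq hx
  have h2 := h1.fderiv_eq (𝕜 := ℝ)
  rw [fderiv_fun_sum fun l _ => (hd l).fun_mul (hd l)] at h2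
  have h3 := congrArg (fun L : E3 →L[ℝ] ℝ => L (EuclideanSpace.single k 1)) h2
  simp only [fderiv_fun_mul (hd _) (hd _)] at h3
  simp only [fderiv_fun_const, sum_apply, add_apply, smul_apply, smul_eq_mul,
    Pi.zero_apply, zero_apply, ← two_mul, ← Finset.mul_sum] at h3
  simp only [hq.pd_extNor hB (frontier_subset_closure hx)]
  linarith

end IsInvGrad

/-! ### The surface divergence theorem -/

/-- `𝒟_l n_l` on the boundary. -/
noncomputable def bdryCurv (B : Set E3) (r : E3 → ℝ) (x : E3) : ℝ :=
  ∑ l, ∑ k, ((if l = k then 1 else 0) - nor r l x * nor r k x) * pd B k (nor r l) x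

lemma continuousOn_pd_nor (hB : IsSmoothRegion B r) (j k : Fin 3) :
    ContinuousOn (pd B k (nor r j)) (frontier B) := by
  obtain ⟨q, hq⟩ := exists_isInvGrad hB
  have h : ContinuousOn (pd B k (extNor r q j)) (frontier B) :=
    (contDiffOn_pd (n := 1) hB ((hq.contDiff_extNor hB j).of_le two_le_infty).contDiffOn
      k).continuousOn.mono frontier_subset_closure
  exact h.congr fun x hx => hq.pd_nor hx j k

lemma continuousOn_bdryCurv (hB : IsSmoothRegion B r) :
    ContinuousOn (bdryCurv B r) (frontier B) :=
  continuousOn_finsetSum _ fun l _ => continuousOn_finsetSum _ fun k _ =>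
    (continuousOn_const.sub ((continuousOn_nor hB l).mul (continuousOn_nor hB k))).mul
      (continuousOn_pd_nor hB l k)

/-- The surface divergence theorem. -/
theorem integral_surfD (hB : IsSmoothRegion B r) {f : E3 → ℝ} (hf : ContDiffOn ℝ 2 f (closure B))
    (j : Fin 3) :
    ∫ x in frontier B, ∑ l, ((if j = l then 1 else 0) - nor r j x * nor r l x) * pd B l f x ∂μHE[2]
      = ∫ x in frontier B, bdryCurv B r x * (nor r j x * f x) ∂μHE[2] := by
  obtain ⟨q, hq⟩ := exists_isInvGrad hB
  have hN : ∀ l, ContDiffOn ℝ 2 (extNor r q l) (closure B) := fun l =>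
    ((hq.contDiff_extNor hB l).of_le two_le_infty).contDiffOn
  have hN1 : ∀ l, ContDiffOn ℝ 1 (extNor r q l) (closure B) := fun l =>
    ((hq.contDiff_extNor hB l).of_le (by simp)).contDiffOn
  have hf1 : ContDiffOn ℝ 1 f (closure B) := hf.of_le (by norm_num)
  -- The rotation identity is applied to `n_l f` and summed over `l`. Since `n` has unit length and
  -- `n_l` is orthogonal to its derivatives, the sum is the surface derivative of `f` minus `n_j f`
  -- times the surface divergence of `n`.
  have hrot := fun l => integral_rot hB ((hN l).mul hf) j l
  have hgc : ∀ l k, ContinuousOn (pd B k fun x => extNor r q l x * f x) (frontier B) := fun l k =>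
    (contDiffOn_pd (n := 1) hB ((hN l).mul hf) k).continuousOn.mono frontier_subset_closure
  have hsum : ∫ x in frontier B, ∑ l, (nor r l x * pd B j (fun x => extNor r q l x * f x) x
      - nor r j x * pd B l (fun x => extNor r q l x * f x) x) ∂μHE[2] = 0 := by
    rw [integral_finsetSum]
    · exact Finset.sum_eq_zero fun l _ => hrot l
    · exact fun l _ => integrableOn_frontier hB (((continuousOn_nor hB l).mul (hgc l j)).sub
        ((continuousOn_nor hB j).mul (hgc l l)))
  have hpt : ∀ x ∈ frontier B, ∑ l, (nor r l x * pd B j (fun x => extNor r q l x * f x) x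
      - nor r j x * pd B l (fun x => extNor r q l x * f x) x) =
      ∑ l, ((if j = l then 1 else 0) - nor r j x * nor r l x) * pd B l f x -
        bdryCurv B r x * (nor r j x * f x) := by
    intro x hx
    have hxc := frontier_subset_closure hx
    have hn : ∀ l, nor r l x = extNor r q l x := fun l => (hq.eventually_nor_eq hx l).self_of_nhds
    have h1 := (hq.eventually_sum_sq hx).self_of_nhds
    have h2 := fun k => hq.sum_extNor_mul_pd hB hx k
    simp only [bdryCurv, hq.pd_nor hx, hn, pd_mul hB (hN1 _) hf1 hxc]
    simp only [Fin.sum_univ_three] at h1 h2 ⊢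
    have h20 := h2 0
    have h21 := h2 1
    have h22 := h2 2
    obtain rfl | rfl | rfl : j = 0 ∨ j = 1 ∨ j = 2 := by fin_cases j <;> simp
    · simp
      linear_combination f x * h20 + pd B 0 f x * h1 - extNor r q 0 x * f x *
        (extNor r q 0 x * h20 + extNor r q 1 x * h21 + extNor r q 2 x * h22)
    · simp
      linear_combination f x * h21 + pd B 1 f x * h1 - extNor r q 1 x * f x *
        (extNor r q 0 x * h20 + extNor r q 1 x * h21 + extNor r q 2 x * h22)
    · simp
      linear_combination f x * h22 + pd B 2 f x * h1 - extNor r q 2 x * f x *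
        (extNor r q 0 x * h20 + extNor r q 1 x * h21 + extNor r q 2 x * h22)
  have hc1 : ContinuousOn (fun x => ∑ l, ((if j = l then 1 else 0) - nor r j x * nor r l x) *
      pd B l f x) (frontier B) :=
    continuousOn_finsetSum _ fun l _ =>
      (continuousOn_const.sub ((continuousOn_nor hB j).mul (continuousOn_nor hB l))).mul
        ((contDiffOn_pd (n := 1) hB hf l).continuousOn.mono frontier_subset_closure)
  have hc2 : ContinuousOn (fun x => bdryCurv B r x * (nor r j x * f x)) (frontier B) :=
    (continuousOn_bdryCurv hB).mul
      ((continuousOn_nor hB j).mul (hf.continuousOn.mono frontier_subset_closure))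
  rw [← sub_eq_zero, ← integral_sub (integrableOn_frontier hB hc1) (integrableOn_frontier hB hc2)]
  refine Eq.trans ?_ hsum
  exact setIntegral_congr_fun isClosed_frontier.measurableSet fun x hx => (hpt x hx).symm

end Divergence

end ThermoPiezo

namespace ThermoPiezo

open Filter

/-! ### Convolution in time of continuous bounded fields -/

lemma tconv_comm (f g : ℝ → ℝ) : tconv f g = tconv g f := by
  funext t
  have h := intervalIntegral.integral_comp_sub_left (fun s => g s * f (t - s)) (a := 0) (b := t) t
  simp only [sub_sub_cancel, sub_self, sub_zero] at h
  rw [tconv, tconv, ← h]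
  exact intervalIntegral.integral_congr fun s _ => mul_comm _ _

lemma fconv_comm (F G : Field) : F ⊛ G = G ⊛ F := funext fun x => tconv_comm (F x) (G x)

lemma tconv_congr {f f' g g' : ℝ → ℝ} {t : ℝ} (ht : 0 ≤ t) (hf : ∀ s ∈ Icc 0 t, f s = f' s)
    (hg : ∀ s ∈ Icc 0 t, g s = g' s) : tconv f g t = tconv f' g' t := by
  refine intervalIntegral.integral_congr fun s hs => ?_
  rw [uIcc_of_le ht] at hs
  simp only [hf s hs, hg (t - s) ⟨by linarith [hs.2], by linarith [hs.1]⟩]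

lemma tconv_eq_zero_right {f g : ℝ → ℝ} {t : ℝ} (ht : 0 ≤ t) (hg : ∀ s ∈ Icc 0 t, g s = 0) :
    tconv f g t = 0 := by
  rw [tconv_congr (f' := f) (g' := 0) ht (fun _ _ => rfl) hg]
  simp [tconv]

lemma tconv_eq_zero_left {f g : ℝ → ℝ} {t : ℝ} (ht : 0 ≤ t) (hf : ∀ s ∈ Icc 0 t, f s = 0) :
    tconv f g t = 0 := by
  rw [tconv_comm]; exact tconv_eq_zero_right ht hf

lemma tconv_zero_time (f g : ℝ → ℝ) : tconv f g 0 = 0 := by simp [tconv]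

/-- The rescaling fixes the interval of integration, so that joint continuity of a convolution in
position and time is continuity of an integral in a parameter. -/
lemma tconv_eq_mul_integral (f g : ℝ → ℝ) (t : ℝ) :
    tconv f g t = t * ∫ s in (0 : ℝ)..1, f (t * s) * g (t * (1 - s)) := by
  have h := intervalIntegral.mul_integral_comp_mul_left (a := 0) (b := 1)
    (f := fun τ => f τ * g (t - τ)) t
  simp only [mul_zero, mul_one] at h
  rw [tconv, ← h]
  congr 1
  exact intervalIntegral.integral_congr fun s _ => by simp only [mul_sub, mul_one]

namespace IsBoundaryDatum

variable {S : Set E3} {F G : Field}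

lemma congr (hF : IsBoundaryDatum S F) (h : ∀ x ∈ S, ∀ t, 0 ≤ t → G x t = F x t) :
    IsBoundaryDatum S G := by
  refine ⟨hF.1.congr fun p hp => h p.1 hp.1 p.2 hp.2, fun T => ?_⟩
  obtain ⟨C, hC⟩ := hF.2 T
  exact ⟨C, fun x hx t ht => by rw [h x hx t ht.1]; exact hC x hx t ht⟩

lemma mono {S' : Set E3} (hF : IsBoundaryDatum S F) (h : S' ⊆ S) : IsBoundaryDatum S' F :=
  ⟨hF.1.mono (prod_mono h subset_rfl), fun T =>
    let ⟨C, hC⟩ := hF.2 T; ⟨C, fun x hx => hC x (h hx)⟩⟩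

lemma add (hF : IsBoundaryDatum S F) (hG : IsBoundaryDatum S G) : IsBoundaryDatum S (F + G) := by
  refine ⟨hF.1.add hG.1, fun T => ?_⟩
  obtain ⟨C, hC⟩ := hF.2 T
  obtain ⟨D, hD⟩ := hG.2 T
  exact ⟨C + D, fun x hx t ht => (abs_add_le _ _).trans (add_le_add (hC x hx t ht) (hD x hx t ht))⟩

lemma mul (hF : IsBoundaryDatum S F) (hG : IsBoundaryDatum S G) : IsBoundaryDatum S (F * G) := by
  refine ⟨hF.1.mul hG.1, fun T => ?_⟩
  obtain ⟨C, hC⟩ := hF.2 T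
  obtain ⟨D, hD⟩ := hG.2 T
  refine ⟨C * D, fun x hx t ht => ?_⟩
  simp only [Pi.mul_apply, abs_mul]
  exact mul_le_mul (hC x hx t ht) (hD x hx t ht) (abs_nonneg _) ((abs_nonneg _).trans (hC x hx t ht))

lemma of_time {k : ℝ → ℝ} (hk : ContinuousOn k (Ici 0)) : IsBoundaryDatum S fun _ => k := by
  refine ⟨hk.comp continuousOn_snd fun p hp => hp.2, fun T => ?_⟩
  obtain ⟨C, hC⟩ := isCompact_Icc.exists_bound_of_continuousOn
    (hk.mono (Icc_subset_Ici_self : Icc 0 T ⊆ Ici 0))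
  exact ⟨C, fun x _ t ht => hC t ht⟩

lemma of_isCompact (hS : IsCompact S)
    (h : ContinuousOn (fun p : E3 × ℝ => F p.1 p.2) (S ×ˢ Ici 0)) : IsBoundaryDatum S F := by
  refine ⟨h, fun T => ?_⟩
  obtain ⟨C, hC⟩ := (hS.prod (isCompact_Icc (a := (0 : ℝ)) (b := T))).exists_bound_of_continuousOn
    (h.mono (prod_mono subset_rfl Icc_subset_Ici_self))
  exact ⟨C, fun x hx t ht => hC (x, t) ⟨hx, ht⟩⟩

lemma of_space (hS : IsCompact S) {w : E3 → ℝ} (hw : ContinuousOn w S) :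
    IsBoundaryDatum S fun x _ => w x :=
  of_isCompact hS (hw.comp continuousOn_fst fun _ hp => hp.1)

lemma zero : IsBoundaryDatum S 0 := (of_time (S := S) (k := 0) continuousOn_const)

lemma smul (hF : IsBoundaryDatum S F) (a : ℝ) : IsBoundaryDatum S (a • F) :=
  ((of_time (S := S) (k := fun _ => a) continuousOn_const).mul hF).congr fun _ _ _ _ => rfl

lemma neg (hF : IsBoundaryDatum S F) : IsBoundaryDatum S (-F) :=
  (hF.smul (-1)).congr fun x _ t _ => by simp

lemma sub (hF : IsBoundaryDatum S F) (hG : IsBoundaryDatum S G) : IsBoundaryDatum S (F - G) := by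
  rw [sub_eq_add_neg]; exact hF.add hG.neg

lemma sum {ι : Type*} {s : Finset ι} {F : ι → Field} (hF : ∀ i ∈ s, IsBoundaryDatum S (F i)) :
    IsBoundaryDatum S (∑ i ∈ s, F i) := by
  classical
  induction s using Finset.induction_on with
  | empty => simpa using zero
  | insert a s ha ih =>
    rw [Finset.sum_insert ha]
    exact (hF a (by simp)).add (ih fun i hi => hF i (by simp [hi]))

lemma time (hF : IsBoundaryDatum S F) {x : E3} (hx : x ∈ S) : ContinuousOn (F x) (Ici 0) :=
  hF.1.comp (Continuous.prodMk_right x).continuousOn fun _ ht => ⟨hx, ht⟩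

lemma space (hF : IsBoundaryDatum S F) {t : ℝ} (ht : 0 ≤ t) : ContinuousOn (fun x => F x t) S :=
  hF.1.comp (Continuous.prodMk_left t).continuousOn fun _ hx => ⟨hx, ht⟩

lemma conv (hF : IsBoundaryDatum S F) (hG : IsBoundaryDatum S G) : IsBoundaryDatum S (F ⊛ G) := by
  refine ⟨?_, fun T => ?_⟩
  · have key : ContinuousOn (fun p : E3 × ℝ =>
        ∫ s in (0 : ℝ)..1, F p.1 (p.2 * s) * G p.1 (p.2 * (1 - s))) (S ×ˢ Ici 0) := by
      rintro ⟨x, t⟩ ⟨hx, ht⟩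
      -- Bounds up to time `t + 1` dominate the integrand for all times near `t`.
      have ht : 0 ≤ t := ht
      obtain ⟨C, hC⟩ := hF.2 (t + 1)
      obtain ⟨D, hD⟩ := hG.2 (t + 1)
      have hI : ∀ s ∈ uIoc (0 : ℝ) 1, 0 ≤ s ∧ s ≤ 1 := fun s hs => by
        rw [uIoc_of_le zero_le_one] at hs; exact ⟨hs.1.le, hs.2⟩
      have hcF : ∀ s, 0 ≤ s → ContinuousOn (fun p : E3 × ℝ => F p.1 (p.2 * s)) (S ×ˢ Ici 0) :=
        fun s hs => hF.1.comp (f := fun p : E3 × ℝ => (p.1, p.2 * s)) (by fun_prop) fun p hp =>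
          ⟨hp.1, mul_nonneg hp.2 hs⟩
      have hcG : ∀ s, 0 ≤ s → ContinuousOn (fun p : E3 × ℝ => G p.1 (p.2 * s)) (S ×ˢ Ici 0) :=
        fun s hs => hG.1.comp (f := fun p : E3 × ℝ => (p.1, p.2 * s)) (by fun_prop) fun p hp =>
          ⟨hp.1, mul_nonneg hp.2 hs⟩
      refine intervalIntegral.continuousWithinAt_of_dominated_interval (bound := fun _ => C * D)
        ?_ ?_ intervalIntegrable_const ?_
      · filter_upwards [self_mem_nhdsWithin] with p hp
        refine ContinuousOn.aestronglyMeasurable (ContinuousOn.mul ?_ ?_) measurableSet_uIoc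
        · exact (hF.time hp.1).comp (by fun_prop) fun s hs => mul_nonneg hp.2 (hI s hs).1
        · exact (hG.time hp.1).comp (by fun_prop) fun s hs =>
            mul_nonneg hp.2 (sub_nonneg.2 (hI s hs).2)
      · have hev : ∀ᶠ p : E3 × ℝ in 𝓝[S ×ˢ Ici 0] (x, t), p.2 < t + 1 :=
          (continuous_snd.continuousAt (x := (x, t))).continuousWithinAt.eventually
            (gt_mem_nhds (by simp))
        filter_upwards [self_mem_nhdsWithin, hev] with p hp hpt
        refine Eventually.of_forall fun s hs => ?_
        obtain ⟨h0, h1⟩ := hI s hs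
        have hp2 : 0 ≤ p.2 := hp.2
        have h2 := hC p.1 hp.1 (p.2 * s) ⟨mul_nonneg hp2 h0, by nlinarith⟩
        have h3 := hD p.1 hp.1 (p.2 * (1 - s)) ⟨mul_nonneg hp2 (by linarith), by nlinarith⟩
        rw [norm_mul]
        exact mul_le_mul h2 h3 (norm_nonneg _) ((abs_nonneg _).trans h2)
      · refine Eventually.of_forall fun s hs => ?_
        obtain ⟨h0, h1⟩ := hI s hs
        exact ((hcF s h0).mul (hcG (1 - s) (by linarith))) (x, t) ⟨hx, ht⟩
    exact (continuousOn_snd.mul key).congr fun p _ => tconv_eq_mul_integral _ _ _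
  · obtain ⟨C, hC⟩ := hF.2 T
    obtain ⟨D, hD⟩ := hG.2 T
    refine ⟨C * D * T, fun x hx t ht => ?_⟩
    have h := intervalIntegral.norm_integral_le_of_norm_le_const (a := 0) (b := t) (C := C * D)
      (f := fun τ => F x τ * G x (t - τ)) fun s hs => by
        rw [uIoc_of_le ht.1] at hs
        have h2 := hC x hx s ⟨hs.1.le, hs.2.trans ht.2⟩
        rw [norm_mul]
        exact mul_le_mul h2 (hD x hx (t - s) ⟨by linarith [hs.2], by linarith [hs.1, ht.2]⟩)
          (norm_nonneg _) ((abs_nonneg _).trans h2)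
    have hCD : 0 ≤ C * D := mul_nonneg ((abs_nonneg _).trans (hC x hx t ht))
      ((abs_nonneg _).trans (hD x hx t ht))
    rw [sub_zero, abs_of_nonneg ht.1] at h
    exact h.trans (mul_le_mul_of_nonneg_left ht.2 hCD)

end IsBoundaryDatum

/-! ### Algebraic laws of convolution in time -/

section Time

variable {f g h : ℝ → ℝ} {t : ℝ}

lemma continuousOn_tconv (hf : ContinuousOn f (Ici 0)) (hg : ContinuousOn g (Ici 0)) :
    ContinuousOn (tconv f g) (Ici 0) :=
  ((IsBoundaryDatum.of_time (S := {0}) hf).conv (.of_time hg)).time (mem_singleton (0 : E3))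

lemma intervalIntegrable_tconv (hf : ContinuousOn f (Ici 0)) (hg : ContinuousOn g (Ici 0))
    (ht : 0 ≤ t) : IntervalIntegrable (fun s => f s * g (t - s)) volume 0 t := by
  refine ContinuousOn.intervalIntegrable_of_Icc ht (ContinuousOn.mul ?_ ?_)
  · exact hf.mono Icc_subset_Ici_self
  · exact hg.comp (by fun_prop) fun s hs => sub_nonneg.2 hs.2

lemma tconv_add (hf : ContinuousOn f (Ici 0)) (hg : ContinuousOn g (Ici 0))
    (hh : ContinuousOn h (Ici 0)) (ht : 0 ≤ t) :
    tconv f (g + h) t = tconv f g t + tconv f h t := by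
  simp only [tconv, Pi.add_apply, mul_add]
  exact intervalIntegral.integral_add (intervalIntegrable_tconv hf hg ht)
    (intervalIntegrable_tconv hf hh ht)

lemma tconv_smul (f g : ℝ → ℝ) (a : ℝ) : tconv f (a • g) = a • tconv f g := by
  funext t
  simp only [tconv, Pi.smul_apply, smul_eq_mul, ← intervalIntegral.integral_const_mul]
  exact intervalIntegral.integral_congr fun s _ => by ring

/-- Both sides integrate the same function over the triangle `0 ≤ s ≤ τ ≤ t`. It is extended by zero
to the square, where it is bounded, and Fubini's theorem applies. -/
lemma tconv_assoc (hf : ContinuousOn f (Ici 0)) (hg : ContinuousOn g (Ici 0))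
    (hh : ContinuousOn h (Ici 0)) (ht : 0 ≤ t) :
    tconv (tconv f g) h t = tconv f (tconv g h) t := by
  obtain ⟨C, hC⟩ := isCompact_Icc.exists_bound_of_continuousOn
    (hf.mono (Icc_subset_Ici_self : Icc 0 t ⊆ Ici 0))
  obtain ⟨D, hD⟩ := isCompact_Icc.exists_bound_of_continuousOn
    (hg.mono (Icc_subset_Ici_self : Icc 0 t ⊆ Ici 0))
  obtain ⟨K, hK⟩ := isCompact_Icc.exists_bound_of_continuousOn
    (hh.mono (Icc_subset_Ici_self : Icc 0 t ⊆ Ici 0))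
  set T : Set (ℝ × ℝ) := {p | p.2 ≤ p.1} with hT
  have hTm : MeasurableSet T := measurableSet_le measurable_snd measurable_fst
  set Φ : ℝ → ℝ → ℝ := fun τ s => T.indicator (fun p => f p.2 * g (p.1 - p.2) * h (t - p.1)) (τ, s)
    with hΦ
  have hint : Integrable (Function.uncurry Φ)
      ((volume.restrict (uIoc 0 t)).prod (volume.restrict (uIoc 0 t))) := by
    rw [uIoc_of_le ht, Measure.prod_restrict]
    have hm : MeasurableSet (Ioc 0 t ×ˢ Ioc 0 t : Set (ℝ × ℝ)) :=
      measurableSet_Ioc.prod measurableSet_Ioc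
    have hun : Function.uncurry Φ
        = T.indicator (fun p => f p.2 * g (p.1 - p.2) * h (t - p.1)) := rfl
    rw [hun, integrable_indicator_iff hTm, IntegrableOn, Measure.restrict_restrict hTm]
    have hb : ∀ p ∈ T ∩ Ioc 0 t ×ˢ Ioc 0 t, p.2 ∈ Icc 0 t ∧ p.1 - p.2 ∈ Icc 0 t ∧
        t - p.1 ∈ Icc 0 t := fun p hp => by
      obtain ⟨h1, h2, h3⟩ := hp
      have h1 : p.2 ≤ p.1 := h1
      exact ⟨⟨h3.1.le, h3.2⟩, ⟨by linarith, by linarith [h2.2, h3.1]⟩,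
        ⟨by linarith [h2.2], by linarith [h2.1]⟩⟩
    refine IntegrableOn.of_bound (C := C * D * K) ?_ ?_ ?_
    · refine (measure_mono inter_subset_right).trans_lt ?_
      rw [Measure.prod_prod]
      simp [ENNReal.mul_lt_top_iff]
    · refine ContinuousOn.aestronglyMeasurable (ContinuousOn.mul (ContinuousOn.mul ?_ ?_) ?_)
        (hTm.inter hm)
      · exact hf.comp continuousOn_snd fun p hp => (hb p hp).1.1
      · exact hg.comp (by fun_prop) fun p hp => (hb p hp).2.1.1
      · exact hh.comp (by fun_prop) fun p hp => (hb p hp).2.2.1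
    · refine (ae_restrict_iff' (hTm.inter hm)).2 (Eventually.of_forall fun p hp => ?_)
      obtain ⟨h1, h2, h3⟩ := hb p hp
      have hC0 := (norm_nonneg _).trans (hC _ h1)
      have hD0 := (norm_nonneg _).trans (hD _ h2)
      rw [norm_mul, norm_mul]
      exact mul_le_mul (mul_le_mul (hC _ h1) (hD _ h2) (norm_nonneg _) hC0) (hK _ h3)
        (norm_nonneg _) (mul_nonneg hC0 hD0)
  have hswap := intervalIntegral_intervalIntegral_swap (F := Φ) (a := 0) (b := t) (c := 0) (d := t)
    (by rwa [Measure.prod_restrict] at hint)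
  have hL : tconv (tconv f g) h t = ∫ τ in (0 : ℝ)..t, ∫ s in (0 : ℝ)..t, Φ τ s := by
    refine intervalIntegral.integral_congr fun τ hτ => ?_
    rw [uIcc_of_le ht] at hτ
    simp only [tconv]
    rw [← intervalIntegral.integral_mul_const, intervalIntegral.integral_of_le hτ.1,
      intervalIntegral.integral_of_le ht, ← integral_indicator measurableSet_Ioc,
      ← integral_indicator measurableSet_Ioc]
    refine integral_congr_ae (Eventually.of_forall fun s => ?_)
    simp only [hΦ, hT, indicator, mem_Ioc, mem_ofPred_eq]
    have h1 := hτ.2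
    by_cases hs : 0 < s <;> by_cases hs' : s ≤ τ <;> simp [hs, hs']
    intro h2; exact absurd (hs'.trans h1) (not_le.2 h2)
  have hR : tconv f (tconv g h) t = ∫ s in (0 : ℝ)..t, ∫ τ in (0 : ℝ)..t, Φ τ s := by
    refine intervalIntegral.integral_congr fun s hs => ?_
    rw [uIcc_of_le ht] at hs
    simp only [tconv]
    have h0 := intervalIntegral.integral_comp_sub_right (fun r => g r * h (t - s - r))
      (a := s) (b := t) s
    rw [sub_self] at h0
    -- The half-open intervals are exchanged for closed ones because the triangle contains its
    -- diagonal `s = τ`; single points have measure zero.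
    rw [← h0, ← intervalIntegral.integral_const_mul, intervalIntegral.integral_of_le hs.2,
      intervalIntegral.integral_of_le ht, integral_Ioc_eq_integral_Ioo,
      ← integral_Icc_eq_integral_Ioc, ← integral_Icc_eq_integral_Ioo,
      ← integral_indicator measurableSet_Icc, ← integral_indicator measurableSet_Icc]
    refine integral_congr_ae (Eventually.of_forall fun τ => ?_)
    simp only [hΦ, hT, indicator, mem_Icc, mem_ofPred_eq]
    have h1 := hs.1
    by_cases h2 : s ≤ τ
    · have h3 := h1.trans h2
      by_cases h4 : τ ≤ t <;> simp [h2, h3, h4, mul_assoc]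
    · simp [h2]
  rw [hL, hR, hswap]

end Time

/-! ### The convolution algebra of a set -/

/-- The continuous, locally bounded fields on `S × [0, ∞)`, extended by zero. -/
noncomputable def ConvAlg (S : Set E3) : Submodule ℝ Field where
  carrier := {F | IsBoundaryDatum S F ∧ ∀ x t, ¬(x ∈ S ∧ 0 ≤ t) → F x t = 0}
  add_mem' h h' := ⟨h.1.add h'.1, fun x t hx => by simp [h.2 x t hx, h'.2 x t hx]⟩
  zero_mem' := ⟨.zero, fun _ _ _ => rfl⟩
  smul_mem' a F h := ⟨h.1.smul a, fun x t hx => by simp [h.2 x t hx]⟩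

namespace ConvAlg

variable {S : Set E3}

lemma conv_mem (F G : ConvAlg S) : F.1 ⊛ G.1 ∈ ConvAlg S := by
  refine ⟨F.2.1.conv G.2.1, fun x t hx => ?_⟩
  by_cases hxS : x ∈ S
  · have ht : t < 0 := not_le.1 fun h => hx ⟨hxS, h⟩
    -- At a negative time `t` the variable runs between `t` and `0`, where `t - s` is negative and
    -- the second factor vanishes.
    refine intervalIntegral.integral_zero_ae (Eventually.of_forall fun s hs => ?_)
    rw [uIoc_of_ge ht.le] at hs
    rw [G.2.2 x (t - s) fun h => not_lt.2 h.2 (by linarith [hs.1]), mul_zero]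
  · have h0 : F.1 x = 0 := funext fun s => F.2.2 x s fun h => hxS h.1
    simp [fconv, tconv, h0]

noncomputable instance : Mul (ConvAlg S) := ⟨fun F G => ⟨F.1 ⊛ G.1, conv_mem F G⟩⟩

lemma coe_mul (F G : ConvAlg S) : (F * G).1 = F.1 ⊛ G.1 := rfl

lemma ext' {F G : ConvAlg S} (h : ∀ x ∈ S, ∀ t, 0 ≤ t → F.1 x t = G.1 x t) : F = G := by
  refine Subtype.ext (funext₂ fun x t => ?_)
  by_cases hx : x ∈ S ∧ 0 ≤ t
  · exact h x hx.1 t hx.2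
  · rw [F.2.2 x t hx, G.2.2 x t hx]

protected lemma mul_comm' (F G : ConvAlg S) : F * G = G * F := Subtype.ext (fconv_comm F.1 G.1)

protected lemma mul_add' (F G H : ConvAlg S) : F * (G + H) = F * G + F * H :=
  ext' fun _ hx _ ht => tconv_add (F.2.1.time hx) (G.2.1.time hx) (H.2.1.time hx) ht

protected lemma mul_smul' (F G : ConvAlg S) (a : ℝ) : F * a • G = a • (F * G) :=
  Subtype.ext (funext fun x => tconv_smul (F.1 x) (G.1 x) a)

noncomputable instance : NonUnitalCommRing (ConvAlg S) :=
  { (inferInstance : AddCommGroup (ConvAlg S)) with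
    mul := (· * ·)
    mul_comm := ConvAlg.mul_comm'
    left_distrib := ConvAlg.mul_add'
    right_distrib := fun F G H => by
      rw [ConvAlg.mul_comm', ConvAlg.mul_add', ConvAlg.mul_comm' H, ConvAlg.mul_comm' H]
    zero_mul := fun F => ext' fun _ _ _ ht => tconv_eq_zero_left ht fun _ _ => rfl
    mul_zero := fun F => ext' fun _ _ _ ht => tconv_eq_zero_right ht fun _ _ => rfl
    mul_assoc := fun F G H => ext' fun x hx _ ht =>
      tconv_assoc (F.2.1.time hx) (G.2.1.time hx) (H.2.1.time hx) ht }

instance : SMulCommClass ℝ (ConvAlg S) (ConvAlg S) :=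
  ⟨fun a F G => (ConvAlg.mul_smul' F G a).symm⟩

instance : IsScalarTower ℝ (ConvAlg S) (ConvAlg S) :=
  ⟨fun a F G => by
    rw [smul_eq_mul, smul_eq_mul, mul_comm, ConvAlg.mul_smul', mul_comm]⟩

end ConvAlg

/-! ### Fields as elements of a commutative real algebra -/

/-- The convolution algebra with a unit adjoined. -/
abbrev UConv (S : Set E3) := Unitization ℝ (ConvAlg S)

/-- The element `a` of the unital convolution algebra is the field `F` on `S × [0, ∞)`. -/
def Rep (S : Set E3) (F : Field) (a : UConv S) : Prop :=
  a.fst = 0 ∧ ∀ x ∈ S, ∀ t, 0 ≤ t → F x t = a.snd.1 x t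

open Classical in
/-- The class of a field in the unital convolution algebra. -/
noncomputable def br (S : Set E3) (F : Field) : UConv S :=
  if h : IsBoundaryDatum S F then
    Unitization.inr ⟨fun x t => if x ∈ S ∧ 0 ≤ t then F x t else 0,
      h.congr fun x hx t ht => by simp [hx, ht], fun x t hx => by simp [hx]⟩
  else 0

lemma rep_br {S : Set E3} {F : Field} (h : IsBoundaryDatum S F) : Rep S F (br S F) := by
  rw [br, dif_pos h]
  exact ⟨rfl, fun x hx t ht => by simp [hx, ht]⟩

namespace Rep

variable {S : Set E3} {F G : Field} {a b : UConv S}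

lemma isBoundaryDatum (h : Rep S F a) : IsBoundaryDatum S F := a.snd.2.1.congr h.2

lemma congr (h : Rep S F a) (hG : ∀ x ∈ S, ∀ t, 0 ≤ t → G x t = F x t) : Rep S G a :=
  ⟨h.1, fun x hx t ht => (hG x hx t ht).trans (h.2 x hx t ht)⟩

lemma add (h : Rep S F a) (h' : Rep S G b) : Rep S (F + G) (a + b) :=
  ⟨by simp [h.1, h'.1], fun x hx t ht => by
    simp only [Pi.add_apply, h.2 x hx t ht, h'.2 x hx t ht]; rfl⟩

lemma smul (h : Rep S F a) (c : ℝ) : Rep S (c • F) (c • a) :=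
  ⟨by simp [h.1], fun x hx t ht => by simp only [Pi.smul_apply, h.2 x hx t ht]; rfl⟩

lemma neg (h : Rep S F a) : Rep S (-F) (-a) :=
  ⟨by simp [h.1], fun x hx t ht => by simp only [Pi.neg_apply, h.2 x hx t ht]; rfl⟩

lemma sub (h : Rep S F a) (h' : Rep S G b) : Rep S (F - G) (a - b) := by
  rw [sub_eq_add_neg, sub_eq_add_neg]; exact h.add h'.neg

lemma zero : Rep S 0 0 := ⟨rfl, fun _ _ _ _ => rfl⟩

lemma sum {ι : Type*} {s : Finset ι} {F : ι → Field} {a : ι → UConv S}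
    (h : ∀ i, Rep S (F i) (a i)) : Rep S (∑ i ∈ s, F i) (∑ i ∈ s, a i) := by
  classical
  induction s using Finset.induction_on with
  | empty => simpa using zero
  | insert i s hi ih =>
    rw [Finset.sum_insert hi, Finset.sum_insert hi]
    exact (h i).add ih

lemma conv (h : Rep S F a) (h' : Rep S G b) : Rep S (F ⊛ G) (a * b) := by
  refine ⟨by simp [h.1, h'.1], fun x hx t ht => ?_⟩
  -- Elements that come from fields have no scalar part, so their product is the convolution alone.
  have h1 : (a * b).snd = a.snd * b.snd := by simp [h.1, h'.1]
  rw [h1, ConvAlg.coe_mul]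
  exact tconv_congr ht (fun s hs => h.2 x hx s hs.1) fun s hs => h'.2 x hx s hs.1

end Rep

/-! ### Integration over a set as a linear functional on the convolution algebra -/

section Integral

variable {S : Set E3} {ν : Measure E3} [IsFiniteMeasure (ν.restrict S)] {F G : Field} {t : ℝ}

lemma IsBoundaryDatum.integrableOn (hS : MeasurableSet S) (hF : IsBoundaryDatum S F) (ht : 0 ≤ t) :
    IntegrableOn (fun x => F x t) S ν := by
  obtain ⟨C, hC⟩ := hF.2 t
  refine IntegrableOn.of_bound (C := C) ?_ ((hF.space ht).aestronglyMeasurable hS)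
    ((ae_restrict_iff' hS).2 (Eventually.of_forall fun x hx => hC x hx t ⟨ht, le_rfl⟩))
  simpa using measure_lt_top (ν.restrict S) univ

/-- Integration over `S` at the time `t`, as a linear functional on the convolution algebra. -/
noncomputable def intAt (ν : Measure E3) [IsFiniteMeasure (ν.restrict S)] (hS : MeasurableSet S)
    {t : ℝ} (ht : 0 ≤ t) : UConv S →ₗ[ℝ] ℝ where
  toFun a := ∫ x in S, a.snd.1 x t ∂ν
  map_add' a b := by
    simp only [Unitization.snd_add]
    exact integral_add (a.snd.2.1.integrableOn hS ht) (b.snd.2.1.integrableOn hS ht)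
  map_smul' c a := by
    simp only [Unitization.snd_smul, RingHom.id_apply, smul_eq_mul]
    exact integral_const_mul c _

lemma Rep.integral (hS : MeasurableSet S) (ht : 0 ≤ t) {a : UConv S} (h : Rep S F a) :
    ∫ x in S, F x t ∂ν = intAt ν hS ht a :=
  setIntegral_congr_fun hS fun x hx => h.2 x hx t ht

lemma integrable_fconv (hS : MeasurableSet S) (hF : IsBoundaryDatum S F) (hG : IsBoundaryDatum S G)
    (ht : 0 ≤ t) : Integrable (Function.uncurry fun τ x => F x τ * G x (t - τ))
      ((volume.restrict (uIoc 0 t)).prod (ν.restrict S)) := by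
  obtain ⟨C, hC⟩ := hF.2 t
  obtain ⟨D, hD⟩ := hG.2 t
  have hR : ν.restrict S = (ν.restrict S).restrict S := by
    rw [Measure.restrict_restrict hS, inter_self]
  rw [uIoc_of_le ht, hR, Measure.prod_restrict]
  have hm : MeasurableSet (Ioc 0 t ×ˢ S) := measurableSet_Ioc.prod hS
  refine IntegrableOn.of_bound (C := C * D) ?_ ?_ ?_
  · rw [Measure.prod_prod]
    exact ENNReal.mul_lt_top (by simp) (measure_lt_top _ _)
  · refine ContinuousOn.aestronglyMeasurable (ContinuousOn.mul ?_ ?_) hm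
    · exact hF.1.comp (f := fun p : ℝ × E3 => (p.2, p.1)) (by fun_prop) fun p hp =>
        ⟨hp.2, hp.1.1.le⟩
    · exact hG.1.comp (f := fun p : ℝ × E3 => (p.2, t - p.1)) (by fun_prop) fun p hp =>
        ⟨hp.2, sub_nonneg.2 hp.1.2⟩
  · refine (ae_restrict_iff' hm).2 (Eventually.of_forall fun p hp => ?_)
    have h2 := hC p.2 hp.2 p.1 ⟨hp.1.1.le, hp.1.2⟩
    simp only [Function.uncurry, norm_mul]
    exact mul_le_mul h2 (hD p.2 hp.2 (t - p.1) ⟨sub_nonneg.2 hp.1.2, by linarith [hp.1.1]⟩)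
      (norm_nonneg _) ((abs_nonneg _).trans h2)

lemma integral_fconv (hS : MeasurableSet S) (hF : IsBoundaryDatum S F) (hG : IsBoundaryDatum S G)
    (ht : 0 ≤ t) :
    ∫ x in S, (F ⊛ G) x t ∂ν = ∫ τ in (0 : ℝ)..t, ∫ x in S, F x τ * G x (t - τ) ∂ν := by
  exact (intervalIntegral_integral_swap (integrable_fconv hS hF hG ht)).symm

lemma tconv_integral (hS : MeasurableSet S) {k : ℝ → ℝ} (hk : ContinuousOn k (Ici 0))
    (hF : IsBoundaryDatum S F) (ht : 0 ≤ t) :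
    tconv k (fun s => ∫ x in S, F x s ∂ν) t = ∫ x in S, ((fun _ => k) ⊛ F) x t ∂ν := by
  rw [integral_fconv hS (.of_time hk) hF ht]
  exact intervalIntegral.integral_congr fun τ _ => (integral_const_mul _ _).symm

end Integral

end ThermoPiezo

namespace ThermoPiezo

open Matrix

/-! ### The algebra of the first variation -/

section Algebraic

variable {ι κ R : Type*} [Fintype κ] [CommRing R] [Algebra ℝ R]

/-- The action of a real matrix on vectors with entries in an algebra. -/
def act (A : Matrix ι κ ℝ) (x : κ → R) : ι → R := fun i => ∑ j, A i j • x j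

lemma act_add (A : Matrix ι κ ℝ) (x y : κ → R) : act A (x + y) = act A x + act A y := by
  funext i; simp [act, Finset.sum_add_distrib]

lemma act_smul (A : Matrix ι κ ℝ) (s : ℝ) (x : κ → R) : act A (s • x) = s • act A x := by
  funext i; simp only [act, Pi.smul_apply, Finset.smul_sum, smul_comm s]

lemma act_dotProduct [Fintype ι] (A : Matrix ι κ ℝ) (x : κ → R) (y : ι → R) :
    act A x ⬝ᵥ y = act Aᵀ y ⬝ᵥ x := by
  simp only [act, dotProduct, Finset.sum_mul]
  rw [Finset.sum_comm]
  refine Finset.sum_congr rfl fun i _ => Finset.sum_congr rfl fun j _ => ?_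
  rw [transpose_apply, smul_mul_assoc, smul_mul_assoc, mul_comm]

end Algebraic

/-- The classes of the fields of a process, and of those of its derivatives that occur in the
first variation. -/
structure Arr (R : Type*) where
  u : Fin 3 → R
  θ : R
  φ : R
  e : Fin 3 × Fin 3 → R
  κ : Fin 3 × Fin 3 × Fin 3 → R
  b : Fin 3 → R
  E : Fin 3 → R
  V : Fin 3 × Fin 3 → R
  τ : Fin 3 × Fin 3 → R
  μ : Fin 3 × Fin 3 × Fin 3 → R
  σ : Fin 3 → R
  Q : Fin 3 × Fin 3 → R
  η : R
  q : Fin 3 → R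
  divS : Fin 3 → R
  divD : R
  divq : R
  gu : Fin 3 × Fin 3 → R
  ggu : Fin 3 × Fin 3 × Fin 3 → R
  gφ : Fin 3 → R
  ggφ : Fin 3 × Fin 3 → R
  gθ : Fin 3 → R

/-- The classes of the given data. -/
structure ArrData (R : Type*) where
  F : Fin 3 → R
  g : R
  H : R
  L : Fin 3 × Fin 3 → R
  M : Fin 3 × Fin 3 → R
  Rr : R

/-- The classes of the convolution kernels. -/
structure Kernels (R : Type*) where
  l : R
  ξ : R
  ζ : R
  χ : R

namespace Material

variable (m : Material)

/-- The constants `a11` as a matrix. -/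
def M11 : Matrix (Fin 3 × Fin 3) (Fin 3 × Fin 3) ℝ := fun i j => m.a11 i.1 i.2 j.1 j.2
/-- The constants `a17` as a matrix. -/
def M17 : Matrix (Fin 3 × Fin 3) (Fin 3 × Fin 3) ℝ := fun i j => m.a17 i.1 i.2 j.1 j.2
/-- The constants `a77` as a matrix. -/
def M77 : Matrix (Fin 3 × Fin 3) (Fin 3 × Fin 3) ℝ := fun i j => m.a77 i.1 i.2 j.1 j.2
/-- The constants `a22` as a matrix. -/
def M22 : Matrix (Fin 3 × Fin 3 × Fin 3) (Fin 3 × Fin 3 × Fin 3) ℝ :=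
  fun i j => m.a22 i.1 i.2.1 i.2.2 j.1 j.2.1 j.2.2
/-- The constants `a23` as a matrix. -/
def M23 : Matrix (Fin 3 × Fin 3 × Fin 3) (Fin 3) ℝ := fun i j => m.a23 i.1 i.2.1 i.2.2 j
/-- The constants `a33` as a matrix. -/
def M33 : Matrix (Fin 3) (Fin 3) ℝ := m.a33
/-- The constants `k` as a matrix. -/
def Mk : Matrix (Fin 3) (Fin 3) ℝ := m.k
/-- The constants `a14` as a row. -/
def M14 : Matrix Unit (Fin 3 × Fin 3) ℝ := fun _ j => m.a14 j.1 j.2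
/-- The constants `a47` as a row. -/
def M47 : Matrix Unit (Fin 3 × Fin 3) ℝ := fun _ j => m.a47 j.1 j.2

lemma M11_symm : m.M11ᵀ = m.M11 := by
  ext i j; exact (m.a11_symm _ _ _ _).2
lemma M77_symm : m.M77ᵀ = m.M77 := by
  ext i j; exact (m.a77_symm _ _ _ _).2
lemma M22_symm : m.M22ᵀ = m.M22 := by
  ext i j; exact (m.a22_symm _ _ _ _ _ _).2
lemma M33_symm : m.M33ᵀ = m.M33 := by
  ext i j; exact m.a33_symm _ _
lemma Mk_symm : m.Mkᵀ = m.Mk := by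
  ext i j; exact m.k_symm _ _

end Material

namespace Arr

variable {R : Type*} [CommRing R] [Algebra ℝ R] (m : Material) (k : Kernels R) (d : ArrData R)

instance : Add (Arr R) where
  add x y := ⟨x.u + y.u, x.θ + y.θ, x.φ + y.φ, x.e + y.e, x.κ + y.κ, x.b + y.b, x.E + y.E,
    x.V + y.V, x.τ + y.τ, x.μ + y.μ, x.σ + y.σ, x.Q + y.Q, x.η + y.η, x.q + y.q,
    x.divS + y.divS, x.divD + y.divD, x.divq + y.divq, x.gu + y.gu, x.ggu + y.ggu, x.gφ + y.gφ,
    x.ggφ + y.ggφ, x.gθ + y.gθ⟩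

instance : SMul ℝ (Arr R) where
  smul s x := ⟨s • x.u, s • x.θ, s • x.φ, s • x.e, s • x.κ, s • x.b, s • x.E,
    s • x.V, s • x.τ, s • x.μ, s • x.σ, s • x.Q, s • x.η, s • x.q,
    s • x.divS, s • x.divD, s • x.divq, s • x.gu, s • x.ggu, s • x.gφ, s • x.ggφ, s • x.gθ⟩

/-- The class of `τ̂`. -/
def hτ (x : Arr R) : Fin 3 × Fin 3 → R := act m.M11 x.e + act m.M17 x.V
/-- The class of `μ̂`. -/
def hμ (x : Arr R) : Fin 3 × Fin 3 × Fin 3 → R := act m.M22 x.κ + act m.M23 x.E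
/-- The class of `σ̂`. -/
def hσ (x : Arr R) : Fin 3 → R := -(act m.M23ᵀ x.κ + act m.M33 x.E)
/-- The class of `Q̂`. -/
def hQ (x : Arr R) : Fin 3 × Fin 3 → R := -(act m.M17ᵀ x.e + act m.M77 x.V)
/-- The class of `q̂`. -/
def hq (x : Arr R) : Fin 3 → R := -(m.T0 • act m.Mk x.b)
/-- The class of `ρη - ρη̂`. -/
def W (x : Arr R) : R := m.ρ • x.η + (act m.M14 x.e () + act m.M47 x.V ())
/-- The class of `-χ * (ρη - ρη̂) + ℛ`. -/
def Z (x : Arr R) : R := -(k.χ * x.W m) + d.Rr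

/-- The class of the volume density of the functional. -/
noncomputable def quad (x : Arr R) : R :=
  k.ζ * (k.ξ * (x.divS ⬝ᵥ x.u) + d.F ⬝ᵥ x.u - (1 / 2 * m.ρ) • (x.u ⬝ᵥ x.u))
  + k.ζ * k.ξ * ((x.divD - d.g) * x.φ)
  - k.ξ * ((1 / m.T0) • (-(k.l * x.divq) + d.H - (m.ρ * m.T0) • x.η)) * x.θ
  + k.ξ * (k.ζ * (x.τ ⬝ᵥ x.e - (1 / 2 : ℝ) • (x.hτ m ⬝ᵥ x.e)) + d.L ⬝ᵥ x.e)
  + k.ζ * k.ξ * (x.μ ⬝ᵥ x.κ - (1 / 2 : ℝ) • (x.hμ m ⬝ᵥ x.κ))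
  - k.ζ * k.ξ * (x.σ ⬝ᵥ x.E - (1 / 2 : ℝ) • (x.hσ m ⬝ᵥ x.E))
  + k.ξ * (-(k.ζ * (x.Q ⬝ᵥ x.V - (1 / 2 : ℝ) • (x.hQ m ⬝ᵥ x.V))) + d.M ⬝ᵥ x.V)
  - k.ξ * ((1 / m.c) • (-(k.χ * ((1 / 2 : ℝ) • x.W m)) + d.Rr)) * x.W m
  + k.ξ * k.l * ((1 / m.T0) • (x.q ⬝ᵥ x.b - (1 / 2 : ℝ) • (x.hq m ⬝ᵥ x.b)))

/-- The part of the first variation of the volume density that is integrated by parts. -/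
noncomputable def green (x y : Arr R) : R :=
  k.ζ * k.ξ * (y.divS ⬝ᵥ x.u + y.τ ⬝ᵥ x.gu + y.μ ⬝ᵥ x.ggu)
  + k.ζ * k.ξ * (y.divD * x.φ + y.σ ⬝ᵥ x.gφ + y.Q ⬝ᵥ x.ggφ)
  + (1 / m.T0) • (k.ξ * k.l * (y.divq * x.θ + y.q ⬝ᵥ x.gθ))

/-- The remaining part of the first variation of the volume density. -/
noncomputable def resid (x y : Arr R) : R :=
  k.ζ * ((k.ξ * (x.divS ⬝ᵥ y.u) + d.F ⬝ᵥ y.u) - m.ρ • (x.u ⬝ᵥ y.u))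
  + k.ζ * k.ξ * (x.divD - d.g) * y.φ
  - k.ξ * ((1 / m.T0) • (-(k.l * x.divq) + d.H - (m.ρ * m.T0) • x.η)) * y.θ
  + (m.ρ • (k.ξ * (x.θ - (1 / m.c) • x.Z m k d)) * y.η)
  + k.ξ * (k.ζ * ((x.τ - x.hτ m) ⬝ᵥ y.e) + d.L ⬝ᵥ y.e
      - (1 / m.c) • x.Z m k d * act m.M14 y.e ())
  + k.ξ * (-(k.ζ * ((x.Q - x.hQ m) ⬝ᵥ y.V)) + d.M ⬝ᵥ y.V
      - (1 / m.c) • x.Z m k d * act m.M47 y.V ())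
  + k.ζ * k.ξ * ((x.μ - x.hμ m) ⬝ᵥ y.κ)
  - k.ζ * k.ξ * ((x.σ - x.hσ m) ⬝ᵥ y.E)
  + k.ξ * k.l * ((1 / m.T0) • ((x.q - x.hq m) ⬝ᵥ y.b))
  + k.ζ * k.ξ * ((x.e - x.gu) ⬝ᵥ y.τ)
  + k.ζ * k.ξ * ((x.κ - x.ggu) ⬝ᵥ y.μ)
  - k.ζ * k.ξ * ((x.E + x.gφ) ⬝ᵥ y.σ)
  - k.ζ * k.ξ * ((x.V + x.ggφ) ⬝ᵥ y.Q)
  + k.ξ * k.l * ((1 / m.T0) • ((x.b - x.gθ) ⬝ᵥ y.q))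

/-- The map from `(e, V)` to `(τ̂, -Q̂)` has a block matrix with symmetric diagonal blocks `a11`,
`a77` and off-diagonal blocks `a17` and its transpose. The cross terms match only when stress and
electric terms are taken together, and commutativity of convolution does the rest. -/
lemma hat_mech_symm (x y : Arr R) :
    y.hτ m ⬝ᵥ x.e - y.hQ m ⬝ᵥ x.V = x.hτ m ⬝ᵥ y.e - x.hQ m ⬝ᵥ y.V := by
  simp only [hτ, hQ, add_dotProduct, neg_dotProduct]
  rw [act_dotProduct m.M11 y.e, act_dotProduct m.M77 y.V, act_dotProduct m.M17 y.V,
    act_dotProduct m.M17 x.V, m.M11_symm, m.M77_symm]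
  ring

/-- The same reciprocity for the map from `(κ, E)` to `(μ̂, -σ̂)`, with `a23` as the off-diagonal
block. -/
lemma hat_hyper_symm (x y : Arr R) :
    y.hμ m ⬝ᵥ x.κ - y.hσ m ⬝ᵥ x.E = x.hμ m ⬝ᵥ y.κ - x.hσ m ⬝ᵥ y.E := by
  simp only [hμ, hσ, add_dotProduct, neg_dotProduct]
  rw [act_dotProduct m.M22 y.κ, act_dotProduct m.M33 y.E, act_dotProduct m.M23 y.E,
    act_dotProduct m.M23 x.E, m.M22_symm, m.M33_symm]
  ring

lemma hat_heat_symm (x y : Arr R) : y.hq m ⬝ᵥ x.b = x.hq m ⬝ᵥ y.b := by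
  simp only [hq, neg_dotProduct, smul_dotProduct]
  rw [act_dotProduct m.Mk y.b, m.Mk_symm]

section Linear

variable (x y : Arr R) (s : ℝ)

lemma hτ_line : (x + s • y).hτ m = x.hτ m + s • y.hτ m := by
  change act _ (x.e + s • y.e) + act _ (x.V + s • y.V) = _
  simp only [hτ, act_add, act_smul]; module
lemma hμ_line : (x + s • y).hμ m = x.hμ m + s • y.hμ m := by
  change act _ (x.κ + s • y.κ) + act _ (x.E + s • y.E) = _
  simp only [hμ, act_add, act_smul]; module
lemma hσ_line : (x + s • y).hσ m = x.hσ m + s • y.hσ m := by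
  change -(act _ (x.κ + s • y.κ) + act _ (x.E + s • y.E)) = _
  simp only [hσ, act_add, act_smul]; module
lemma hQ_line : (x + s • y).hQ m = x.hQ m + s • y.hQ m := by
  change -(act _ (x.e + s • y.e) + act _ (x.V + s • y.V)) = _
  simp only [hQ, act_add, act_smul]; module
lemma hq_line : (x + s • y).hq m = x.hq m + s • y.hq m := by
  change -(m.T0 • act _ (x.b + s • y.b)) = _
  simp only [hq, act_add, act_smul]; module
lemma W_line : (x + s • y).W m = x.W m + s • y.W m := by
  change m.ρ • (x.η + s • y.η) + (act _ (x.e + s • y.e) () + act _ (x.V + s • y.V) ()) = _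
  simp only [W, act_add, act_smul, Pi.add_apply, Pi.smul_apply]; module

end Linear

/-- The density is quadratic. In its linear part the terms with derivatives of `y`, completed by
products such as `y.τ` times the gradient of `x.u`, form `green`, which integrates to boundary
terms. Subtracting the same products leaves in `resid` the residuals of the geometric relations. -/
theorem quad_line (x y : Arr R) : ∃ q : R, ∀ s : ℝ, (x + s • y).quad m k d
    = x.quad m k d + s • (green m k x y + resid m k d x y) + (s * s) • q := by
  -- The second-order coefficient is the density of the variation itself with all data set to zero.
  refine ⟨y.quad m k ⟨0, 0, 0, 0, 0, 0⟩, fun s => ?_⟩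
  simp only [quad, hτ_line, hμ_line, hσ_line, hQ_line, hq_line, W_line]
  simp only [show (x + s • y).u = x.u + s • y.u from rfl,
    show (x + s • y).θ = x.θ + s • y.θ from rfl, show (x + s • y).φ = x.φ + s • y.φ from rfl,
    show (x + s • y).e = x.e + s • y.e from rfl, show (x + s • y).κ = x.κ + s • y.κ from rfl,
    show (x + s • y).b = x.b + s • y.b from rfl, show (x + s • y).E = x.E + s • y.E from rfl,
    show (x + s • y).V = x.V + s • y.V from rfl, show (x + s • y).τ = x.τ + s • y.τ from rfl,
    show (x + s • y).μ = x.μ + s • y.μ from rfl, show (x + s • y).σ = x.σ + s • y.σ from rfl,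
    show (x + s • y).Q = x.Q + s • y.Q from rfl, show (x + s • y).η = x.η + s • y.η from rfl,
    show (x + s • y).q = x.q + s • y.q from rfl,
    show (x + s • y).divS = x.divS + s • y.divS from rfl,
    show (x + s • y).divD = x.divD + s • y.divD from rfl,
    show (x + s • y).divq = x.divq + s • y.divq from rfl]
  have hW : y.W m = m.ρ • y.η + (act m.M14 y.e () + act m.M47 y.V ()) := rfl
  have h1 := hat_mech_symm m x y
  have h2 := hat_hyper_symm m x y
  have h3 := hat_heat_symm m x y
  simp only [green, resid, Z, add_dotProduct, dotProduct_add, smul_dotProduct, dotProduct_smul,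
    sub_dotProduct, zero_dotProduct]
  rw [dotProduct_comm y.u x.u, dotProduct_comm x.e y.τ, dotProduct_comm x.gu y.τ,
    dotProduct_comm x.κ y.μ, dotProduct_comm x.ggu y.μ, dotProduct_comm x.E y.σ,
    dotProduct_comm x.gφ y.σ, dotProduct_comm x.V y.Q, dotProduct_comm x.ggφ y.Q,
    dotProduct_comm x.b y.q, dotProduct_comm x.gθ y.q]
  have hT : ∀ z : R, (1 / m.T0) • ((m.ρ * m.T0) • z) = m.ρ • z := fun z => by
    rw [smul_smul]; congr 1; field_simp [m.T0_pos.ne']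
  simp only [smul_sub (1 / m.T0) (_ : R), hT, smul_add, smul_neg]
  -- The two halves of each reciprocal cross term combine to one full term; this is the only
  -- arithmetic of scalars the ring computation needs.
  have hh : algebraMap ℝ R (1 / 2) + algebraMap ℝ R (1 / 2) = 1 := by
    rw [← map_add]; norm_num
  simp only [Algebra.smul_def, map_mul] at h1 h2 h3 hW ⊢
  -- After scalars and scalar products are replaced by variables, the claim is a polynomial identity
  -- modulo the three reciprocity relations and `hh`.
  generalize algebraMap ℝ R (1 / 2) = o at *
  generalize algebraMap ℝ R (1 / m.T0) = T at *
  generalize algebraMap ℝ R (1 / m.c) = C at *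
  generalize algebraMap ℝ R m.ρ = ρ at *
  generalize algebraMap ℝ R s = s at *
  generalize x.hτ m ⬝ᵥ x.e = a1 at *
  generalize x.hτ m ⬝ᵥ y.e = a2 at *
  generalize y.hτ m ⬝ᵥ x.e = a3 at *
  generalize y.hτ m ⬝ᵥ y.e = a4 at *
  generalize x.hQ m ⬝ᵥ x.V = a5 at *
  generalize x.hQ m ⬝ᵥ y.V = a6 at *
  generalize y.hQ m ⬝ᵥ x.V = a7 at *
  generalize y.hQ m ⬝ᵥ y.V = a8 at *
  generalize x.hμ m ⬝ᵥ x.κ = b1 at *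
  generalize x.hμ m ⬝ᵥ y.κ = b2 at *
  generalize y.hμ m ⬝ᵥ x.κ = b3 at *
  generalize y.hμ m ⬝ᵥ y.κ = b4 at *
  generalize x.hσ m ⬝ᵥ x.E = b5 at *
  generalize x.hσ m ⬝ᵥ y.E = b6 at *
  generalize y.hσ m ⬝ᵥ x.E = b7 at *
  generalize y.hσ m ⬝ᵥ y.E = b8 at *
  generalize x.hq m ⬝ᵥ x.b = c1 at *
  generalize x.hq m ⬝ᵥ y.b = c2 at *
  generalize y.hq m ⬝ᵥ x.b = c3 at *
  generalize y.hq m ⬝ᵥ y.b = c4 at *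
  generalize x.u ⬝ᵥ y.u = c5 at *
  generalize act m.M14 y.e () = w1 at *
  generalize act m.M47 y.V () = w2 at *
  generalize y.W m = w at *
  generalize x.W m = W at *
  generalize k.ζ = ζ at *
  generalize k.ξ = ξ at *
  generalize k.χ = χ at *
  generalize k.l = l at *
  subst hW
  linear_combination (-o * s * ξ * ζ) * (h1 + h2) - s * T * ξ * l * o * h3
    + (s * ξ * C * χ * W * (ρ * y.η + (w1 + w2)) - s * ξ * ζ * (a2 - a6 + (b2 - b6))
      - s * T * ξ * l * c2 - s * ζ * ρ * c5) * hh

end Arr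

end ThermoPiezo

namespace ThermoPiezo

/-! ### Green's formulas -/

section Green

variable {B : Set E3} {r : E3 → ℝ}

lemma IsSmoothRegion.integrableOn (hB : IsSmoothRegion B r) {f : E3 → ℝ}
    (hf : ContinuousOn f (closure B)) : IntegrableOn f B :=
  (hf.integrableOn_compact hB.isCompact_closure).mono_set subset_closure

/-- The normal derivative of a function of position. -/
noncomputable def ndv (B : Set E3) (r f : E3 → ℝ) (x : E3) : ℝ := ∑ l, nor r l x * pd B l f x

/-- The boundary operator dual to the second derivative `f ↦ f_{,kj}`. -/
noncomputable def bdryT (B : Set E3) (r : E3 → ℝ) (k j : Fin 3) (f : E3 → ℝ) (x : E3) : ℝ :=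
  -(pd B k f x * nor r j x)
    - ∑ l, ((if j = l then 1 else 0) - nor r j x * nor r l x)
        * (pd B l f x * nor r k x + f x * pd B l (nor r k) x)
    + bdryCurv B r x * (f x * nor r k x * nor r j x)

lemma continuousOn_pd (hB : IsSmoothRegion B r) {f : E3 → ℝ} (hf : ContDiffOn ℝ 1 f (closure B))
    (j : Fin 3) : ContinuousOn (pd B j f) (closure B) :=
  (contDiffOn_pd (n := 0) hB (by exact_mod_cast hf) j).continuousOn

lemma continuousOn_ndv (hB : IsSmoothRegion B r) {f : E3 → ℝ} (hf : ContDiffOn ℝ 1 f (closure B)) :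
    ContinuousOn (ndv B r f) (frontier B) :=
  continuousOn_finsetSum _ fun l _ => (continuousOn_nor hB l).mul
    ((continuousOn_pd hB hf l).mono frontier_subset_closure)

lemma continuousOn_bdryT (hB : IsSmoothRegion B r) {f : E3 → ℝ} (hf : ContDiffOn ℝ 1 f (closure B))
    (k j : Fin 3) : ContinuousOn (bdryT B r k j f) (frontier B) := by
  have h1 := fun l => (continuousOn_pd hB hf l).mono frontier_subset_closure
  have h2 := hf.continuousOn.mono frontier_subset_closure
  have h3 := continuousOn_nor hB
  refine ((((h1 k).mul (h3 j)).neg).sub (continuousOn_finsetSum _ fun l _ => ?_)).add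
    ((continuousOn_bdryCurv hB).mul ((h2.mul (h3 k)).mul (h3 j)))
  exact (continuousOn_const.sub ((h3 j).mul (h3 l))).mul
    (((h1 l).mul (h3 k)).add (h2.mul (continuousOn_pd_nor hB k l)))

/-- The derivative of `u` is split into normal and tangential parts. The surface divergence theorem
for `f n_k u` takes the tangential part off `u`. The added term with the derivative of `f` only
undoes the first term of `bdryT`, which belongs to a later integration by parts. -/
lemma integral_tangential (hB : IsSmoothRegion B r) {f u : E3 → ℝ}
    (hf : ContDiffOn ℝ 2 f (closure B)) (hu : ContDiffOn ℝ 2 u (closure B)) (k j : Fin 3) :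
    ∫ x in frontier B, f x * nor r k x * pd B j u x ∂μHE[2] =
      ∫ x in frontier B, ((bdryT B r k j f x + pd B k f x * nor r j x) * u x
        + f x * nor r k x * nor r j x * ndv B r u x) ∂μHE[2] := by
  obtain ⟨q, hq⟩ := exists_isInvGrad hB
  have hN : ContDiffOn ℝ 2 (extNor r q k) (closure B) :=
    ((hq.contDiff_extNor hB k).of_le two_le_infty).contDiffOn
  have h12 : (1 : WithTop ℕ∞) ≤ 2 := by norm_num
  have hf1 := hf.of_le h12
  have hu1 := hu.of_le h12
  have hN1 := hN.of_le h12
  have c1 : ∀ {g : E3 → ℝ}, ContDiffOn ℝ 1 g (closure B) → ∀ l,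
      ContinuousOn (pd B l g) (frontier B) := fun hg l =>
    (continuousOn_pd hB hg l).mono frontier_subset_closure
  have cn := continuousOn_nor hB
  have cf := hf.continuousOn.mono frontier_subset_closure
  have cu := hu.continuousOn.mono frontier_subset_closure
  have hmul := (hf.mul hN).mul hu
  have key := integral_surfD hB hmul j
  have hmul1 := hmul.of_le h12
  have i1 := integrableOn_frontier hB (F := fun x =>
      ∑ l, ((if j = l then 1 else 0) - nor r j x * nor r l x)
        * pd B l (fun x => f x * extNor r q k x * u x) x)
    (continuousOn_finsetSum _ fun l _ =>
      (continuousOn_const.sub ((cn j).mul (cn l))).mul (c1 hmul1 l))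
  have i2 := integrableOn_frontier hB
    (F := fun x => bdryCurv B r x * (nor r j x * (f x * extNor r q k x * u x)))
    ((continuousOn_bdryCurv hB).mul ((cn j).mul
      (hmul.continuousOn.mono frontier_subset_closure)))
  have i3 := integrableOn_frontier hB (F := fun x => f x * nor r k x * pd B j u x)
    ((cf.mul (cn k)).mul (c1 hu1 j))
  have i4 := integrableOn_frontier hB
    (F := fun x => (bdryT B r k j f x + pd B k f x * nor r j x) * u x
        + f x * nor r k x * nor r j x * ndv B r u x)
    ((((continuousOn_bdryT hB hf1 k j).add ((c1 hf1 k).mul (cn j))).mul cu).add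
      (((cf.mul (cn k)).mul (cn j)).mul (continuousOn_ndv hB hu1)))
  rw [← sub_eq_zero, ← integral_sub i3 i4]
  rw [← sub_eq_zero, ← integral_sub i1 i2] at key
  rw [← key]
  refine setIntegral_congr_fun hB.isCompact_frontier.measurableSet fun x hx => ?_
  have hxc := frontier_subset_closure hx
  have hNx : extNor r q k x = nor r k x := (hq.eventually_nor_eq hx k).self_of_nhds.symm
  have hpd : ∀ l, pd B l (fun x => f x * extNor r q k x * u x) x
      = (pd B l f x * nor r k x + f x * pd B l (nor r k) x) * u x
        + f x * nor r k x * pd B l u x := fun l => by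
    rw [pd_mul hB (f := fun x => f x * extNor r q k x) (hf1.mul hN1) hu1 hxc, pd_mul hB hf1 hN1 hxc,
      hNx, hq.pd_nor hx]
  have hj : pd B j u x = nor r j x * ndv B r u x
      + ∑ l, ((if j = l then 1 else 0) - nor r j x * nor r l x) * pd B l u x := by
    simp only [ndv, sub_mul, ite_mul, one_mul, zero_mul, Finset.sum_sub_distrib,
      Finset.sum_ite_eq, Finset.mem_univ, if_true, Finset.mul_sum, mul_assoc]
    ring
  simp only [hpd, hNx, bdryT]
  rw [hj]
  have hS : ∑ l, ((if j = l then 1 else 0) - nor r j x * nor r l x)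
        * ((pd B l f x * nor r k x + f x * pd B l (nor r k) x) * u x
          + f x * nor r k x * pd B l u x)
      = (∑ l, ((if j = l then 1 else 0) - nor r j x * nor r l x)
          * (pd B l f x * nor r k x + f x * pd B l (nor r k) x)) * u x
        + f x * nor r k x
          * ∑ l, ((if j = l then 1 else 0) - nor r j x * nor r l x) * pd B l u x := by
    rw [Finset.sum_mul, Finset.mul_sum, ← Finset.sum_add_distrib]
    exact Finset.sum_congr rfl fun l _ => by ring
  rw [hS]
  ring

lemma integral_green_one (hB : IsSmoothRegion B r) {f u : E3 → ℝ}
    (hf : ContDiffOn ℝ 1 f (closure B)) (hu : ContDiffOn ℝ 1 u (closure B)) (j : Fin 3) :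
    ∫ x in B, (pd B j f x * u x + f x * pd B j u x) =
      ∫ x in frontier B, f x * nor r j x * u x ∂μHE[2] := by
  rw [integral_pd_mul hB hf hu]
  exact integral_congr_ae (.of_forall fun x => by ring)

/-- Two first-order formulas are subtracted so that the terms with one derivative on each factor
cancel. The remaining boundary integral with a full derivative of `u` is reduced to `u` and its
normal derivative by `integral_tangential`. -/
lemma integral_green_two (hB : IsSmoothRegion B r) {f u : E3 → ℝ}
    (hf : ContDiffOn ℝ 2 f (closure B)) (hu : ContDiffOn ℝ 2 u (closure B)) (k j : Fin 3) :
    ∫ x in B, (-(pd B j (pd B k f) x) * u x + f x * pd B j (pd B k u) x) =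
      ∫ x in frontier B, (bdryT B r k j f x * u x
        + f x * nor r k x * nor r j x * ndv B r u x) ∂μHE[2] := by
  have h12 : (1 : WithTop ℕ∞) ≤ 2 := by norm_num
  have hf1 := hf.of_le h12
  have hu1 := hu.of_le h12
  have dpf := contDiffOn_pd (n := 1) hB hf
  have dpu := contDiffOn_pd (n := 1) hB hu
  have a1 := integral_green_one hB (dpf k) hu1 j
  have a2 := integral_green_one hB hf1 (dpu j) k
  have a3 := integral_tangential hB hf hu k j
  have cp : ∀ {g : E3 → ℝ}, ContDiffOn ℝ 1 g (closure B) → ∀ l, ContinuousOn (pd B l g) (closure B) :=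
    fun hg l => continuousOn_pd hB hg l
  have cF : ∀ {g : E3 → ℝ}, ContinuousOn g (closure B) → ContinuousOn g (frontier B) :=
    fun h => h.mono frontier_subset_closure
  have cn := continuousOn_nor hB
  have i1 := hB.integrableOn (f := fun x => pd B j (pd B k f) x * u x + pd B k f x * pd B j u x)
    (((cp (dpf k) j).mul hu.continuousOn).add ((cp hf1 k).mul (cp hu1 j)))
  have i2 := hB.integrableOn (f := fun x => pd B k f x * pd B j u x + f x * pd B k (pd B j u) x)
    (((cp hf1 k).mul (cp hu1 j)).add (hf.continuousOn.mul (cp (dpu j) k)))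
  have i3 := integrableOn_frontier hB (F := fun x => pd B k f x * nor r j x * u x)
    (((cF (cp hf1 k)).mul (cn j)).mul (cF hu.continuousOn))
  have i4 := integrableOn_frontier hB
    (F := fun x => (bdryT B r k j f x + pd B k f x * nor r j x) * u x
        + f x * nor r k x * nor r j x * ndv B r u x)
    ((((continuousOn_bdryT hB hf1 k j).add ((cF (cp hf1 k)).mul (cn j))).mul
      (cF hu.continuousOn)).add
      ((((cF hf.continuousOn).mul (cn k)).mul (cn j)).mul (continuousOn_ndv hB hu1)))
  have e1 : ∫ x in B, (-(pd B j (pd B k f) x) * u x + f x * pd B j (pd B k u) x)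
      = (∫ x in B, (pd B k f x * pd B j u x + f x * pd B k (pd B j u) x))
        - ∫ x in B, (pd B j (pd B k f) x * u x + pd B k f x * pd B j u x) := by
    rw [← integral_sub i2 i1]
    refine setIntegral_congr_fun hB.isOpen.measurableSet fun x hx => ?_
    simp only [pd_comm hB hu hx j k]
    ring
  rw [e1, a1, a2, a3, ← integral_sub i4 i3]
  exact integral_congr_ae (.of_forall fun x => by ring)

end Green

end ThermoPiezo

namespace ThermoPiezo

/-! ### Regularity of admissible fields -/

namespace IsC

variable {B : Set E3} {r : E3 → ℝ} {M N : ℕ} {F G : Field}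

lemma mono {M' N' : ℕ} (h : IsC B M N F) (hM : M' ≤ M) (hN : N' ≤ N) : IsC B M' N' F where
  time x hx := (h.time x hx).of_le (by exact_mod_cast hN)
  space n hn t ht := (h.space n (hn.trans hN) t ht).of_le (by exact_mod_cast hM)
  cont n hn m hm := h.cont n (hn.trans hN) m (hm.trans hM)

lemma slice (h : IsC B M N F) {t : ℝ} (ht : 0 ≤ t) :
    ContDiffOn ℝ M (fun x => F x t) (closure B) := by
  simpa [iteratedDerivWithin_zero] using h.space 0 (Nat.zero_le _) t ht

lemma isBoundaryDatum (h : IsC B M N F) (hB : IsSmoothRegion B r) :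
    IsBoundaryDatum (closure B) F := by
  refine .of_isCompact hB.isCompact_closure ?_
  have h0 := h.cont 0 (Nat.zero_le _) 0 (Nat.zero_le _)
  have h1 := (ContinuousMultilinearMap.apply ℝ (fun _ : Fin 0 => E3) ℝ 0).continuous.comp_continuousOn
    h0
  exact h1.congr fun p _ => by simp [iteratedDerivWithin_zero]

lemma isBoundaryDatum_dx (h : IsC B 1 N F) (hB : IsSmoothRegion B r) (j : Fin 3) :
    IsBoundaryDatum (closure B) (dx B j F) := by
  refine .of_isCompact hB.isCompact_closure ?_
  have h0 := h.cont 0 (Nat.zero_le _) 1 le_rfl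
  have h1 := (ContinuousMultilinearMap.apply ℝ (fun _ : Fin 1 => E3) ℝ
    fun _ => EuclideanSpace.single j 1).continuous.comp_continuousOn h0
  refine h1.congr fun p hp => ?_
  simp only [Function.comp, ContinuousMultilinearMap.apply_apply, iteratedDerivWithin_zero]
  rw [iteratedFDerivWithin_one_apply (hB.uniqueDiffOn p.1 hp.1)]
  rfl

lemma isBoundaryDatum_dx_dx (h : IsC B 2 N F) (hB : IsSmoothRegion B r) (i j : Fin 3) :
    IsBoundaryDatum (closure B) (dx B j (dx B i F)) := by
  refine .of_isCompact hB.isCompact_closure ?_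
  have h0 := h.cont 0 (Nat.zero_le _) 2 le_rfl
  -- The direction of the outer derivative is the first argument of the second derivative.
  have h1 := (ContinuousMultilinearMap.apply ℝ (fun _ : Fin 2 => E3) ℝ
    ![EuclideanSpace.single j 1, EuclideanSpace.single i 1]).continuous.comp_continuousOn h0
  refine h1.congr fun p hp => ?_
  simp only [Function.comp, ContinuousMultilinearMap.apply_apply, iteratedDerivWithin_zero]
  rw [iteratedFDerivWithin_two_apply _ hB.uniqueDiffOn hp.1]
  have hd : DifferentiableWithinAt ℝ (fderivWithin ℝ (fun y => F y p.2) (closure B)) (closure B)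
      p.1 :=
    ((h.slice hp.2).fderivWithin (m := 1) hB.uniqueDiffOn (by norm_num)).differentiableOn
      one_ne_zero p.1 hp.1
  simp only [dx]
  rw [fderivWithin_clm_apply (hB.uniqueDiffOn p.1 hp.1) hd (differentiableWithinAt_const _)]
  simp

lemma isBoundaryDatum_dx' (h : IsC B M N F) (hM : 1 ≤ M) (hB : IsSmoothRegion B r) (j : Fin 3) :
    IsBoundaryDatum (closure B) (dx B j F) := (h.mono hM le_rfl).isBoundaryDatum_dx hB j

lemma isBoundaryDatum_dx_dx' (h : IsC B M N F) (hM : 2 ≤ M) (hB : IsSmoothRegion B r)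
    (i j : Fin 3) : IsBoundaryDatum (closure B) (dx B j (dx B i F)) :=
  (h.mono hM le_rfl).isBoundaryDatum_dx_dx hB i j

end IsC

section Differentiation

variable {B : Set E3} {r : E3 → ℝ} {F G : Field} {s t : ℝ} {x : E3}

lemma pd_line (hB : IsSmoothRegion B r) {f g : E3 → ℝ} (hf : ContDiffOn ℝ 1 f (closure B))
    (hg : ContDiffOn ℝ 1 g (closure B)) (hx : x ∈ closure B) (s : ℝ) (j : Fin 3) :
    pd B j (fun y => f y + s * g y) x = pd B j f x + s * pd B j g x := by
  have hu := hB.uniqueDiffOn x hx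
  have hg' := hg.differentiableOn one_ne_zero x hx
  rw [pd, fderivWithin_fun_add hu (hf.differentiableOn one_ne_zero x hx) (hg'.const_mul s),
    fderivWithin_const_mul hu hg']
  simp [pd]

lemma dx_line (hB : IsSmoothRegion B r) (hF : IsC B 1 0 F) (hG : IsC B 1 0 G) (ht : 0 ≤ t)
    (hx : x ∈ closure B) (s : ℝ) (j : Fin 3) :
    dx B j (F + s • G) x t = dx B j F x t + s * dx B j G x t :=
  pd_line hB (by exact_mod_cast hF.slice ht) (by exact_mod_cast hG.slice ht) hx s j

lemma dx_dx_line (hB : IsSmoothRegion B r) (hF : IsC B 2 0 F) (hG : IsC B 2 0 G) (ht : 0 ≤ t)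
    (hx : x ∈ closure B) (s : ℝ) (i j : Fin 3) :
    dx B j (dx B i (F + s • G)) x t = dx B j (dx B i F) x t + s * dx B j (dx B i G) x t := by
  have h1 : ∀ {F : Field}, IsC B 2 0 F → ContDiffOn ℝ 1 (fun y => dx B i F y t) (closure B) :=
    fun h => contDiffOn_pd (n := 1) hB (h.slice ht) i
  have h12 : 1 ≤ 2 := one_le_two
  refine Eq.trans ?_ (pd_line hB (h1 hF) (h1 hG) hx s j)
  refine congrArg (fun L : E3 →L[ℝ] ℝ => L (EuclideanSpace.single j 1)) ?_
  exact fderivWithin_congr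
    (fun y hy => dx_line hB (hF.mono h12 le_rfl) (hG.mono h12 le_rfl) ht hy s i)
    (dx_line hB (hF.mono h12 le_rfl) (hG.mono h12 le_rfl) ht hx s i)

end Differentiation

/-! ### Green's formulas for convolutions -/

section ConvGreen

variable {B : Set E3} {r : E3 → ℝ} {F G : Field} {t : ℝ}

lemma isFiniteMeasure_volume (hB : IsSmoothRegion B r) :
    IsFiniteMeasure ((volume : Measure E3).restrict B) :=
  ⟨by simpa using hB.measure_lt_top⟩

lemma isFiniteMeasure_area (hB : IsSmoothRegion B r) {S : Set E3} (hS : S ⊆ frontier B) :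
    IsFiniteMeasure ((μHE[2] : Measure E3).restrict S) :=
  ⟨by simpa using (measure_mono hS).trans_lt hB.area_lt_top⟩

/-- The operator `bdryT` at each time. -/
noncomputable def bdryTF (B : Set E3) (r : E3 → ℝ) (k j : Fin 3) (F : Field) : Field :=
  fun x t => bdryT B r k j (fun y => F y t) x

lemma isBoundaryDatum_nrm (hB : IsSmoothRegion B r) (j : Fin 3) :
    IsBoundaryDatum (frontier B) (nrm r j) :=
  .of_space hB.isCompact_frontier (continuousOn_nor hB j)

lemma normalD_apply (F : Field) (x : E3) (t : ℝ) :
    normalD B r F x t = ndv B r (fun y => F y t) x := by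
  simp only [normalD, Finset.sum_apply]; rfl

lemma isBoundaryDatum_normalD (hB : IsSmoothRegion B r) (hF : IsC B 1 0 F) :
    IsBoundaryDatum (frontier B) (normalD B r F) :=
  .sum fun j _ => (isBoundaryDatum_nrm hB j).mul
    ((hF.isBoundaryDatum_dx hB j).mono frontier_subset_closure)

lemma isBoundaryDatum_bdryTF (hB : IsSmoothRegion B r) (hF : IsC B 1 0 F) (k j : Fin 3) :
    IsBoundaryDatum (frontier B) (bdryTF B r k j F) := by
  have h1 := fun l => (hF.isBoundaryDatum_dx hB l).mono frontier_subset_closure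
  have h2 := (hF.isBoundaryDatum hB).mono frontier_subset_closure
  have h3 := isBoundaryDatum_nrm hB
  have h4 : ∀ {w : E3 → ℝ}, ContinuousOn w (frontier B) →
    IsBoundaryDatum (frontier B) fun x _ => w x := fun h => .of_space hB.isCompact_frontier h
  refine (((((h1 k).mul (h3 j)).neg).sub (.sum (s := Finset.univ) fun l _ =>
    (((h4 (w := fun _ => if j = l then 1 else 0) continuousOn_const).sub ((h3 j).mul (h3 l))).mul
    (((h1 l).mul (h3 k)).add (h2.mul (h4 (continuousOn_pd_nor hB k l))))))).add
    ((h4 (continuousOn_bdryCurv hB)).mul ((h2.mul (h3 k)).mul (h3 j)))).congr fun x _ t _ => ?_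
  simp only [bdryTF, bdryT, Pi.add_apply, Pi.sub_apply, Pi.neg_apply, Pi.mul_apply,
    Finset.sum_apply]
  rfl

lemma bdryT_line (hB : IsSmoothRegion B r) {f g : E3 → ℝ} (hf : ContDiffOn ℝ 1 f (closure B))
    (hg : ContDiffOn ℝ 1 g (closure B)) {x : E3} (hx : x ∈ closure B) (s : ℝ) (k j : Fin 3) :
    bdryT B r k j (fun y => f y + s * g y) x = bdryT B r k j f x + s * bdryT B r k j g x := by
  simp only [bdryT, pd_line hB hf hg hx]
  rw [mul_add, mul_sub, Finset.mul_sum]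
  have hS : ∑ l, ((if j = l then 1 else 0) - nor r j x * nor r l x)
        * ((pd B l f x + s * pd B l g x) * nor r k x + (f x + s * g x) * pd B l (nor r k) x)
      = ∑ l, ((if j = l then 1 else 0) - nor r j x * nor r l x)
        * (pd B l f x * nor r k x + f x * pd B l (nor r k) x)
        + ∑ l, s * (((if j = l then 1 else 0) - nor r j x * nor r l x)
        * (pd B l g x * nor r k x + g x * pd B l (nor r k) x)) := by
    rw [← Finset.sum_add_distrib]
    exact Finset.sum_congr rfl fun l _ => by ring
  rw [hS]
  ring

/-- With the time integral outside, a purely spatial formula can be applied to the slices at times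
`τ` and `t - τ`; this is how Green's formulas pass to convolutions. -/
lemma integral_fconv_add {S : Set E3} {ν : Measure E3} [IsFiniteMeasure (ν.restrict S)]
    {F₁ F₂ G₁ G₂ : Field} (hS : MeasurableSet S) (h1 : IsBoundaryDatum S F₁)
    (h2 : IsBoundaryDatum S F₂) (h3 : IsBoundaryDatum S G₁) (h4 : IsBoundaryDatum S G₂)
    (ht : 0 ≤ t) :
    ∫ x in S, (F₁ ⊛ G₁ + F₂ ⊛ G₂) x t ∂ν =
      ∫ τ in (0 : ℝ)..t, ∫ x in S, (F₁ x τ * G₁ x (t - τ) + F₂ x τ * G₂ x (t - τ)) ∂ν := by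
  have e1 := (h1.conv h3).integrableOn (ν := ν) hS ht
  have e2 := (h2.conv h4).integrableOn (ν := ν) hS ht
  have e3 : ∫ x in S, (F₁ ⊛ G₁ + F₂ ⊛ G₂) x t ∂ν
      = ∫ x in S, (F₁ ⊛ G₁) x t ∂ν + ∫ x in S, (F₂ ⊛ G₂) x t ∂ν := integral_add e1 e2
  have c : ∀ {F G : Field}, IsBoundaryDatum S F → IsBoundaryDatum S G →
      ∀ τ ∈ Icc 0 t, IntegrableOn (fun x => F x τ * G x (t - τ)) S ν := fun {F G} hF hG τ hτ =>
    -- The slice of `G` at time `t - τ` is regarded as a field constant in time.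
    (hF.mul (G := fun x _ => G x (t - τ)) ⟨(hG.space (sub_nonneg.2 hτ.2)).comp continuousOn_fst
      fun _ hp => hp.1, fun _ => (hG.2 t).imp fun C hC x hx _ _ =>
        hC x hx _ ⟨sub_nonneg.2 hτ.2, by linarith [hτ.1]⟩⟩).integrableOn hS hτ.1
  have i : ∀ {F G : Field}, IsBoundaryDatum S F → IsBoundaryDatum S G →
      IntervalIntegrable (fun τ => ∫ x in S, F x τ * G x (t - τ) ∂ν) volume 0 t :=
    fun hF hG => intervalIntegrable_iff.2 (integrable_fconv hS hF hG ht).integral_prod_left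
  rw [e3, integral_fconv hS h1 h3 ht, integral_fconv hS h2 h4 ht,
    ← intervalIntegral.integral_add (i h1 h3) (i h2 h4)]
  refine intervalIntegral.integral_congr fun τ hτ => ?_
  rw [uIcc_of_le ht] at hτ
  exact (integral_add (c h1 h3 τ hτ) (c h2 h4 τ hτ)).symm

lemma conv_green_one (hB : IsSmoothRegion B r) (hF : IsC B 1 0 F) (hG : IsC B 1 0 G) (ht : 0 ≤ t)
    (j : Fin 3) : ∫ x in B, (dx B j F ⊛ G + F ⊛ dx B j G) x t =
      ∫ x in frontier B, ((F * nrm r j) ⊛ G) x t ∂μHE[2] := by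
  have := isFiniteMeasure_volume hB
  have := isFiniteMeasure_area hB subset_rfl
  have c : ∀ {F : Field}, IsBoundaryDatum (closure B) F → IsBoundaryDatum B F :=
    fun h => h.mono subset_closure
  have cF : ∀ {F : Field}, IsBoundaryDatum (closure B) F → IsBoundaryDatum (frontier B) F :=
    fun h => h.mono frontier_subset_closure
  rw [integral_fconv_add hB.isOpen.measurableSet (c (hF.isBoundaryDatum_dx hB j))
    (c (hF.isBoundaryDatum hB)) (c (hG.isBoundaryDatum hB)) (c (hG.isBoundaryDatum_dx hB j)) ht,
    integral_fconv hB.isCompact_frontier.measurableSet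
      ((cF (hF.isBoundaryDatum hB)).mul (isBoundaryDatum_nrm hB j)) (cF (hG.isBoundaryDatum hB)) ht]
  refine intervalIntegral.integral_congr fun τ hτ => ?_
  rw [uIcc_of_le ht] at hτ
  exact integral_green_one hB (by exact_mod_cast hF.slice hτ.1)
    (by exact_mod_cast hG.slice (sub_nonneg.2 hτ.2)) j

lemma conv_green_two (hB : IsSmoothRegion B r) (hF : IsC B 2 0 F) (hG : IsC B 2 0 G) (ht : 0 ≤ t)
    (k j : Fin 3) : ∫ x in B, ((-dx B j (dx B k F)) ⊛ G + F ⊛ dx B j (dx B k G)) x t =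
      ∫ x in frontier B, (bdryTF B r k j F ⊛ G + (F * nrm r k * nrm r j) ⊛ normalD B r G) x t
        ∂μHE[2] := by
  have := isFiniteMeasure_volume hB
  have := isFiniteMeasure_area hB subset_rfl
  have c : ∀ {F : Field}, IsBoundaryDatum (closure B) F → IsBoundaryDatum B F :=
    fun h => h.mono subset_closure
  have cF : ∀ {F : Field}, IsBoundaryDatum (closure B) F → IsBoundaryDatum (frontier B) F :=
    fun h => h.mono frontier_subset_closure
  have hF1 := hF.mono one_le_two le_rfl
  have hG1 := hG.mono one_le_two le_rfl
  rw [integral_fconv_add hB.isOpen.measurableSet (c (hF.isBoundaryDatum_dx_dx hB k j)).neg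
    (c (hF.isBoundaryDatum hB)) (c (hG.isBoundaryDatum hB)) (c (hG.isBoundaryDatum_dx_dx hB k j)) ht,
    integral_fconv_add hB.isCompact_frontier.measurableSet (isBoundaryDatum_bdryTF hB hF1 k j)
      (((cF (hF.isBoundaryDatum hB)).mul (isBoundaryDatum_nrm hB k)).mul (isBoundaryDatum_nrm hB j))
      (cF (hG.isBoundaryDatum hB)) (isBoundaryDatum_normalD hB hG1) ht]
  refine intervalIntegral.integral_congr fun τ hτ => ?_
  rw [uIcc_of_le ht] at hτ
  simp only [normalD_apply]
  exact integral_green_two hB (by exact_mod_cast hF.slice hτ.1)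
    (by exact_mod_cast hG.slice (sub_nonneg.2 hτ.2)) k j

end ConvGreen

end ThermoPiezo

namespace ThermoPiezo

namespace Arr

variable {R : Type*} [CommRing R] [Algebra ℝ R] (m : Material) (k : Kernels R) (d : ArrData R)

/-- The coefficients of the variations in the first variation of the volume density. -/
noncomputable def coef (x : Arr R) : Arr R where
  u i := k.ζ * (k.ξ * x.divS i + d.F i - m.ρ • x.u i)
  θ := -(k.ξ * ((1 / m.T0) • (-(k.l * x.divq) + d.H - (m.ρ * m.T0) • x.η)))
  φ := k.ζ * (k.ξ * (x.divD - d.g))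
  e i := k.ξ * (k.ζ * (x.τ i - x.hτ m i) + d.L i - (1 / m.c * m.a14 i.1 i.2) • x.Z m k d)
  κ i := k.ζ * (k.ξ * (x.μ i - x.hμ m i))
  b i := k.ξ * (k.l * ((1 / m.T0) • (x.q i - x.hq m i)))
  E i := -(k.ζ * (k.ξ * (x.σ i - x.hσ m i)))
  V i := k.ξ * (-(k.ζ * (x.Q i - x.hQ m i)) + d.M i - (1 / m.c * m.a47 i.1 i.2) • x.Z m k d)
  τ i := k.ζ * (k.ξ * (x.e i - x.gu i))
  μ i := k.ζ * (k.ξ * (x.κ i - x.ggu i))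
  σ i := -(k.ζ * (k.ξ * (x.E i + x.gφ i)))
  Q i := -(k.ζ * (k.ξ * (x.V i + x.ggφ i)))
  η := m.ρ • (k.ξ * (x.θ - (1 / m.c) • x.Z m k d))
  q i := k.ξ * (k.l * ((1 / m.T0) • (x.b i - x.gθ i)))
  divS := 0
  divD := 0
  divq := 0
  gu := 0
  ggu := 0
  gφ := 0
  ggφ := 0
  gθ := 0

/-- The pairing of coefficients with variations. -/
def pair (c y : Arr R) : R :=
  c.u ⬝ᵥ y.u + c.θ * y.θ + c.φ * y.φ + c.e ⬝ᵥ y.e + c.κ ⬝ᵥ y.κ + c.b ⬝ᵥ y.b + c.E ⬝ᵥ y.E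
    + c.V ⬝ᵥ y.V + c.τ ⬝ᵥ y.τ + c.μ ⬝ᵥ y.μ + c.σ ⬝ᵥ y.σ + c.Q ⬝ᵥ y.Q + c.η * y.η + c.q ⬝ᵥ y.q

lemma resid_eq_pair (x y : Arr R) : resid m k d x y = (x.coef m k d).pair y := by
  have e1 : (x.coef m k d).u ⬝ᵥ y.u
      = k.ζ * ((k.ξ * (x.divS ⬝ᵥ y.u) + d.F ⬝ᵥ y.u) - m.ρ • (x.u ⬝ᵥ y.u)) := by
    simp only [dotProduct, coef, Finset.mul_sum, Finset.smul_sum, ← Finset.sum_add_distrib,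
      ← Finset.sum_sub_distrib]
    exact Finset.sum_congr rfl fun i _ => by algebra
  have e2 : (x.coef m k d).e ⬝ᵥ y.e = k.ξ * (k.ζ * ((x.τ - x.hτ m) ⬝ᵥ y.e) + d.L ⬝ᵥ y.e
      - (1 / m.c) • x.Z m k d * act m.M14 y.e ()) := by
    simp only [dotProduct, coef, act, Finset.mul_sum, ← Finset.sum_add_distrib,
      ← Finset.sum_sub_distrib]
    refine Finset.sum_congr rfl fun i _ => ?_
    simp only [Pi.sub_apply, Material.M14]
    algebra
  have e3 : (x.coef m k d).V ⬝ᵥ y.V = k.ξ * (-(k.ζ * ((x.Q - x.hQ m) ⬝ᵥ y.V)) + d.M ⬝ᵥ y.V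
      - (1 / m.c) • x.Z m k d * act m.M47 y.V ()) := by
    simp only [dotProduct, coef, act, Finset.mul_sum, ← Finset.sum_add_distrib,
      ← Finset.sum_sub_distrib, ← Finset.sum_neg_distrib]
    refine Finset.sum_congr rfl fun i _ => ?_
    simp only [Pi.sub_apply, Material.M47]
    algebra
  have f1 : ∀ {ι : Type} [Fintype ι] (a b c : ι → R), (fun i => k.ζ * (k.ξ * (a i - b i))) ⬝ᵥ c
      = k.ζ * k.ξ * ((a - b) ⬝ᵥ c) := fun a b c => by
    simp only [dotProduct, Finset.mul_sum, Pi.sub_apply]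
    exact Finset.sum_congr rfl fun i _ => by ring
  have f2 : ∀ {ι : Type} [Fintype ι] (a b c : ι → R), (fun i => -(k.ζ * (k.ξ * (a i - b i)))) ⬝ᵥ c
      = -(k.ζ * k.ξ * ((a - b) ⬝ᵥ c)) := fun a b c => by
    simp only [dotProduct, Finset.mul_sum, Pi.sub_apply, ← Finset.sum_neg_distrib]
    exact Finset.sum_congr rfl fun i _ => by ring
  have f3 : ∀ {ι : Type} [Fintype ι] (a b c : ι → R), (fun i => -(k.ζ * (k.ξ * (a i + b i)))) ⬝ᵥ c
      = -(k.ζ * k.ξ * ((a + b) ⬝ᵥ c)) := fun a b c => by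
    simp only [dotProduct, Finset.mul_sum, Pi.add_apply, ← Finset.sum_neg_distrib]
    exact Finset.sum_congr rfl fun i _ => by ring
  have f4 : ∀ a b c : Fin 3 → R, (fun i => k.ξ * (k.l * ((1 / m.T0) • (a i - b i)))) ⬝ᵥ c
      = k.ξ * k.l * ((1 / m.T0) • ((a - b) ⬝ᵥ c)) := fun a b c => by
    simp only [dotProduct, Finset.mul_sum, Finset.smul_sum, Pi.sub_apply]
    exact Finset.sum_congr rfl fun i _ => by algebra
  have e4 : (x.coef m k d).κ ⬝ᵥ y.κ = _ := f1 x.μ (x.hμ m) y.κ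
  have e5 : (x.coef m k d).b ⬝ᵥ y.b = _ := f4 x.q (x.hq m) y.b
  have e6 : (x.coef m k d).E ⬝ᵥ y.E = _ := f2 x.σ (x.hσ m) y.E
  have e7 : (x.coef m k d).τ ⬝ᵥ y.τ = _ := f1 x.e x.gu y.τ
  have e8 : (x.coef m k d).μ ⬝ᵥ y.μ = _ := f1 x.κ x.ggu y.μ
  have e9 : (x.coef m k d).σ ⬝ᵥ y.σ = _ := f3 x.E x.gφ y.σ
  have e10 : (x.coef m k d).Q ⬝ᵥ y.Q = _ := f3 x.V x.ggφ y.Q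
  have e11 : (x.coef m k d).q ⬝ᵥ y.q = _ := f4 x.b x.gθ y.q
  rw [pair, e1, e2, e3, e4, e5, e6, e7, e8, e9, e10, e11]
  simp only [resid, coef]
  ring

end Arr

/-! ### Processes and their classes -/

/-- The sum of the convolutions of the components of two arrays. -/
noncomputable def Proc.pair (c p : Proc) : Field :=
  ∑ i, c.u i ⊛ p.u i + c.θ ⊛ p.θ + c.φ ⊛ p.φ + ∑ i, ∑ j, c.e i j ⊛ p.e i j
    + ∑ i, ∑ j, ∑ k, c.κ i j k ⊛ p.κ i j k + ∑ i, c.b i ⊛ p.b i + ∑ i, c.E i ⊛ p.E i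
    + ∑ i, ∑ j, c.V i j ⊛ p.V i j + ∑ i, ∑ j, c.τ i j ⊛ p.τ i j
    + ∑ i, ∑ j, ∑ k, c.μ i j k ⊛ p.μ i j k + ∑ i, c.σ i ⊛ p.σ i + ∑ i, ∑ j, c.Q i j ⊛ p.Q i j
    + c.η ⊛ p.η + ∑ i, c.q i ⊛ p.q i

/-- `-χ * (ρη - ρη̂) + ℛ`. -/
noncomputable def relaxZ (m : Material) (Γ : Data) (p : Proc) : Field :=
  -(kχ m ⊛ (m.ρ • p.η - hatρη m p)) + dataR m Γ

/-- `τ_{ji,j} - μ_{kji,kj}`. -/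
noncomputable def divStress (B : Set E3) (p : Proc) (i : Fin 3) : Field :=
  ∑ j, dx B j (p.τ j i) - ∑ k, ∑ j, dx B j (dx B k (p.μ k j i))

/-- `σ_{i,i} - Q_{ji,ji}`. -/
noncomputable def divDisp (B : Set E3) (p : Proc) : Field :=
  ∑ i, dx B i (p.σ i) - ∑ j, ∑ i, dx B i (dx B j (p.Q j i))

/-- The coefficients of the components of a variation in the first variation of the functional. -/
noncomputable def coefP (m : Material) (B : Set E3) (Γ : Data) (p : Proc) : Proc where
  u i := kζ m ⊛ (kξ ⊛ divStress B p i + dataF m Γ i - m.ρ • p.u i)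
  θ := -(kξ ⊛ ((1 / m.T0) • (-(kl ⊛ ∑ i, dx B i (p.q i)) + dataH m Γ - (m.ρ * m.T0) • p.η)))
  φ := kζ m ⊛ kξ ⊛ (divDisp B p - Γ.g)
  e i j := kξ ⊛ (kζ m ⊛ (p.τ i j - hatτ m p i j) + dataL m Γ i j
    - (1 / m.c * m.a14 i j) • relaxZ m Γ p)
  κ i j k := kζ m ⊛ kξ ⊛ (p.μ i j k - hatμ m p i j k)
  b i := kξ ⊛ kl ⊛ ((1 / m.T0) • (p.q i - hatq m p i))
  E i := -(kζ m ⊛ kξ ⊛ (p.σ i - hatσ m p i))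
  V i j := kξ ⊛ (-(kζ m ⊛ (p.Q i j - hatQ m p i j)) + dataM m Γ i j
    - (1 / m.c * m.a47 i j) • relaxZ m Γ p)
  τ i j := kζ m ⊛ kξ ⊛ (p.e i j - dx B i (p.u j))
  μ i j k := kζ m ⊛ kξ ⊛ (p.κ i j k - dx B j (dx B i (p.u k)))
  σ i := -(kζ m ⊛ kξ ⊛ (p.E i + dx B i p.φ))
  Q i j := -(kζ m ⊛ kξ ⊛ (p.V i j + dx B j (dx B i p.φ)))
  η := m.ρ • (kξ ⊛ (p.θ - (1 / m.c) • relaxZ m Γ p))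
  q i := kξ ⊛ kl ⊛ ((1 / m.T0) • (p.b i - dx B i p.θ))

/-- The classes of the components of `p` are those of `a`. -/
structure RepComponents (B : Set E3) (p : Proc) (a : Arr (UConv B)) : Prop where
  u : ∀ i, Rep B (p.u i) (a.u i)
  θ : Rep B p.θ a.θ
  φ : Rep B p.φ a.φ
  e : ∀ i j, Rep B (p.e i j) (a.e (i, j))
  κ : ∀ i j k, Rep B (p.κ i j k) (a.κ (i, j, k))
  b : ∀ i, Rep B (p.b i) (a.b i)
  E : ∀ i, Rep B (p.E i) (a.E i)
  V : ∀ i j, Rep B (p.V i j) (a.V (i, j))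
  τ : ∀ i j, Rep B (p.τ i j) (a.τ (i, j))
  μ : ∀ i j k, Rep B (p.μ i j k) (a.μ (i, j, k))
  σ : ∀ i, Rep B (p.σ i) (a.σ i)
  Q : ∀ i j, Rep B (p.Q i j) (a.Q (i, j))
  η : Rep B p.η a.η
  q : ∀ i, Rep B (p.q i) (a.q i)

/-- `a` consists of the classes of the components of `p` and of their derivatives. -/
structure Represents (B : Set E3) (p : Proc) (a : Arr (UConv B)) : Prop
    extends RepComponents B p a where
  divS : ∀ i, Rep B (divStress B p i) (a.divS i)
  divD : Rep B (divDisp B p) a.divD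
  divq : Rep B (∑ i, dx B i (p.q i)) a.divq
  gu : ∀ i j, Rep B (dx B i (p.u j)) (a.gu (i, j))
  ggu : ∀ i j k, Rep B (dx B j (dx B i (p.u k))) (a.ggu (i, j, k))
  gφ : ∀ i, Rep B (dx B i p.φ) (a.gφ i)
  ggφ : ∀ i j, Rep B (dx B j (dx B i p.φ)) (a.ggφ (i, j))
  gθ : ∀ i, Rep B (dx B i p.θ) (a.gθ i)

/-- `d` consists of the classes of the given data. -/
structure RepData (m : Material) (B : Set E3) (Γ : Data) (d : ArrData (UConv B)) : Prop where
  F : ∀ i, Rep B (dataF m Γ i) (d.F i)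
  g : Rep B Γ.g d.g
  H : Rep B (dataH m Γ) d.H
  L : ∀ i j, Rep B (dataL m Γ i j) (d.L (i, j))
  M : ∀ i j, Rep B (dataM m Γ i j) (d.M (i, j))
  Rr : Rep B (dataR m Γ) d.Rr

/-- `k` consists of the classes of the kernels. -/
structure RepKernels (m : Material) (S : Set E3) (k : Kernels (UConv S)) : Prop where
  l : Rep S kl k.l
  ξ : Rep S kξ k.ξ
  ζ : Rep S (kζ m) k.ζ
  χ : Rep S (kχ m) k.χ

section

variable {m : Material} {B : Set E3} {p : Proc} {a : Arr (UConv B)} {k : Kernels (UConv B)}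
  {d : ArrData (UConv B)} {Γ : Data}

lemma Rep.sum_prod {S : Set E3} {ι κ : Type*} [Fintype ι] [Fintype κ] {F : ι → κ → Field}
    {a : ι × κ → UConv S} (h : ∀ i j, Rep S (F i j) (a (i, j))) :
    Rep S (∑ i, ∑ j, F i j) (∑ x, a x) := by
  rw [Fintype.sum_prod_type]
  exact .sum fun i => .sum fun j => h i j

lemma Rep.sum_prod₃ {S : Set E3} {ι κ μ : Type*} [Fintype ι] [Fintype κ] [Fintype μ]
    {F : ι → κ → μ → Field}
    {a : ι × κ × μ → UConv S} (h : ∀ i j l, Rep S (F i j l) (a (i, j, l))) :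
    Rep S (∑ i, ∑ j, ∑ l, F i j l) (∑ x, a x) := by
  rw [Fintype.sum_prod_type]
  exact .sum fun i => .sum_prod (a := fun x => a (i, x)) fun j l => h i j l

namespace Represents

lemma hatτ (h : Represents B p a) (i j : Fin 3) : Rep B (hatτ m p i j) (a.hτ m (i, j)) :=
  (Rep.sum_prod (a := fun x => m.M11 (i, j) x • a.e x) fun _ _ => (h.e _ _).smul _).add
    (Rep.sum_prod (a := fun x => m.M17 (i, j) x • a.V x) fun _ _ => (h.V _ _).smul _)

lemma hatμ (h : Represents B p a) (i j l : Fin 3) : Rep B (hatμ m p i j l) (a.hμ m (i, j, l)) :=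
  (Rep.sum_prod₃ (a := fun x => m.M22 (i, j, l) x • a.κ x) fun _ _ _ => (h.κ _ _ _).smul _).add
    (.sum fun _ => (h.E _).smul _)

lemma hatσ (h : Represents B p a) (i : Fin 3) : Rep B (hatσ m p i) (a.hσ m i) :=
  ((Rep.sum_prod₃ (a := fun x => m.M23 x i • a.κ x) fun _ _ _ => (h.κ _ _ _).smul _).add
    (.sum fun _ => (h.E _).smul _)).neg

lemma hatQ (h : Represents B p a) (i j : Fin 3) : Rep B (hatQ m p i j) (a.hQ m (i, j)) :=
  ((Rep.sum_prod (a := fun x => m.M17 x (i, j) • a.e x) fun _ _ => (h.e _ _).smul _).add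
    (Rep.sum_prod (a := fun x => m.M77 (i, j) x • a.V x) fun _ _ => (h.V _ _).smul _)).neg

lemma hatq (h : Represents B p a) (i : Fin 3) : Rep B (hatq m p i) (a.hq m i) :=
  ((Rep.sum fun _ => (h.b _).smul _).smul _).neg

lemma W (h : Represents B p a) : Rep B (m.ρ • p.η - hatρη m p) (a.W m) := by
  rw [hatρη, sub_neg_eq_add]
  exact (h.η.smul _).add
    ((Rep.sum_prod (a := fun x => m.M14 () x • a.e x) fun _ _ => (h.e _ _).smul _).add
    (Rep.sum_prod (a := fun x => m.M47 () x • a.V x) fun _ _ => (h.V _ _).smul _))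

lemma Z (h : Represents B p a) (hk : RepKernels m B k) (hd : RepData m B Γ d) :
    Rep B (relaxZ m Γ p) (a.Z m k d) := (hk.χ.conv h.W).neg.add hd.Rr

end Represents

set_option maxRecDepth 4000 in
lemma RepComponents.pair {p c : Proc} {a b : Arr (UConv B)} (hc : RepComponents B c b)
    (h : RepComponents B p a) : Rep B (c.pair p) (b.pair a) := by
  have h1 := Rep.sum (s := Finset.univ) fun i => (hc.u i).conv (h.u i)
  have h2 := hc.θ.conv h.θ
  have h3 := hc.φ.conv h.φ
  have h4 := Rep.sum_prod (a := fun x => b.e x * a.e x) fun i j => (hc.e i j).conv (h.e i j)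
  have h5 := Rep.sum_prod₃ (a := fun x => b.κ x * a.κ x) fun i j l => (hc.κ i j l).conv (h.κ i j l)
  have h6 := Rep.sum (s := Finset.univ) fun i => (hc.b i).conv (h.b i)
  have h7 := Rep.sum (s := Finset.univ) fun i => (hc.E i).conv (h.E i)
  have h8 := Rep.sum_prod (a := fun x => b.V x * a.V x) fun i j => (hc.V i j).conv (h.V i j)
  have h9 := Rep.sum_prod (a := fun x => b.τ x * a.τ x) fun i j => (hc.τ i j).conv (h.τ i j)
  have h10 := Rep.sum_prod₃ (a := fun x => b.μ x * a.μ x) fun i j l =>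
    (hc.μ i j l).conv (h.μ i j l)
  have h11 := Rep.sum (s := Finset.univ) fun i => (hc.σ i).conv (h.σ i)
  have h12 := Rep.sum_prod (a := fun x => b.Q x * a.Q x) fun i j => (hc.Q i j).conv (h.Q i j)
  have h13 := hc.η.conv h.η
  have h14 := Rep.sum (s := Finset.univ) fun i => (hc.q i).conv (h.q i)
  have H := ((((((((((((h1.add h2).add h3).add h4).add h5).add h6).add h7).add h8).add h9).add
    h10).add h11).add h12).add h13).add h14
  unfold Proc.pair Arr.pair dotProduct
  exact H

lemma Represents.coef (h : Represents B p a) (hk : RepKernels m B k) (hd : RepData m B Γ d) :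
    RepComponents B (coefP m B Γ p) (a.coef m k d) where
  u i := hk.ζ.conv (((hk.ξ.conv (h.divS i)).add (hd.F i)).sub ((h.u i).smul _))
  θ := (hk.ξ.conv ((((hk.l.conv h.divq).neg.add hd.H).sub (h.η.smul _)).smul _)).neg
  φ := hk.ζ.conv (hk.ξ.conv (h.divD.sub hd.g))
  e i j := hk.ξ.conv (((hk.ζ.conv ((h.τ i j).sub (h.hatτ i j))).add (hd.L i j)).sub
    ((h.Z hk hd).smul _))
  κ i j l := hk.ζ.conv (hk.ξ.conv ((h.μ i j l).sub (h.hatμ i j l)))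
  b i := hk.ξ.conv (hk.l.conv (((h.q i).sub (h.hatq i)).smul _))
  E i := (hk.ζ.conv (hk.ξ.conv ((h.σ i).sub (h.hatσ i)))).neg
  V i j := hk.ξ.conv (((hk.ζ.conv ((h.Q i j).sub (h.hatQ i j))).neg.add (hd.M i j)).sub
    ((h.Z hk hd).smul _))
  τ i j := hk.ζ.conv (hk.ξ.conv ((h.e i j).sub (h.gu i j)))
  μ i j l := hk.ζ.conv (hk.ξ.conv ((h.κ i j l).sub (h.ggu i j l)))
  σ i := (hk.ζ.conv (hk.ξ.conv ((h.E i).add (h.gφ i)))).neg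
  Q i j := (hk.ζ.conv (hk.ξ.conv ((h.V i j).add (h.ggφ i j)))).neg
  η := (hk.ξ.conv (h.θ.sub ((h.Z hk hd).smul _))).smul _
  q i := hk.ξ.conv (hk.l.conv (((h.b i).sub (h.gθ i)).smul _))

lemma Represents.volumeDensity (h : Represents B p a) (hk : RepKernels m B k)
    (hd : RepData m B Γ d) : Rep B (volumeDensity m B Γ p) (a.quad m k d) := by
  have h1 := Rep.sum (s := Finset.univ) fun i => (hk.ζ.conv (((hk.ξ.conv (h.divS i)).add
    (hd.F i)).sub ((h.u i).smul (1 / 2 * m.ρ)))).conv (h.u i)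
  have h2 := hk.ζ.conv (hk.ξ.conv ((h.divD.sub hd.g).conv h.φ))
  have h3 := hk.ξ.conv (((((hk.l.conv h.divq).neg.add hd.H).sub (h.η.smul (m.ρ * m.T0))).smul
    (1 / m.T0)).conv h.θ)
  have h4 := Rep.sum_prod (a := fun x => k.ξ * ((k.ζ * (a.τ x - (1 / 2 : ℝ) • a.hτ m x) + d.L x)
    * a.e x)) fun i j => hk.ξ.conv (((hk.ζ.conv ((h.τ i j).sub ((h.hatτ i j).smul (1 / 2 : ℝ)))).add
      (hd.L i j)).conv (h.e i j))
  have h5 := Rep.sum_prod₃ (a := fun x => k.ζ * (k.ξ * ((a.μ x - (1 / 2 : ℝ) • a.hμ m x) * a.κ x)))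
    fun i j l => hk.ζ.conv (hk.ξ.conv (((h.μ i j l).sub ((h.hatμ i j l).smul (1 / 2 : ℝ))).conv
      (h.κ i j l)))
  have h6 := Rep.sum (s := Finset.univ) fun i => hk.ζ.conv (hk.ξ.conv
    (((h.σ i).sub ((h.hatσ (m := m) i).smul (1 / 2 : ℝ))).conv (h.E i)))
  have h7 := Rep.sum_prod (a := fun x => k.ξ * ((-(k.ζ * (a.Q x - (1 / 2 : ℝ) • a.hQ m x)) + d.M x)
    * a.V x)) fun i j => hk.ξ.conv
      (((hk.ζ.conv ((h.Q i j).sub ((h.hatQ i j).smul (1 / 2 : ℝ)))).neg.add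
      (hd.M i j)).conv (h.V i j))
  have h8 := hk.ξ.conv ((((hk.χ.conv ((h.W (m := m)).smul (1 / 2 : ℝ))).neg.add hd.Rr).smul
    (1 / m.c)).conv (h.W (m := m)))
  have h9 := Rep.sum (s := Finset.univ) fun i => hk.ξ.conv (hk.l.conv
    ((((h.q i).sub ((h.hatq (m := m) i).smul (1 / 2 : ℝ))).smul (1 / m.T0)).neg.conv (h.b i)))
  have H := (((((((h1.add h2).sub h3).add h4).add h5).sub h6).add h7).sub h8).sub h9
  refine Eq.mp (congrArg (Rep B (ThermoPiezo.volumeDensity m B Γ p)) (Eq.symm ?_)) H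
  simp only [Arr.quad, dotProduct, Finset.mul_sum, Finset.smul_sum, ← Finset.sum_add_distrib,
    ← Finset.sum_sub_distrib, ← Finset.sum_neg_distrib]
  have e : ∀ a1 a2 a3 a4 a5 a6 a7 a8 a9 b1 b2 b3 b4 b5 b6 b7 b8 b9 : UConv B, a1 = b1 → a2 = b2 →
      a3 = b3 → a4 = b4 → a5 = b5 → a6 = b6 → a7 = b7 → a8 = b8 → a9 = -b9 →
      a1 + a2 - a3 + a4 + a5 - a6 + a7 - a8 + a9 = b1 + b2 - b3 + b4 + b5 - b6 + b7 - b8 - b9 := by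
    intros; subst_vars; ring
  refine e _ _ _ _ _ _ _ _ _ _ _ _ _ _ _ _ _ _ ?_ ?_ ?_ ?_ ?_ ?_ ?_ ?_ ?_
  · exact Finset.sum_congr rfl fun i _ => by algebra
  · ring
  · algebra
  · exact Finset.sum_congr rfl fun i _ => by algebra
  · exact Finset.sum_congr rfl fun i _ => by algebra
  · exact Finset.sum_congr rfl fun i _ => by algebra
  · exact Finset.sum_congr rfl fun i _ => by algebra
  · algebra
  · rw [← Finset.sum_neg_distrib]
    exact Finset.sum_congr rfl fun i _ => by algebra

end

/-! ### Existence of the classes -/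

section Existence

variable {m : Material} {B : Set E3} {r : E3 → ℝ} {p p' : Proc} {Γ : Data} {S Sg : Fin 5 → Set E3}

lemma continuousOn_kernel (S : Set E3) {k : ℝ → ℝ} (hk : Continuous k) :
    IsBoundaryDatum S fun _ => k := .of_time hk.continuousOn

lemma isBoundaryDatum_kl (S : Set E3) : IsBoundaryDatum S kl :=
  continuousOn_kernel S (k := fun _ => 1) continuous_const

lemma isBoundaryDatum_kξ (S : Set E3) : IsBoundaryDatum S kξ :=
  continuousOn_kernel S (k := fun t => t) continuous_id

lemma isBoundaryDatum_kζ (m : Material) (S : Set E3) : IsBoundaryDatum S (kζ m) :=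
  continuousOn_kernel S (k := fun t => 1 / m.β * Real.exp (-t / m.β)) (by fun_prop)

lemma isBoundaryDatum_kχ (m : Material) (S : Set E3) : IsBoundaryDatum S (kχ m) :=
  continuousOn_kernel S (k := fun t => 1 / m.β' * Real.exp (-t / m.β')) (by fun_prop)

/-- The classes of the kernels. -/
noncomputable def kernelsOf (m : Material) (S : Set E3) : Kernels (UConv S) :=
  ⟨br S kl, br S kξ, br S (kζ m), br S (kχ m)⟩

lemma repKernels (m : Material) (S : Set E3) : RepKernels m S (kernelsOf m S) :=
  ⟨rep_br (isBoundaryDatum_kl S), rep_br (isBoundaryDatum_kξ S), rep_br (isBoundaryDatum_kζ m S),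
    rep_br (isBoundaryDatum_kχ m S)⟩

lemma IsSupply.isBoundaryDatum (hB : IsSmoothRegion B r) {F : Field} (h : IsSupply B F) :
    IsBoundaryDatum B F :=
  (IsBoundaryDatum.of_isCompact hB.isCompact_closure h).mono subset_closure

/-- The classes of the given data. -/
noncomputable def arrDataOf (m : Material) (B : Set E3) (Γ : Data) : ArrData (UConv B) :=
  ⟨fun i => br B (dataF m Γ i), br B Γ.g, br B (dataH m Γ), fun x => br B (dataL m Γ x.1 x.2),
    fun x => br B (dataM m Γ x.1 x.2), br B (dataR m Γ)⟩

lemma repData (m : Material) (hB : IsSmoothRegion B r) (hΓ : Γ.IsContinuous B S Sg) :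
    RepData m B Γ (arrDataOf m B Γ) := by
  have sp : ∀ {w : E3 → ℝ}, ContinuousOn w (closure B) → IsBoundaryDatum B fun x _ => w x :=
    fun h => (IsBoundaryDatum.of_space hB.isCompact_closure h).mono subset_closure
  have ex : ∀ {w : E3 → ℝ} (a b : ℝ), ContinuousOn w (closure B) →
      IsBoundaryDatum B fun x t => a * w x * Real.exp (-t / b) := fun a b h =>
    (((sp h).smul a).mul (continuousOn_kernel B (k := fun t => Real.exp (-t / b))
      (by fun_prop))).congr fun _ _ _ _ => rfl
  refine ⟨fun i => rep_br ?_, rep_br (hΓ.g.isBoundaryDatum hB), rep_br ?_, fun i j => rep_br ?_,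
    fun i j => rep_br ?_, rep_br ?_⟩
  · refine (((isBoundaryDatum_kξ B).conv ((hΓ.f i).isBoundaryDatum hB)).smul m.ρ).add
      (((((sp (hΓ.v0 i)).smul m.ρ).mul (isBoundaryDatum_kξ B)).add ((sp (hΓ.u0 i)).smul m.ρ)).congr
        fun _ _ _ _ => rfl)
  · exact ((sp hΓ.η0).smul (m.ρ * m.T0)).add
      ((isBoundaryDatum_kl B).conv ((hΓ.h.isBoundaryDatum hB).smul m.ρ))
  · exact ex _ _ hΓ.θ0
  · exact ex _ _ hΓ.θ0
  · exact ex _ _ hΓ.θ0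

/-- The classes of the fields of a process. -/
noncomputable def arrOf (B : Set E3) (p : Proc) : Arr (UConv B) where
  u i := br B (p.u i)
  θ := br B p.θ
  φ := br B p.φ
  e x := br B (p.e x.1 x.2)
  κ x := br B (p.κ x.1 x.2.1 x.2.2)
  b i := br B (p.b i)
  E i := br B (p.E i)
  V x := br B (p.V x.1 x.2)
  τ x := br B (p.τ x.1 x.2)
  μ x := br B (p.μ x.1 x.2.1 x.2.2)
  σ i := br B (p.σ i)
  Q x := br B (p.Q x.1 x.2)
  η := br B p.η
  q i := br B (p.q i)
  divS i := br B (divStress B p i)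
  divD := br B (divDisp B p)
  divq := br B (∑ i, dx B i (p.q i))
  gu x := br B (dx B x.1 (p.u x.2))
  ggu x := br B (dx B x.2.1 (dx B x.1 (p.u x.2.2)))
  gφ i := br B (dx B i p.φ)
  ggφ x := br B (dx B x.2 (dx B x.1 p.φ))
  gθ i := br B (dx B i p.θ)

lemma IsAdmissible.represents (hB : IsSmoothRegion B r) (h : IsAdmissible B p) :
    Represents B p (arrOf B p) := by
  have c : ∀ {F : Field}, IsBoundaryDatum (closure B) F → IsBoundaryDatum B F :=
    fun h => h.mono subset_closure
  have b : ∀ {M N : ℕ} {F : Field}, IsC B M N F → Rep B F (br B F) :=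
    fun h => rep_br (c (h.isBoundaryDatum hB))
  have d : ∀ {M N : ℕ} {F : Field}, IsC B M N F → 1 ≤ M → ∀ j, IsBoundaryDatum B (dx B j F) :=
    fun h hM j => c (h.isBoundaryDatum_dx' hM hB j)
  have dd : ∀ {M N : ℕ} {F : Field}, IsC B M N F → 2 ≤ M → ∀ i j,
      IsBoundaryDatum B (dx B j (dx B i F)) := fun h hM i j => c (h.isBoundaryDatum_dx_dx' hM hB i j)
  exact
    { u := fun i => b (h.u i), θ := b h.θ, φ := b h.φ, e := fun i j => b (h.e i j),
      κ := fun i j l => b (h.κ i j l), b := fun i => b (h.b i), E := fun i => b (h.E i),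
      V := fun i j => b (h.V i j), τ := fun i j => b (h.τ i j), μ := fun i j l => b (h.μ i j l),
      σ := fun i => b (h.σ i), Q := fun i j => b (h.Q i j), η := b h.η, q := fun i => b (h.q i),
      divS := fun i => rep_br ((IsBoundaryDatum.sum fun j _ => d (h.τ j i) le_rfl j).sub
        (.sum fun k _ => .sum fun j _ => dd (h.μ k j i) le_rfl k j)),
      divD := rep_br ((IsBoundaryDatum.sum fun j _ => d (h.σ j) le_rfl j).sub
        (.sum fun k _ => .sum fun j _ => dd (h.Q k j) le_rfl k j)),
      divq := rep_br (.sum fun i _ => d (h.q i) le_rfl i),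
      gu := fun i j => rep_br (d (h.u j) (by norm_num) i),
      ggu := fun i j l => rep_br (dd (h.u l) (by norm_num) i j),
      gφ := fun i => rep_br (d h.φ (by norm_num) i),
      ggφ := fun i j => rep_br (dd h.φ (by norm_num) i j),
      gθ := fun i => rep_br (d h.θ (by norm_num) i) }

/-- The derivative classes depend linearly on the process only because admissible fields are
differentiable up to the boundary. -/
lemma Represents.line (hB : IsSmoothRegion B r) (h : IsAdmissible B p) (h' : IsAdmissible B p')
    {a a' : Arr (UConv B)} (ha : Represents B p a) (ha' : Represents B p' a') (s : ℝ) :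
    Represents B (p + s • p') (a + s • a') := by
  have d : ∀ {M N : ℕ} {F G : Field}, IsC B M N F → IsC B M N G → 1 ≤ M → ∀ j, ∀ x ∈ B, ∀ t, 0 ≤ t →
      dx B j (F + s • G) x t = dx B j F x t + s * dx B j G x t := fun h h' hM j x hx t ht =>
    dx_line hB (h.mono hM (Nat.zero_le _)) (h'.mono hM (Nat.zero_le _)) ht (subset_closure hx) s j
  have dd : ∀ {M N : ℕ} {F G : Field}, IsC B M N F → IsC B M N G → 2 ≤ M → ∀ i j, ∀ x ∈ B, ∀ t,
      0 ≤ t → dx B j (dx B i (F + s • G)) x t = dx B j (dx B i F) x t + s * dx B j (dx B i G) x t :=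
    fun h h' hM i j x hx t ht =>
    dx_dx_line hB (h.mono hM (Nat.zero_le _)) (h'.mono hM (Nat.zero_le _)) ht (subset_closure hx)
      s i j
  exact
    { u := fun i => (ha.u i).add ((ha'.u i).smul s), θ := ha.θ.add (ha'.θ.smul s),
      φ := ha.φ.add (ha'.φ.smul s), e := fun i j => (ha.e i j).add ((ha'.e i j).smul s),
      κ := fun i j l => (ha.κ i j l).add ((ha'.κ i j l).smul s),
      b := fun i => (ha.b i).add ((ha'.b i).smul s), E := fun i => (ha.E i).add ((ha'.E i).smul s),
      V := fun i j => (ha.V i j).add ((ha'.V i j).smul s),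
      τ := fun i j => (ha.τ i j).add ((ha'.τ i j).smul s),
      μ := fun i j l => (ha.μ i j l).add ((ha'.μ i j l).smul s),
      σ := fun i => (ha.σ i).add ((ha'.σ i).smul s),
      Q := fun i j => (ha.Q i j).add ((ha'.Q i j).smul s), η := ha.η.add (ha'.η.smul s),
      q := fun i => (ha.q i).add ((ha'.q i).smul s),
      divS := fun i => ((ha.divS i).add ((ha'.divS i).smul s)).congr fun x hx t ht => by
        have e1 : ∀ j, dx B j ((p + s • p').τ j i) x t
            = dx B j (p.τ j i) x t + s * dx B j (p'.τ j i) x t :=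
          fun j => d (h.τ j i) (h'.τ j i) le_rfl j x hx t ht
        have e2 : ∀ k j, dx B j (dx B k ((p + s • p').μ k j i)) x t
            = dx B j (dx B k (p.μ k j i)) x t + s * dx B j (dx B k (p'.μ k j i)) x t :=
          fun k j => dd (h.μ k j i) (h'.μ k j i) le_rfl k j x hx t ht
        simp only [divStress, Pi.sub_apply, Pi.add_apply, Pi.smul_apply, Finset.sum_apply,
          smul_eq_mul]
        simp only [e1, e2, Finset.sum_add_distrib, ← Finset.mul_sum]
        ring,
      divD := (ha.divD.add (ha'.divD.smul s)).congr fun x hx t ht => by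
        have e1 : ∀ j, dx B j ((p + s • p').σ j) x t
            = dx B j (p.σ j) x t + s * dx B j (p'.σ j) x t :=
          fun j => d (h.σ j) (h'.σ j) le_rfl j x hx t ht
        have e2 : ∀ k j, dx B j (dx B k ((p + s • p').Q k j)) x t
            = dx B j (dx B k (p.Q k j)) x t + s * dx B j (dx B k (p'.Q k j)) x t :=
          fun k j => dd (h.Q k j) (h'.Q k j) le_rfl k j x hx t ht
        simp only [divDisp, Pi.sub_apply, Pi.add_apply, Pi.smul_apply, Finset.sum_apply,
          smul_eq_mul]
        simp only [e1, e2, Finset.sum_add_distrib, ← Finset.mul_sum]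
        ring,
      divq := (ha.divq.add (ha'.divq.smul s)).congr fun x hx t ht => by
        have e1 : ∀ j, dx B j ((p + s • p').q j) x t
            = dx B j (p.q j) x t + s * dx B j (p'.q j) x t :=
          fun j => d (h.q j) (h'.q j) le_rfl j x hx t ht
        simp only [Pi.add_apply, Pi.smul_apply, Finset.sum_apply, smul_eq_mul]
        simp only [e1, Finset.sum_add_distrib, ← Finset.mul_sum],
      gu := fun i j => ((ha.gu i j).add ((ha'.gu i j).smul s)).congr
        (d (h.u j) (h'.u j) (by norm_num) i),
      ggu := fun i j l => ((ha.ggu i j l).add ((ha'.ggu i j l).smul s)).congr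
        (dd (h.u l) (h'.u l) (by norm_num) i j),
      gφ := fun i => ((ha.gφ i).add ((ha'.gφ i).smul s)).congr (d h.φ h'.φ (by norm_num) i),
      ggφ := fun i j => ((ha.ggφ i j).add ((ha'.ggφ i j).smul s)).congr
        (dd h.φ h'.φ (by norm_num) i j),
      gθ := fun i => ((ha.gθ i).add ((ha'.gθ i).smul s)).congr (d h.θ h'.θ (by norm_num) i) }

end Existence

end ThermoPiezo

namespace ThermoPiezo

/-! ### The boundary operators -/

section Boundary

variable {B : Set E3} {r : E3 → ℝ} {τ τ' : Fin 3 → Field} {μ μ' : Fin 3 → Fin 3 → Field}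
  {u u' : Field} {t : ℝ} {x : E3}

/-- The operator that gives `P_i` and `Λ`. -/
noncomputable def trac (B : Set E3) (r : E3 → ℝ) (τ : Fin 3 → Field) (μ : Fin 3 → Fin 3 → Field) :
    Field :=
  ∑ j, (τ j - ∑ k, dx B k (μ k j)) * nrm r j
    - ∑ j, surfD B r j (∑ k, μ k j * nrm r k)
    + (∑ l, surfD B r l (nrm r l)) * ∑ k, ∑ j, μ k j * nrm r k * nrm r j

/-- The operator that gives `R_i` and `H`. -/
noncomputable def hypT (r : E3 → ℝ) (μ : Fin 3 → Fin 3 → Field) : Field :=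
  ∑ k, ∑ j, μ k j * nrm r k * nrm r j

lemma tractionP_eq (p : Proc) (i : Fin 3) :
    tractionP B r p i = trac B r (fun j => p.τ j i) fun k j => p.μ k j i := rfl

lemma chargeΛ_eq (p : Proc) : chargeΛ B r p = trac B r p.σ p.Q := rfl

/-- Expanding the surface derivative of `μ n` by the product rule identifies the traction with the
boundary operator that double integration by parts produces. -/
lemma trac_eq (hB : IsSmoothRegion B r)
    (hμ1 : ∀ k j, ContDiffOn ℝ 1 (fun y => μ k j y t) (closure B)) (hx : x ∈ frontier B) :
    trac B r τ μ x t
      = (∑ j, τ j * nrm r j + ∑ k, ∑ j, bdryTF B r k j (μ k j)) x t := by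
  obtain ⟨q, hq⟩ := exists_isInvGrad hB
  have hxc := frontier_subset_closure hx
  have hN : ∀ k, ContDiffOn ℝ 1 (extNor r q k) (closure B) := fun k =>
    ((hq.contDiff_extNor hB k).of_le (by simp)).contDiffOn
  have hcurv : (∑ l, surfD B r l (nrm r l)) x t = bdryCurv B r x := by
    simp only [Finset.sum_apply, surfD, bdryCurv, Pi.mul_apply, Pi.sub_apply]
    refine Finset.sum_congr rfl fun l _ => Finset.sum_congr rfl fun k _ => ?_
    split_ifs <;> rfl
  have hpd : ∀ l j, dx B l (∑ k, μ k j * nrm r k) x t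
      = ∑ k, (dx B l (μ k j) x t * nor r k x + μ k j x t * pd B l (nor r k) x) := fun l j => by
    -- Only germs at the boundary point enter a derivative, so the normal may be replaced by its
    -- smooth extension, to which the product rule applies.
    have e1 : dx B l (∑ k, μ k j * nrm r k) x t
        = pd B l (fun y => ∑ k, μ k j y t * extNor r q k y) x := by
      refine congrArg (fun L : E3 →L[ℝ] ℝ => L (EuclideanSpace.single l 1)) ?_
      have h1 : (fun y => (∑ k, μ k j * nrm r k) y t)
          =ᶠ[𝓝 x] fun y => ∑ k, μ k j y t * extNor r q k y := by
        filter_upwards [(Filter.eventually_all (ι := Fin 3)).2 fun k => hq.eventually_nor_eq hx k]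
          with y hy
        simp only [Finset.sum_apply, Pi.mul_apply]
        exact Finset.sum_congr rfl fun k _ => by rw [← hy k]; rfl
      exact (h1.filter_mono nhdsWithin_le_nhds).fderivWithin_eq h1.self_of_nhds
    rw [e1, pd_sum hB (f := fun k y => μ k j y t * extNor r q k y)
      (fun k => (hμ1 k j).mul (hN k)) hxc]
    refine Finset.sum_congr rfl fun k _ => ?_
    rw [pd_mul hB (hμ1 k j) (hN k) hxc, ← hq.pd_nor hx k l,
      ← (hq.eventually_nor_eq hx k).self_of_nhds]
    rfl
  have hsurf : ∀ j, surfD B r j (∑ k, μ k j * nrm r k) x t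
      = ∑ k, ∑ l, ((if j = l then 1 else 0) - nor r j x * nor r l x)
        * (dx B l (μ k j) x t * nor r k x + μ k j x t * pd B l (nor r k) x) := fun j => by
    simp only [surfD, Finset.sum_apply, Pi.mul_apply, Pi.sub_apply, hpd, Finset.mul_sum]
    rw [Finset.sum_comm]
    refine Finset.sum_congr rfl fun k _ => Finset.sum_congr rfl fun l _ => ?_
    split_ifs <;> rfl
  have hT : ∀ k j, bdryTF B r k j (μ k j) x t = -(dx B k (μ k j) x t * nor r j x)
      - ∑ l, ((if j = l then 1 else 0) - nor r j x * nor r l x)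
        * (dx B l (μ k j) x t * nor r k x + μ k j x t * pd B l (nor r k) x)
      + bdryCurv B r x * (μ k j x t * nor r k x * nor r j x) := fun k j => rfl
  have hn : ∀ j, nrm r j x t = nor r j x := fun _ => rfl
  simp only [trac, Pi.add_apply, Pi.sub_apply, Pi.mul_apply, hcurv]
  simp only [Finset.sum_apply, Pi.mul_apply, Pi.sub_apply, hsurf, hT, hn, sub_mul,
    Finset.sum_mul, Finset.mul_sum, Finset.sum_add_distrib, Finset.sum_sub_distrib,
    Finset.sum_neg_distrib]
  rw [Finset.sum_comm (f := fun j k => dx B k (μ k j) x t * nor r j x)]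
  have hc : ∀ f : Fin 3 → Fin 3 → Fin 3 → ℝ, ∑ j, ∑ k, ∑ l, f j k l = ∑ k, ∑ j, ∑ l, f j k l :=
    fun f => Finset.sum_comm
  rw [hc (fun j k l => (if j = l then 1 else 0)
      * (dx B l (μ k j) x t * nor r k x + μ k j x t * pd B l (nor r k) x)),
    hc (fun j k l => nor r j x * nor r l x
      * (dx B l (μ k j) x t * nor r k x + μ k j x t * pd B l (nor r k) x))]
  ring

lemma isBoundaryDatum_trac (hB : IsSmoothRegion B r) (hτ : ∀ j, IsC B 1 0 (τ j))
    (hμ : ∀ k j, IsC B 1 0 (μ k j)) : IsBoundaryDatum (frontier B) (trac B r τ μ) := by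
  refine ((IsBoundaryDatum.sum (s := Finset.univ) fun j _ =>
    (((hτ j).isBoundaryDatum hB).mono frontier_subset_closure).mul (isBoundaryDatum_nrm hB j)).add
    (.sum (s := Finset.univ) fun k _ => .sum (s := Finset.univ) fun j _ =>
      isBoundaryDatum_bdryTF hB (hμ k j) k j)).congr fun x hx t ht =>
      trac_eq hB (fun k j => (hμ k j).slice ht) hx

lemma isBoundaryDatum_hypT (hB : IsSmoothRegion B r) (hμ : ∀ k j, IsC B 1 0 (μ k j)) :
    IsBoundaryDatum (frontier B) (hypT r μ) :=
  .sum fun k _ => .sum fun j _ =>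
    ((((hμ k j).isBoundaryDatum hB).mono frontier_subset_closure).mul
      (isBoundaryDatum_nrm hB k)).mul (isBoundaryDatum_nrm hB j)

lemma hypT_line (s : ℝ) :
    hypT r (fun k j => μ k j + s • μ' k j) = hypT r μ + s • hypT r μ' := by
  simp only [hypT, Finset.smul_sum, ← Finset.sum_add_distrib]
  refine Finset.sum_congr rfl fun k _ => Finset.sum_congr rfl fun j _ => ?_
  funext x t
  simp only [Pi.add_apply, Pi.mul_apply, Pi.smul_apply, smul_eq_mul]; ring

lemma normalD_line (hB : IsSmoothRegion B r) (hu : IsC B 1 0 u) (hu' : IsC B 1 0 u')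
    (hx : x ∈ frontier B) (ht : 0 ≤ t) (s : ℝ) :
    normalD B r (u + s • u') x t = (normalD B r u + s • normalD B r u') x t := by
  simp only [normalD, Finset.sum_apply, Pi.mul_apply, Pi.add_apply, Pi.smul_apply, smul_eq_mul,
    dx_line hB hu hu' ht (frontier_subset_closure hx), Finset.mul_sum, ← Finset.sum_add_distrib]
  exact Finset.sum_congr rfl fun j _ => by ring

lemma trac_line (hB : IsSmoothRegion B r) (hμ : ∀ k j, IsC B 1 0 (μ k j))
    (hμ' : ∀ k j, IsC B 1 0 (μ' k j)) {σ : Fin 3 → Field} {ν : Fin 3 → Fin 3 → Field} (s : ℝ)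
    (hσ : ∀ j, σ j = τ j + s • τ' j) (hν : ∀ k j, ν k j = μ k j + s • μ' k j)
    (hx : x ∈ frontier B) (ht : 0 ≤ t) :
    trac B r σ ν x t = (trac B r τ μ + s • trac B r τ' μ') x t := by
  have h1 : ∀ k j, ContDiffOn ℝ 1 (fun y => μ k j y t) (closure B) := fun k j => by
    exact_mod_cast (hμ k j).slice ht
  have h2 : ∀ k j, ContDiffOn ℝ 1 (fun y => μ' k j y t) (closure B) := fun k j => by
    exact_mod_cast (hμ' k j).slice ht
  have h3 : ∀ k j, ContDiffOn ℝ 1 (fun y => ν k j y t) (closure B) := fun k j => by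
    rw [hν]; exact (h1 k j).add (contDiffOn_const.mul (h2 k j))
  have h4 : (trac B r τ μ + s • trac B r τ' μ') x t
      = trac B r τ μ x t + s * trac B r τ' μ' x t := rfl
  rw [h4, trac_eq hB h3 hx, trac_eq hB h1 hx, trac_eq hB h2 hx]
  have e : ∀ k j, bdryTF B r k j (ν k j) x t
      = bdryTF B r k j (μ k j) x t + s * bdryTF B r k j (μ' k j) x t := fun k j => by
    rw [hν]
    exact bdryT_line hB (h1 k j) (h2 k j) (frontier_subset_closure hx) s k j
  simp only [Pi.add_apply, Finset.sum_apply, Pi.mul_apply, e, hσ, Pi.smul_apply, smul_eq_mul,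
    add_mul, Finset.sum_add_distrib, mul_add, Finset.mul_sum]
  have e2 : ∀ j, s * τ' j x t * nrm r j x t = s * (τ' j x t * nrm r j x t) := fun _ => by ring
  simp only [e2]
  ring

/-- Green's formula for the convolutions with the operators `trac` and `hypT`. -/
theorem conv_green (hB : IsSmoothRegion B r) (hτ : ∀ j, IsC B 1 0 (τ j))
    (hμ : ∀ k j, IsC B 2 0 (μ k j)) (hu : IsC B 2 0 u) (ht : 0 ≤ t) :
    ∫ x in B, ((∑ j, dx B j (τ j) - ∑ k, ∑ j, dx B j (dx B k (μ k j))) ⊛ u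
      + ∑ j, τ j ⊛ dx B j u + ∑ k, ∑ j, μ k j ⊛ dx B j (dx B k u)) x t =
    ∫ x in frontier B, (trac B r τ μ ⊛ u + hypT r μ ⊛ normalD B r u) x t ∂μHE[2] := by
  have i1 := isFiniteMeasure_volume hB
  have i2 := isFiniteMeasure_area hB subset_rfl
  have hBm := hB.isOpen.measurableSet
  have hFm := hB.isCompact_frontier.measurableSet
  have hμ1 := fun k j => (hμ k j).mono one_le_two le_rfl
  have hu1 := hu.mono one_le_two le_rfl
  have c : ∀ {F : Field}, IsBoundaryDatum (closure B) F → Rep B F (br B F) :=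
    fun h => rep_br (h.mono subset_closure)
  have cF : ∀ {F : Field}, IsBoundaryDatum (closure B) F → IsBoundaryDatum (frontier B) F :=
    fun h => h.mono frontier_subset_closure
  have n := isBoundaryDatum_nrm hB
  have rτ := fun j => c ((hτ j).isBoundaryDatum hB)
  have rdτ := fun j => c ((hτ j).isBoundaryDatum_dx hB j)
  have rμ := fun k j => c ((hμ k j).isBoundaryDatum hB)
  have rdμ := fun k j => c ((hμ k j).isBoundaryDatum_dx_dx hB k j)
  have ru := c (hu.isBoundaryDatum hB)
  have rdu := fun j => c (hu1.isBoundaryDatum_dx hB j)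
  have rddu := fun k j => c (hu.isBoundaryDatum_dx_dx hB k j)
  have L := ((((Rep.sum (s := Finset.univ) fun j => rdτ j).sub (.sum (s := Finset.univ) fun k =>
    .sum (s := Finset.univ) fun j => rdμ k j)).conv ru).add (.sum (s := Finset.univ) fun j =>
    (rτ j).conv (rdu j))).add (.sum (s := Finset.univ) fun k => .sum (s := Finset.univ) fun j =>
    (rμ k j).conv (rddu k j))
  have rT := fun k j => rep_br (isBoundaryDatum_bdryTF hB (hμ1 k j) k j)
  have rn := fun j => rep_br ((cF ((hτ j).isBoundaryDatum hB)).mul (n j))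
  have rm := fun k j => rep_br (((cF ((hμ k j).isBoundaryDatum hB)).mul (n k)).mul (n j))
  have ru' := rep_br (cF (hu.isBoundaryDatum hB))
  have rD := rep_br (isBoundaryDatum_normalD hB hu1)
  have rtr : Rep (frontier B) (trac B r τ μ) _ := ((Rep.sum (s := Finset.univ) fun j => rn j).add
    (.sum (s := Finset.univ) fun k => .sum (s := Finset.univ) fun j => rT k j)).congr
      fun x hx t ht => trac_eq hB (fun k j => by exact_mod_cast (hμ1 k j).slice ht) hx
  have R := (rtr.conv ru').add ((show Rep (frontier B) (hypT r μ) _ from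
    .sum (s := Finset.univ) fun k => .sum (s := Finset.univ) fun j => rm k j).conv rD)
  rw [L.integral hBm ht, R.integral hFm ht]
  have g1 := fun j => conv_green_one hB (hτ j) hu1 ht j
  have g2 := fun k j => conv_green_two hB (hμ k j) hu ht k j
  have g1' := fun j => (((rdτ j).conv ru).add ((rτ j).conv (rdu j))).integral (ν := volume) hBm ht
  have g1'' := fun j => ((rn j).conv ru').integral (ν := μHE[2]) hFm ht
  have g2' := fun k j => (((rdμ k j).neg.conv ru).add ((rμ k j).conv (rddu k j))).integral
    (ν := volume) hBm ht
  have g2'' := fun k j => (((rT k j).conv ru').add ((rm k j).conv rD)).integral (ν := μHE[2])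
    hFm ht
  have h1 := fun j => ((g1' j).symm.trans (g1 j)).trans (g1'' j)
  have h2 := fun k j => ((g2' k j).symm.trans (g2 k j)).trans (g2'' k j)
  -- The formulas for single components are summed, and the integrals of the sums are then compared
  -- in the convolution algebra.
  have H : ∑ j, _ + ∑ k, ∑ j, _ = ∑ j, _ + ∑ k, ∑ j, _ := congrArg₂ (· + ·)
    (Finset.sum_congr rfl fun j _ => h1 j)
    (Finset.sum_congr rfl fun k _ => Finset.sum_congr rfl fun j _ => h2 k j)
  simp only [← map_sum, ← map_add] at H
  refine Eq.trans (congrArg _ ?_) (H.trans (congrArg _ ?_))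
  · simp only [sub_mul, Finset.sum_mul, Finset.sum_add_distrib, neg_mul, Finset.sum_neg_distrib]
    ring
  · simp only [add_mul, Finset.sum_mul, Finset.sum_add_distrib]
    ring

end Boundary

end ThermoPiezo

namespace ThermoPiezo

/-! ### The first variation of the functional -/

section SurfaceParts

variable {S : Set E3} {ν : Measure E3} [IsFiniteMeasure (ν.restrict S)] {F : Field} {t : ℝ}

lemma continuousOn_integral (hS : MeasurableSet S) (hF : IsBoundaryDatum S F) :
    ContinuousOn (fun s => ∫ x in S, F x s ∂ν) (Ici 0) := by
  intro s hs
  have hs : 0 ≤ s := hs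
  obtain ⟨C, hC⟩ := hF.2 (s + 1)
  refine continuousWithinAt_of_dominated (bound := fun _ => C) ?_ ?_ (integrable_const C) ?_
  · filter_upwards [self_mem_nhdsWithin] with y hy
    exact (hF.space hy).aestronglyMeasurable hS
  · filter_upwards [self_mem_nhdsWithin, nhdsWithin_le_nhds (gt_mem_nhds (lt_add_one s))]
      with y hy hy1
    exact (ae_restrict_iff' hS).2 (.of_forall fun x hx => hC x hx y ⟨hy, hy1.le⟩)
  · exact (ae_restrict_iff' hS).2 (.of_forall fun x hx => hF.time hx s hs)

lemma tconv_tconv {f g h : ℝ → ℝ} (hf : ContinuousOn f (Ici 0)) (hg : ContinuousOn g (Ici 0))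
    (hh : ContinuousOn h (Ici 0)) {A : ℝ → ℝ} (hA : ContinuousOn A (Ici 0)) (ht : 0 ≤ t) :
    tconv f (tconv g (tconv h A)) t = tconv (tconv f (tconv g h)) A t := by
  rw [tconv_assoc hf (continuousOn_tconv hg hh) hA ht]
  exact tconv_congr ht (fun _ _ => rfl) fun s hs => (tconv_assoc hg hh hA hs.1).symm

/-- A kernel of the surface terms, which does not depend on the position. -/
structure IsKernel (K : Field) : Prop where
  indep : ∀ x, K x = K 0
  cont : ContinuousOn (K 0) (Ici 0)

namespace IsKernel

variable {K : Field}

lemma isBoundaryDatum (hK : IsKernel K) (S : Set E3) : IsBoundaryDatum S K :=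
  (IsBoundaryDatum.of_time hK.cont).congr fun x _ t _ => by rw [hK.indep]

lemma tconv_integral (hK : IsKernel K) (hS : MeasurableSet S) (hF : IsBoundaryDatum S F)
    (ht : 0 ≤ t) :
    tconv (K 0) (fun s => ∫ x in S, F x s ∂ν) t = ∫ x in S, (K ⊛ F) x t ∂ν := by
  have : K = fun _ => K 0 := funext hK.indep
  rw [this]
  exact ThermoPiezo.tconv_integral hS hK.cont hF ht

end IsKernel

end SurfaceParts

/-- The kernel `χ * ζ * ξ`. -/
noncomputable def kmech (m : Material) : Field := kχ m ⊛ kζ m ⊛ kξ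

/-- The kernel `χ * ξ * l`. -/
noncomputable def kheat (m : Material) : Field := kχ m ⊛ kξ ⊛ kl

lemma isKernel_kmech (m : Material) : IsKernel (kmech m) :=
  ⟨fun _ => rfl, ((isBoundaryDatum_kχ m univ).conv ((isBoundaryDatum_kζ m univ).conv
    (isBoundaryDatum_kξ univ))).time (mem_univ 0)⟩

lemma isKernel_kheat (m : Material) : IsKernel (kheat m) :=
  ⟨fun _ => rfl, ((isBoundaryDatum_kχ m univ).conv ((isBoundaryDatum_kξ univ).conv
    (isBoundaryDatum_kl univ))).time (mem_univ 0)⟩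

/-! ### Surface terms for a pair of complementary boundary conditions -/

section Part

variable {B : Set E3} {r : E3 → ℝ} {S Sg : Set E3} {K P P' Ph u u' uh : Field} {t : ℝ}

/-- The data for one pair of complementary boundary conditions. -/
structure IsPart (B S Sg : Set E3) : Prop where
  subS : S ⊆ frontier B
  subSg : Sg ⊆ frontier B
  disj : Disjoint S Sg
  measS : MeasurableSet S
  measSg : MeasurableSet Sg
  null : μHE[2] (frontier B \ (S ∪ Sg)) = 0

lemma IsBoundarySplitting.isPart {S Sg : Fin 5 → Set E3} (h : IsBoundarySplitting B S Sg)
    (i : Fin 5) : IsPart B (S i) (Sg i) where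
  subS := subset_closure.trans (subset_union_left.trans (h.cover i).le)
  subSg := subset_union_right.trans (h.cover i).le
  disj := disjoint_iff_inter_eq_empty.2 (h.disjoint i)
  measS := (h.meas i).1
  measSg := (h.meas i).2
  null := h.null i

lemma IsPart.integral_add (h : IsPart B S Sg) {f : E3 → ℝ}
    (hf : IntegrableOn f (frontier B) μHE[2]) :
    ∫ x in frontier B, f x ∂μHE[2] = ∫ x in S, f x ∂μHE[2] + ∫ x in Sg, f x ∂μHE[2] := by
  rw [← setIntegral_union h.disj h.measSg (hf.mono_set h.subS) (hf.mono_set h.subSg)]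
  refine setIntegral_congr_set ?_
  have h1 : S ∪ Sg ⊆ frontier B := union_subset h.subS h.subSg
  exact (ae_le_set.2 h.null).antisymm (LE.le.eventuallyLE (show S ∪ Sg ≤ frontier B from h1))

/-- The surface terms of the functional for one pair of boundary conditions. -/
noncomputable def partInt (S Sg : Set E3) (K P Ph u uh : Field) (t : ℝ) : ℝ :=
  ∫ x in S, (K ⊛ (P ⊛ uh)) x t ∂μHE[2] + ∫ x in Sg, (K ⊛ ((P - Ph) ⊛ u)) x t ∂μHE[2]

/-- The surface terms of the first variation for one pair of boundary conditions. -/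
noncomputable def partVar (S Sg : Set E3) (K P Ph u uh P' u' : Field) (t : ℝ) : ℝ :=
  ∫ x in S, (K ⊛ (P' ⊛ (u - uh))) x t ∂μHE[2] - ∫ x in Sg, (K ⊛ ((P - Ph) ⊛ u')) x t ∂μHE[2]

/-- The linear coefficient is `P' * û` on `S` and `P' * u + (P - P̂) * u'` on the complementary
part. Completing `P' * û` to `P' * u` gives one integral over the whole boundary, which Green's
formula will cancel, and the remainder `partVar`. The varied fields need to agree with the line only
on the boundary at nonnegative times, where the boundary operators are linear. -/
lemma partInt_line (hB : IsSmoothRegion B r) (h : IsPart B S Sg) (hK : IsKernel K)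
    (hP : IsBoundaryDatum (frontier B) P) (hP' : IsBoundaryDatum (frontier B) P')
    (hu : IsBoundaryDatum (frontier B) u) (hu' : IsBoundaryDatum (frontier B) u')
    (huh : IsBoundaryDatum S uh) (hPh : IsBoundaryDatum Sg Ph) (ht : 0 ≤ t) :
    ∃ c : ℝ, ∀ (s : ℝ) (Q v : Field),
      (∀ x ∈ frontier B, ∀ t, 0 ≤ t → Q x t = (P + s • P') x t) →
      (∀ x ∈ frontier B, ∀ t, 0 ≤ t → v x t = (u + s • u') x t) →
      partInt S Sg K Q Ph v uh t = partInt S Sg K P Ph u uh t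
        + s * (∫ x in frontier B, (K ⊛ (P' ⊛ u)) x t ∂μHE[2]
          - partVar S Sg K P Ph u uh P' u' t) + s * s * c := by
  have i1 := isFiniteMeasure_area hB subset_rfl
  have i2 := isFiniteMeasure_area hB h.subS
  have i3 := isFiniteMeasure_area hB h.subSg
  rw [h.integral_add (((hK.isBoundaryDatum _).conv (hP'.conv hu)).integrableOn
    hB.isCompact_frontier.measurableSet ht)]
  have b : ∀ {F : Field}, IsBoundaryDatum (frontier B) F → Rep S F (br S F) :=
    fun hF => rep_br (hF.mono h.subS)
  have c : ∀ {F : Field}, IsBoundaryDatum (frontier B) F → Rep Sg F (br Sg F) :=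
    fun hF => rep_br (hF.mono h.subSg)
  have kS := rep_br (hK.isBoundaryDatum S)
  have kG := rep_br (hK.isBoundaryDatum Sg)
  have rPh := rep_br hPh
  have ruh := rep_br huh
  set I := intAt μHE[2] h.measS ht with hI
  set J := intAt μHE[2] h.measSg ht with hJ
  -- Both factors vary only on the part where `P` is prescribed, so the second-order term comes from
  -- there alone.
  refine ⟨J (br Sg K * (br Sg P' * br Sg u')), fun s Q v hQ hv => ?_⟩
  have rQ : Rep S Q _ := ((b hP).add ((b hP').smul s)).congr fun x hx => hQ x (h.subS hx)
  have rQ' : Rep Sg Q _ := ((c hP).add ((c hP').smul s)).congr fun x hx => hQ x (h.subSg hx)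
  have rv' : Rep Sg v _ := ((c hu).add ((c hu').smul s)).congr fun x hx => hv x (h.subSg hx)
  simp only [partInt, partVar]
  rw [(kS.conv (rQ.conv ruh)).integral (ν := μHE[2]) h.measS ht,
    (kG.conv ((rQ'.sub rPh).conv rv')).integral (ν := μHE[2]) h.measSg ht,
    (kS.conv ((b hP).conv ruh)).integral (ν := μHE[2]) h.measS ht,
    (kG.conv (((c hP).sub rPh).conv (c hu))).integral (ν := μHE[2]) h.measSg ht,
    (kS.conv ((b hP').conv (b hu))).integral (ν := μHE[2]) h.measS ht,
    (kG.conv ((c hP').conv (c hu))).integral (ν := μHE[2]) h.measSg ht,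
    (kS.conv ((b hP').conv ((b hu).sub ruh))).integral (ν := μHE[2]) h.measS ht,
    (kG.conv (((c hP).sub rPh).conv (c hu'))).integral (ν := μHE[2]) h.measSg ht,
    ← hI, ← hJ]
  have e1 : br S K * ((br S P + s • br S P') * br S uh)
      = br S K * (br S P * br S uh) + s • (br S K * (br S P' * br S u)
        - br S K * (br S P' * (br S u - br S uh))) := by algebra
  have e2 : br Sg K * ((br Sg P + s • br Sg P' - br Sg Ph) * (br Sg u + s • br Sg u'))
      = br Sg K * ((br Sg P - br Sg Ph) * br Sg u) + s • (br Sg K * (br Sg P' * br Sg u)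
        + br Sg K * ((br Sg P - br Sg Ph) * br Sg u'))
        + (s * s) • (br Sg K * (br Sg P' * br Sg u')) := by algebra
  rw [e1, e2]
  simp only [map_add, map_sub, map_smul, smul_eq_mul]
  ring

end Part

/-! ### Assembly of the first variation -/

section FirstVariation

variable {m : Material} {B : Set E3} {r : E3 → ℝ} {S Sg : Fin 5 → Set E3} {Γ : Data}
  {p p' : Proc} {t : ℝ}

/-- The boundary values of the process are continuous. -/
structure HasBoundaryValues (B : Set E3) (r : E3 → ℝ) (p : Proc) : Prop where
  P : ∀ i, IsBoundaryDatum (frontier B) (tractionP B r p i)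
  R : ∀ i, IsBoundaryDatum (frontier B) (hyperR r p i)
  u : ∀ i, IsBoundaryDatum (frontier B) (p.u i)
  du : ∀ i, IsBoundaryDatum (frontier B) (normalD B r (p.u i))
  Λ : IsBoundaryDatum (frontier B) (chargeΛ B r p)
  H : IsBoundaryDatum (frontier B) (hyperH r p)
  φ : IsBoundaryDatum (frontier B) p.φ
  dφ : IsBoundaryDatum (frontier B) (normalD B r p.φ)
  q : IsBoundaryDatum (frontier B) (fluxq r p)
  θ : IsBoundaryDatum (frontier B) p.θ

lemma IsAdmissible.hasBoundaryValues (hB : IsSmoothRegion B r) (h : IsAdmissible B p) :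
    HasBoundaryValues B r p := by
  have c : ∀ {M N : ℕ} {F : Field}, IsC B M N F → IsBoundaryDatum (frontier B) F :=
    fun h => (h.isBoundaryDatum hB).mono frontier_subset_closure
  have h1 : ∀ {M N : ℕ} {F : Field}, 1 ≤ M → IsC B M N F → IsC B 1 0 F :=
    fun hM h => h.mono hM (Nat.zero_le _)
  exact
    { P := fun i => isBoundaryDatum_trac hB (fun j => h.τ j i) fun k j => h1 (by norm_num) (h.μ k j i)
      R := fun i => isBoundaryDatum_hypT hB fun k j => h1 (by norm_num) (h.μ k j i)
      u := fun i => c (h.u i)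
      du := fun i => isBoundaryDatum_normalD hB (h1 (by norm_num) (h.u i))
      Λ := isBoundaryDatum_trac hB h.σ fun k j => h1 (by norm_num) (h.Q k j)
      H := isBoundaryDatum_hypT hB fun k j => h1 (by norm_num) (h.Q k j)
      φ := c h.φ
      dφ := isBoundaryDatum_normalD hB (h1 (by norm_num) h.φ)
      q := .sum fun i _ => (c (h.q i)).mul (isBoundaryDatum_nrm hB i)
      θ := c h.θ }

/-- The boundary values of a process along a line of processes. -/
structure BoundaryLine (B : Set E3) (r : E3 → ℝ) (p p' : Proc) (s : ℝ) : Prop where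
  P : ∀ i, ∀ x ∈ frontier B, ∀ t, 0 ≤ t →
    tractionP B r (p + s • p') i x t = (tractionP B r p i + s • tractionP B r p' i) x t
  R : ∀ i, ∀ x ∈ frontier B, ∀ t, 0 ≤ t →
    hyperR r (p + s • p') i x t = (hyperR r p i + s • hyperR r p' i) x t
  du : ∀ i, ∀ x ∈ frontier B, ∀ t, 0 ≤ t → normalD B r ((p + s • p').u i) x t
    = (normalD B r (p.u i) + s • normalD B r (p'.u i)) x t
  Λ : ∀ x ∈ frontier B, ∀ t, 0 ≤ t →
    chargeΛ B r (p + s • p') x t = (chargeΛ B r p + s • chargeΛ B r p') x t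
  H : ∀ x ∈ frontier B, ∀ t, 0 ≤ t →
    hyperH r (p + s • p') x t = (hyperH r p + s • hyperH r p') x t
  dφ : ∀ x ∈ frontier B, ∀ t, 0 ≤ t → normalD B r (p + s • p').φ x t
    = (normalD B r p.φ + s • normalD B r p'.φ) x t
  q : ∀ x ∈ frontier B, ∀ t, 0 ≤ t →
    fluxq r (p + s • p') x t = (fluxq r p + s • fluxq r p') x t

lemma boundaryLine (hB : IsSmoothRegion B r) (h : IsAdmissible B p) (h' : IsAdmissible B p')
    (s : ℝ) : BoundaryLine B r p p' s := by
  have h1 : ∀ {M N : ℕ} {F : Field}, 1 ≤ M → IsC B M N F → IsC B 1 0 F :=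
    fun hM h => h.mono hM (Nat.zero_le _)
  exact
    { P := fun i x hx t ht => trac_line hB (fun k j => h1 (by norm_num) (h.μ k j i))
        (fun k j => h1 (by norm_num) (h'.μ k j i)) s (fun _ => rfl) (fun _ _ => rfl) hx ht
      R := fun i x _ t _ => congrFun₂ (hypT_line s) x t
      du := fun i x hx t ht => normalD_line hB (h1 (by norm_num) (h.u i))
        (h1 (by norm_num) (h'.u i)) hx ht s
      Λ := fun x hx t ht => trac_line hB (fun k j => h1 (by norm_num) (h.Q k j))
        (fun k j => h1 (by norm_num) (h'.Q k j)) s (fun _ => rfl) (fun _ _ => rfl) hx ht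
      H := fun x _ t _ => congrFun₂ (hypT_line s) x t
      dφ := fun x hx t ht => normalD_line hB (h1 (by norm_num) h.φ)
        (h1 (by norm_num) h'.φ) hx ht s
      q := fun x _ t _ => by
        have e : ∀ i, (p + s • p').q i x t = p.q i x t + s * p'.q i x t := fun _ => rfl
        simp only [fluxq, Pi.add_apply, Pi.smul_apply, Finset.sum_apply, Pi.mul_apply, smul_eq_mul,
          e, Finset.mul_sum, ← Finset.sum_add_distrib]
        exact Finset.sum_congr rfl fun _ _ => by ring }

lemma HasBoundaryValues.line (h : HasBoundaryValues B r p) (h' : HasBoundaryValues B r p') {s : ℝ}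
    (hl : BoundaryLine B r p p' s) : HasBoundaryValues B r (p + s • p') where
  P i := ((h.P i).add ((h'.P i).smul s)).congr (hl.P i)
  R i := ((h.R i).add ((h'.R i).smul s)).congr (hl.R i)
  u i := (h.u i).add ((h'.u i).smul s)
  du i := ((h.du i).add ((h'.du i).smul s)).congr (hl.du i)
  Λ := (h.Λ.add (h'.Λ.smul s)).congr hl.Λ
  H := (h.H.add (h'.H.smul s)).congr hl.H
  φ := h.φ.add (h'.φ.smul s)
  dφ := (h.dφ.add (h'.dφ.smul s)).congr hl.dφ
  q := (h.q.add (h'.q.smul s)).congr hl.q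
  θ := h.θ.add (h'.θ.smul s)

lemma tconv_surfInt_sum {ι : Type*} [Fintype ι] {A : Set E3} [IsFiniteMeasure (μHE[2].restrict A)]
    (hA : MeasurableSet A) {K : Field} (hK : IsKernel K) {F : ι → Field}
    (hF : ∀ i, IsBoundaryDatum A (F i)) (ht : 0 ≤ t) :
    tconv (K 0) (surfInt A (∑ i, F i)) t = ∑ i, ∫ x in A, (K ⊛ F i) x t ∂μHE[2] := by
  have hk := rep_br (hK.isBoundaryDatum A)
  have e := fun i => (hk.conv (rep_br (hF i))).integral (ν := μHE[2]) hA ht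
  rw [show surfInt A (∑ i, F i) = fun s => ∫ x in A, (∑ i, F i) x s ∂μHE[2] from rfl,
    hK.tconv_integral hA (.sum fun i _ => hF i) ht,
    (hk.conv (.sum fun i => rep_br (hF i))).integral hA ht, Finset.mul_sum, map_sum]
  exact Finset.sum_congr rfl fun i _ => (e i).symm

lemma continuousOn_surfInt {A : Set E3} [IsFiniteMeasure (μHE[2].restrict A)]
    (hA : MeasurableSet A) {F : Field} (hF : IsBoundaryDatum A F) :
    ContinuousOn (surfInt A F) (Ici 0) := continuousOn_integral hA hF

lemma tconv_part_sum {ι : Type*} [Fintype ι] {A G : Set E3} (hB : IsSmoothRegion B r)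
    (h : IsPart B A G) {K : Field}
    (hK : IsKernel K) {P Ph u uh : ι → Field} (hP : ∀ i, IsBoundaryDatum (frontier B) (P i))
    (hu : ∀ i, IsBoundaryDatum (frontier B) (u i)) (huh : ∀ i, IsBoundaryDatum A (uh i))
    (hPh : ∀ i, IsBoundaryDatum G (Ph i)) :
    ContinuousOn (surfInt A (∑ i, P i ⊛ uh i) + surfInt G (∑ i, (P i - Ph i) ⊛ u i)) (Ici 0) ∧
    ∀ t, 0 ≤ t → tconv (K 0) (surfInt A (∑ i, P i ⊛ uh i) + surfInt G (∑ i, (P i - Ph i) ⊛ u i)) t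
      = ∑ i, partInt A G K (P i) (Ph i) (u i) (uh i) t := by
  have i2 := isFiniteMeasure_area hB h.subS
  have i3 := isFiniteMeasure_area hB h.subSg
  have h1 := fun i => ((hP i).mono h.subS).conv (huh i)
  have h2 := fun i => (((hP i).mono h.subSg).sub (hPh i)).conv ((hu i).mono h.subSg)
  have c1 := continuousOn_surfInt h.measS (.sum (s := Finset.univ) fun i _ => h1 i)
  have c2 := continuousOn_surfInt h.measSg (.sum (s := Finset.univ) fun i _ => h2 i)
  refine ⟨c1.add c2, fun t ht => ?_⟩
  rw [tconv_add hK.cont c1 c2 ht, tconv_surfInt_sum h.measS hK h1 ht,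
    tconv_surfInt_sum h.measSg hK h2 ht, ← Finset.sum_add_distrib]
  rfl

lemma tconv_part {A G : Set E3} (hB : IsSmoothRegion B r)
    (h : IsPart B A G) {K : Field}
    (hK : IsKernel K) {P Ph u uh : Field} (hP : IsBoundaryDatum (frontier B) P)
    (hu : IsBoundaryDatum (frontier B) u) (huh : IsBoundaryDatum A uh)
    (hPh : IsBoundaryDatum G Ph) :
    ContinuousOn (surfInt A (P ⊛ uh) + surfInt G ((P - Ph) ⊛ u)) (Ici 0) ∧
    ∀ t, 0 ≤ t → tconv (K 0) (surfInt A (P ⊛ uh) + surfInt G ((P - Ph) ⊛ u)) t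
      = partInt A G K P Ph u uh t := by
  simpa using tconv_part_sum (ι := Unit) hB h hK (fun _ => hP) (fun _ => hu) (fun _ => huh)
    fun _ => hPh

/-- The surface terms of the functional. -/
lemma functional_eq (hB : IsSmoothRegion B r) (hS : IsBoundarySplitting B S Sg)
    (hΓ : Γ.IsContinuous B S Sg) (h : HasBoundaryValues B r p) (ht : 0 ≤ t) :
    functional m B r S Sg Γ t p = (∫ x in B, (kχ m ⊛ volumeDensity m B Γ p) x t)
      - ((∑ i, partInt (S 0) (Sg 0) (kmech m) (tractionP B r p i) (Γ.bP i) (p.u i) (Γ.bu i) t)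
        + (∑ i, partInt (S 1) (Sg 1) (kmech m) (hyperR r p i) (Γ.bR i) (normalD B r (p.u i))
            (Γ.bd i) t)
        + partInt (S 3) (Sg 3) (kmech m) (chargeΛ B r p) Γ.bΛ p.φ Γ.bφ t
        + partInt (S 4) (Sg 4) (kmech m) (hyperH r p) Γ.bH (normalD B r p.φ) Γ.bω t)
      - 1 / m.T0 * partInt (S 2) (Sg 2) (kheat m) (fluxq r p) Γ.bq p.θ Γ.bθ t := by
  have hk := isKernel_kmech m
  have hk' := isKernel_kheat m
  obtain ⟨a0, b0⟩ := tconv_part_sum hB (hS.isPart 0) hk h.P h.u hΓ.bu hΓ.bP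
  obtain ⟨a1, b1⟩ := tconv_part_sum hB (hS.isPart 1) hk h.R h.du hΓ.bd hΓ.bR
  obtain ⟨a3, b3⟩ := tconv_part hB (hS.isPart 3) hk h.Λ h.φ hΓ.bφ hΓ.bΛ
  obtain ⟨a4, b4⟩ := tconv_part hB (hS.isPart 4) hk h.H h.dφ hΓ.bω hΓ.bH
  obtain ⟨a2, b2⟩ := tconv_part hB (hS.isPart 2) hk' h.q h.θ hΓ.bθ hΓ.bq
  have c : ∀ {F : Field}, IsBoundaryDatum univ F → ContinuousOn (F 0) (Ici 0) :=
    fun h => h.time (mem_univ 0)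
  have cχ := c (isBoundaryDatum_kχ m univ)
  have cζ := c (isBoundaryDatum_kζ m univ)
  have cξ := c (isBoundaryDatum_kξ univ)
  have cl := c (isBoundaryDatum_kl univ)
  rw [functional, tconv_tconv cχ cζ cξ (A := surfaceMech B r S Sg Γ p)
      (((a0.add a1).add a3).add a4) ht,
    tconv_tconv cχ cξ cl (A := surfaceHeat r S Sg Γ p) a2 ht]
  have e1 : tconv (kmech m 0) (surfaceMech B r S Sg Γ p) t = _ :=
    tconv_add hk.cont ((a0.add a1).add a3) a4 ht
  rw [tconv_add hk.cont (a0.add a1) a3 ht, tconv_add hk.cont a0 a1 ht, b0 t ht, b1 t ht, b3 t ht,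
    b4 t ht] at e1
  have e2 : tconv (kheat m 0) (surfaceHeat r S Sg Γ p) t = _ := b2 t ht
  rw [show tconv (kχ m 0) (tconv (kζ m 0) (kξ 0)) = kmech m 0 from rfl,
    show tconv (kχ m 0) (tconv (kξ 0) (kl 0)) = kheat m 0 from rfl, e1, e2]

/-- A kernel that does not depend on position passes through both spatial integrals, so Green's
formula at each time may be convolved with it. -/
lemma conv_green_kernel (hB : IsSmoothRegion B r) {K : Field} (hK : IsKernel K)
    {τ : Fin 3 → Field} {μ : Fin 3 → Fin 3 → Field} {u : Field} (hτ : ∀ j, IsC B 1 0 (τ j))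
    (hμ : ∀ k j, IsC B 2 0 (μ k j)) (hu : IsC B 2 0 u) (ht : 0 ≤ t) :
    ∫ x in B, (K ⊛ ((∑ j, dx B j (τ j) - ∑ k, ∑ j, dx B j (dx B k (μ k j))) ⊛ u
      + ∑ j, τ j ⊛ dx B j u + ∑ k, ∑ j, μ k j ⊛ dx B j (dx B k u))) x t =
    ∫ x in frontier B, (K ⊛ (trac B r τ μ ⊛ u)) x t ∂μHE[2]
      + ∫ x in frontier B, (K ⊛ (hypT r μ ⊛ normalD B r u)) x t ∂μHE[2] := by
  have i1 := isFiniteMeasure_volume hB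
  have i2 := isFiniteMeasure_area hB subset_rfl
  have hFm := hB.isCompact_frontier.measurableSet
  have c : ∀ {F : Field}, IsBoundaryDatum (closure B) F → IsBoundaryDatum B F :=
    fun h => h.mono subset_closure
  have hμ1 := fun k j => (hμ k j).mono one_le_two le_rfl
  have hu1 := hu.mono one_le_two le_rfl
  have n1 := ((((IsBoundaryDatum.sum (s := Finset.univ) fun j _ =>
    c ((hτ j).isBoundaryDatum_dx hB j)).sub (.sum (s := Finset.univ) fun k _ =>
    .sum (s := Finset.univ) fun j _ => c ((hμ k j).isBoundaryDatum_dx_dx hB k j))).conv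
    (c (hu.isBoundaryDatum hB))).add (.sum (s := Finset.univ) fun j _ =>
    (c ((hτ j).isBoundaryDatum hB)).conv (c (hu1.isBoundaryDatum_dx hB j)))).add
    (.sum (s := Finset.univ) fun k _ => .sum (s := Finset.univ) fun j _ =>
    (c ((hμ k j).isBoundaryDatum hB)).conv (c (hu.isBoundaryDatum_dx_dx hB k j)))
  have n2 := (isBoundaryDatum_trac hB hτ hμ1).conv
    ((hu.isBoundaryDatum hB).mono frontier_subset_closure)
  have n3 := (isBoundaryDatum_hypT hB hμ1).conv (isBoundaryDatum_normalD hB hu1)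
  rw [← hK.tconv_integral hB.isOpen.measurableSet n1 ht,
    tconv_congr ht (fun _ _ => rfl) fun s hs => conv_green hB hτ hμ hu hs.1,
    hK.tconv_integral hFm (n2.add n3) ht,
    ((rep_br (hK.isBoundaryDatum _)).conv ((rep_br n2).add (rep_br n3))).integral hFm ht,
    ((rep_br (hK.isBoundaryDatum _)).conv (rep_br n2)).integral (ν := μHE[2]) hFm ht,
    ((rep_br (hK.isBoundaryDatum _)).conv (rep_br n3)).integral (ν := μHE[2]) hFm ht,
    ← map_add, mul_add]

lemma conv_green_heat (hB : IsSmoothRegion B r) {K : Field} (hK : IsKernel K)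
    {q : Fin 3 → Field} {θ : Field} (hq : ∀ j, IsC B 1 0 (q j)) (hθ : IsC B 1 0 θ) (ht : 0 ≤ t) :
    ∫ x in B, (K ⊛ ((∑ j, dx B j (q j)) ⊛ θ + ∑ j, q j ⊛ dx B j θ)) x t =
    ∫ x in frontier B, (K ⊛ ((∑ j, q j * nrm r j) ⊛ θ)) x t ∂μHE[2] := by
  have i1 := isFiniteMeasure_volume hB
  have i2 := isFiniteMeasure_area hB subset_rfl
  have hBm := hB.isOpen.measurableSet
  have hFm := hB.isCompact_frontier.measurableSet
  have c : ∀ {F : Field}, IsBoundaryDatum (closure B) F → Rep B F (br B F) :=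
    fun h => rep_br (h.mono subset_closure)
  have cF : ∀ {F : Field}, IsBoundaryDatum (closure B) F → IsBoundaryDatum (frontier B) F :=
    fun h => h.mono frontier_subset_closure
  have rdq := fun j => c ((hq j).isBoundaryDatum_dx hB j)
  have rq := fun j => c ((hq j).isBoundaryDatum hB)
  have rθ := c (hθ.isBoundaryDatum hB)
  have rdθ := fun j => c (hθ.isBoundaryDatum_dx hB j)
  have rn := fun j => rep_br ((cF ((hq j).isBoundaryDatum hB)).mul (isBoundaryDatum_nrm hB j))
  have rθ' := rep_br (cF (hθ.isBoundaryDatum hB))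
  have L := ((Rep.sum (s := Finset.univ) fun j => rdq j).conv rθ).add
    (.sum (s := Finset.univ) fun j => (rq j).conv (rdθ j))
  have R := (Rep.sum (s := Finset.univ) fun j => rn j).conv rθ'
  rw [← hK.tconv_integral hBm L.isBoundaryDatum ht, ← hK.tconv_integral hFm R.isBoundaryDatum ht]
  refine tconv_congr ht (fun _ _ => rfl) fun s hs => ?_
  rw [L.integral hBm hs.1, R.integral hFm hs.1]
  have h1 := fun j => ((((rdq j).conv rθ).add ((rq j).conv (rdθ j))).integral (ν := volume) hBm
    hs.1).symm.trans ((conv_green_one hB (hq j) hθ hs.1 j).trans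
      (((rn j).conv rθ').integral (ν := μHE[2]) hFm hs.1))
  have H := Finset.sum_congr (rfl : (Finset.univ : Finset (Fin 3)) = _) fun j _ => h1 j
  simp only [← map_sum] at H
  refine Eq.trans (congrArg _ ?_) (H.trans (congrArg _ ?_))
  · simp only [Finset.sum_mul, Finset.sum_add_distrib]
  · simp only [Finset.sum_mul]

/-- The boundary integrals obtained here are those over the whole boundary that `partInt_line`
produces, with the same kernels. -/
lemma intAt_green [IsFiniteMeasure ((volume : Measure E3).restrict B)] (hB : IsSmoothRegion B r)
    (h : IsAdmissible B p) (h' : IsAdmissible B p')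
    {a a' : Arr (UConv B)} (ha : Represents B p a) (ha' : Represents B p' a')
    {k : Kernels (UConv B)} (hk : RepKernels m B k) (ht : 0 ≤ t) :
    intAt volume hB.isOpen.measurableSet ht (k.χ * Arr.green m k a a') =
      (∑ i, ∫ x in frontier B, (kmech m ⊛ (tractionP B r p' i ⊛ p.u i)) x t ∂μHE[2])
      + (∑ i, ∫ x in frontier B, (kmech m ⊛ (hyperR r p' i ⊛ normalD B r (p.u i))) x t ∂μHE[2])
      + (∫ x in frontier B, (kmech m ⊛ (chargeΛ B r p' ⊛ p.φ)) x t ∂μHE[2])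
      + (∫ x in frontier B, (kmech m ⊛ (hyperH r p' ⊛ normalD B r p.φ)) x t ∂μHE[2])
      + 1 / m.T0 * ∫ x in frontier B, (kheat m ⊛ (fluxq r p' ⊛ p.θ)) x t ∂μHE[2] := by
  have hBm := hB.isOpen.measurableSet
  have rK : Rep B (kmech m) _ := hk.χ.conv (hk.ζ.conv hk.ξ)
  have rK' : Rep B (kheat m) _ := hk.χ.conv (hk.ξ.conv hk.l)
  have g1 := fun i => conv_green_kernel hB (isKernel_kmech m) (fun j => h'.τ j i)
    (fun k j => h'.μ k j i) ((h.u i).mono (by norm_num) (Nat.zero_le _)) ht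
  have g2 := conv_green_kernel hB (isKernel_kmech m) h'.σ h'.Q
    (h.φ.mono (by norm_num) (Nat.zero_le _)) ht
  have g3 := conv_green_heat hB (isKernel_kheat m) h'.q (h.θ.mono (by norm_num) (Nat.zero_le _)) ht
  have f1 := fun i => (rK.conv ((((ha'.divS i).conv (ha.u i)).add (.sum (s := Finset.univ)
    fun j => (ha'.τ j i).conv (ha.gu j i))).add (.sum (s := Finset.univ) fun k =>
    .sum (s := Finset.univ) fun j => (ha'.μ k j i).conv (ha.ggu k j i)))).integral
    (ν := volume) hBm ht
  have f2 := (rK.conv (((ha'.divD.conv ha.φ).add (.sum (s := Finset.univ)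
    fun j => (ha'.σ j).conv (ha.gφ j))).add (.sum (s := Finset.univ) fun k =>
    .sum (s := Finset.univ) fun j => (ha'.Q k j).conv (ha.ggφ k j)))).integral
    (ν := volume) hBm ht
  have f3 := (rK'.conv ((ha'.divq.conv ha.θ).add (.sum (s := Finset.univ)
    fun j => (ha'.q j).conv (ha.gθ j)))).integral (ν := volume) hBm ht
  have e1 := fun i => (g1 i).symm.trans (f1 i)
  have e2 := g2.symm.trans f2
  have e3 := g3.symm.trans f3
  have e3' := (congrArg (1 / m.T0 * ·) e3).trans
    (map_smul (intAt volume hBm ht) (1 / m.T0 : ℝ) _).symm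
  have H : (∑ i, (_ + _)) + (_ + _) + 1 / m.T0 * _ = (∑ i, _) + _ + _ :=
    congrArg₂ (· + ·) (congrArg₂ (· + ·) (Finset.sum_congr rfl fun i _ => e1 i) e2) e3'
  rw [Finset.sum_add_distrib, ← map_sum, ← map_add, ← map_add] at H
  refine Eq.trans (congrArg _ ?_) (H.symm.trans ?_)
  · have s2 : ∀ f : Fin 3 × Fin 3 → UConv B, ∑ x, f x = ∑ i, ∑ j, f (j, i) := fun f => by
      rw [Fintype.sum_prod_type, Finset.sum_comm]
    have s3 : ∀ f : Fin 3 × Fin 3 × Fin 3 → UConv B, ∑ x, f x = ∑ i, ∑ k, ∑ j, f (k, j, i) :=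
      fun f => by
        simp only [Fintype.sum_prod_type]
        refine Eq.trans (Finset.sum_congr rfl fun k _ => Finset.sum_comm) ?_
        rw [Finset.sum_comm]
    have s2' : ∀ f : Fin 3 × Fin 3 → UConv B, ∑ x, f x = ∑ k, ∑ j, f (k, j) :=
      fun f => Fintype.sum_prod_type f
    rw [← Finset.mul_sum]
    simp only [Finset.sum_add_distrib]
    simp only [Arr.green, dotProduct]
    rw [s2, s3, s2']
    algebra
  · exact congrArg (· + _) (add_assoc _ _ _).symm

/-- The first variation of the functional. -/
noncomputable def firstVar (m : Material) (B : Set E3) (r : E3 → ℝ) (S Sg : Fin 5 → Set E3)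
    (Γ : Data) (t : ℝ) (p p' : Proc) : ℝ :=
  (∫ x in B, (kχ m ⊛ (coefP m B Γ p).pair p') x t)
  + ((∑ i, partVar (S 0) (Sg 0) (kmech m) (tractionP B r p i) (Γ.bP i) (p.u i) (Γ.bu i)
        (tractionP B r p' i) (p'.u i) t)
    + (∑ i, partVar (S 1) (Sg 1) (kmech m) (hyperR r p i) (Γ.bR i) (normalD B r (p.u i)) (Γ.bd i)
        (hyperR r p' i) (normalD B r (p'.u i)) t)
    + partVar (S 3) (Sg 3) (kmech m) (chargeΛ B r p) Γ.bΛ p.φ Γ.bφ (chargeΛ B r p') p'.φ t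
    + partVar (S 4) (Sg 4) (kmech m) (hyperH r p) Γ.bH (normalD B r p.φ) Γ.bω
        (hyperH r p') (normalD B r p'.φ) t)
  + 1 / m.T0 * partVar (S 2) (Sg 2) (kheat m) (fluxq r p) Γ.bq p.θ Γ.bθ (fluxq r p') p'.θ t

/-- The volume density contributes Green's boundary integrals with a plus sign and the surface terms
contribute them with a minus sign. After cancellation only the pairing with `coefP` and the terms
`partVar` remain in first order. -/
theorem functional_line (hB : IsSmoothRegion B r) (hS : IsBoundarySplitting B S Sg)
    (hΓ : Γ.IsContinuous B S Sg) (h : IsAdmissible B p) (h' : IsAdmissible B p') (ht : 0 ≤ t) :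
    ∃ c : ℝ, ∀ s : ℝ, functional m B r S Sg Γ t (p + s • p') = functional m B r S Sg Γ t p
      + s * firstVar m B r S Sg Γ t p p' + s * s * c := by
  have i1 := isFiniteMeasure_volume hB
  have hBm := hB.isOpen.measurableSet
  have v := h.hasBoundaryValues hB
  have v' := h'.hasBoundaryValues hB
  have ha := h.represents hB
  have ha' := h'.represents hB
  have hk := repKernels m B
  have hd := repData m hB hΓ
  obtain ⟨c, hc⟩ := Arr.quad_line m (kernelsOf m B) (arrDataOf m B Γ) (arrOf B p) (arrOf B p')
  have gr := intAt_green hB h h' ha ha' hk ht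
  have K := isKernel_kmech m
  have K' := isKernel_kheat m
  choose c0 h0 using fun i => partInt_line hB (hS.isPart 0) K (v.P i) (v'.P i) (v.u i) (v'.u i)
    (hΓ.bu i) (hΓ.bP i) ht
  choose c1 h1 using fun i => partInt_line hB (hS.isPart 1) K (v.R i) (v'.R i) (v.du i) (v'.du i)
    (hΓ.bd i) (hΓ.bR i) ht
  obtain ⟨c3, h3⟩ := partInt_line hB (hS.isPart 3) K v.Λ v'.Λ v.φ v'.φ hΓ.bφ hΓ.bΛ ht
  obtain ⟨c4, h4⟩ := partInt_line hB (hS.isPart 4) K v.H v'.H v.dφ v'.dφ hΓ.bω hΓ.bH ht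
  obtain ⟨c2, h2⟩ := partInt_line hB (hS.isPart 2) K' v.q v'.q v.θ v'.θ hΓ.bθ hΓ.bq ht
  refine ⟨intAt volume hBm ht ((kernelsOf m B).χ * c) - (∑ i, c0 i + ∑ i, c1 i + c3 + c4)
    - 1 / m.T0 * c2, fun s => ?_⟩
  have l := boundaryLine hB h h' s
  have hvol := (hk.χ.conv ((ha.line hB h h' ha' s).volumeDensity hk hd)).integral
    (ν := volume) hBm ht
  have hvol' := (hk.χ.conv (ha.volumeDensity hk hd)).integral (ν := volume) hBm ht
  have hpair := (hk.χ.conv ((ha.coef hk hd).pair ha'.toRepComponents)).integral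
    (ν := volume) hBm ht
  rw [← Arr.resid_eq_pair] at hpair
  rw [hc, mul_add, mul_add, mul_smul_comm, mul_smul_comm, mul_add] at hvol
  simp only [map_add, map_smul, smul_eq_mul] at hvol
  rw [gr] at hvol
  rw [functional_eq hB hS hΓ (v.line v' l) ht, functional_eq hB hS hΓ v ht, firstVar, hvol, hvol',
    hpair, h3 s _ (p + s • p').φ l.Λ (fun _ _ _ _ => rfl), h4 s _ _ l.H l.dφ,
    h2 s _ (p + s • p').θ l.q (fun _ _ _ _ => rfl),
    Finset.sum_congr rfl fun i _ => h0 i s _ ((p + s • p').u i) (l.P i) (fun _ _ _ _ => rfl),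
    Finset.sum_congr rfl fun i _ => h1 i s _ _ (l.R i) (l.du i)]
  simp only [Finset.sum_add_distrib, Finset.sum_sub_distrib, ← Finset.mul_sum]
  ring

/-- A quadratic polynomial in `s` is differentiable at zero with its linear coefficient as
derivative, so existence of the derivative is no condition. -/
theorem variationVanishes_iff (hB : IsSmoothRegion B r) (hS : IsBoundarySplitting B S Sg)
    (hΓ : Γ.IsContinuous B S Sg) (h : IsAdmissible B p) (ht : 0 ≤ t) :
    VariationVanishes m B r S Sg Γ t p ↔
      ∀ p', IsAdmissible B p' → firstVar m B r S Sg Γ t p p' = 0 := by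
  refine forall₂_congr fun p' h' => ?_
  obtain ⟨c, hc⟩ := functional_line (m := m) hB hS hΓ h h' ht
  have hd : HasDerivAt (fun s : ℝ => functional m B r S Sg Γ t (p + s • p'))
      (firstVar m B r S Sg Γ t p p') 0 := by
    rw [funext hc]
    have h1 := (((hasDerivAt_id (0 : ℝ)).mul_const (firstVar m B r S Sg Γ t p p')).const_add
      (functional m B r S Sg Γ t p)).add
      (((hasDerivAt_id (0 : ℝ)).mul (hasDerivAt_id (0 : ℝ))).mul_const c)
    exact h1.congr_deriv (by simp)
  exact ⟨fun h => hd.unique h, fun h => h ▸ hd⟩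

end FirstVariation

end ThermoPiezo

namespace ThermoPiezo

/-! ### Inversion of the convolution kernels -/

section Inversion

variable {k f g A X W u θ η q h : ℝ → ℝ} {t T : ℝ}

/-- Convolution with the continuous function `k` is injective on every interval `[0, T]`. -/
structure IsInjKernel (k : ℝ → ℝ) : Prop where
  cont : ContinuousOn k (Ici 0)
  inj : ∀ A : ℝ → ℝ, ContinuousOn A (Ici 0) → ∀ T : ℝ, 0 < T →
    (∀ t ∈ Icc 0 T, tconv k A t = 0) → ∀ t ∈ Icc 0 T, A t = 0

/-- The exponential of `t - s` factors, which turns the convolution into an exponential times a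
primitive. -/
lemma tconv_exp (c a : ℝ) (A : ℝ → ℝ) (t : ℝ) :
    tconv (fun t => c * Real.exp (a * t)) A t
      = c * Real.exp (a * t) * ∫ s in (0 : ℝ)..t, Real.exp (-(a * s)) * A s := by
  rw [tconv_comm, tconv, ← intervalIntegral.integral_const_mul]
  refine intervalIntegral.integral_congr fun s _ => ?_
  have : Real.exp (a * (t - s)) = Real.exp (a * t) * Real.exp (-(a * s)) := by
    rw [← Real.exp_add]; ring_nf
  simp only [this]
  ring

/-- If the convolution vanishes on `[0, T]`, so does the primitive in `tconv_exp`. Differentiating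
it gives the claim inside the interval, and continuity gives the endpoints. The sign of the exponent
plays no role. -/
lemma isInjKernel_exp {c : ℝ} (hc : c ≠ 0) (a : ℝ) :
    IsInjKernel fun t => c * Real.exp (a * t) := by
  refine ⟨by fun_prop, fun A hA T hT h => ?_⟩
  have hG : ContinuousOn (fun s => Real.exp (-(a * s)) * A s) (Ici 0) :=
    ContinuousOn.mul (by fun_prop) hA
  have h0 : ∀ t ∈ Icc 0 T, ∫ s in (0 : ℝ)..t, Real.exp (-(a * s)) * A s = 0 := fun t ht => by
    have := h t ht
    rw [tconv_exp] at this
    exact (mul_eq_zero.1 this).resolve_left (mul_ne_zero hc (Real.exp_ne_zero _))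
  have h1 : EqOn A 0 (Ioo 0 T) := fun t ht => by
    have hn : Ici (0 : ℝ) ∈ 𝓝 t := Ici_mem_nhds ht.1
    have hd := intervalIntegral.integral_hasDerivAt_right
      ((hG.mono Icc_subset_Ici_self).intervalIntegrable_of_Icc ht.1.le)
      (ContinuousOn.stronglyMeasurableAtFilter_nhdsWithin
        (hG.mono Ioi_subset_Ici_self) measurableSet_Ioi t |>.filter_mono
        (by rw [(isOpen_Ioi (a := (0 : ℝ))).nhdsWithin_eq ht.1]))
      (hG.continuousAt hn)
    have hz : HasDerivAt (fun t => ∫ s in (0 : ℝ)..t, Real.exp (-(a * s)) * A s) 0 t := by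
      refine (hasDerivAt_const t (0 : ℝ)).congr_of_eventuallyEq ?_
      filter_upwards [Ioo_mem_nhds ht.1 ht.2] with s hs using h0 s ⟨hs.1.le, hs.2.le⟩
    exact (mul_eq_zero.1 (hd.unique hz)).resolve_left (Real.exp_ne_zero _)
  have h2 : EqOn A 0 (Icc 0 T) := h1.of_subset_closure (hA.mono Icc_subset_Ici_self)
    continuousOn_const Ioo_subset_Icc_self (closure_Ioo hT.ne).ge
  exact fun t ht => h2 ht

lemma IsInjKernel.conv (hf : IsInjKernel f) (hg : IsInjKernel g) : IsInjKernel (tconv f g) :=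
  ⟨continuousOn_tconv hf.cont hg.cont, fun A hA T hT h =>
    hg.inj A hA T hT (hf.inj _ (continuousOn_tconv hg.cont hA) T hT fun t ht => by
      rw [← tconv_assoc hf.cont hg.cont hA ht.1, h t ht])⟩

lemma IsInjKernel.iff (hk : IsInjKernel k) (hA : ContinuousOn A (Ici 0)) (hT : 0 < T) :
    (∀ t ∈ Icc 0 T, tconv k A t = 0) ↔ ∀ t ∈ Icc 0 T, A t = 0 :=
  ⟨hk.inj A hA T hT, fun h _ ht => tconv_eq_zero_right ht.1 fun s hs =>
    h s ⟨hs.1, hs.2.trans ht.2⟩⟩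

lemma tconv_one (A : ℝ → ℝ) (t : ℝ) : tconv (fun _ => 1) A t = ∫ s in (0 : ℝ)..t, A s := by
  rw [tconv_comm]; simp [tconv]

lemma isInjKernel_kl (x : E3) : IsInjKernel (kl x) := by
  have : kl x = fun t => 1 * Real.exp (0 * t) := by funext t; simp [kl]
  rw [this]; exact isInjKernel_exp one_ne_zero 0

lemma kξ_eq (x : E3) : kξ x = tconv (kl x) (kl x) := by
  funext t
  simp [kξ, kl, tconv]

lemma isInjKernel_kξ (x : E3) : IsInjKernel (kξ x) := by
  rw [kξ_eq]; exact (isInjKernel_kl x).conv (isInjKernel_kl x)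

lemma isInjKernel_kζ (m : Material) (x : E3) : IsInjKernel (kζ m x) := by
  have : kζ m x = fun t => 1 / m.β * Real.exp (-(1 / m.β) * t) := by
    funext t; simp only [kζ]; ring_nf
  rw [this]; exact isInjKernel_exp (one_div_ne_zero m.β_ne) _

lemma isInjKernel_kχ (m : Material) (x : E3) : IsInjKernel (kχ m x) := by
  have : kχ m x = fun t => 1 / m.β' * Real.exp (-(1 / m.β') * t) := by
    funext t; simp only [kχ]; ring_nf
  rw [this]; exact isInjKernel_exp (one_div_ne_zero m.β'_ne) _

lemma isInjKernel_kmech (m : Material) (x : E3) : IsInjKernel (kmech m x) :=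
  (isInjKernel_kχ m x).conv ((isInjKernel_kζ m x).conv (isInjKernel_kξ x))

lemma isInjKernel_kheat (m : Material) (x : E3) : IsInjKernel (kheat m x) :=
  (isInjKernel_kχ m x).conv ((isInjKernel_kξ x).conv (isInjKernel_kl x))

lemma integral_derivWithin (hA : ContDiffOn ℝ 1 A (Ici 0)) (ht : 0 ≤ t) :
    ∫ s in (0 : ℝ)..t, derivWithin A (Ici 0) s = A t - A 0 := by
  refine intervalIntegral.integral_eq_sub_of_hasDerivAt_of_le ht
    (hA.continuousOn.mono Icc_subset_Ici_self) (fun s hs => ?_) ?_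
  · exact ((hA.differentiableOn one_ne_zero s hs.1.le).hasDerivWithinAt).hasDerivAt
      (Ici_mem_nhds hs.1)
  · exact ((hA.continuousOn_derivWithin (uniqueDiffOn_Ici 0) le_rfl).mono
      Icc_subset_Ici_self).intervalIntegrable_of_Icc ht

lemma tconv_kl_derivWithin (x : E3) (hA : ContDiffOn ℝ 1 A (Ici 0)) (ht : 0 ≤ t) :
    tconv (kl x) (derivWithin A (Ici 0)) t = A t - A 0 :=
  (tconv_one _ _).trans (integral_derivWithin hA ht)

/-- With the integrating factor `exp (t / b)` the integrand is the derivative of `exp (t / b) * A`.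
This is how the combinations of the temperature with its rate arise from the relaxation kernels. -/
lemma tconv_exp_derivWithin {b : ℝ} (hb : b ≠ 0) (hA : ContDiffOn ℝ 1 A (Ici 0)) (ht : 0 ≤ t) :
    tconv (fun t => 1 / b * Real.exp (-t / b)) (fun t => A t + b * derivWithin A (Ici 0) t) t
      = A t - A 0 * Real.exp (-t / b) := by
  have hk : (fun t => 1 / b * Real.exp (-t / b)) = fun t => 1 / b * Real.exp (-(1 / b) * t) := by
    funext t; ring_nf
  have hE : ContDiffOn ℝ 1 (fun s => Real.exp (1 / b * s)) (Ici 0) := by fun_prop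
  have hd : ∀ s ∈ Ici (0 : ℝ), derivWithin (fun s => Real.exp (1 / b * s) * A s) (Ici 0) s
      = 1 / b * (Real.exp (-(-(1 / b) * s)) * (A s + b * derivWithin A (Ici 0) s)) := fun s hs => by
    have h1 : HasDerivWithinAt (fun s => Real.exp (1 / b * s)) (Real.exp (1 / b * s) * (1 / b))
        (Ici 0) s := by
      simpa using (((hasDerivAt_id s).const_mul (1 / b)).exp).hasDerivWithinAt
    rw [(h1.fun_mul (hA.differentiableOn one_ne_zero s hs).hasDerivWithinAt).derivWithin
      (uniqueDiffOn_Ici 0 s hs), neg_mul, neg_neg]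
    field_simp
  have hI := integral_derivWithin (hE.mul hA) ht
  rw [intervalIntegral.integral_congr (g := fun s => 1 / b * (Real.exp (-(-(1 / b) * s))
      * (A s + b * derivWithin A (Ici 0) s))) fun s hs => hd s (by
        rw [uIcc_of_le ht] at hs; exact hs.1), intervalIntegral.integral_const_mul] at hI
  rw [hk, tconv_exp, mul_right_comm, hI, mul_zero, Real.exp_zero, one_mul, sub_mul, mul_right_comm,
    ← Real.exp_add]
  rw [show 1 / b * t + -(1 / b) * t = 0 by ring, Real.exp_zero, one_mul,
    show -(1 / b) * t = -t / b by ring]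

/-- At time zero the convolution vanishes and isolates `a`; injectivity of the kernel then gives
`A`. Each use strips off one initial condition. -/
lemma forall_Icc_zero_of_initial (hT : 0 < T) {a : ℝ} (hA : ContinuousOn A (Ici 0)) (x : E3) :
    (∀ t ∈ Icc 0 T, tconv (kl x) A t + a = 0) ↔ a = 0 ∧ ∀ t ∈ Icc 0 T, A t = 0 := by
  constructor
  · intro h
    have h0 : a = 0 := by simpa [tconv_zero_time] using h 0 ⟨le_rfl, hT.le⟩
    exact ⟨h0, ((isInjKernel_kl x).iff hA hT).1 fun t ht => by simpa [h0] using h t ht⟩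
  · rintro ⟨rfl, h⟩ t ht
    rw [add_zero, ((isInjKernel_kl x).iff hA hT).2 h t ht]

/-- Since `ξ = l * l`, the left side is `l * (l * D + ρ (v0 - u'(0))) + ρ (u0 - u(0))` with `D` the
residual of the equation of motion. Two strips give displacement, velocity and equation. -/
theorem motion_iff (hT : 0 < T) {ρ u0 v0 : ℝ} (hρ : ρ ≠ 0) (hX : ContinuousOn X (Ici 0))
    (hf : ContinuousOn f (Ici 0)) (hu : ContDiffOn ℝ 2 u (Ici 0)) (x : E3) :
    (∀ t ∈ Icc 0 T, tconv (kξ x) X t + (ρ * tconv (kξ x) f t + (ρ * v0 * t + ρ * u0)) - ρ * u t = 0)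
      ↔ u 0 = u0 ∧ derivWithin u (Ici 0) 0 = v0 ∧
        ∀ t ∈ Icc 0 T, X t + ρ * f t = ρ * derivWithin (derivWithin u (Ici 0)) (Ici 0) t := by
  have hu' : ContDiffOn ℝ 1 (derivWithin u (Ici 0)) (Ici 0) :=
    hu.derivWithin (uniqueDiffOn_Ici 0) (by norm_num)
  have hu'' : ContinuousOn (derivWithin (derivWithin u (Ici 0)) (Ici 0)) (Ici 0) :=
    hu'.continuousOn_derivWithin (uniqueDiffOn_Ici 0) le_rfl
  have hl := (isInjKernel_kl x).cont
  have hξ := (isInjKernel_kξ x).cont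
  set D : ℝ → ℝ := X + ρ • f + (-ρ) • derivWithin (derivWithin u (Ici 0)) (Ici 0) with hD
  have cD : ContinuousOn D (Ici 0) := (hX.add (hf.const_smul ρ)).add (hu''.const_smul (-ρ))
  set v1 := derivWithin u (Ici 0) 0 with hv1
  have clD := continuousOn_tconv hl cD
  have e1 : ∀ t ∈ Icc 0 T, tconv (kξ x) (derivWithin (derivWithin u (Ici 0)) (Ici 0)) t
      = u t - u 0 - v1 * t := fun t ht => by
    rw [kξ_eq, tconv_assoc hl hl hu'' ht.1,
      tconv_congr ht.1 (g' := derivWithin u (Ici 0) + fun _ => -v1) (fun _ _ => rfl) fun s hs => by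
        rw [tconv_kl_derivWithin x hu' hs.1]; rfl,
      tconv_add hl hu'.continuousOn continuousOn_const ht.1,
      tconv_kl_derivWithin x (hu.of_le one_le_two) ht.1]
    have : tconv (kl x) (fun _ => -v1) t = -v1 * t := by
      rw [show kl x = fun _ => 1 from rfl, tconv_one, intervalIntegral.integral_const, smul_eq_mul]; ring
    rw [this]; ring
  have e2 : ∀ t ∈ Icc 0 T, tconv (kξ x) X t + (ρ * tconv (kξ x) f t + (ρ * v0 * t + ρ * u0))
      - ρ * u t = tconv (kl x) (tconv (kl x) D + fun _ => ρ * (v0 - v1)) t + ρ * (u0 - u 0) :=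
    fun t ht => by
    have hc : tconv (kl x) (fun _ => ρ * (v0 - v1)) t = ρ * (v0 - v1) * t := by
      rw [show kl x = fun _ => 1 from rfl, tconv_one, intervalIntegral.integral_const, smul_eq_mul]; ring
    rw [tconv_add hl clD continuousOn_const ht.1, hc, ← tconv_assoc hl hl cD ht.1, ← kξ_eq, hD,
      tconv_add hξ (hX.add (hf.const_smul ρ)) (hu''.const_smul (-ρ)) ht.1,
      tconv_add hξ hX (hf.const_smul ρ) ht.1, tconv_smul, tconv_smul, Pi.smul_apply, Pi.smul_apply,
      smul_eq_mul, smul_eq_mul, e1 t ht]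
    ring
  rw [forall₂_congr fun t ht => by rw [e2 t ht],
    forall_Icc_zero_of_initial hT (clD.add continuousOn_const) x]
  simp only [Pi.add_apply]
  rw [forall_Icc_zero_of_initial hT cD x]
  refine and_congr ?_ (and_congr ?_ (forall₂_congr fun t _ => ?_))
  · rw [mul_eq_zero, or_iff_right hρ, sub_eq_zero, eq_comm]
  · rw [mul_eq_zero, or_iff_right hρ, sub_eq_zero, eq_comm]
  · simp only [hD, Pi.add_apply, Pi.smul_apply, smul_eq_mul]
    constructor <;> intro h <;> linarith

/-- The left side is `l` convolved with the residual, up to sign, plus `a (η0 - η(0))`; one strip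
suffices. -/
theorem energy_iff (hT : 0 < T) {a ρ η0 : ℝ} (ha : a ≠ 0) (hq : ContinuousOn q (Ici 0))
    (hh : ContinuousOn h (Ici 0)) (hη : ContDiffOn ℝ 1 η (Ici 0)) (x : E3) :
    (∀ t ∈ Icc 0 T, -tconv (kl x) q t + (a * η0 + tconv (kl x) (ρ • h) t) - a * η t = 0)
      ↔ η 0 = η0 ∧ ∀ t ∈ Icc 0 T, a * derivWithin η (Ici 0) t + q t - ρ * h t = 0 := by
  have hη' : ContinuousOn (derivWithin η (Ici 0)) (Ici 0) :=
    hη.continuousOn_derivWithin (uniqueDiffOn_Ici 0) le_rfl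
  have hl := (isInjKernel_kl x).cont
  set D : ℝ → ℝ := (-1 : ℝ) • q + ρ • h + (-a) • derivWithin η (Ici 0) with hD
  have cD : ContinuousOn D (Ici 0) :=
    ((hq.const_smul (-1 : ℝ)).add (hh.const_smul ρ)).add (hη'.const_smul (-a))
  have e : ∀ t ∈ Icc 0 T, -tconv (kl x) q t + (a * η0 + tconv (kl x) (ρ • h) t) - a * η t
      = tconv (kl x) D t + a * (η0 - η 0) := fun t ht => by
    rw [hD, tconv_add hl ((hq.const_smul (-1 : ℝ)).add (hh.const_smul ρ)) (hη'.const_smul (-a)) ht.1,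
      tconv_add hl (hq.const_smul (-1 : ℝ)) (hh.const_smul ρ) ht.1, tconv_smul _ q, tconv_smul _ _ (-a),
      Pi.smul_apply, Pi.smul_apply, smul_eq_mul, smul_eq_mul, tconv_kl_derivWithin x hη ht.1]
    ring
  rw [forall₂_congr fun t ht => by rw [e t ht], forall_Icc_zero_of_initial hT cD x]
  refine and_congr ?_ (forall₂_congr fun t _ => ?_)
  · rw [mul_eq_zero, or_iff_right ha, sub_eq_zero, eq_comm]
  · simp only [hD, Pi.add_apply, Pi.smul_apply, smul_eq_mul]
    constructor <;> intro h <;> linarith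

/-- The expression is `1 / c` times the kernel convolved with the constitutive residual, plus `(θ(0)
- θ0) exp(-t / b)`. Time zero gives the initial temperature, and injectivity the constitutive
equation. -/
theorem relaxation_iff (hT : 0 < T) {b c θ0 : ℝ} (hb : b ≠ 0) (hc : c ≠ 0)
    (hW : ContinuousOn W (Ici 0)) (hθ : ContDiffOn ℝ 1 θ (Ici 0)) :
    (∀ t ∈ Icc 0 T, θ t - 1 / c * (-tconv (fun t => 1 / b * Real.exp (-t / b)) W t
        + c * θ0 * Real.exp (-t / b)) = 0)
      ↔ θ 0 = θ0 ∧ ∀ t ∈ Icc 0 T, W t + c * (θ t + b * derivWithin θ (Ici 0) t) = 0 := by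
  have hk : IsInjKernel fun t => 1 / b * Real.exp (-t / b) := by
    have : (fun t => 1 / b * Real.exp (-t / b)) = fun t => 1 / b * Real.exp (-(1 / b) * t) := by
      funext t; ring_nf
    rw [this]; exact isInjKernel_exp (one_div_ne_zero hb) _
  have hθ' : ContinuousOn (fun t => θ t + b * derivWithin θ (Ici 0) t) (Ici 0) :=
    hθ.continuousOn.add (continuousOn_const.mul
      (hθ.continuousOn_derivWithin (uniqueDiffOn_Ici 0) le_rfl))
  have cD : ContinuousOn (W + c • fun t => θ t + b * derivWithin θ (Ici 0) t) (Ici 0) :=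
    hW.add (hθ'.const_smul c)
  have e : ∀ t ∈ Icc 0 T, θ t - 1 / c * (-tconv (fun t => 1 / b * Real.exp (-t / b)) W t
        + c * θ0 * Real.exp (-t / b)) = 1 / c * tconv (fun t => 1 / b * Real.exp (-t / b))
        (W + c • fun t => θ t + b * derivWithin θ (Ici 0) t) t
        + (θ 0 - θ0) * Real.exp (-t / b) := fun t ht => by
    rw [tconv_add hk.cont hW (hθ'.const_smul c) ht.1, tconv_smul, Pi.smul_apply, smul_eq_mul,
      tconv_exp_derivWithin hb hθ ht.1]
    field_simp
    ring
  rw [forall₂_congr fun t ht => by rw [e t ht]]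
  constructor
  · intro h
    have h0 : θ 0 - θ0 = 0 := by simpa [tconv_zero_time] using h 0 ⟨le_rfl, hT.le⟩
    refine ⟨sub_eq_zero.1 h0, (hk.iff cD hT).1 fun t ht => ?_⟩
    have := h t ht
    rw [h0, zero_mul, add_zero] at this
    exact (mul_eq_zero.1 this).resolve_left (one_div_ne_zero hc)
  · rintro ⟨h0, h⟩ t ht
    rw [(hk.iff cD hT).2 h t ht, h0]
    ring

/-- By `hZ` the last term is `a θ`, and with the initial value known the terms in `θ` are minus the
kernel convolved with `a (θ + b θ')`. The thermal relation has to be settled before the mechanical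
ones. -/
theorem stress_iff (hT : 0 < T) {a b c θ0 : ℝ} {Z : ℝ → ℝ} (hb : b ≠ 0)
    (hX : ContinuousOn X (Ici 0)) (hθ : ContDiffOn ℝ 1 θ (Ici 0)) (h0 : θ 0 = θ0)
    (hZ : ∀ t ∈ Icc 0 T, θ t - 1 / c * Z t = 0) :
    (∀ t ∈ Icc 0 T, tconv (fun t => 1 / b * Real.exp (-t / b)) X t
        + a * θ0 * Real.exp (-t / b) - 1 / c * a * Z t = 0)
      ↔ ∀ t ∈ Icc 0 T, X t = a * (θ t + b * derivWithin θ (Ici 0) t) := by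
  have hk : IsInjKernel fun t => 1 / b * Real.exp (-t / b) := by
    have : (fun t => 1 / b * Real.exp (-t / b)) = fun t => 1 / b * Real.exp (-(1 / b) * t) := by
      funext t; ring_nf
    rw [this]; exact isInjKernel_exp (one_div_ne_zero hb) _
  have hθ' : ContinuousOn (fun t => θ t + b * derivWithin θ (Ici 0) t) (Ici 0) :=
    hθ.continuousOn.add (continuousOn_const.mul
      (hθ.continuousOn_derivWithin (uniqueDiffOn_Ici 0) le_rfl))
  have cD : ContinuousOn (X + (-a) • fun t => θ t + b * derivWithin θ (Ici 0) t) (Ici 0) :=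
    hX.add (hθ'.const_smul (-a))
  have e : ∀ t ∈ Icc 0 T, tconv (fun t => 1 / b * Real.exp (-t / b)) X t
        + a * θ0 * Real.exp (-t / b) - 1 / c * a * Z t = tconv (fun t => 1 / b * Real.exp (-t / b))
        (X + (-a) • fun t => θ t + b * derivWithin θ (Ici 0) t) t := fun t ht => by
    rw [tconv_add hk.cont hX (hθ'.const_smul (-a)) ht.1, tconv_smul, Pi.smul_apply, smul_eq_mul,
      tconv_exp_derivWithin hb hθ ht.1, h0]
    linear_combination a * hZ t ht
  rw [forall₂_congr fun t ht => by rw [e t ht], hk.iff cD hT]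
  refine forall₂_congr fun t _ => ?_
  simp only [Pi.add_apply, Pi.smul_apply, smul_eq_mul]
  constructor <;> intro h <;> linarith

end Inversion

end ThermoPiezo

namespace ThermoPiezo

/-! ### The field equations in terms of the coefficients of the first variation -/

lemma IsInjKernel.add_iff {k X Y : ℝ → ℝ} {T : ℝ} (hk : IsInjKernel k)
    (hX : ContinuousOn X (Ici 0)) (hY : ContinuousOn Y (Ici 0)) (hT : 0 < T) :
    (∀ t ∈ Icc 0 T, tconv k X t + tconv k Y t = 0) ↔ ∀ t ∈ Icc 0 T, X t + Y t = 0 :=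
  (forall₂_congr fun t ht => by rw [← tconv_add hk.cont hX hY ht.1]; rfl).trans
    (hk.iff (hX.add hY) hT)

/-- The symmetrized components of `c` vanish on `B × J`. -/
structure SymmVanishes (B : Set E3) (J : Set ℝ) (c : Proc) : Prop where
  u : ∀ x ∈ B, ∀ i, ∀ t ∈ J, c.u i x t = 0
  θ : ∀ x ∈ B, ∀ t ∈ J, c.θ x t = 0
  φ : ∀ x ∈ B, ∀ t ∈ J, c.φ x t = 0
  e : ∀ x ∈ B, ∀ i j, ∀ t ∈ J, c.e i j x t + c.e j i x t = 0
  κ : ∀ x ∈ B, ∀ i j k, ∀ t ∈ J, c.κ i j k x t + c.κ j i k x t = 0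
  b : ∀ x ∈ B, ∀ i, ∀ t ∈ J, c.b i x t = 0
  E : ∀ x ∈ B, ∀ i, ∀ t ∈ J, c.E i x t = 0
  V : ∀ x ∈ B, ∀ i j, ∀ t ∈ J, c.V i j x t + c.V j i x t = 0
  τ : ∀ x ∈ B, ∀ i j, ∀ t ∈ J, c.τ i j x t + c.τ j i x t = 0
  μ : ∀ x ∈ B, ∀ i j k, ∀ t ∈ J, c.μ i j k x t + c.μ j i k x t = 0
  σ : ∀ x ∈ B, ∀ i, ∀ t ∈ J, c.σ i x t = 0
  Q : ∀ x ∈ B, ∀ i j, ∀ t ∈ J, c.Q i j x t + c.Q j i x t = 0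
  η : ∀ x ∈ B, ∀ t ∈ J, c.η x t = 0
  q : ∀ x ∈ B, ∀ i, ∀ t ∈ J, c.q i x t = 0

section Coefficients

variable {m : Material} {B : Set E3} {r : E3 → ℝ} {S Sg : Fin 5 → Set E3} {Γ : Data}
  {p : Proc} {T : ℝ} {x : E3}

lemma conv_conv_iff {K L : Field} {X : ℝ → ℝ} (hK : IsInjKernel (K x)) (hL : IsInjKernel (L x))
    (hT : 0 < T) (hX : ContinuousOn X (Ici 0)) :
    (∀ t ∈ Icc 0 T, tconv (K x) (tconv (L x) X) t = 0) ↔ ∀ t ∈ Icc 0 T, X t = 0 :=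
  (hK.iff (continuousOn_tconv hL.cont hX) hT).trans (hL.iff hX hT)

lemma conv_conv_add_iff {K L : Field} {X Y : ℝ → ℝ} (hK : IsInjKernel (K x))
    (hL : IsInjKernel (L x)) (hT : 0 < T) (hX : ContinuousOn X (Ici 0))
    (hY : ContinuousOn Y (Ici 0)) :
    (∀ t ∈ Icc 0 T, tconv (K x) (tconv (L x) X) t + tconv (K x) (tconv (L x) Y) t = 0) ↔
      ∀ t ∈ Icc 0 T, X t + Y t = 0 :=
  (hK.add_iff (continuousOn_tconv hL.cont hX) (continuousOn_tconv hL.cont hY) hT).trans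
    (hL.add_iff hX hY hT)

lemma continuousOn_of_rep {F : Field} {a : UConv B} (h : Rep B F a) (hx : x ∈ B) :
    ContinuousOn (F x) (Ici 0) := h.isBoundaryDatum.time hx

lemma coef_u_iff (hB : IsSmoothRegion B r) (hΓ : Γ.IsContinuous B S Sg) (h : IsAdmissible B p)
    (hT : 0 < T) (hx : x ∈ B) (i : Fin 3) :
    (∀ t ∈ Icc 0 T, (coefP m B Γ p).u i x t = 0) ↔ p.u i x 0 = Γ.u0 i x ∧
      dt (p.u i) x 0 = Γ.v0 i x ∧ ∀ t ∈ Icc 0 T,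
      (∑ j, dx B j (p.τ j i)) x t - (∑ k, ∑ j, dx B j (dx B k (p.μ k j i))) x t
        + m.ρ * Γ.f i x t = m.ρ * dt (dt (p.u i)) x t := by
  have ha := h.represents hB
  have hk := repKernels m B
  have hd := repData m hB hΓ
  exact ((isInjKernel_kζ m x).iff (continuousOn_of_rep (((hk.ξ.conv (ha.divS i)).add
    (hd.F i)).sub ((ha.u i).smul m.ρ)) hx) hT).trans
    (motion_iff hT m.ρ_pos.ne' (continuousOn_of_rep (ha.divS i) hx)
      (((hΓ.f i).isBoundaryDatum hB).time hx)
      (by exact_mod_cast (h.u i).time x (subset_closure hx)) x)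

lemma coef_θ_iff (hB : IsSmoothRegion B r) (hΓ : Γ.IsContinuous B S Sg) (h : IsAdmissible B p)
    (hT : 0 < T) (hx : x ∈ B) :
    (∀ t ∈ Icc 0 T, (coefP m B Γ p).θ x t = 0) ↔ p.η x 0 = Γ.η0 x ∧
      ∀ t ∈ Icc 0 T,
      m.ρ * m.T0 * dt p.η x t + (∑ j, dx B j (p.q j)) x t - m.ρ * Γ.h x t = 0 := by
  have ha := h.represents hB
  have hk := repKernels m B
  have hd := repData m hB hΓ
  refine Iff.trans ?_ (((isInjKernel_kξ x).iff (continuousOn_of_rep (((((hk.l.conv ha.divq).neg.add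
    hd.H).sub (ha.η.smul (m.ρ * m.T0))).smul (1 / m.T0))) hx) hT).trans (Iff.trans ?_
    (energy_iff hT (mul_ne_zero m.ρ_pos.ne' m.T0_pos.ne') (continuousOn_of_rep ha.divq hx)
      ((hΓ.h.isBoundaryDatum hB).time hx)
      (by exact_mod_cast h.η.time x (subset_closure hx)) x)))
  · exact forall₂_congr fun t _ => neg_eq_zero
  · exact forall₂_congr fun t _ => mul_eq_zero_iff_left (one_div_ne_zero m.T0_pos.ne')

lemma coef_φ_iff (hB : IsSmoothRegion B r) (hΓ : Γ.IsContinuous B S Sg) (h : IsAdmissible B p)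
    (hT : 0 < T) (hx : x ∈ B) :
    (∀ t ∈ Icc 0 T, (coefP m B Γ p).φ x t = 0) ↔ ∀ t ∈ Icc 0 T,
      (∑ i, dx B i (p.σ i)) x t - (∑ j, ∑ i, dx B i (dx B j (p.Q j i))) x t = Γ.g x t := by
  have ha := h.represents hB
  have hd := repData m hB hΓ
  exact (conv_conv_iff (isInjKernel_kζ m x) (isInjKernel_kξ x) hT
    (continuousOn_of_rep (ha.divD.sub hd.g) hx)).trans
    (forall₂_congr fun t _ => sub_eq_zero)

lemma continuousOn_W (hB : IsSmoothRegion B r) (h : IsAdmissible B p) (hx : x ∈ B) :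
    ContinuousOn ((m.ρ • p.η - hatρη m p) x) (Ici 0) :=
  continuousOn_of_rep (h.represents hB).W hx

/-- The entropy coefficient is kept here in the form that the equations for `τ` and `Q` consume as a
hypothesis. -/
lemma coef_η_iff' (hB : IsSmoothRegion B r) (hΓ : Γ.IsContinuous B S Sg) (h : IsAdmissible B p)
    (hT : 0 < T) (hx : x ∈ B) :
    (∀ t ∈ Icc 0 T, (coefP m B Γ p).η x t = 0) ↔
      ∀ t ∈ Icc 0 T, p.θ x t - 1 / m.c * relaxZ m Γ p x t = 0 := by
  have ha := h.represents hB
  have hk := repKernels m B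
  have hd := repData m hB hΓ
  refine Iff.trans ?_ ((isInjKernel_kξ x).iff (continuousOn_of_rep (ha.θ.sub
    ((ha.Z hk hd).smul (1 / m.c))) hx) hT)
  exact forall₂_congr fun t _ => mul_eq_zero_iff_left m.ρ_pos.ne'

lemma coef_η_iff (hB : IsSmoothRegion B r) (hΓ : Γ.IsContinuous B S Sg) (h : IsAdmissible B p)
    (hT : 0 < T) (hx : x ∈ B) :
    (∀ t ∈ Icc 0 T, (coefP m B Γ p).η x t = 0) ↔ p.θ x 0 = Γ.θ0 x ∧
      ∀ t ∈ Icc 0 T, -(m.ρ * p.η x t) = ∑ i, ∑ j, m.a14 i j * p.e i j x t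
        + ∑ i, ∑ j, m.a47 i j * p.V i j x t + m.c * (p.θ x t + m.β' * dt p.θ x t) := by
  refine (coef_η_iff' hB hΓ h hT hx).trans ((relaxation_iff hT m.β'_ne m.c_ne
    (continuousOn_W (m := m) hB h hx)
    ((by exact_mod_cast h.θ.time x (subset_closure hx) : ContDiffOn ℝ 2 (p.θ x) (Ici 0)).of_le
      one_le_two)).trans (and_congr_right fun _ => forall₂_congr fun t _ => ?_))
  have e : (m.ρ • p.η - hatρη m p) x t = m.ρ * p.η x t + (∑ i, ∑ j, m.a14 i j * p.e i j x t
      + ∑ i, ∑ j, m.a47 i j * p.V i j x t) := by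
    simp only [hatρη, sub_neg_eq_add, Pi.add_apply, Finset.sum_apply, Pi.smul_apply, smul_eq_mul]
  rw [e]
  change _ + m.c * (_ + m.β' * dt p.θ x t) = 0 ↔ _
  constructor <;> intro h <;> linarith

lemma hatτ_apply (i j : Fin 3) (t : ℝ) : hatτ m p i j x t = ∑ k, ∑ l, m.a11 i j k l * p.e k l x t
    + ∑ k, ∑ l, m.a17 i j k l * p.V k l x t := by
  simp only [hatτ, Pi.add_apply, Finset.sum_apply, Pi.smul_apply, smul_eq_mul]

lemma hatQ_apply (i j : Fin 3) (t : ℝ) : hatQ m p i j x t = -(∑ k, ∑ l, m.a17 k l i j * p.e k l x t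
    + ∑ k, ∑ l, m.a77 i j k l * p.V k l x t) := by
  simp only [hatQ, Pi.neg_apply, Pi.add_apply, Finset.sum_apply, Pi.smul_apply, smul_eq_mul]

lemma hatμ_apply (i j k : Fin 3) (t : ℝ) : hatμ m p i j k x t
    = ∑ l, ∑ h, ∑ n, m.a22 i j k l h n * p.κ l h n x t + ∑ l, m.a23 i j k l * p.E l x t := by
  simp only [hatμ, Pi.add_apply, Finset.sum_apply, Pi.smul_apply, smul_eq_mul]

lemma hatσ_apply (i : Fin 3) (t : ℝ) : hatσ m p i x t
    = -(∑ j, ∑ k, ∑ l, m.a23 j k l i * p.κ j k l x t + ∑ j, m.a33 i j * p.E j x t) := by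
  simp only [hatσ, Pi.neg_apply, Pi.add_apply, Finset.sum_apply, Pi.smul_apply, smul_eq_mul]

lemma hatq_apply (i : Fin 3) (t : ℝ) :
    hatq m p i x t = -(m.T0 * ∑ j, m.k i j * p.b j x t) := by
  simp only [hatq, Pi.neg_apply, Finset.sum_apply, Pi.smul_apply, smul_eq_mul]

/-- The material symmetries and the symmetry of `τ` make this coefficient symmetric already, so its
symmetrization vanishes only together with the coefficient itself. -/
lemma coef_e_iff (hB : IsSmoothRegion B r) (hΓ : Γ.IsContinuous B S Sg) (h : IsAdmissible B p)
    (hT : 0 < T) (hx : x ∈ B) (h0 : p.θ x 0 = Γ.θ0 x)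
    (hZ : ∀ t ∈ Icc 0 T, p.θ x t - 1 / m.c * relaxZ m Γ p x t = 0) (i j : Fin 3) :
    (∀ t ∈ Icc 0 T, (coefP m B Γ p).e i j x t + (coefP m B Γ p).e j i x t = 0) ↔
      ∀ t ∈ Icc 0 T,
    p.τ i j x t = ∑ k, ∑ l, m.a11 i j k l * p.e k l x t + ∑ k, ∑ l, m.a17 i j k l * p.V k l x t
      + m.a14 i j * (p.θ x t + m.β * dt p.θ x t) := by
  have ha := h.represents hB
  have hk := repKernels m B
  have hd := repData m hB hΓ
  have hs : ∀ t ∈ Icc 0 T, (coefP m B Γ p).e j i x t = (coefP m B Γ p).e i j x t := fun t ht => by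
    have e1 : ∀ s ∈ Icc 0 t, (p.τ j i - hatτ m p j i) x s = (p.τ i j - hatτ m p i j) x s :=
      fun s hs => by
        simp only [Pi.sub_apply, hatτ_apply, (h.symm x (subset_closure hx) s hs.1 j i 0).2.2.2.1,
          fun k l => (m.a11_symm j i k l).1, fun k l => (m.a17_symm j i k l).1]
    refine tconv_congr ht.1 (fun _ _ => rfl) fun s hs => ?_
    have e2 : (kζ m ⊛ (p.τ j i - hatτ m p j i)) x s = (kζ m ⊛ (p.τ i j - hatτ m p i j)) x s :=
      tconv_congr hs.1 (fun _ _ => rfl) fun s' hs' => e1 s' ⟨hs'.1, hs'.2.trans hs.2⟩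
    simp only [Pi.add_apply, Pi.sub_apply, Pi.smul_apply, dataL, m.a14_symm j i] at e2 ⊢
    rw [e2]
  refine Iff.trans (forall₂_congr fun t ht => by rw [hs t ht, add_self_eq_zero]; rfl)
    (((isInjKernel_kξ x).iff (continuousOn_of_rep (((hk.ζ.conv ((ha.τ i j).sub (ha.hatτ i j))).add
    (hd.L i j)).sub ((ha.Z hk hd).smul (1 / m.c * m.a14 i j))) hx) hT).trans
    ((stress_iff hT m.β_ne (continuousOn_of_rep ((ha.τ i j).sub (ha.hatτ (m := m) i j)) hx)
    ((by exact_mod_cast h.θ.time x (subset_closure hx) : ContDiffOn ℝ 2 (p.θ x) (Ici 0)).of_le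
      one_le_two) h0 hZ).trans (forall₂_congr fun t _ => ?_)))
  rw [show (p.τ i j - hatτ m p i j) x t = p.τ i j x t - hatτ m p i j x t from rfl, hatτ_apply,
    sub_eq_iff_eq_add']
  rfl

lemma coef_V_iff (hB : IsSmoothRegion B r) (hΓ : Γ.IsContinuous B S Sg) (h : IsAdmissible B p)
    (hT : 0 < T) (hx : x ∈ B) (h0 : p.θ x 0 = Γ.θ0 x)
    (hZ : ∀ t ∈ Icc 0 T, p.θ x t - 1 / m.c * relaxZ m Γ p x t = 0) (i j : Fin 3) :
    (∀ t ∈ Icc 0 T, (coefP m B Γ p).V i j x t + (coefP m B Γ p).V j i x t = 0) ↔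
      ∀ t ∈ Icc 0 T,
    -p.Q i j x t = ∑ k, ∑ l, m.a17 k l i j * p.e k l x t + ∑ k, ∑ l, m.a77 i j k l * p.V k l x t
      + m.a47 i j * (p.θ x t + m.β * dt p.θ x t) := by
  have ha := h.represents hB
  have hk := repKernels m B
  have hd := repData m hB hΓ
  have hs : ∀ t ∈ Icc 0 T, (coefP m B Γ p).V j i x t = (coefP m B Γ p).V i j x t := fun t ht => by
    have e1 : ∀ s ∈ Icc 0 t, (p.Q j i - hatQ m p j i) x s = (p.Q i j - hatQ m p i j) x s :=
      fun s hs => by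
        simp only [Pi.sub_apply, hatQ_apply, (h.symm x (subset_closure hx) s hs.1 j i 0).2.2.2.2.2,
          fun k l => (m.a77_symm j i k l).1, fun k l => (m.a17_symm k l j i).2]
    refine tconv_congr ht.1 (fun _ _ => rfl) fun s hs => ?_
    have e2 : (kζ m ⊛ (p.Q j i - hatQ m p j i)) x s = (kζ m ⊛ (p.Q i j - hatQ m p i j)) x s :=
      tconv_congr hs.1 (fun _ _ => rfl) fun s' hs' => e1 s' ⟨hs'.1, hs'.2.trans hs.2⟩
    simp only [Pi.add_apply, Pi.sub_apply, Pi.neg_apply, Pi.smul_apply, dataM, m.a47_symm j i]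
      at e2 ⊢
    rw [e2]
  refine Iff.trans (forall₂_congr fun t ht => by rw [hs t ht, add_self_eq_zero]; rfl)
    (((isInjKernel_kξ x).iff (continuousOn_of_rep (((hk.ζ.conv ((ha.Q i j).sub
    (ha.hatQ (m := m) i j))).neg.add (hd.M i j)).sub ((ha.Z hk hd).smul (1 / m.c * m.a47 i j))) hx)
    hT).trans (Iff.trans (forall₂_congr fun t ht => ?_)
    ((stress_iff (a := m.a47 i j) hT m.β_ne
    (continuousOn_of_rep (((ha.Q i j).sub (ha.hatQ (m := m) i j)).smul (-1)) hx)
    ((by exact_mod_cast h.θ.time x (subset_closure hx) : ContDiffOn ℝ 2 (p.θ x) (Ici 0)).of_le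
      one_le_two) h0 hZ).trans (forall₂_congr fun t _ => ?_))))
  -- `Q` enters with the opposite sign to `τ`, so the stress criterion is applied to `-(Q - Q̂)`.
  · have e : tconv (fun t => 1 / m.β * Real.exp (-t / m.β)) (((-1 : ℝ) • (p.Q i j - hatQ m p i j)) x) t
        = -(kζ m ⊛ (p.Q i j - hatQ m p i j)) x t := by
      rw [show ((-1 : ℝ) • (p.Q i j - hatQ m p i j)) x = (-1 : ℝ) • (p.Q i j - hatQ m p i j) x from rfl,
        tconv_smul, neg_one_smul]
      rfl
    rw [e]
    rfl
  · rw [show ((-1 : ℝ) • (p.Q i j - hatQ m p i j)) x t = -1 * (p.Q i j x t - hatQ m p i j x t) from rfl,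
      hatQ_apply]
    change _ = m.a47 i j * (_ + m.β * dt p.θ x t) ↔ _
    constructor <;> intro h <;> linarith

lemma coef_κ_iff (hB : IsSmoothRegion B r) (h : IsAdmissible B p) (hT : 0 < T) (hx : x ∈ B)
    (i j k : Fin 3) :
    (∀ t ∈ Icc 0 T, (coefP m B Γ p).κ i j k x t + (coefP m B Γ p).κ j i k x t = 0) ↔
      ∀ t ∈ Icc 0 T, p.μ i j k x t = ∑ l, ∑ h, ∑ n, m.a22 i j k l h n * p.κ l h n x t
      + ∑ l, m.a23 i j k l * p.E l x t := by
  have ha := h.represents hB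
  have c := fun i j => continuousOn_of_rep ((ha.μ i j k).sub (ha.hatμ (m := m) i j k)) hx
  refine (conv_conv_add_iff (isInjKernel_kζ m x) (isInjKernel_kξ x) hT (c i j) (c j i)).trans
    (forall₂_congr fun t ht => ?_)
  simp only [Pi.sub_apply, hatμ_apply, (h.symm x (subset_closure hx) t ht.1 j i k).2.2.2.2.1,
    fun l n s => (m.a22_symm j i k l n s).1, fun l => m.a23_symm j i k l, add_self_eq_zero,
    sub_eq_zero]

lemma coef_b_iff (hB : IsSmoothRegion B r) (h : IsAdmissible B p) (hT : 0 < T) (hx : x ∈ B)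
    (i : Fin 3) :
    (∀ t ∈ Icc 0 T, (coefP m B Γ p).b i x t = 0) ↔
      ∀ t ∈ Icc 0 T, -(p.q i x t / m.T0) = ∑ j, m.k i j * p.b j x t := by
  have ha := h.represents hB
  have hT0 := m.T0_pos.ne'
  refine (conv_conv_iff (isInjKernel_kξ x) (isInjKernel_kl x) hT
    (continuousOn_of_rep (((ha.q i).sub (ha.hatq (m := m) i)).smul (1 / m.T0)) hx)).trans
    (forall₂_congr fun t _ => ?_)
  rw [show ((1 / m.T0) • (p.q i - hatq m p i)) x t = 1 / m.T0 * (p.q i x t - hatq m p i x t) from rfl,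
    hatq_apply, mul_eq_zero_iff_left (one_div_ne_zero hT0), neg_eq_iff_eq_neg, div_eq_iff hT0]
  constructor <;> intro h <;> linarith

lemma coef_E_iff (hB : IsSmoothRegion B r) (h : IsAdmissible B p) (hT : 0 < T) (hx : x ∈ B)
    (i : Fin 3) :
    (∀ t ∈ Icc 0 T, (coefP m B Γ p).E i x t = 0) ↔ ∀ t ∈ Icc 0 T,
      -p.σ i x t = ∑ j, ∑ k, ∑ l, m.a23 j k l i * p.κ j k l x t + ∑ j, m.a33 i j * p.E j x t := by
  have ha := h.represents hB
  refine Iff.trans (forall₂_congr fun t _ => neg_eq_zero) ((conv_conv_iff (isInjKernel_kζ m x)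
    (isInjKernel_kξ x) hT (continuousOn_of_rep ((ha.σ i).sub (ha.hatσ (m := m) i)) hx)).trans
    (forall₂_congr fun t _ => ?_))
  rw [show (p.σ i - hatσ m p i) x t = p.σ i x t - hatσ m p i x t from rfl, hatσ_apply]
  constructor <;> intro h <;> linarith

/-- The coefficient contains the full displacement gradient, which is not symmetric. Only its
symmetrization is seen by symmetric stresses, and that is the strain relation. -/
lemma coef_τ_iff (hB : IsSmoothRegion B r) (h : IsAdmissible B p) (hT : 0 < T) (hx : x ∈ B)
    (i j : Fin 3) :
    (∀ t ∈ Icc 0 T, (coefP m B Γ p).τ i j x t + (coefP m B Γ p).τ j i x t = 0) ↔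
      ∀ t ∈ Icc 0 T, p.e i j x t = 1 / 2 * (dx B j (p.u i) x t + dx B i (p.u j) x t) := by
  have ha := h.represents hB
  have c := fun i j => continuousOn_of_rep ((ha.e i j).sub (ha.gu i j)) hx
  refine (conv_conv_add_iff (isInjKernel_kζ m x) (isInjKernel_kξ x) hT (c i j) (c j i)).trans
    (forall₂_congr fun t ht => ?_)
  simp only [Pi.sub_apply, (h.symm x (subset_closure hx) t ht.1 j i 0).1]
  constructor <;> intro h <;> linarith

lemma coef_μ_iff (hB : IsSmoothRegion B r) (h : IsAdmissible B p) (hT : 0 < T) (hx : x ∈ B)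
    (i j k : Fin 3) :
    (∀ t ∈ Icc 0 T, (coefP m B Γ p).μ i j k x t + (coefP m B Γ p).μ j i k x t = 0) ↔
      ∀ t ∈ Icc 0 T, p.κ i j k x t = dx B j (dx B i (p.u k)) x t := by
  have ha := h.represents hB
  have c := fun i j => continuousOn_of_rep ((ha.κ i j k).sub (ha.ggu i j k)) hx
  refine (conv_conv_add_iff (isInjKernel_kζ m x) (isInjKernel_kξ x) hT (c i j) (c j i)).trans
    (forall₂_congr fun t ht => ?_)
  have e : dx B i (dx B j (p.u k)) x t = dx B j (dx B i (p.u k)) x t :=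
    pd_comm hB (((h.u k).slice ht.1).of_le (by norm_num)) hx i j
  simp only [Pi.sub_apply, (h.symm x (subset_closure hx) t ht.1 j i k).2.1, e, add_self_eq_zero,
    sub_eq_zero]

lemma coef_σ_iff (hB : IsSmoothRegion B r) (h : IsAdmissible B p) (hT : 0 < T) (hx : x ∈ B)
    (i : Fin 3) :
    (∀ t ∈ Icc 0 T, (coefP m B Γ p).σ i x t = 0) ↔ ∀ t ∈ Icc 0 T,
      p.E i x t = -dx B i p.φ x t := by
  have ha := h.represents hB
  exact Iff.trans (forall₂_congr fun t _ => neg_eq_zero) ((conv_conv_iff (isInjKernel_kζ m x)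
    (isInjKernel_kξ x) hT (continuousOn_of_rep ((ha.E i).add (ha.gφ i)) hx)).trans
    (forall₂_congr fun t _ => add_eq_zero_iff_eq_neg))

lemma coef_Q_iff (hB : IsSmoothRegion B r) (h : IsAdmissible B p) (hT : 0 < T) (hx : x ∈ B)
    (i j : Fin 3) :
    (∀ t ∈ Icc 0 T, (coefP m B Γ p).Q i j x t + (coefP m B Γ p).Q j i x t = 0) ↔
      ∀ t ∈ Icc 0 T, p.V i j x t = -dx B j (dx B i p.φ) x t := by
  have ha := h.represents hB
  have c := fun i j => continuousOn_of_rep ((ha.V i j).add (ha.ggφ i j)) hx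
  refine Iff.trans (forall₂_congr fun t _ => ?_) ((conv_conv_add_iff (isInjKernel_kζ m x)
    (isInjKernel_kξ x) hT (c i j) (c j i)).trans (forall₂_congr fun t ht => ?_))
  · have e : ∀ a b : ℝ, -a + -b = 0 ↔ a + b = 0 := fun a b => by rw [← neg_add, neg_eq_zero]
    exact e _ _
  have e : dx B i (dx B j p.φ) x t = dx B j (dx B i p.φ) x t :=
    pd_comm hB ((h.φ.slice ht.1).of_le (by norm_num)) hx i j
  simp only [Pi.add_apply, (h.symm x (subset_closure hx) t ht.1 j i 0).2.2.1, e, add_self_eq_zero,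
    add_eq_zero_iff_eq_neg]

lemma coef_q_iff (hB : IsSmoothRegion B r) (h : IsAdmissible B p) (hT : 0 < T) (hx : x ∈ B)
    (i : Fin 3) :
    (∀ t ∈ Icc 0 T, (coefP m B Γ p).q i x t = 0) ↔ ∀ t ∈ Icc 0 T, p.b i x t = dx B i p.θ x t := by
  have ha := h.represents hB
  refine (conv_conv_iff (isInjKernel_kξ x) (isInjKernel_kl x) hT
    (continuousOn_of_rep (((ha.b i).sub (ha.gθ i)).smul (1 / m.T0)) hx)).trans
    (forall₂_congr fun t _ => ?_)
  rw [show ((1 / m.T0) • (p.b i - dx B i p.θ)) x t = 1 / m.T0 * (p.b i x t - dx B i p.θ x t) from rfl,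
    mul_eq_zero_iff_left (one_div_ne_zero m.T0_pos.ne'), sub_eq_zero]

/-- The coefficients are tested in the open region only; the initial conditions reach the boundary
by continuity. -/
lemma eqOn_closure {f g : E3 → ℝ} (hf : ContinuousOn f (closure B)) (hg : ContinuousOn g (closure B))
    (h : ∀ x ∈ B, f x = g x) : ∀ x ∈ closure B, f x = g x := fun _ hx =>
  EqOn.of_subset_closure (s := B) (t := closure B) h hf hg subset_closure subset_rfl hx

/-- In both directions the entropy coefficient comes first: it yields the initial temperature and
the relation between `θ` and `relaxZ` on which the coefficients of `e` and `V` depend. -/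
theorem symmVanishes_coefP_iff (hB : IsSmoothRegion B r) (hΓ : Γ.IsContinuous B S Sg)
    (h : IsAdmissible B p) (hT : 0 < T) : SymmVanishes B (Icc 0 T) (coefP m B Γ p) ↔
      SatisfiesFieldEquations m B Γ (Icc 0 T) p ∧ SatisfiesInitial B Γ p := by
  constructor
  · intro H
    have hu := fun x hx i => (coef_u_iff (m := m) hB hΓ h hT hx i).1 (H.u x hx i)
    have hθ := fun x hx => (coef_θ_iff (m := m) hB hΓ h hT hx).1 (H.θ x hx)
    have hη := fun x hx => (coef_η_iff (m := m) hB hΓ h hT hx).1 (H.η x hx)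
    have hZ := fun x hx => (coef_η_iff' (m := m) hB hΓ h hT hx).1 (H.η x hx)
    have c0 : ∀ {M N : ℕ} {F : Field}, IsC B M N F → ContinuousOn (fun x => F x 0) (closure B) :=
      fun hF => (hF.slice le_rfl).continuousOn
    refine ⟨⟨fun x hx t ht i => (hu x hx i).2.2 t ht,
      fun x hx t ht => (coef_φ_iff (m := m) hB hΓ h hT hx).1 (H.φ x hx) t ht,
      fun x hx t ht => (hθ x hx).2 t ht,
      fun x hx t ht i j => (coef_τ_iff (m := m) (Γ := Γ) hB h hT hx i j).1 (H.τ x hx i j) t ht,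
      fun x hx t ht i j k =>
        (coef_μ_iff (m := m) (Γ := Γ) hB h hT hx i j k).1 (H.μ x hx i j k) t ht,
      fun x hx t ht i => (coef_q_iff (m := m) (Γ := Γ) hB h hT hx i).1 (H.q x hx i) t ht,
      fun x hx t ht i => (coef_σ_iff (m := m) (Γ := Γ) hB h hT hx i).1 (H.σ x hx i) t ht,
      fun x hx t ht i j => (coef_Q_iff (m := m) (Γ := Γ) hB h hT hx i j).1 (H.Q x hx i j) t ht,
      fun x hx t ht i j => (coef_e_iff (m := m) hB hΓ h hT hx (hη x hx).1 (hZ x hx) i j).1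
        (H.e x hx i j) t ht,
      fun x hx t ht i j k =>
        (coef_κ_iff (m := m) (Γ := Γ) hB h hT hx i j k).1 (H.κ x hx i j k) t ht,
      fun x hx t ht i => (coef_E_iff (m := m) (Γ := Γ) hB h hT hx i).1 (H.E x hx i) t ht,
      fun x hx t ht i j => (coef_V_iff (m := m) hB hΓ h hT hx (hη x hx).1 (hZ x hx) i j).1
        (H.V x hx i j) t ht,
      fun x hx t ht => (hη x hx).2 t ht,
      fun x hx t ht i => (coef_b_iff (m := m) (Γ := Γ) hB h hT hx i).1 (H.b x hx i) t ht⟩,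
      ⟨fun x hx i => eqOn_closure (c0 (h.u i)) (hΓ.u0 i) (fun y hy => (hu y hy i).1) x hx,
      fun x hx i => eqOn_closure ?_ (hΓ.v0 i) (fun y hy => (hu y hy i).2.1) x hx,
      eqOn_closure (c0 h.θ) hΓ.θ0 fun y hy => (hη y hy).1,
      eqOn_closure (c0 h.η) hΓ.η0 fun y hy => (hθ y hy).1⟩⟩
    have := ((h.u i).space 1 one_le_two 0 self_mem_Ici).continuousOn
    simp only [iteratedDerivWithin_one] at this
    exact this
  · rintro ⟨F, I⟩
    have hη := fun x hx => (coef_η_iff (m := m) hB hΓ h hT hx).2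
      ⟨I.θ x (subset_closure hx), fun t ht => F.const_η x hx t ht⟩
    have hZ := fun x hx => (coef_η_iff' (m := m) hB hΓ h hT hx).1 (hη x hx)
    exact ⟨fun x hx i => (coef_u_iff (m := m) hB hΓ h hT hx i).2
        ⟨I.u x (subset_closure hx) i, I.v x (subset_closure hx) i, fun t ht => F.motion x hx t ht i⟩,
      fun x hx => (coef_θ_iff (m := m) hB hΓ h hT hx).2
        ⟨I.η x (subset_closure hx), fun t ht => F.energy x hx t ht⟩,
      fun x hx => (coef_φ_iff (m := m) hB hΓ h hT hx).2 fun t ht => F.electric x hx t ht,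
      fun x hx i j => (coef_e_iff (m := m) hB hΓ h hT hx (I.θ x (subset_closure hx)) (hZ x hx)
        i j).2 fun t ht => F.const_τ x hx t ht i j,
      fun x hx i j k => (coef_κ_iff hB h hT hx i j k).2 fun t ht => F.const_μ x hx t ht i j k,
      fun x hx i => (coef_b_iff hB h hT hx i).2 fun t ht => F.const_q x hx t ht i,
      fun x hx i => (coef_E_iff hB h hT hx i).2 fun t ht => F.const_σ x hx t ht i,
      fun x hx i j => (coef_V_iff (m := m) hB hΓ h hT hx (I.θ x (subset_closure hx)) (hZ x hx)
        i j).2 fun t ht => F.const_Q x hx t ht i j,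
      fun x hx i j => (coef_τ_iff hB h hT hx i j).2 fun t ht => F.geom_e x hx t ht i j,
      fun x hx i j k => (coef_μ_iff hB h hT hx i j k).2 fun t ht => F.geom_κ x hx t ht i j k,
      fun x hx i => (coef_σ_iff hB h hT hx i).2 fun t ht => F.geom_E x hx t ht i,
      fun x hx i j => (coef_Q_iff hB h hT hx i j).2 fun t ht => F.geom_V x hx t ht i j,
      hη,
      fun x hx i => (coef_q_iff hB h hT hx i).2 fun t ht => F.geom_b x hx t ht i⟩

end Coefficients

end ThermoPiezo

namespace ThermoPiezo

/-! ### Test fields -/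

/-- The product of a function of the position and a function of time. -/
def sep (w : E3 → ℝ) (ψ : ℝ → ℝ) : Field := fun x t => w x * ψ t

section Separable

variable {B : Set E3} {r : E3 → ℝ} {w : E3 → ℝ} {ψ : ℝ → ℝ} {M N : ℕ}

lemma isC_sep (hB : IsSmoothRegion B r) (hw : ContDiff ℝ ∞ w) (hψ : ContDiff ℝ ∞ ψ) :
    IsC B M N (sep w ψ) := by
  have hc : ∀ n : ℕ, ContinuousOn (iteratedDerivWithin n ψ (Ici 0)) (Ici 0) := fun n =>
    hψ.contDiffOn.continuousOn_iteratedDerivWithin (by exact_mod_cast le_top) (uniqueDiffOn_Ici 0)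
  have hM : ∀ n : ℕ, ContDiffOn ℝ n w (closure B) := fun n =>
    (hw.of_le (by exact_mod_cast le_top)).contDiffOn
  have he : ∀ n t, (fun x => iteratedDerivWithin n (sep w ψ x) (Ici 0) t)
      = iteratedDerivWithin n ψ (Ici 0) t • w := fun n t => by
    funext x
    exact (iteratedDerivWithin_const_mul_field (w x) ψ).trans (mul_comm _ _)
  refine ⟨fun x _ => ?_, fun n _ t _ => ?_, fun n _ m _ => ?_⟩
  · exact ((contDiff_const.mul hψ).of_le (by exact_mod_cast le_top)).contDiffOn
  · rw [he]
    exact contDiffOn_const.smul (hM M)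
  · refine ContinuousOn.congr (f := fun p : E3 × ℝ => iteratedDerivWithin n ψ (Ici 0) p.2 •
      iteratedFDerivWithin ℝ m w (closure B) p.1) ?_ fun p hp => ?_
    · exact ((hc n).comp continuousOn_snd fun p hp => hp.2).smul
        (((hM m).continuousOn_iteratedFDerivWithin le_rfl hB.uniqueDiffOn).comp continuousOn_fst
          fun p hp => hp.1)
    · simp only [he]
      exact iteratedFDerivWithin_const_smul_apply (hM m p.1 hp.1) hB.uniqueDiffOn hp.1

lemma isC_zero (hB : IsSmoothRegion B r) : IsC B M N 0 := by
  have := isC_sep (M := M) (N := N) hB (w := fun _ => 0) contDiff_const (ψ := fun _ => 0)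
    contDiff_const
  have e : sep (fun _ => 0) (fun _ => 0) = 0 := by funext x t; simp [sep]
  rwa [e] at this

end Separable

/-! ### Fundamental lemmas of the calculus of variations, in space and in time -/

section Separating

variable {S : Set E3} {ν : Measure E3} {𝒲 : Set (E3 → ℝ)} {F : Field} {T : ℝ}

/-- Bounded continuous functions on `S` are determined by their integrals against `𝒲`. -/
def IsSeparating (S : Set E3) (ν : Measure E3) (𝒲 : Set (E3 → ℝ)) : Prop :=
  ∀ g : E3 → ℝ, ContinuousOn g S → IntegrableOn g S ν →
    (∀ w ∈ 𝒲, ∫ x in S, w x * g x ∂ν = 0) → ∀ x ∈ S, g x = 0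

/-- If a value were nonzero, continuity would keep the function nonzero on a relative neighbourhood,
whose measure is positive by hypothesis. -/
lemma eq_zero_of_ae_of_fat {g : E3 → ℝ} (hg : ContinuousOn g S)
    (hfat : ∀ x ∈ S, ∀ U ∈ 𝓝 x, 0 < ν (S ∩ U)) (h : ∀ᵐ x ∂ν, x ∈ S → g x = 0) :
    ∀ x ∈ S, g x = 0 := by
  intro x hx
  by_contra hne
  obtain ⟨U, hU, hUS⟩ := mem_nhdsWithin_iff_exists_mem_nhds_inter.1
    ((hg x hx).eventually_ne hne)
  refine (hfat x hx U hU).ne' (measure_mono_null ?_ h)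
  intro y hy hz
  exact hUS ⟨hy.2, hy.1⟩ (hz hy.1)

/-- Tests with support inside `B` suffice for the volume, and they leave no trace on the boundary.
-/
lemma isSeparating_volume {B : Set E3} (hB : IsOpen B) :
    IsSeparating B volume {w | ContDiff ℝ ∞ w ∧ tsupport w ⊆ B} := by
  intro g hg hi h
  refine eq_zero_of_ae_of_fat hg (fun x hx U hU => ?_)
    (hB.ae_eq_zero_of_integral_contDiff_smul_eq_zero (μ := volume) hi.locallyIntegrableOn
      fun w hw _ hs => ?_)
  · exact Measure.measure_pos_of_mem_nhds volume (Filter.inter_mem (hB.mem_nhds hx) hU)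
  · rw [← h w ⟨hw, hs⟩]
    refine (setIntegral_eq_integral_of_forall_compl_eq_zero fun x hx => ?_).symm
    rw [image_eq_zero_of_notMem_tsupport fun h => hx (hs h), zero_smul]

lemma isSeparating_area (hS : MeasurableSet S)
    (hfat : ∀ x ∈ S, ∀ U ∈ 𝓝 x, 0 < ν (S ∩ U)) :
    IsSeparating S ν {w | ContDiff ℝ ∞ w} := by
  intro g hg hi h
  refine eq_zero_of_ae_of_fat hg hfat ((ae_restrict_iff' hS).1
    (ae_eq_zero_of_integral_contDiff_smul_eq_zero hi.locallyIntegrable fun w hw _ => h w hw))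

/-- The test function `w (T - s)` turns the convolution at `T` into the integral of `f w` over `[0,
T]`. This time reversal lets one final time control the whole history. -/
lemma eq_zero_of_tconv_smooth {f : ℝ → ℝ} (hf : ContinuousOn f (Ici 0)) (hT : 0 < T)
    (h : ∀ ψ : ℝ → ℝ, ContDiff ℝ ∞ ψ → tconv f ψ T = 0) : ∀ s ∈ Icc 0 T, f s = 0 := by
  have hi : IntegrableOn f (Ioo 0 T) :=
    ((hf.mono Icc_subset_Ici_self).integrableOn_Icc (μ := volume)).mono_set Ioo_subset_Icc_self
  have h1 := isOpen_Ioo.ae_eq_zero_of_integral_contDiff_smul_eq_zero (μ := volume)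
    hi.locallyIntegrableOn fun w hw _ hs => by
      have h2 := h (fun s => w (T - s)) (hw.comp (contDiff_const.sub contDiff_id))
      simp only [tconv, sub_sub_cancel] at h2
      rw [intervalIntegral.integral_of_le hT.le, integral_Ioc_eq_integral_Ioo] at h2
      rw [← setIntegral_eq_integral_of_forall_compl_eq_zero (s := Ioo 0 T) fun x hx => by
        rw [image_eq_zero_of_notMem_tsupport fun h => hx (hs h), zero_smul]]
      exact Eq.trans (setIntegral_congr_fun measurableSet_Ioo fun s _ => mul_comm (w s) (f s)) h2
  have h3 : ∀ s ∈ Ioo 0 T, f s = 0 := by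
    intro s hs
    by_contra hne
    have hc : ContinuousAt f s := hf.continuousAt (Ici_mem_nhds hs.1)
    have hU : {y | f y ≠ 0} ∩ Ioo 0 T ∈ 𝓝 s :=
      Filter.inter_mem (hc.eventually_ne hne) (Ioo_mem_nhds hs.1 hs.2)
    exact (Measure.measure_pos_of_mem_nhds volume hU).ne'
      (measure_mono_null (fun y hy => fun hz => hy.1 (hz hy.2)) (ae_iff.1 h1))
  have h4 : EqOn f 0 (Icc 0 T) := EqOn.of_subset_closure (s := Ioo 0 T) (fun s hs => h3 s hs)
    (hf.mono Icc_subset_Ici_self) continuousOn_const Ioo_subset_Icc_self (closure_Ioo hT.ne).ge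
  exact fun s hs => h4 hs

/-- For a fixed `ψ` the convolution at `T` is a function of position, which the tests `w`
annihilate; afterwards `ψ` varies at each fixed point. -/
theorem eq_zero_of_conv_tests [IsFiniteMeasure (ν.restrict S)] (hS : MeasurableSet S)
    (hsep : IsSeparating S ν 𝒲) (hF : IsBoundaryDatum S F) (hT : 0 < T)
    (h : ∀ w ∈ 𝒲, ∀ ψ, ContDiff ℝ ∞ ψ → ∫ x in S, (F ⊛ sep w ψ) x T ∂ν = 0) :
    ∀ x ∈ S, ∀ s ∈ Icc 0 T, F x s = 0 := by
  intro x hx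
  refine eq_zero_of_tconv_smooth (hF.time hx) hT fun ψ hψ => ?_
  have hn := hF.conv (IsBoundaryDatum.of_time (S := S) hψ.continuous.continuousOn)
  refine hsep (fun x => tconv (F x) ψ T) (hn.space hT.le) (hn.integrableOn hS hT.le)
    (fun w hw => ?_) x hx
  rw [← h w hw ψ hψ]
  exact setIntegral_congr_fun hS fun y _ => (congrFun (tconv_smul (F y) ψ (w y)) T).symm

/-- The kernel `K` may be inserted in the tests. -/
theorem eq_zero_of_kernel_tests [IsFiniteMeasure (ν.restrict S)] (hS : MeasurableSet S)
    (hsep : IsSeparating S ν 𝒲) {K : Field} (hKn : IsKernel K)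
    (hK : ∀ x, IsInjKernel (K x)) (hF : IsBoundaryDatum S F) (hT : 0 < T)
    (h : ∀ w ∈ 𝒲, ∀ ψ, ContDiff ℝ ∞ ψ → ∃ W : Field, (∀ x ∈ S, ∀ t, 0 ≤ t → W x t = sep w ψ x t) ∧
      ∫ x in S, (K ⊛ (F ⊛ W)) x T ∂ν = 0) :
    ∀ x ∈ S, ∀ s ∈ Icc 0 T, F x s = 0 := by
  have hKF := (hKn.isBoundaryDatum S).conv hF
  have h1 := eq_zero_of_conv_tests hS hsep hKF hT fun w hw ψ hψ => by
    obtain ⟨W, hW, h0⟩ := h w hw ψ hψ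
    rw [← h0]
    refine setIntegral_congr_fun hS fun x hx => ?_
    have e : tconv (K x) (tconv (F x) (W x)) T = tconv (K x) (tconv (F x) (w x • ψ)) T :=
      tconv_congr hT.le (fun _ _ => rfl) fun s hs => tconv_congr hs.1 (fun _ _ => rfl)
        fun s' hs' => hW x hx s' hs'.1
    exact (tconv_assoc (hK x).cont (hF.time hx) (hψ.continuous.continuousOn.const_smul (w x))
      hT.le).trans e.symm
  exact fun x hx => (hK x).inj _ (hF.time hx) T hT (h1 x hx)

end Separating

/-! ### Interior tests -/

section Interior

variable {m : Material} {B : Set E3} {r : E3 → ℝ} {S Sg : Fin 5 → Set E3} {Γ : Data}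
  {p p' c : Proc} {T t : ℝ} {x : E3}

/-- The process with the components `A • W`. -/
def testP (A : Arr ℝ) (W : Field) : Proc where
  u i := A.u i • W
  θ := A.θ • W
  φ := A.φ • W
  e i j := A.e (i, j) • W
  κ i j k := A.κ (i, j, k) • W
  b i := A.b i • W
  E i := A.E i • W
  V i j := A.V (i, j) • W
  τ i j := A.τ (i, j) • W
  μ i j k := A.μ (i, j, k) • W
  σ i := A.σ i • W
  Q i j := A.Q (i, j) • W
  η := A.η • W
  q i := A.q i • W

/-- The symmetries of the components of processes. -/
def Arr.IsSymm (A : Arr ℝ) : Prop := ∀ i j k, A.e (i, j) = A.e (j, i) ∧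
  A.κ (i, j, k) = A.κ (j, i, k) ∧ A.V (i, j) = A.V (j, i) ∧ A.τ (i, j) = A.τ (j, i) ∧
  A.μ (i, j, k) = A.μ (j, i, k) ∧ A.Q (i, j) = A.Q (j, i)

lemma isAdmissible_testP (hB : IsSmoothRegion B r) {A : Arr ℝ} (hA : A.IsSymm) {w : E3 → ℝ}
    {ψ : ℝ → ℝ} (hw : ContDiff ℝ ∞ w) (hψ : ContDiff ℝ ∞ ψ) :
    IsAdmissible B (testP A (sep w ψ)) := by
  have h : ∀ {M N : ℕ} (a : ℝ), IsC B M N (a • sep w ψ) := fun {M N} a => by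
    have e : a • sep w ψ = sep (fun x => a * w x) ψ := by
      funext x t; simp [sep, mul_assoc]
    rw [e]; exact isC_sep hB (contDiff_const.mul hw) hψ
  refine ⟨fun _ => h _, h _, h _, fun _ _ => h _, fun _ _ => h _, h _, fun _ _ _ => h _,
    fun _ => h _, fun _ _ _ => h _, fun _ _ => h _, fun _ => h _, fun _ _ => h _, fun _ => h _,
    fun _ => h _, fun x _ t _ i j k => ?_⟩
  obtain ⟨h1, h2, h3, h4, h5, h6⟩ := hA i j k
  simp only [testP, h1, h2, h3, h4, h5, h6, and_self]

/-- The linear combination of the components of `c` with the coefficients `A`. -/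
noncomputable def Proc.comb (c : Proc) (A : Arr ℝ) : Field :=
  ∑ i, A.u i • c.u i + A.θ • c.θ + A.φ • c.φ + ∑ i, ∑ j, A.e (i, j) • c.e i j
    + ∑ i, ∑ j, ∑ k, A.κ (i, j, k) • c.κ i j k + ∑ i, A.b i • c.b i + ∑ i, A.E i • c.E i
    + ∑ i, ∑ j, A.V (i, j) • c.V i j + ∑ i, ∑ j, A.τ (i, j) • c.τ i j
    + ∑ i, ∑ j, ∑ k, A.μ (i, j, k) • c.μ i j k + ∑ i, A.σ i • c.σ i
    + ∑ i, ∑ j, A.Q (i, j) • c.Q i j + A.η • c.η + ∑ i, A.q i • c.q i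

/-- The components of `c` are continuous. -/
lemma rep_comb {b : Arr (UConv B)} (hc : RepComponents B c b) (A : Arr ℝ) :
    Rep B (c.comb A) (∑ i, A.u i • b.u i + A.θ • b.θ + A.φ • b.φ + ∑ i, ∑ j, A.e (i, j) • b.e (i, j)
    + ∑ i, ∑ j, ∑ k, A.κ (i, j, k) • b.κ (i, j, k) + ∑ i, A.b i • b.b i + ∑ i, A.E i • b.E i
    + ∑ i, ∑ j, A.V (i, j) • b.V (i, j) + ∑ i, ∑ j, A.τ (i, j) • b.τ (i, j)
    + ∑ i, ∑ j, ∑ k, A.μ (i, j, k) • b.μ (i, j, k) + ∑ i, A.σ i • b.σ i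
    + ∑ i, ∑ j, A.Q (i, j) • b.Q (i, j) + A.η • b.η + ∑ i, A.q i • b.q i) := by
  have h1 := Rep.sum (s := Finset.univ) fun i => (hc.u i).smul (A.u i)
  have h4 := Rep.sum (s := Finset.univ) fun i => Rep.sum (s := Finset.univ) fun j =>
    (hc.e i j).smul (A.e (i, j))
  have h5 := Rep.sum (s := Finset.univ) fun i => Rep.sum (s := Finset.univ) fun j =>
    Rep.sum (s := Finset.univ) fun k => (hc.κ i j k).smul (A.κ (i, j, k))
  have h6 := Rep.sum (s := Finset.univ) fun i => (hc.b i).smul (A.b i)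
  have h7 := Rep.sum (s := Finset.univ) fun i => (hc.E i).smul (A.E i)
  have h8 := Rep.sum (s := Finset.univ) fun i => Rep.sum (s := Finset.univ) fun j =>
    (hc.V i j).smul (A.V (i, j))
  have h9 := Rep.sum (s := Finset.univ) fun i => Rep.sum (s := Finset.univ) fun j =>
    (hc.τ i j).smul (A.τ (i, j))
  have h10 := Rep.sum (s := Finset.univ) fun i => Rep.sum (s := Finset.univ) fun j =>
    Rep.sum (s := Finset.univ) fun k => (hc.μ i j k).smul (A.μ (i, j, k))
  have h11 := Rep.sum (s := Finset.univ) fun i => (hc.σ i).smul (A.σ i)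
  have h12 := Rep.sum (s := Finset.univ) fun i => Rep.sum (s := Finset.univ) fun j =>
    (hc.Q i j).smul (A.Q (i, j))
  have h14 := Rep.sum (s := Finset.univ) fun i => (hc.q i).smul (A.q i)
  exact ((((((((((((h1.add (hc.θ.smul A.θ)).add (hc.φ.smul A.φ)).add h4).add h5).add h6).add
    h7).add h8).add h9).add h10).add h11).add h12).add (hc.η.smul A.η)).add h14

lemma pair_testP {b : Arr (UConv B)} (hc : RepComponents B c b) (A : Arr ℝ) {W : Field}
    (hW : IsBoundaryDatum B W) (hx : x ∈ B) (ht : 0 ≤ t) :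
    c.pair (testP A W) x t = (c.comb A ⊛ W) x t := by
  set w := br B W
  have rw' : Rep B W w := rep_br hW
  have hA : RepComponents B (testP A W) ⟨fun i => A.u i • w, A.θ • w, A.φ • w, fun i => A.e i • w,
      fun i => A.κ i • w, fun i => A.b i • w, fun i => A.E i • w, fun i => A.V i • w,
      fun i => A.τ i • w, fun i => A.μ i • w, fun i => A.σ i • w, fun i => A.Q i • w, A.η • w,
      fun i => A.q i • w, 0, 0, 0, 0, 0, 0, 0, 0⟩ :=
    ⟨fun _ => rw'.smul _, rw'.smul _, rw'.smul _, fun _ _ => rw'.smul _, fun _ _ _ => rw'.smul _,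
      fun _ => rw'.smul _, fun _ => rw'.smul _, fun _ _ => rw'.smul _, fun _ _ => rw'.smul _,
      fun _ _ _ => rw'.smul _, fun _ => rw'.smul _, fun _ _ => rw'.smul _, rw'.smul _,
      fun _ => rw'.smul _⟩
  have h1 := hc.pair hA
  have h2 := (rep_comb hc A).conv rw'
  refine (h1.2 x hx t ht).trans (Eq.trans ?_ (h2.2 x hx t ht).symm)
  simp only [Arr.pair, dotProduct, Fintype.sum_prod_type, add_mul, Finset.sum_mul, smul_mul_assoc,
    mul_smul_comm]

lemma dx_eq_zero_of_eventually {F : Field} {j : Fin 3} (h : ∀ᶠ y in 𝓝 x, F y t = 0) :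
    dx B j F x t = 0 := by
  have h1 : (fun y => F y t) =ᶠ[𝓝[closure B] x] fun _ => 0 := h.filter_mono nhdsWithin_le_nhds
  rw [dx, h1.fderivWithin_eq h.self_of_nhds]
  simp

lemma normalD_eq_zero {F : Field} (h : ∀ᶠ y in 𝓝 x, F y t = 0) : normalD B r F x t = 0 := by
  simp only [normalD, Finset.sum_apply, Pi.mul_apply, dx_eq_zero_of_eventually h, mul_zero,
    Finset.sum_const_zero]

lemma hypT_eq_zero {μ : Fin 3 → Fin 3 → Field} (hμ : ∀ k j, μ k j x t = 0) :
    hypT r μ x t = 0 := by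
  simp only [hypT, Finset.sum_apply, Pi.mul_apply, hμ, zero_mul, Finset.sum_const_zero]

/-- All terms of the traction with `μ`, including its surface derivatives, depend on the germ of `μ`
only. -/
lemma trac_of_eventually_zero {τ : Fin 3 → Field} {μ : Fin 3 → Fin 3 → Field}
    (hμ : ∀ k j, ∀ᶠ y in 𝓝 x, μ k j y t = 0) :
    trac B r τ μ x t = ∑ j, τ j x t * nrm r j x t := by
  have h1 : ∀ k j, dx B k (μ k j) x t = 0 := fun k j => dx_eq_zero_of_eventually (hμ k j)
  have h2 : ∀ l j, dx B l (∑ k, μ k j * nrm r k) x t = 0 := fun l j =>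
    dx_eq_zero_of_eventually <| by
      filter_upwards [(Filter.eventually_all (ι := Fin 3)).2 fun k => hμ k j] with y hy
      simp only [Finset.sum_apply, Pi.mul_apply, hy, zero_mul, Finset.sum_const_zero]
  have h3 := hypT_eq_zero (r := r) fun k j => (hμ k j).self_of_nhds
  rw [hypT] at h3
  simp only [trac, Pi.add_apply, Pi.sub_apply, Pi.mul_apply, h3, mul_zero, add_zero]
  simp only [Finset.sum_apply, Pi.mul_apply, Pi.sub_apply, h1, surfD, h2, mul_zero,
    Finset.sum_const_zero, sub_zero]

lemma trac_eq_zero {τ : Fin 3 → Field} {μ : Fin 3 → Fin 3 → Field} (hτ : ∀ j, τ j x t = 0)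
    (hμ : ∀ k j, ∀ᶠ y in 𝓝 x, μ k j y t = 0) : trac B r τ μ x t = 0 := by
  rw [trac_of_eventually_zero hμ]
  simp only [hτ, zero_mul, Finset.sum_const_zero]

lemma integral_conv_eq_zero {S : Set E3} {ν : Measure E3} {K F G : Field} (ht : 0 ≤ t)
    (h : ∀ x ∈ S, (∀ s ∈ Icc 0 t, F x s = 0) ∨ ∀ s ∈ Icc 0 t, G x s = 0) :
    ∫ x in S, (K ⊛ (F ⊛ G)) x t ∂ν = 0 := by
  refine setIntegral_eq_zero_of_forall_eq_zero fun x hx => tconv_eq_zero_right ht fun s hs => ?_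
  have e : Icc 0 s ⊆ Icc 0 t := Icc_subset_Icc le_rfl hs.2
  rcases h x hx with h | h
  · exact tconv_eq_zero_left hs.1 fun s' hs' => h s' (e hs')
  · exact tconv_eq_zero_right hs.1 fun s' hs' => h s' (e hs')

/-- One surface integral drops out when at every point either the test field or the residual of the
boundary condition is zero. The second alternative lets conditions already proved be used. -/
lemma partVar_left {S Sg : Set E3} {K P Ph u uh P' u' : Field} (ht : 0 ≤ t)
    (h : ∀ x ∈ Sg, (∀ s ∈ Icc 0 t, u' x s = 0) ∨ ∀ s ∈ Icc 0 t, P x s = Ph x s) :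
    partVar S Sg K P Ph u uh P' u' t = ∫ x in S, (K ⊛ (P' ⊛ (u - uh))) x t ∂μHE[2] := by
  rw [partVar, integral_conv_eq_zero (S := Sg) (F := P - Ph) ht fun x hx => (h x hx).symm.imp_left fun h s hs =>
    sub_eq_zero.2 (h s hs), sub_zero]

lemma partVar_right {S Sg : Set E3} {K P Ph u uh P' u' : Field} (ht : 0 ≤ t)
    (h : ∀ x ∈ S, (∀ s ∈ Icc 0 t, P' x s = 0) ∨ ∀ s ∈ Icc 0 t, u x s = uh x s) :
    partVar S Sg K P Ph u uh P' u' t = -∫ x in Sg, (K ⊛ ((P - Ph) ⊛ u')) x t ∂μHE[2] := by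
  rw [partVar, integral_conv_eq_zero (S := S) (G := u - uh) ht fun x hx => (h x hx).imp_right fun h s hs =>
    sub_eq_zero.2 (h s hs), zero_sub]

lemma partVar_eq_zero {S Sg : Set E3} {K P Ph u uh P' u' : Field} (ht : 0 ≤ t)
    (h1 : ∀ x ∈ S, (∀ s ∈ Icc 0 t, P' x s = 0) ∨ ∀ s ∈ Icc 0 t, u x s = uh x s)
    (h2 : ∀ x ∈ Sg, (∀ s ∈ Icc 0 t, u' x s = 0) ∨ ∀ s ∈ Icc 0 t, P x s = Ph x s) :
    partVar S Sg K P Ph u uh P' u' t = 0 := by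
  rw [partVar_left ht h2, integral_conv_eq_zero (G := u - uh) ht fun x hx => (h1 x hx).imp_right fun h s hs =>
    sub_eq_zero.2 (h s hs)]

lemma sum_symm_mul (c : Fin 3 → Fin 3 → ℝ) :
    ∑ i, ∑ j, (c i j + c j i) * c i j = 1 / 2 * ∑ i, ∑ j, (c i j + c j i) ^ 2 := by
  simp only [Fin.sum_univ_three]; ring

lemma sum_symm_mul₃ (c : Fin 3 → Fin 3 → Fin 3 → ℝ) :
    ∑ i, ∑ j, ∑ k, (c i j k + c j i k) * c i j k
      = 1 / 2 * ∑ i, ∑ j, ∑ k, (c i j k + c j i k) ^ 2 := by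
  simp only [Fin.sum_univ_three]; ring

lemma eq_zero_of_sum_sq {ι : Type*} [Fintype ι] {f : ι → ℝ} (h : ∑ i, f i ^ 2 = 0) (i : ι) :
    f i = 0 := by
  have := (Finset.sum_eq_zero_iff_of_nonneg fun i _ => sq_nonneg (f i)).1 h i (Finset.mem_univ i)
  exact pow_eq_zero_iff two_ne_zero |>.1 this

/-- A process whose combinations with symmetric coefficients vanish. -/
lemma symmVanishes_of_comb {J : Set ℝ}
    (h : ∀ A : Arr ℝ, A.IsSymm → ∀ x ∈ B, ∀ t ∈ J, c.comb A x t = 0) : SymmVanishes B J c := by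
  have key : ∀ x ∈ B, ∀ t ∈ J, (∑ i, c.u i x t ^ 2 = 0 ∧ c.θ x t ^ 2 = 0 ∧ c.φ x t ^ 2 = 0 ∧
      ∑ i, ∑ j, (c.e i j x t + c.e j i x t) ^ 2 = 0 ∧
      ∑ i, ∑ j, ∑ k, (c.κ i j k x t + c.κ j i k x t) ^ 2 = 0 ∧ ∑ i, c.b i x t ^ 2 = 0 ∧
      ∑ i, c.E i x t ^ 2 = 0) ∧ ∑ i, ∑ j, (c.V i j x t + c.V j i x t) ^ 2 = 0 ∧
      ∑ i, ∑ j, (c.τ i j x t + c.τ j i x t) ^ 2 = 0 ∧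
      ∑ i, ∑ j, ∑ k, (c.μ i j k x t + c.μ j i k x t) ^ 2 = 0 ∧ ∑ i, c.σ i x t ^ 2 = 0 ∧
      ∑ i, ∑ j, (c.Q i j x t + c.Q j i x t) ^ 2 = 0 ∧ c.η x t ^ 2 = 0 ∧
      ∑ i, c.q i x t ^ 2 = 0 := by
    intro x hx t ht
    -- The coefficients are the symmetrized values of `c` at the point `(x, t)` itself, which makes
    -- the combination a sum of squares with positive weights.
    have H := h ⟨fun i => c.u i x t, c.θ x t, c.φ x t, fun i => c.e i.1 i.2 x t + c.e i.2 i.1 x t,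
      fun i => c.κ i.1 i.2.1 i.2.2 x t + c.κ i.2.1 i.1 i.2.2 x t, fun i => c.b i x t,
      fun i => c.E i x t, fun i => c.V i.1 i.2 x t + c.V i.2 i.1 x t,
      fun i => c.τ i.1 i.2 x t + c.τ i.2 i.1 x t,
      fun i => c.μ i.1 i.2.1 i.2.2 x t + c.μ i.2.1 i.1 i.2.2 x t, fun i => c.σ i x t,
      fun i => c.Q i.1 i.2 x t + c.Q i.2 i.1 x t, c.η x t, fun i => c.q i x t, 0, 0, 0, 0, 0, 0, 0,
      0⟩ (fun i j k => ⟨add_comm _ _, add_comm _ _, add_comm _ _, add_comm _ _, add_comm _ _,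
        add_comm _ _⟩) x hx t ht
    simp only [Proc.comb, Pi.add_apply, Finset.sum_apply, Pi.smul_apply, smul_eq_mul] at H
    rw [sum_symm_mul fun i j => c.e i j x t, sum_symm_mul₃ fun i j k => c.κ i j k x t,
      sum_symm_mul fun i j => c.V i j x t, sum_symm_mul fun i j => c.τ i j x t,
      sum_symm_mul₃ fun i j k => c.μ i j k x t, sum_symm_mul fun i j => c.Q i j x t] at H
    simp only [← pow_two] at H
    have s1 : ∀ f : Fin 3 → ℝ, 0 ≤ ∑ i, f i ^ 2 := fun f => by positivity
    have s2 : ∀ f : Fin 3 → Fin 3 → ℝ, 0 ≤ ∑ i, ∑ j, f i j ^ 2 := fun f => by positivity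
    have s3 : ∀ f : Fin 3 → Fin 3 → Fin 3 → ℝ, 0 ≤ ∑ i, ∑ j, ∑ k, f i j k ^ 2 :=
      fun f => by positivity
    have h1 := s1 fun i => c.u i x t
    have h2 := sq_nonneg (c.θ x t)
    have h3 := sq_nonneg (c.φ x t)
    have h4 := s2 fun i j => c.e i j x t + c.e j i x t
    have h5 := s3 fun i j k => c.κ i j k x t + c.κ j i k x t
    have h6 := s1 fun i => c.b i x t
    have h7 := s1 fun i => c.E i x t
    have h8 := s2 fun i j => c.V i j x t + c.V j i x t
    have h9 := s2 fun i j => c.τ i j x t + c.τ j i x t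
    have h10 := s3 fun i j k => c.μ i j k x t + c.μ j i k x t
    have h11 := s1 fun i => c.σ i x t
    have h12 := s2 fun i j => c.Q i j x t + c.Q j i x t
    have h13 := sq_nonneg (c.η x t)
    have h14 := s1 fun i => c.q i x t
    refine ⟨⟨?_, ?_, ?_, ?_, ?_, ?_, ?_⟩, ?_, ?_, ?_, ?_, ?_, ?_, ?_⟩ <;> linarith
  have z2 : ∀ {f : Fin 3 → Fin 3 → ℝ}, ∑ i, ∑ j, f i j ^ 2 = 0 → ∀ i j, f i j = 0 := fun {f} h i j =>
    eq_zero_of_sum_sq (f := fun i : Fin 3 × Fin 3 => f i.1 i.2)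
      (by rw [Fintype.sum_prod_type]; exact h) (i, j)
  have z3 : ∀ {f : Fin 3 → Fin 3 → Fin 3 → ℝ}, ∑ i, ∑ j, ∑ k, f i j k ^ 2 = 0 →
      ∀ i j k, f i j k = 0 := fun {f} h i j k =>
    eq_zero_of_sum_sq (f := fun i : Fin 3 × Fin 3 × Fin 3 => f i.1 i.2.1 i.2.2)
      (by simp only [Fintype.sum_prod_type]; exact h) (i, j, k)
  have z0 : ∀ {a : ℝ}, a ^ 2 = 0 → a = 0 := fun h => (pow_eq_zero_iff two_ne_zero).1 h
  exact ⟨fun x hx i t ht => eq_zero_of_sum_sq (key x hx t ht).1.1 i,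
    fun x hx t ht => z0 (key x hx t ht).1.2.1, fun x hx t ht => z0 (key x hx t ht).1.2.2.1,
    fun x hx i j t ht => z2 (key x hx t ht).1.2.2.2.1 i j,
    fun x hx i j k t ht => z3 (key x hx t ht).1.2.2.2.2.1 i j k,
    fun x hx i t ht => eq_zero_of_sum_sq (key x hx t ht).1.2.2.2.2.2.1 i,
    fun x hx i t ht => eq_zero_of_sum_sq (key x hx t ht).1.2.2.2.2.2.2 i,
    fun x hx i j t ht => z2 (key x hx t ht).2.1 i j,
    fun x hx i j t ht => z2 (key x hx t ht).2.2.1 i j,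
    fun x hx i j k t ht => z3 (key x hx t ht).2.2.2.1 i j k,
    fun x hx i t ht => eq_zero_of_sum_sq (key x hx t ht).2.2.2.2.1 i,
    fun x hx i j t ht => z2 (key x hx t ht).2.2.2.2.2.1 i j,
    fun x hx t ht => z0 (key x hx t ht).2.2.2.2.2.2.1,
    fun x hx i t ht => eq_zero_of_sum_sq (key x hx t ht).2.2.2.2.2.2.2 i⟩

/-- Test processes supported inside `B` vanish near the boundary, so every surface term disappears.
Admissible processes are symmetric, hence only the symmetrized coefficients are determined. -/
theorem symmVanishes_of_firstVar (hB : IsSmoothRegion B r) (hS : IsBoundarySplitting B S Sg)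
    (hΓ : Γ.IsContinuous B S Sg) (h : IsAdmissible B p) (hT : 0 < T)
    (H : ∀ p', IsAdmissible B p' → firstVar m B r S Sg Γ T p p' = 0) :
    SymmVanishes B (Icc 0 T) (coefP m B Γ p) := by
  have i1 := isFiniteMeasure_volume hB
  have hBm := hB.isOpen.measurableSet
  have hc := (h.represents hB).coef (repKernels m B) (repData m hB hΓ)
  have hSF := fun i => (hS.isPart i).subS
  have hSgF := fun i => (hS.isPart i).subSg
  refine symmVanishes_of_comb fun A hA => ?_
  refine eq_zero_of_kernel_tests (ν := volume) hBm (isSeparating_volume hB.isOpen)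
    (K := kχ m)
    ⟨fun _ => rfl, (isInjKernel_kχ m 0).cont⟩ (isInjKernel_kχ m)
    (rep_comb hc A).isBoundaryDatum hT fun w hw ψ hψ =>
    ⟨sep w ψ, fun _ _ _ _ => rfl, ?_⟩
  have hW : ∀ x ∈ frontier B, ∀ t, ∀ a : ℝ, ∀ᶠ y in 𝓝 x, (a • sep w ψ) y t = 0 := fun x hx t a => by
    have hx' : x ∉ tsupport w := fun hx' => by
      have := hw.2 hx'
      rw [← hB.isOpen.interior_eq] at this
      exact hx.2 this
    filter_upwards [(isClosed_tsupport w).isOpen_compl.mem_nhds hx'] with y hy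
    simp [sep, image_eq_zero_of_notMem_tsupport hy]
  have hW0 : ∀ x ∈ frontier B, ∀ t, ∀ a : ℝ, (a • sep w ψ) x t = 0 := fun x hx t a =>
    (hW x hx t a).self_of_nhds
  have hp := H _ (isAdmissible_testP hB hA hw.1 hψ)
  have z : ∀ (i : Fin 5) {K P Ph u uh P' u' : Field}, (∀ x ∈ frontier B, ∀ t, P' x t = 0) →
      (∀ x ∈ frontier B, ∀ t, u' x t = 0) → partVar (S i) (Sg i) K P Ph u uh P' u' T = 0 :=
    fun i => fun h1 h2 => partVar_eq_zero hT.le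
      (fun x hx => .inl fun s _ => h1 x (hSF i hx) s) fun x hx => .inl fun s _ => h2 x (hSgF i hx) s
  have hP : ∀ i, ∀ x ∈ frontier B, ∀ t, tractionP B r (testP A (sep w ψ)) i x t = 0 :=
    fun i x hx t => trac_eq_zero (fun j => hW0 x hx t _) fun k j => hW x hx t _
  have hR : ∀ i, ∀ x ∈ frontier B, ∀ t, hyperR r (testP A (sep w ψ)) i x t = 0 :=
    fun i x hx t => hypT_eq_zero fun k j => hW0 x hx t _
  have hΛ : ∀ x ∈ frontier B, ∀ t, chargeΛ B r (testP A (sep w ψ)) x t = 0 :=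
    fun x hx t => trac_eq_zero (fun j => hW0 x hx t _) fun k j => hW x hx t _
  have hH : ∀ x ∈ frontier B, ∀ t, hyperH r (testP A (sep w ψ)) x t = 0 :=
    fun x hx t => hypT_eq_zero fun k j => hW0 x hx t _
  have hD : ∀ a : ℝ, ∀ x ∈ frontier B, ∀ t, normalD B r (a • sep w ψ) x t = 0 :=
    fun a x hx t => normalD_eq_zero (hW x hx t _)
  have hV : ∀ a : ℝ, ∀ x ∈ frontier B, ∀ t, (a • sep w ψ) x t = 0 := fun a x hx t => hW0 x hx t a
  have hq : ∀ x ∈ frontier B, ∀ t, fluxq r (testP A (sep w ψ)) x t = 0 := fun x hx t => by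
    simp only [fluxq, Finset.sum_apply, Pi.mul_apply]
    exact Finset.sum_eq_zero fun i _ => by
      rw [show (testP A (sep w ψ)).q i x t = 0 from hW0 x hx t _, zero_mul]
  have s0 : (∑ i, partVar (S 0) (Sg 0) (kmech m) (tractionP B r p i) (Γ.bP i) (p.u i) (Γ.bu i)
      (tractionP B r (testP A (sep w ψ)) i) ((testP A (sep w ψ)).u i) T) = 0 :=
    Finset.sum_eq_zero fun i _ => z 0 (hP i) (hV _)
  have s1 : (∑ i, partVar (S 1) (Sg 1) (kmech m) (hyperR r p i) (Γ.bR i) (normalD B r (p.u i))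
      (Γ.bd i) (hyperR r (testP A (sep w ψ)) i) (normalD B r ((testP A (sep w ψ)).u i)) T) = 0 :=
    Finset.sum_eq_zero fun i _ => z 1 (hR i) (hD _)
  rw [firstVar, s0, s1, z 2 hq (u' := (testP A (sep w ψ)).θ) (hV A.θ),
    z 3 hΛ (u' := (testP A (sep w ψ)).φ) (hV A.φ),
    z 4 hH (u' := normalD B r (testP A (sep w ψ)).φ) (hD A.φ),
    mul_zero, add_zero, add_zero, add_zero, add_zero, add_zero] at hp
  rw [← hp]
  refine setIntegral_congr_fun hBm fun x hx => tconv_congr hT.le (fun _ _ => rfl) fun s hs => ?_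
  exact (pair_testP hc A (((isC_sep (M := 0) (N := 0) hB hw.1 hψ).isBoundaryDatum hB).mono
    subset_closure) hx hs.1).symm

end Interior

end ThermoPiezo

namespace ThermoPiezo

/-! ### Boundary tests -/

section Pairing

variable {B : Set E3} {c y : Proc} {t : ℝ} {x : E3}

lemma tconv_eq_neg {c c' y y' : ℝ → ℝ} (ht : 0 ≤ t) (hc : ∀ s ∈ Icc 0 t, c s + c' s = 0)
    (hy : ∀ s ∈ Icc 0 t, y s = y' s) : tconv c' y' t = -tconv c y t := by
  rw [tconv_comm c y, tconv_comm c' y', tconv_congr ht (g' := (-1 : ℝ) • c)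
    (fun s hs => (hy s hs).symm) fun s hs => ?_, tconv_smul]
  · simp
  · simp only [Pi.smul_apply, smul_eq_mul]; linarith [hc s hs]

/-- An antisymmetric array is paired with a symmetric one: interchanging the indices changes the
sign of the sum. -/
lemma sum_tconv_symm {c y : Fin 3 → Fin 3 → ℝ → ℝ} (ht : 0 ≤ t)
    (hc : ∀ i j, ∀ s ∈ Icc 0 t, c i j s + c j i s = 0)
    (hy : ∀ i j, ∀ s ∈ Icc 0 t, y i j s = y j i s) : ∑ i, ∑ j, tconv (c i j) (y i j) t = 0 := by
  have h := fun i j => tconv_eq_neg ht (hc i j) (hy i j)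
  have h1 : ∑ i, ∑ j, tconv (c j i) (y j i) t = -∑ i, ∑ j, tconv (c i j) (y i j) t := by
    rw [← Finset.sum_neg_distrib]
    refine Finset.sum_congr rfl fun i _ => ?_
    rw [← Finset.sum_neg_distrib]
    exact Finset.sum_congr rfl fun j _ => h i j
  rw [Finset.sum_comm] at h1
  linarith

lemma pair_eq_zero (hc : SymmVanishes B (Icc 0 t) c) (hy : IsAdmissible B y) (ht : 0 ≤ t)
    (hx : x ∈ B) : c.pair y x t = 0 := by
  have hy' := fun s (hs : s ∈ Icc 0 t) => hy.symm x (subset_closure hx) s hs.1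
  have z : ∀ {F G : ℝ → ℝ}, (∀ s ∈ Icc 0 t, F s = 0) → tconv F G t = 0 :=
    fun h => tconv_eq_zero_left ht h
  have he := sum_tconv_symm ht (hc.e x hx) fun i j s hs => (hy' s hs i j 0).1
  have hV := sum_tconv_symm ht (hc.V x hx) fun i j s hs => (hy' s hs i j 0).2.2.1
  have hτ := sum_tconv_symm ht (hc.τ x hx) fun i j s hs => (hy' s hs i j 0).2.2.2.1
  have hQ := sum_tconv_symm ht (hc.Q x hx) fun i j s hs => (hy' s hs i j 0).2.2.2.2.2
  have s3 : ∀ f : Fin 3 → Fin 3 → Fin 3 → ℝ, (∀ k, ∑ i, ∑ j, f i j k = 0) →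
      ∑ i, ∑ j, ∑ k, f i j k = 0 := fun f hf => by
    simp only [Fin.sum_univ_three] at hf ⊢
    linarith [hf 0, hf 1, hf 2]
  have hκ := s3 (fun i j k => tconv (c.κ i j k x) (y.κ i j k x) t) fun k => sum_tconv_symm ht
    (fun i j => hc.κ x hx i j k) fun i j s hs => (hy' s hs i j k).2.1
  have hμ := s3 (fun i j k => tconv (c.μ i j k x) (y.μ i j k x) t) fun k => sum_tconv_symm ht
    (fun i j => hc.μ x hx i j k) fun i j s hs => (hy' s hs i j k).2.2.2.2.1
  simp only [Proc.pair, Pi.add_apply, Finset.sum_apply, fconv]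
  rw [he, hV, hτ, hQ, hκ, hμ, z (hc.θ x hx), z (hc.φ x hx), z (hc.η x hx),
    Finset.sum_eq_zero fun i _ => z (hc.u x hx i), Finset.sum_eq_zero fun i _ => z (hc.b x hx i),
    Finset.sum_eq_zero fun i _ => z (hc.E x hx i), Finset.sum_eq_zero fun i _ => z (hc.σ x hx i),
    Finset.sum_eq_zero fun i _ => z (hc.q x hx i)]
  simp

end Pairing

/-! ### Separation of the boundary conditions within one channel -/

section Channel

variable {B : Set E3} {r : E3 → ℝ} {S Sg : Fin 5 → Set E3} {K P Ph u uh R Rh d dh : Field} {T : ℝ}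

lemma eq_zero_of_area_tests (hB : IsSmoothRegion B r) {A : Set E3} (hA : A ⊆ frontier B)
    (hAm : MeasurableSet A) (hfat : ∀ x ∈ A, ∀ U ∈ 𝓝 x, 0 < μHE[2] (A ∩ U)) (hK : IsKernel K)
    (hKi : ∀ x, IsInjKernel (K x)) {F : Field} (hF : IsBoundaryDatum A F) (hT : 0 < T)
    (h : ∀ w ψ, ContDiff ℝ ∞ w → ContDiff ℝ ∞ ψ → ∃ W : Field,
      (∀ x ∈ frontier B, ∀ t, W x t = sep w ψ x t) ∧
      ∫ x in A, (K ⊛ (F ⊛ W)) x T ∂μHE[2] = 0) :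
    ∀ x ∈ A, ∀ s ∈ Icc 0 T, F x s = 0 := by
  have i1 := isFiniteMeasure_area hB hA
  refine eq_zero_of_kernel_tests hAm (isSeparating_area hAm hfat) hK hKi hF hT fun w hw ψ hψ => ?_
  obtain ⟨W, hW, h0⟩ := h w ψ hw hψ
  exact ⟨W, fun x hx t _ => hW x (hA hx) t, h0⟩

/-- A smooth field that vanishes on the boundary with a given normal derivative. -/
lemma exists_normalD_eq (hB : IsSmoothRegion B r) {w : E3 → ℝ} (hw : ContDiff ℝ ∞ w) :
    ∃ v : E3 → ℝ, ContDiff ℝ ∞ v ∧ ∀ ψ, ∀ x ∈ frontier B, ∀ t, sep v ψ x t = 0 ∧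
      normalD B r (sep v ψ) x t = sep w ψ x t := by
  obtain ⟨q, hq⟩ := exists_isInvGrad hB
  have hs := hq.smooth.mul hw
  have c1 : ∀ {f : E3 → ℝ}, ContDiff ℝ ∞ f → ContDiffOn ℝ 1 f (closure B) :=
    fun h => (h.of_le (by simp)).contDiffOn
  -- The factor `r` vanishes on the boundary, and there `q` times its gradient is the unit normal,
  -- so the normal derivative of the product is `w`.
  refine ⟨fun x => r x * (q x * w x), hB.smooth.mul hs, fun ψ x hx t => ?_⟩
  have hr := hB.mem_frontier_iff.1 hx
  have hxc := frontier_subset_closure hx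
  refine ⟨by simp [sep, hr], ?_⟩
  have h1 : ∀ j, pd B j (fun y => sep (fun x => r x * (q x * w x)) ψ y t) x
      = nor r j x * (w x * ψ t) := fun j => by
    have e := pd_mul hB (c1 hB.smooth) (c1 (hs.mul (contDiff_const (c := ψ t)))) hxc j
    rw [hr, zero_mul, add_zero] at e
    have e2 : pd B j r x = fderiv ℝ r x (EuclideanSpace.single j 1) := by
      rw [pd, (hB.differentiable x).fderivWithin (hB.uniqueDiffOn x hxc)]
    rw [(hq.eventually_nor_eq hx j).self_of_nhds, extNor, ← e2]
    refine Eq.trans (congrArg (fun f => pd B j f x) (funext fun y => ?_)) (e.trans ?_)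
    · simp only [sep]; ring
    · ring
  have h2 := (hq.eventually_sum_sq hx).self_of_nhds
  simp only [← (hq.eventually_nor_eq hx _).self_of_nhds] at h2
  rw [normalD_apply, ndv]
  simp only [h1]
  simp only [← mul_assoc, ← Finset.sum_mul, h2, one_mul, sep]

/-- The four test quantities are not independent: a prescribed `w₁` spoils control of the traction,
and a field with prescribed boundary values has an uncontrolled normal derivative. The conditions
are therefore obtained in the order `R`, `u`, `P`, `d`, where the last two use the earlier ones to
discard the uncontrolled terms. -/
theorem eq_of_partVar_tests (hB : IsSmoothRegion B r) (hS : IsBoundarySplitting B S Sg)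
    {a b : Fin 5} (hK : IsKernel K) (hKi : ∀ x, IsInjKernel (K x))
    (hP : IsBoundaryDatum (frontier B) P) (hPh : IsBoundaryDatum (Sg a) Ph)
    (hu : IsBoundaryDatum (frontier B) u) (huh : IsBoundaryDatum (S a) uh)
    (hR : IsBoundaryDatum (frontier B) R) (hRh : IsBoundaryDatum (Sg b) Rh)
    (hd : IsBoundaryDatum (frontier B) d) (hdh : IsBoundaryDatum (S b) dh) (hT : 0 < T)
    (H : ∀ v w₀ w₁ ψ, ContDiff ℝ ∞ v → ContDiff ℝ ∞ w₀ → ContDiff ℝ ∞ w₁ → ContDiff ℝ ∞ ψ →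
      ∃ P' R' : Field, (w₁ = 0 → ∀ x ∈ frontier B, ∀ t, P' x t = sep w₀ ψ x t) ∧
      (∀ x ∈ frontier B, ∀ t, R' x t = sep w₁ ψ x t) ∧
      partVar (S a) (Sg a) K P Ph u uh P' (sep v ψ) T
        + partVar (S b) (Sg b) K R Rh d dh R' (normalD B r (sep v ψ)) T = 0) :
    ((∀ x ∈ S a, ∀ s ∈ Icc 0 T, u x s = uh x s) ∧ ∀ x ∈ Sg a, ∀ s ∈ Icc 0 T, P x s = Ph x s) ∧
    (∀ x ∈ S b, ∀ s ∈ Icc 0 T, d x s = dh x s) ∧ ∀ x ∈ Sg b, ∀ s ∈ Icc 0 T, R x s = Rh x s := by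
  have pa := hS.isPart a
  have pb := hS.isPart b
  have hz : ContDiff ℝ ∞ (0 : E3 → ℝ) := contDiff_const
  have sz : ∀ ψ x t, sep 0 ψ x t = 0 := fun ψ x t => zero_mul _
  have dz : ∀ ψ x t, normalD B r (sep 0 ψ) x t = 0 := fun ψ x t =>
    normalD_eq_zero (.of_forall fun y => sz ψ y t)
  have hRR : ∀ x ∈ Sg b, ∀ s ∈ Icc 0 T, (R - Rh) x s = 0 :=
    eq_zero_of_area_tests hB pb.subSg pb.measSg (hS.fat b).2 hK hKi ((hR.mono pb.subSg).sub hRh) hT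
      fun w ψ hw hψ => by
    obtain ⟨v, hv, hvn⟩ := exists_normalD_eq hB hw
    obtain ⟨P', R', h1, h2, h3⟩ := H v 0 0 ψ hv hz hz hψ
    rw [partVar_eq_zero hT.le
      (fun x hx => .inl fun s _ => (h1 rfl x (pa.subS hx) s).trans (sz ψ x s))
      (fun x hx => .inl fun s _ => (hvn ψ x (pa.subSg hx) s).1), zero_add, partVar_right hT.le
      (fun x hx => .inl fun s _ => (h2 x (pb.subS hx) s).trans (sz ψ x s)), neg_eq_zero] at h3
    exact ⟨_, fun x hx t => (hvn ψ x hx t).2, h3⟩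
  have hRR' : ∀ x ∈ Sg b, ∀ s ∈ Icc 0 T, R x s = Rh x s := fun x hx s hs =>
    sub_eq_zero.1 (hRR x hx s hs)
  have hUU : ∀ x ∈ S a, ∀ s ∈ Icc 0 T, (u - uh) x s = 0 :=
    eq_zero_of_area_tests hB pa.subS pa.measS (hS.fat a).1 hK hKi ((hu.mono pa.subS).sub huh) hT
      fun w ψ hw hψ => by
    obtain ⟨P', R', h1, h2, h3⟩ := H 0 w 0 ψ hz hw hz hψ
    rw [partVar_eq_zero (S := S b) hT.le
      (fun x hx => .inl fun s _ => (h2 x (pb.subS hx) s).trans (sz ψ x s))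
      (fun x hx => .inl fun s _ => dz ψ x s), add_zero, partVar_left hT.le
      (fun x hx => .inl fun s _ => sz ψ x s), fconv_comm P'] at h3
    exact ⟨_, h1 rfl, h3⟩
  have hUU' : ∀ x ∈ S a, ∀ s ∈ Icc 0 T, u x s = uh x s := fun x hx s hs =>
    sub_eq_zero.1 (hUU x hx s hs)
  -- The normal derivative of the test `w` is arbitrary, but it multiplies `R - Rh`, already known
  -- to vanish.
  have hPP : ∀ x ∈ Sg a, ∀ s ∈ Icc 0 T, (P - Ph) x s = 0 :=
    eq_zero_of_area_tests hB pa.subSg pa.measSg (hS.fat a).2 hK hKi ((hP.mono pa.subSg).sub hPh) hT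
      fun w ψ hw hψ => by
    obtain ⟨P', R', h1, h2, h3⟩ := H w 0 0 ψ hw hz hz hψ
    rw [partVar_eq_zero (S := S b) hT.le
      (fun x hx => .inl fun s _ => (h2 x (pb.subS hx) s).trans (sz ψ x s))
      (fun x hx => .inr (hRR' x hx)), add_zero, partVar_right hT.le
      (fun x hx => .inl fun s _ => (h1 rfl x (pa.subS hx) s).trans (sz ψ x s)), neg_eq_zero] at h3
    exact ⟨_, fun _ _ _ => rfl, h3⟩
  -- The test with nonzero `w₁` has an unknown traction, but it multiplies `u - uh`, already known
  -- to vanish.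
  have hDD : ∀ x ∈ S b, ∀ s ∈ Icc 0 T, (d - dh) x s = 0 :=
    eq_zero_of_area_tests hB pb.subS pb.measS (hS.fat b).1 hK hKi ((hd.mono pb.subS).sub hdh) hT
      fun w ψ hw hψ => by
    obtain ⟨P', R', h1, h2, h3⟩ := H 0 0 w ψ hz hz hw hψ
    rw [partVar_eq_zero (S := S a) hT.le (fun x hx => .inr (hUU' x hx))
      (fun x hx => .inl fun s _ => sz ψ x s), zero_add, partVar_left hT.le
      (fun x hx => .inl fun s _ => dz ψ x s), fconv_comm R'] at h3
    exact ⟨_, h2, h3⟩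
  exact ⟨⟨hUU', fun x hx s hs => sub_eq_zero.1 (hPP x hx s hs)⟩,
    fun x hx s hs => sub_eq_zero.1 (hDD x hx s hs), hRR'⟩

theorem eq_of_partVar_tests_heat (hB : IsSmoothRegion B r) (hS : IsBoundarySplitting B S Sg)
    {a : Fin 5} (hK : IsKernel K) (hKi : ∀ x, IsInjKernel (K x))
    (hP : IsBoundaryDatum (frontier B) P) (hPh : IsBoundaryDatum (Sg a) Ph)
    (hu : IsBoundaryDatum (frontier B) u) (huh : IsBoundaryDatum (S a) uh) (hT : 0 < T)
    (H : ∀ v w ψ, ContDiff ℝ ∞ v → ContDiff ℝ ∞ w → ContDiff ℝ ∞ ψ → ∃ P' : Field,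
      (∀ x ∈ frontier B, ∀ t, P' x t = sep w ψ x t) ∧
      partVar (S a) (Sg a) K P Ph u uh P' (sep v ψ) T = 0) :
    (∀ x ∈ S a, ∀ s ∈ Icc 0 T, u x s = uh x s) ∧ ∀ x ∈ Sg a, ∀ s ∈ Icc 0 T, P x s = Ph x s := by
  have pa := hS.isPart a
  have hz : ContDiff ℝ ∞ (0 : E3 → ℝ) := contDiff_const
  have sz : ∀ ψ x t, sep 0 ψ x t = 0 := fun ψ x t => zero_mul _
  have hUU : ∀ x ∈ S a, ∀ s ∈ Icc 0 T, (u - uh) x s = 0 :=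
    eq_zero_of_area_tests hB pa.subS pa.measS (hS.fat a).1 hK hKi ((hu.mono pa.subS).sub huh) hT
      fun w ψ hw hψ => by
    obtain ⟨P', h1, h3⟩ := H 0 w ψ hz hw hψ
    rw [partVar_left hT.le (fun x hx => .inl fun s _ => sz ψ x s), fconv_comm P'] at h3
    exact ⟨_, h1, h3⟩
  have hPP : ∀ x ∈ Sg a, ∀ s ∈ Icc 0 T, (P - Ph) x s = 0 :=
    eq_zero_of_area_tests hB pa.subSg pa.measSg (hS.fat a).2 hK hKi ((hP.mono pa.subSg).sub hPh) hT
      fun w ψ hw hψ => by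
    obtain ⟨P', h1, h3⟩ := H w 0 ψ hw hz hψ
    rw [partVar_right hT.le
      (fun x hx => .inl fun s _ => (h1 x (pa.subS hx) s).trans (sz ψ x s)), neg_eq_zero] at h3
    exact ⟨_, fun _ _ _ => rfl, h3⟩
  exact ⟨fun x hx s hs => sub_eq_zero.1 (hUU x hx s hs),
    fun x hx s hs => sub_eq_zero.1 (hPP x hx s hs)⟩

end Channel

end ThermoPiezo

namespace ThermoPiezo

/-! ### The boundary conditions -/

section BoundaryTest

variable {m : Material} {B : Set E3} {r : E3 → ℝ} {S Sg : Fin 5 → Set E3} {Γ : Data}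
  {p c y : Proc} {T t : ℝ} {x : E3} {N : Fin 3 → E3 → ℝ} {i a : Fin 3}
  {v w₀ w₁ f s₀ s₁ θ h : E3 → ℝ} {ψ : ℝ → ℝ}

lemma SymmVanishes.mono {J J' : Set ℝ} (hc : SymmVanishes B J c) (h : J' ⊆ J) :
    SymmVanishes B J' c :=
  ⟨fun x hx i t ht => hc.u x hx i t (h ht), fun x hx t ht => hc.θ x hx t (h ht),
    fun x hx t ht => hc.φ x hx t (h ht), fun x hx i j t ht => hc.e x hx i j t (h ht),
    fun x hx i j k t ht => hc.κ x hx i j k t (h ht), fun x hx i t ht => hc.b x hx i t (h ht),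
    fun x hx i t ht => hc.E x hx i t (h ht), fun x hx i j t ht => hc.V x hx i j t (h ht),
    fun x hx i j t ht => hc.τ x hx i j t (h ht), fun x hx i j k t ht => hc.μ x hx i j k t (h ht),
    fun x hx i t ht => hc.σ x hx i t (h ht), fun x hx i j t ht => hc.Q x hx i j t (h ht),
    fun x hx t ht => hc.η x hx t (h ht), fun x hx i t ht => hc.q x hx i t (h ht)⟩

lemma integral_pair_eq_zero (hc : SymmVanishes B (Icc 0 T) c) (hy : IsAdmissible B y)
    (hT : 0 ≤ T) {K : Field} : ∫ x in B, (K ⊛ c.pair y) x T = 0 :=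
  setIntegral_eq_zero_of_forall_eq_zero fun _ hx => tconv_eq_zero_right hT fun _ hs =>
    pair_eq_zero (hc.mono (Icc_subset_Icc le_rfl hs.2)) hy hs.1 hx

/-- A process with prescribed values of the kinematic variables and of the tractions at the
boundary, where `N` extends the normal. -/
def bdryTest (N : Fin 3 → E3 → ℝ) (i : Fin 3) (v w₀ w₁ f s₀ s₁ θ h : E3 → ℝ) (ψ : ℝ → ℝ) : Proc where
  u a := sep (fun x => if a = i then v x else 0) ψ
  θ := sep θ ψ
  φ := sep f ψ
  e _ _ := 0
  κ _ _ _ := 0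
  b _ := 0
  E _ := 0
  V _ _ := 0
  -- This symmetric tensor maps the unit vector `N` to the `i`-th basis vector, so its traction is
  -- `w₀` in the direction `i` and nothing else.
  τ a b := sep (fun x => ((if b = i then N a x else 0) + (if a = i then N b x else 0)
    - N a x * N b x * N i x) * w₀ x) ψ
  μ k j a := sep (fun x => N k x * N j x * if a = i then w₁ x else 0) ψ
  σ j := sep (fun x => N j x * s₀ x) ψ
  Q k j := sep (fun x => N k x * N j x * s₁ x) ψ
  η := 0
  q j := sep (fun x => N j x * h x) ψ

lemma isAdmissible_bdryTest (hB : IsSmoothRegion B r) (hN : ∀ j, ContDiff ℝ ∞ (N j))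
    (hv : ContDiff ℝ ∞ v) (hw₀ : ContDiff ℝ ∞ w₀) (hw₁ : ContDiff ℝ ∞ w₁) (hf : ContDiff ℝ ∞ f)
    (hs₀ : ContDiff ℝ ∞ s₀) (hs₁ : ContDiff ℝ ∞ s₁) (hθ : ContDiff ℝ ∞ θ) (hh : ContDiff ℝ ∞ h)
    (hψ : ContDiff ℝ ∞ ψ) : IsAdmissible B (bdryTest N i v w₀ w₁ f s₀ s₁ θ h ψ) := by
  have hi : ∀ {a : Fin 3} {g : E3 → ℝ}, ContDiff ℝ ∞ g →
      ContDiff ℝ ∞ fun x => if a = i then g x else 0 := fun {a g} hg => by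
    split_ifs
    · exact hg
    · exact contDiff_const
  refine ⟨fun _ => isC_sep hB (hi hv) hψ, isC_sep hB hf hψ, isC_sep hB hθ hψ,
    fun _ _ => isC_zero hB, fun _ _ => isC_zero hB, isC_zero hB, fun _ _ _ => isC_zero hB,
    fun _ => isC_zero hB, fun k j _ => isC_sep hB (((hN k).mul (hN j)).mul (hi hw₁)) hψ,
    fun k j => isC_sep hB (((hN k).mul (hN j)).mul hs₁) hψ, fun _ => isC_zero hB,
    fun a b => isC_sep hB ((((hi (hN a)).add (hi (hN b))).sub
      (((hN a).mul (hN b)).mul (hN i))).mul hw₀) hψ, fun j => isC_sep hB ((hN j).mul hs₀) hψ,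
    fun j => isC_sep hB ((hN j).mul hh) hψ,
    fun x _ t _ a b k => ⟨rfl, rfl, rfl, ?_, ?_, ?_⟩⟩ <;> simp only [bdryTest, sep] <;> ring

/-- `N` is the unit normal at `x`. -/
structure IsNormalAt (r : E3 → ℝ) (N : Fin 3 → E3 → ℝ) (x : E3) : Prop where
  eq : ∀ j t, nrm r j x t = N j x
  sum_sq : ∑ j, N j x * N j x = 1

lemma IsInvGrad.isNormalAt {q : E3 → ℝ} (hq : IsInvGrad B r q) (hx : x ∈ frontier B) :
    IsNormalAt r (extNor r q) x :=
  ⟨fun j _ => (hq.eventually_nor_eq hx j).self_of_nhds, (hq.eventually_sum_sq hx).self_of_nhds⟩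

namespace IsNormalAt

/-- Under the hypothesis on `w₁` and `a` the couple stress acting in the direction `a` is
identically zero, so only the contraction of `τ` with the normal counts. -/
lemma tractionP_bdryTest (hN : IsNormalAt r N x) (hw : w₁ = 0 ∨ a ≠ i) :
    tractionP B r (bdryTest N i v w₀ w₁ f s₀ s₁ θ h ψ) a x t
      = (if a = i then w₀ x else 0) * ψ t := by
  rw [tractionP_eq, trac_of_eventually_zero fun k j => .of_forall fun y => ?_]
  · simp only [bdryTest, sep, hN.eq]
    have h1 := hN.sum_sq
    simp only [Fin.sum_univ_three] at h1 ⊢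
    have e : ∀ b : ℝ, ((N 0 x * N 0 x + N 1 x * N 1 x + N 2 x * N 2 x) * b) = b := fun b => by
      rw [h1, one_mul]
    have e2 : ∑ j, (if j = i then N a x else 0) * N j x = N a x * N i x := by
      simp [ite_mul]
    simp only [Fin.sum_univ_three] at e2
    have e1 := e (if a = i then w₀ x else 0)
    have e3 := e (N a x * N i x * w₀ x * ψ t)
    by_cases ha : a = i
    · simp only [ha, if_true] at e1 e2 e3 ⊢
      linear_combination w₀ x * ψ t * e2 + ψ t * e1 - e3
    · simp only [ha, if_false] at e1 e2 e3 ⊢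
      linear_combination w₀ x * ψ t * e2 - e3
  · rcases hw with hw | hw <;> simp [bdryTest, sep, hw]

lemma hypT_sep (hN : IsNormalAt r N x) (w : E3 → ℝ) :
    hypT r (fun k j => sep (fun x => N k x * N j x * w x) ψ) x t = w x * ψ t := by
  have h1 := hN.sum_sq
  simp only [hypT, Finset.sum_apply, Pi.mul_apply, sep, hN.eq]
  have e : ∑ k, ∑ j, N k x * N j x * w x * ψ t * N k x * N j x
      = (∑ k, N k x * N k x) * (∑ j, N j x * N j x) * (w x * ψ t) := by
    simp only [Fin.sum_univ_three]; ring
  rw [e, h1, one_mul, one_mul]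

lemma hyperR_bdryTest (hN : IsNormalAt r N x) :
    hyperR r (bdryTest N i v w₀ w₁ f s₀ s₁ θ h ψ) a x t = (if a = i then w₁ x else 0) * ψ t :=
  hN.hypT_sep fun x => if a = i then w₁ x else 0

lemma hyperH_bdryTest (hN : IsNormalAt r N x) :
    hyperH r (bdryTest N i v w₀ w₁ f s₀ s₁ θ h ψ) x t = s₁ x * ψ t := hN.hypT_sep s₁

lemma sum_sep (hN : IsNormalAt r N x) (w : E3 → ℝ) :
    ∑ j, sep (fun x => N j x * w x) ψ x t * nrm r j x t = w x * ψ t := by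
  have e : ∑ j, N j x * w x * ψ t * N j x = (∑ j, N j x * N j x) * (w x * ψ t) := by
    rw [Finset.sum_mul]
    exact Finset.sum_congr rfl fun _ _ => by ring
  simp only [sep, hN.eq]
  rw [e, hN.sum_sq, one_mul]

lemma chargeΛ_bdryTest (hN : IsNormalAt r N x) (hs : s₁ = 0) :
    chargeΛ B r (bdryTest N i v w₀ w₁ f s₀ s₁ θ h ψ) x t = s₀ x * ψ t := by
  rw [chargeΛ_eq, trac_of_eventually_zero fun k j => .of_forall fun y => ?_]
  · exact hN.sum_sep s₀
  · simp [bdryTest, sep, hs]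

lemma fluxq_bdryTest (hN : IsNormalAt r N x) :
    fluxq r (bdryTest N i v w₀ w₁ f s₀ s₁ θ h ψ) x t = h x * ψ t := by
  simp only [fluxq, Finset.sum_apply, Pi.mul_apply]
  exact hN.sum_sep h

end IsNormalAt

lemma normalD_sep_zero : normalD B r (sep (fun _ => 0) ψ) x t = 0 :=
  normalD_eq_zero (.of_forall fun _ => zero_mul _)

/-- The volume term vanishes for every admissible variation, because symmetric arrays cannot see the
antisymmetric rest of the coefficients. Test processes active in a single channel then isolate each
displacement component, the electric potential and the temperature in turn. -/
theorem satisfiesBoundary_of_firstVar (hB : IsSmoothRegion B r) (hS : IsBoundarySplitting B S Sg)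
    (hΓ : Γ.IsContinuous B S Sg) (hp : IsAdmissible B p) (hT : 0 < T)
    (hc : SymmVanishes B (Icc 0 T) (coefP m B Γ p))
    (H : ∀ p', IsAdmissible B p' → firstVar m B r S Sg Γ T p p' = 0) :
    SatisfiesBoundary B r S Sg Γ (Icc 0 T) p := by
  obtain ⟨q, hq⟩ := exists_isInvGrad hB
  have hN := fun {x} hx => hq.isNormalAt (x := x) hx
  have hNs := hq.contDiff_extNor hB
  have bv := hp.hasBoundaryValues hB
  have hk := isKernel_kmech m
  have hki := isInjKernel_kmech m
  have hSF := fun i => (hS.isPart i).subS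
  have hSgF := fun i => (hS.isPart i).subSg
  have hz : ContDiff ℝ ∞ (0 : E3 → ℝ) := contDiff_const
  have z : ∀ (i : Fin 5) {K P Ph u uh P' u' : Field}, (∀ x ∈ frontier B, ∀ t, P' x t = 0) →
      (∀ x ∈ frontier B, ∀ t, u' x t = 0) → partVar (S i) (Sg i) K P Ph u uh P' u' T = 0 :=
    fun i => fun h1 h2 => partVar_eq_zero hT.le
      (fun x hx => .inl fun s _ => h1 x (hSF i hx) s) fun x hx => .inl fun s _ => h2 x (hSgF i hx) s
  have mech := fun i => eq_of_partVar_tests hB hS (a := 0) (b := 1) hk hki (bv.P i) (hΓ.bP i)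
    (bv.u i) (hΓ.bu i) (bv.R i) (hΓ.bR i) (bv.du i) (hΓ.bd i) hT fun v w₀ w₁ ψ hv hw₀ hw₁ hψ => by
      have ha := isAdmissible_bdryTest (i := i) hB hNs hv hw₀ hw₁ hz hz hz hz hz hψ
      have h0 := H _ ha
      set y := bdryTest (extNor r q) i v w₀ w₁ 0 0 0 0 0 ψ with hy
      have hu : ∀ j, j ≠ i → y.u j = sep (fun _ => 0) ψ := fun j hj => by
        simp only [hy, bdryTest, if_neg hj]
      have hui : y.u i = sep v ψ := by simp only [hy, bdryTest, if_true]
      refine ⟨tractionP B r y i, hyperR r y i, fun h x hx t => ?_, fun x hx t => ?_, ?_⟩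
      · rw [hy, (hN hx).tractionP_bdryTest (.inl h), if_pos rfl, sep]
      · rw [hy, (hN hx).hyperR_bdryTest, if_pos rfl, sep]
      -- The test acts on the single component `i`, so both mechanical sums reduce to one term and
      -- the electric and thermal terms vanish.
      rw [firstVar, integral_pair_eq_zero hc ha hT.le, Finset.sum_eq_single i
        (fun j _ hj => z 0 (fun x hx t => ?_) fun x hx t => ?_) (fun h => absurd (Finset.mem_univ i) h),
        Finset.sum_eq_single i
        (fun j _ hj => z 1 (fun x hx t => ?_) fun x hx t => ?_) (fun h => absurd (Finset.mem_univ i) h),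
        z 2 (fun x hx t => ?_) (fun x hx t => ?_), z 3 (fun x hx t => ?_) (fun x hx t => ?_),
        z 4 (fun x hx t => ?_) (fun x hx t => ?_), hui] at h0
      · linarith
      · rw [hy, (hN hx).hyperH_bdryTest, Pi.zero_apply, zero_mul]
      · exact normalD_sep_zero
      · rw [hy, (hN hx).chargeΛ_bdryTest rfl, Pi.zero_apply, zero_mul]
      · exact zero_mul _
      · rw [hy, (hN hx).fluxq_bdryTest, Pi.zero_apply, zero_mul]
      · exact zero_mul _
      · rw [hy, (hN hx).hyperR_bdryTest, if_neg hj, zero_mul]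
      · rw [hu j hj, normalD_sep_zero]
      · rw [hy, (hN hx).tractionP_bdryTest (.inr hj), if_neg hj, zero_mul]
      · rw [hu j hj, sep, zero_mul]
  have zmech : ∀ {f s₀ s₁ θ h : E3 → ℝ} {ψ : ℝ → ℝ},
      (∑ i, partVar (S 0) (Sg 0) (kmech m) (tractionP B r p i) (Γ.bP i) (p.u i) (Γ.bu i)
        (tractionP B r (bdryTest (extNor r q) 0 0 0 0 f s₀ s₁ θ h ψ) i)
        ((bdryTest (extNor r q) 0 0 0 0 f s₀ s₁ θ h ψ).u i) T) = 0 ∧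
      (∑ i, partVar (S 1) (Sg 1) (kmech m) (hyperR r p i) (Γ.bR i) (normalD B r (p.u i)) (Γ.bd i)
        (hyperR r (bdryTest (extNor r q) 0 0 0 0 f s₀ s₁ θ h ψ) i)
        (normalD B r ((bdryTest (extNor r q) 0 0 0 0 f s₀ s₁ θ h ψ).u i)) T) = 0 := by
    intro f s₀ s₁ θ h ψ
    have hu : ∀ j, (bdryTest (extNor r q) 0 0 0 0 f s₀ s₁ θ h ψ).u j = sep (fun _ => 0) ψ :=
      fun j => by simp only [bdryTest, Pi.zero_apply, ite_self]
    refine ⟨Finset.sum_eq_zero fun j _ => z 0 (fun x hx t => ?_) fun x hx t => ?_,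
      Finset.sum_eq_zero fun j _ => z 1 (fun x hx t => ?_) fun x hx t => ?_⟩
    · rw [(hN hx).tractionP_bdryTest (.inl rfl), Pi.zero_apply, ite_self, zero_mul]
    · rw [hu, sep, zero_mul]
    · rw [(hN hx).hyperR_bdryTest, Pi.zero_apply, ite_self, zero_mul]
    · rw [hu, normalD_sep_zero]
  have elec := eq_of_partVar_tests hB hS (a := 3) (b := 4) hk hki bv.Λ hΓ.bΛ
    bv.φ hΓ.bφ bv.H hΓ.bH bv.dφ hΓ.bω hT fun v w₀ w₁ ψ hv hw₀ hw₁ hψ => by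
      have ha := isAdmissible_bdryTest (i := 0) hB hNs hz hz hz hv hw₀ hw₁ hz hz hψ
      have h0 := H _ ha
      refine ⟨chargeΛ B r (bdryTest (extNor r q) 0 0 0 0 v w₀ w₁ 0 0 ψ),
        hyperH r (bdryTest (extNor r q) 0 0 0 0 v w₀ w₁ 0 0 ψ), fun h x hx t => ?_,
        fun x hx t => ?_, ?_⟩
      · rw [(hN hx).chargeΛ_bdryTest h, sep]
      · rw [(hN hx).hyperH_bdryTest, sep]
      rw [firstVar, integral_pair_eq_zero hc ha hT.le, zmech.1, zmech.2,
        z 2 (fun x hx t => ?_) (fun x hx t => ?_)] at h0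
      · rw [mul_zero, add_zero, zero_add, zero_add, zero_add] at h0
        exact h0
      · rw [(hN hx).fluxq_bdryTest, Pi.zero_apply, zero_mul]
      · exact zero_mul _
  have heat := eq_of_partVar_tests_heat hB hS (a := 2) (isKernel_kheat m) (isInjKernel_kheat m)
    bv.q hΓ.bq bv.θ hΓ.bθ hT fun v w ψ hv hw hψ => by
      have ha := isAdmissible_bdryTest (i := 0) hB hNs hz hz hz hz hz hz hv hw hψ
      have h0 := H _ ha
      refine ⟨fluxq r (bdryTest (extNor r q) 0 0 0 0 0 0 0 v w ψ), fun x hx t => ?_, ?_⟩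
      · rw [(hN hx).fluxq_bdryTest, sep]
      rw [firstVar, integral_pair_eq_zero hc ha hT.le, zmech.1, zmech.2,
        z 3 (fun x hx t => ?_) (fun x hx t => ?_), z 4 (fun x hx t => ?_) (fun x hx t => ?_),
        add_zero, add_zero, add_zero, zero_add, zero_add] at h0
      · exact (mul_eq_zero.1 h0).resolve_left (one_div_ne_zero m.T0_pos.ne')
      · rw [(hN hx).hyperH_bdryTest, Pi.zero_apply, zero_mul]
      · exact normalD_sep_zero
      · rw [(hN hx).chargeΛ_bdryTest rfl, Pi.zero_apply, zero_mul]
      · exact zero_mul _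
  exact
    { u := fun x hx t ht i => (mech i).1.1 x hx t ht
      P := fun x hx t ht i => (mech i).1.2 x hx t ht
      d := fun x hx t ht i => (mech i).2.1 x hx t ht
      R := fun x hx t ht i => (mech i).2.2 x hx t ht
      θ := heat.1
      q := heat.2
      φ := elec.1.1
      Λ := elec.1.2
      w := elec.2.1
      H := elec.2.2 }

/-- Every surface integrand contains the residual of a boundary condition as a factor, and the
volume term vanishes by pairing. -/
lemma firstVar_eq_zero (hT : 0 ≤ T) (hc : SymmVanishes B (Icc 0 T) (coefP m B Γ p))
    (hb : SatisfiesBoundary B r S Sg Γ (Icc 0 T) p) (hy : IsAdmissible B y) :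
    firstVar m B r S Sg Γ T p y = 0 := by
  rw [firstVar, integral_pair_eq_zero hc hy hT,
    Finset.sum_eq_zero fun i _ => partVar_eq_zero hT (fun x hx => .inr fun s hs => hb.u x hx s hs i)
      (fun x hx => .inr fun s hs => hb.P x hx s hs i),
    Finset.sum_eq_zero fun i _ => partVar_eq_zero hT (fun x hx => .inr fun s hs => hb.d x hx s hs i)
      (fun x hx => .inr fun s hs => hb.R x hx s hs i),
    partVar_eq_zero hT (fun x hx => .inr (hb.φ x hx)) (fun x hx => .inr (hb.Λ x hx)),
    partVar_eq_zero hT (fun x hx => .inr (hb.w x hx)) (fun x hx => .inr (hb.H x hx)),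
    partVar_eq_zero hT (fun x hx => .inr (hb.θ x hx)) (fun x hx => .inr (hb.q x hx))]
  simp

theorem variationVanishes_iff_isSolutionOn (hB : IsSmoothRegion B r)
    (hS : IsBoundarySplitting B S Sg) (hΓ : Γ.IsContinuous B S Sg) (hp : IsAdmissible B p)
    (hT : 0 < T) :
    VariationVanishes m B r S Sg Γ T p ↔ IsSolutionOn m B r S Sg Γ (Icc 0 T) p := by
  rw [variationVanishes_iff hB hS hΓ hp hT.le]
  refine ⟨fun H => ?_, fun hs p' hp' => firstVar_eq_zero hT.le
    ((symmVanishes_coefP_iff hB hΓ hp hT).2 ⟨hs.field, hs.initial⟩) hs.boundary hp'⟩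
  have hc := symmVanishes_of_firstVar hB hS hΓ hp hT H
  obtain ⟨h1, h2⟩ := (symmVanishes_coefP_iff hB hΓ hp hT).1 hc
  exact ⟨hp, h1, h2, satisfiesBoundary_of_firstVar hB hS hΓ hp hT hc H⟩

/-- At time zero all convolutions run over a degenerate interval. The variation is then trivially
zero, so the pointwise criterion needs a positive time. -/
lemma variationVanishes_zero (hB : IsSmoothRegion B r) (hS : IsBoundarySplitting B S Sg)
    (hΓ : Γ.IsContinuous B S Sg) (hp : IsAdmissible B p) :
    VariationVanishes m B r S Sg Γ 0 p := by
  refine (variationVanishes_iff hB hS hΓ hp le_rfl).2 fun p' _ => ?_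
  simp only [firstVar, partVar, fconv, tconv_zero_time, integral_zero, sub_zero,
    Finset.sum_const_zero, mul_zero, add_zero]

lemma isSolutionOn_Ici_iff :
    IsSolutionOn m B r S Sg Γ (Ici 0) p ↔ ∀ T, 0 < T → IsSolutionOn m B r S Sg Γ (Icc 0 T) p := by
  refine ⟨fun h T _ => ⟨h.admissible, ?_, h.initial, ?_⟩, fun h =>
    ⟨(h 1 one_pos).admissible, ?_, (h 1 one_pos).initial, ?_⟩⟩
  · obtain ⟨h1, h2, h3, h4, h5, h6, h7, h8, h9, h10, h11, h12, h13, h14⟩ := h.field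
    exact ⟨fun x hx t ht => h1 x hx t ht.1, fun x hx t ht => h2 x hx t ht.1,
      fun x hx t ht => h3 x hx t ht.1, fun x hx t ht => h4 x hx t ht.1,
      fun x hx t ht => h5 x hx t ht.1, fun x hx t ht => h6 x hx t ht.1,
      fun x hx t ht => h7 x hx t ht.1, fun x hx t ht => h8 x hx t ht.1,
      fun x hx t ht => h9 x hx t ht.1, fun x hx t ht => h10 x hx t ht.1,
      fun x hx t ht => h11 x hx t ht.1, fun x hx t ht => h12 x hx t ht.1,
      fun x hx t ht => h13 x hx t ht.1, fun x hx t ht => h14 x hx t ht.1⟩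
  · obtain ⟨h1, h2, h3, h4, h5, h6, h7, h8, h9, h10⟩ := h.boundary
    exact ⟨fun x hx t ht => h1 x hx t ht.1, fun x hx t ht => h2 x hx t ht.1,
      fun x hx t ht => h3 x hx t ht.1, fun x hx t ht => h4 x hx t ht.1,
      fun x hx t ht => h5 x hx t ht.1, fun x hx t ht => h6 x hx t ht.1,
      fun x hx t ht => h7 x hx t ht.1, fun x hx t ht => h8 x hx t ht.1,
      fun x hx t ht => h9 x hx t ht.1, fun x hx t ht => h10 x hx t ht.1⟩
  all_goals
    -- The endpoint `t + 1` is positive even for `t = 0`, so the hypothesis covers the initial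
    -- instant.
    have hI : ∀ {t : ℝ}, t ∈ Ici (0 : ℝ) → 0 < t + 1 ∧ t ∈ Icc 0 (t + 1) := fun {t} ht =>
      have ht : 0 ≤ t := ht
      ⟨by linarith, ht, by linarith⟩
  · have hf := fun {t} ht => (h (t + 1) (hI (t := t) ht).1).field
    exact ⟨fun x hx t ht => (hf ht).motion x hx t (hI ht).2,
      fun x hx t ht => (hf ht).electric x hx t (hI ht).2,
      fun x hx t ht => (hf ht).energy x hx t (hI ht).2,
      fun x hx t ht => (hf ht).geom_e x hx t (hI ht).2,
      fun x hx t ht => (hf ht).geom_κ x hx t (hI ht).2,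
      fun x hx t ht => (hf ht).geom_b x hx t (hI ht).2,
      fun x hx t ht => (hf ht).geom_E x hx t (hI ht).2,
      fun x hx t ht => (hf ht).geom_V x hx t (hI ht).2,
      fun x hx t ht => (hf ht).const_τ x hx t (hI ht).2,
      fun x hx t ht => (hf ht).const_μ x hx t (hI ht).2,
      fun x hx t ht => (hf ht).const_σ x hx t (hI ht).2,
      fun x hx t ht => (hf ht).const_Q x hx t (hI ht).2,
      fun x hx t ht => (hf ht).const_η x hx t (hI ht).2,
      fun x hx t ht => (hf ht).const_q x hx t (hI ht).2⟩
  · have hf := fun {t} ht => (h (t + 1) (hI (t := t) ht).1).boundary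
    exact ⟨fun x hx t ht => (hf ht).u x hx t (hI ht).2, fun x hx t ht => (hf ht).P x hx t (hI ht).2,
      fun x hx t ht => (hf ht).d x hx t (hI ht).2, fun x hx t ht => (hf ht).R x hx t (hI ht).2,
      fun x hx t ht => (hf ht).θ x hx t (hI ht).2, fun x hx t ht => (hf ht).q x hx t (hI ht).2,
      fun x hx t ht => (hf ht).φ x hx t (hI ht).2, fun x hx t ht => (hf ht).Λ x hx t (hI ht).2,
      fun x hx t ht => (hf ht).w x hx t (hI ht).2, fun x hx t ht => (hf ht).H x hx t (hI ht).2⟩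

end BoundaryTest

end ThermoPiezo

theorem mainTheorem4 (m : ThermoPiezo.Material)
    (B : Set ThermoPiezo.E3) (r : ThermoPiezo.E3 → ℝ) (hB : ThermoPiezo.IsSmoothRegion B r)
    (S Sg : Fin 5 → Set ThermoPiezo.E3) (hS : ThermoPiezo.IsBoundarySplitting B S Sg)
    (Γ : ThermoPiezo.Data) (hΓ : Γ.IsContinuous B S Sg)
    (p : ThermoPiezo.Proc) (hp : ThermoPiezo.IsAdmissible B p) :
    ((∀ t : ℝ, 0 ≤ t → ThermoPiezo.VariationVanishes m B r S Sg Γ t p) ↔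
      ThermoPiezo.IsSolutionOn m B r S Sg Γ (Set.Ici 0) p) ∧
    (∀ t : ℝ, 0 < t → (ThermoPiezo.VariationVanishes m B r S Sg Γ t p ↔
      ThermoPiezo.IsSolutionOn m B r S Sg Γ (Set.Icc 0 t) p)) := by
  have h2 := fun (t : ℝ) (ht : 0 < t) =>
    ThermoPiezo.variationVanishes_iff_isSolutionOn (m := m) hB hS hΓ hp ht
  refine ⟨?_, h2⟩
  rw [ThermoPiezo.isSolutionOn_Ici_iff]
  refine ⟨fun h t ht => (h2 t ht).1 (h t ht.le), fun h t ht => ?_⟩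
  rcases ht.eq_or_lt with rfl | ht
  · exact ThermoPiezo.variationVanishes_zero hB hS hΓ hp
  · exact (h2 t ht).2 (h t ht)
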